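/- Let $p\ge 0$, let $\mathcal A=\{a_0,\dots,a_p\}\subset\mathbb C$ be distinct points, let $\rho_0,\dots,\rho_p\in\mathbb C$, and let $$\varphi=\operatorname{Re}\Phi,\qquad \Phi(z)=-\sum_{k=0}^p\frac{\rho_k}{2}\log(z-a_k),\qquad \Phi'(z)=-\sum_{k=0}^p\frac{\rho_k/2}{z-a_k}.$$ For a finite real Borel measure $\mu$ on $\mathbb C$ with compact support put $$E_\varphi(\mu)=\iint\log\frac1{|x-y|}\,d\mu(x)\,d\mu(y)+2\int\varphi\,d\mu .$$ Such a $\mu$, with these integrals absolutely convergent (in particular without atoms), is called a *continuous $(\mathcal A,\varphi)$-critical measure* if for every smooth $h:\mathbb C\to\mathbb C$ with $h|_{\mathcal A}=0$ $$\lim_{t\to0,\ t\in\mathbb C}\frac{E_\varphi(\mu^t)-E_\varphi(\mu)}{t}=0,$$ where $\mu^t$ is the image of $\mu$ under $z\mapsto z^t=z+t\,h(z)$; if $\varphi$ is multivalued, then in $\int\varphi\,d\mu^t=\int\varphi(z^t)\,d\mu(z)$ the value $\varphi(z^t)$ is obtained from $\varphi(z)$ by continuation along the segment from $z$ to $z^t$.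 For a rational function $R$ consider the quadratic differential $\varpi=-R(z)\,dz^2$ on the Riemann sphere (in the coordinate $w=1/z$ it is $-R(1/w)w^{-4}dw^2$). A *horizontal arc* of $\varpi$ is a smooth curve $z(t)$, $t\in(\alpha,\beta)$, with $-R(z(t))\,z'(t)^2>0$ (read in the coordinate $w$ at $\infty$); a *trajectory* is a maximal horizontal arc. The zeros and poles of $\varpi$ on the sphere are its singular points; its zeros and simple poles are its *finite critical points*. A trajectory is *critical* if it joins two (not necessarily different) finite critical points, and *closed* if it is a Jordan curve; $\varpi$ is *closed* if each of its trajectories is critical or closed. **Theorem.** For every continuous $(\mathcal A,\varphi)$-critical measure $\mu$ there is a rational function $R$, all of whose poles in $\mathbb C$ lie in $\mathcal A$, such that $$R(z)=\Big(\frac{\kappa}{z}\Big)^2+O\Big(\frac1{z^3}\Big),\quad z\to\infty,\qquad \kappa=\mu(\mathbb C)+\frac12\sum_{j=0}^p\rho_j,$$ and the following hold. 1. $\operatorname{supp}\mu$ is a union of trajectories of $\varpi=-R(z)\,dz^2$ together with their endpoints: there is a set $\mathcal T$ of trajectories whose union is $\operatorname{supp}\mu$ without the singular points of $\varpi$, and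 the closure of this union is $\operatorname{supp}\mu$. 2. If all $\rho_j$ are real, then $\varpi$ is closed and $\mathcal T$ is finite. 3. If $\rho_j=0$, then $a_j$ is either a simple pole or a regular point of $R$; if $\rho_j\ne0$, then $R$ has a double pole at $a_j$. -/

import Mathlib

open MeasureTheory Filter Topology
open scoped ComplexOrder

noncomputable section

namespace CriticalMeasure

/-! ### Logarithmic energy of signed measures -/

/-- The absolute value of the logarithmic kernel `log (1 / |x - y|)`, equal to `+∞` on the
diagonal. -/
def absLogKernel (x y : ℂ) : ENNReal :=
  open Classical in if x = y then ⊤ else ENNReal.ofReal |Real.log ‖x - y‖|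

/-- `μ` has finite logarithmic energy: the double integral defining `E(μ)` converges absolutely. In
particular such a measure has no atoms. -/
def HasFiniteEnergy (μ : SignedMeasure ℂ) : Prop :=
  ∫⁻ x, ∫⁻ y, absLogKernel x y ∂μ.variation ∂μ.variation < ⊤

/-- The logarithmic energy `E(μ) = ∬ log (1 / |x - y|) dμ(y) dμ(x)` of a signed measure. -/
def energy (μ : SignedMeasure ℂ) : ℝ :=
  μ.integral (fun x => μ.integral (fun y => Real.log (1 / ‖x - y‖))
    (ContinuousLinearMap.lsmul ℝ ℝ)) (ContinuousLinearMap.lsmul ℝ ℝ)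

/-! ### The external field -/

variable {p : ℕ}

/-- The principal branch of `φ = Re Φ`, `Φ(z) = - ∑ (ρ_k / 2) log (z - a_k)`. -/
def field (a ρ : Fin (p + 1) → ℂ) (z : ℂ) : ℝ :=
  (-∑ k, ρ k / 2 * Complex.log (z - a k)).re

/-- The single-valued derivative `Φ'(z) = - ∑ (ρ_k / 2) / (z - a_k)`. -/
def fieldDeriv (a ρ : Fin (p + 1) → ℂ) (z : ℂ) : ℂ :=
  -∑ k, (ρ k / 2) / (z - a k)

/-- The increment `φ(x + v) - φ(x)`, where `Φ` is continued analytically along the segment from `x`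
to `x + v`: the real part of the integral of `Φ'` over this segment. -/
def fieldIncrement (a ρ : Fin (p + 1) → ℂ) (x v : ℂ) : ℝ :=
  (∫ s in (0 : ℝ)..1, fieldDeriv a ρ (x + s * v) * v).re

/-- For real charges the external field is single-valued. -/
theorem field_eq_of_real (a ρ : Fin (p + 1) → ℂ) (hρ : ∀ k, (ρ k).im = 0) (z : ℂ) :
    field a ρ z = ∑ k, (ρ k).re / 2 * Real.log (1 / ‖z - a k‖) := by
  simp only [field, Complex.neg_re, Complex.re_sum, ← Finset.sum_neg_distrib]
  refine Finset.sum_congr rfl fun k _ => ?_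
  have : (ρ k / 2) = (((ρ k).re / 2 : ℝ) : ℂ) := by
    apply Complex.ext <;> simp [hρ k]
  rw [this, Complex.re_ofReal_mul, Complex.log_re, one_div, Real.log_inv]
  ring

/-- For real charges, `fieldIncrement` is the increment of the single-valued function `φ`. -/
theorem fieldIncrement_eq_of_real (a ρ : Fin (p + 1) → ℂ) (hρ : ∀ k, (ρ k).im = 0) (x v : ℂ)
    (hx : ∀ s ∈ Set.Icc (0 : ℝ) 1, ∀ k, x + s * v ≠ a k) :
    fieldIncrement a ρ x v = field a ρ (x + v) - field a ρ x := by
  have hcont : ContinuousOn (fun s : ℝ => fieldDeriv a ρ (x + s * v) * v) (Set.uIcc 0 1) := by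
    rw [Set.uIcc_of_le zero_le_one]
    unfold fieldDeriv
    refine ContinuousOn.mul (ContinuousOn.neg (continuousOn_finsetSum _ fun k _ => ?_))
      continuousOn_const
    refine ContinuousOn.div continuousOn_const (by fun_prop) fun s hs => ?_
    exact sub_ne_zero.2 (hx s hs k)
  have hint := hcont.intervalIntegrable (μ := volume)
  have hre : fieldIncrement a ρ x v =
      ∫ s in (0 : ℝ)..1, (fieldDeriv a ρ (x + s * v) * v).re :=
    (Complex.reCLM.intervalIntegral_comp_comm hint).symm
  have hderiv : ∀ s ∈ Set.uIcc (0 : ℝ) 1, HasDerivAt (fun s : ℝ => field a ρ (x + s * v))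
      (fieldDeriv a ρ (x + s * v) * v).re s := by
    intro s hs
    rw [Set.uIcc_of_le zero_le_one] at hs
    simp only [field_eq_of_real a ρ hρ, fieldDeriv, neg_mul, Finset.sum_mul, Complex.neg_re,
      Complex.re_sum, ← Finset.sum_neg_distrib]
    refine HasDerivAt.fun_sum fun k _ => ?_
    have hne : x + s * v - a k ≠ 0 := sub_ne_zero.2 (hx s hs k)
    have hw : HasDerivAt (fun s : ℝ => x + s * v - a k) v s := by
      have h1 : HasDerivAt (fun s : ℝ => (s : ℂ)) 1 s := Complex.ofRealCLM.hasDerivAt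
      simpa using ((h1.mul_const v).const_add x).sub_const (a k)
    have hn := (hw.norm_sq).log (by positivity)
    have hfun : (fun s : ℝ => (ρ k).re / 2 * Real.log (1 / ‖x + s * v - a k‖)) =
        fun s : ℝ => (-(ρ k).re / 4) * Real.log (‖x + s * v - a k‖ ^ 2) := by
      funext r
      rw [one_div, Real.log_inv, Real.log_pow]
      push_cast
      ring
    rw [hfun]
    refine (hn.const_mul (-(ρ k).re / 4)).congr_deriv ?_
    have hρk : ρ k = ((ρ k).re : ℂ) := by apply Complex.ext <;> simp [hρ k]
    have hdiv : ρ k / 2 / (x + s * v - a k) * v =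
        (((ρ k).re / 2 : ℝ) : ℂ) * (v / (x + s * v - a k)) := by
      rw [hρk]
      push_cast
      simp only [Complex.ofReal_re]
      ring
    rw [hdiv, Complex.re_ofReal_mul, Complex.div_re, ← Complex.normSq_eq_norm_sq]
    have hN : Complex.normSq (x + s * v - a k) ≠ 0 := by simpa using hne
    simp only [Complex.inner, Complex.mul_re, Complex.conj_re, Complex.conj_im]
    field_simp
    ring
  rw [hre, intervalIntegral.integral_eq_sub_of_hasDerivAt hderiv
    ((Complex.reCLM.continuous.comp_continuousOn hcont).intervalIntegrable)]
  simp

/-- The weighted energy `E_φ(μ^t) = E(μ^t) + 2 ∫ φ dμ^t` of the measure `μ^t`, the image of `μ`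
under `z ↦ z^t = z + t h(z)`. The second integral is written as `∫ φ(x^t) dμ(x)`, where
`φ` is continued from `x` to `x^t` along the segment. -/
def variedEnergy (a ρ : Fin (p + 1) → ℂ) (μ : SignedMeasure ℂ) (h : ℂ → ℂ) (t : ℂ) : ℝ :=
  energy (μ.map fun z => z + t * h z) +
    2 * μ.integral (fun x => field a ρ x + fieldIncrement a ρ x (t * h x))
      (ContinuousLinearMap.lsmul ℝ ℝ)

/-- At `t = 0` one recovers the weighted energy `E_φ(μ) = E(μ) + 2 ∫ φ dμ`. -/
theorem variedEnergy_zero (a ρ : Fin (p + 1) → ℂ) (μ : SignedMeasure ℂ) (h : ℂ → ℂ) :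
    variedEnergy a ρ μ h 0 =
      energy μ + 2 * μ.integral (field a ρ) (ContinuousLinearMap.lsmul ℝ ℝ) := by
  have hid : μ.map (fun z : ℂ => z) = μ := VectorMeasure.map_id μ
  simp [variedEnergy, fieldIncrement, hid]

/-- `μ` is a (continuous) `(𝒜, φ)`-critical measure, where `𝒜 = {a_0, …, a_p}`: a real measure with
compact support and finite weighted energy, for which
`lim_{t → 0} (E_φ(μ^t) - E_φ(μ)) / t = 0`, `t ∈ ℂ`, for every smooth `h` vanishing on `𝒜`. -/
structure IsCritical (a ρ : Fin (p + 1) → ℂ) (μ : SignedMeasure ℂ) : Prop where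
  isCompact_support : IsCompact μ.variation.support
  finite_energy : HasFiniteEnergy μ
  integrable_field : μ.Integrable (field a ρ)
  stationary : ∀ h : ℂ → ℂ, ContDiff ℝ (⊤ : ℕ∞) h → (∀ k, h (a k) = 0) →
    Tendsto (fun t : ℂ => ((variedEnergy a ρ μ h t - variedEnergy a ρ μ h 0 : ℝ) : ℂ) / t)
      (𝓝[≠] 0) (𝓝 0)

/-! ### The quadratic differential `ϖ = -R(z) dz²` on the Riemann sphere -/

/-- The value `R(z)` (only used where `R` has no pole; it is `0` at the poles). -/
def value (R : RatFunc ℂ) (z : ℂ) : ℂ := R.eval (RingHom.id ℂ) z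

/-- The order of the rational function `R ≠ 0` at `z ∈ ℂ`: positive at zeros, negative at poles. -/
def order (R : RatFunc ℂ) (z : ℂ) : ℤ :=
  (R.num.rootMultiplicity z : ℤ) - (R.denom.rootMultiplicity z : ℤ)

/-- The order of `ϖ = -R(z) dz²`, `R ≠ 0`, at a point of the Riemann sphere. In the coordinate
`w = 1 / z` one has `ϖ = -R(1 / w) w⁻⁴ dw²`. -/
def qdOrder (R : RatFunc ℂ) (P : OnePoint ℂ) : ℤ :=
  P.elim (-R.intDegree - 4) (order R)

/-- The zeros and poles of `ϖ` on the Riemann sphere. -/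
def singularPoints (R : RatFunc ℂ) : Set (OnePoint ℂ) := {P | qdOrder R P ≠ 0}

/-- The finite critical points of `ϖ`: the singular points of order at least `-1`, that is, the
zeros and the simple poles. -/
def finiteCriticalPoints (R : RatFunc ℂ) : Set (OnePoint ℂ) :=
  {P | qdOrder R P ≠ 0 ∧ -1 ≤ qdOrder R P}

/-- The coefficient at `w = 0` of `ϖ = -R(1 / w) w⁻⁴ dw²`, `w = 1 / z`, if `∞` is a regular point of
`ϖ`, and `0` otherwise. -/
def coeffAtInfty (R : RatFunc ℂ) : ℂ :=
  if R.intDegree = -4 then -(R.num.leadingCoeff / R.denom.leadingCoeff) else 0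

/-- The coordinate `z` on the Riemann sphere, away from `∞`. -/
def coordZ (P : OnePoint ℂ) : ℂ := P.elim 0 id

/-- The coordinate `w = 1 / z` on the Riemann sphere, away from `0`; it is `0` at `∞`. -/
def coordW (P : OnePoint ℂ) : ℂ := P.elim 0 (fun z => z⁻¹)

/-- `γ` is a smooth parametrization, on `(α, β)`, of a horizontal arc of `ϖ = -R(z) dz²` on the
Riemann sphere: `-R(γ(t)) γ'(t)² > 0`, read in the coordinate `w = 1 / z` where `γ(t) = ∞`.
(`0 < c` for complex `c` means that `c` is a positive real number.) -/
structure IsHorizontal (R : RatFunc ℂ) (α β : ℝ) (γ : ℝ → OnePoint ℂ) : Prop where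
  lt : α < β
  continuousOn : ContinuousOn γ (Set.Ioo α β)
  finite : ∀ t ∈ Set.Ioo α β, γ t ≠ OnePoint.infty →
    ContDiffAt ℝ 1 (fun s => coordZ (γ s)) t ∧
      0 < -value R (coordZ (γ t)) * deriv (fun s => coordZ (γ s)) t ^ 2
  infinite : ∀ t ∈ Set.Ioo α β, γ t = OnePoint.infty →
    ContDiffAt ℝ 1 (fun s => coordW (γ s)) t ∧
      0 < coeffAtInfty R * deriv (fun s => coordW (γ s)) t ^ 2

/-- `T` is a horizontal arc of `ϖ`. -/
def IsHorizontalArc (R : RatFunc ℂ) (T : Set (OnePoint ℂ)) : Prop :=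
  ∃ α β γ, IsHorizontal R α β γ ∧ T = γ '' Set.Ioo α β

/-- A trajectory of `ϖ = -R(z) dz²`: a maximal horizontal arc. -/
def IsTrajectory (R : RatFunc ℂ) (T : Set (OnePoint ℂ)) : Prop :=
  Maximal (IsHorizontalArc R) T

/-- A critical trajectory joins two (not necessarily different) finite critical points. -/
def IsCriticalTrajectory (R : RatFunc ℂ) (T : Set (OnePoint ℂ)) : Prop :=
  IsTrajectory R T ∧ ∃ α β γ, IsHorizontal R α β γ ∧ T = γ '' Set.Ioo α β ∧
    (∃ P ∈ finiteCriticalPoints R, Tendsto γ (𝓝[>] α) (𝓝 P)) ∧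
    (∃ Q ∈ finiteCriticalPoints R, Tendsto γ (𝓝[<] β) (𝓝 Q))

/-- A closed trajectory is a Jordan curve. -/
def IsClosedTrajectory (R : RatFunc ℂ) (T : Set (OnePoint ℂ)) : Prop :=
  IsTrajectory R T ∧ ∃ f : Circle → OnePoint ℂ,
    Continuous f ∧ Function.Injective f ∧ Set.range f = T

/-- The quadratic differential `ϖ = -R(z) dz²` is closed: each of its trajectories is critical or
closed. -/
def IsClosedDifferential (R : RatFunc ℂ) : Prop :=
  ∀ T, IsTrajectory R T → IsCriticalTrajectory R T ∨ IsClosedTrajectory R T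

/-- The support of `μ`, as a subset of the Riemann sphere. -/
def supportOnSphere (μ : SignedMeasure ℂ) : Set (OnePoint ℂ) :=
  (fun z : ℂ => (z : OnePoint ℂ)) '' μ.variation.support

end CriticalMeasure

end

/-! ### From criticality to a quadratic equation for the Cauchy transform -/

namespace CriticalMeasure

/-! ### Signed measures as densities with respect to their variation -/

/-! Criticality is turned into an algebraic equation, and the equation into flat geometry.

Write `μ = h ν` with `ν` the variation of `μ` and `h = ±1`. Differentiating the energy at `t = 0`
gives `∬ (g(x) - g(y)) / (x - y) dμ dμ = 2 ∫ Φ' g dμ` for test functions `g` vanishing on the nodes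
(`IsCritical.integral_diffQuot`). The choice `g(x) = A(x) / (x - z)`, `A = ∏ (x - a_k)`, reached by
regularizing the kernel, yields `A C² + 2 B C = P` with `C(z) = ∫ dμ(x) / (x - z)`, `B = A Φ'` and
`P` a polynomial (`IsStationary.exists_quadratic`). Completing the square, `(C + Φ')² = R = (P A +
B²) / A²` almost everywhere (`IsStationary.exists_isSquare`). The orders at the nodes are read off
from the numerator, which equals `B(a_j)²` at `a_j`; the behaviour at infinity comes from expanding
`C + Φ'`.

Near a regular point there is a coordinate `e` with `e'² = R`, in which trajectories are vertical
lines. There `s = (C + Φ') / e'` is `±1` almost everywhere, and the weak equation `∂̄(C + Φ') = -π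
μ` reads `∂_x s = -2π μ`, `∂_y s = 0` (`IsSquare.integral_fderiv_mul_signFun`). So `s` depends on
`x` alone and `μ` lives on the vertical lines where `s` jumps: the support is invariant under
vertical translation (`IsSquare.mem_support_vertical`), and a jump costs a mass bounded below
independently of the width of the box, so that only finitely many lines occur in a box
(`IsSquare.finite_support_horizontal`). Transition maps of such coordinates are `w ↦ ±w + b`, hence
trajectories are images of maximal unit-speed vertical curves (`isTrajectory_iff`), and the support
is a union of them up to finitely many singular points, which carry no mass.

A maximal curve that is not injective is periodic, hence a Jordan curve. For real charges, an
injective one runs between finite critical points. The potential with differential `v ↦ Re ((C + Φ')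
v)` is then single-valued; it is constant on vertical lines off the support and strictly monotone
across them. Thus the curve meets a short transversal finitely often and cannot accumulate at a
regular point in infinite time (`IsSquare.not_mapClusterPt_atTop`); it converges to a singular
point. A singular point that is not a finite critical point is a double pole where `R` has positive
leading coefficient (`IsSquare.singular_dichotomy`); near it `Re e` is `c log |f|` for a local
coordinate `f` and is constant on trajectories, which therefore cannot tend to it. At a finite
critical point `e²` is single-valued and a quadratic polynomial of the time, so the end is reached
in finite time (`IsSquare.exists_tendsto`).

Finiteness of the trajectories in the support follows from compactness and local finiteness
(`IsSquare.locally_finite`): regular points and double poles are covered by boxes or half-strips,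
and near a finite critical point every trajectory must leave through a compact frontier of regular
points. -/

theorem integral_lsmul_toSignedMeasure (m : Measure ℂ) [IsFiniteMeasure m] (F : ℂ → ℝ) :
    m.toSignedMeasure.integral F (ContinuousLinearMap.lsmul ℝ ℝ) = ∫ x, F x ∂m := by
  have : (ContinuousLinearMap.lsmul ℝ ℝ : ℝ →L[ℝ] ℝ →L[ℝ] ℝ) =
      (ContinuousLinearMap.lsmul ℝ ℝ : ℝ →L[ℝ] ℝ →L[ℝ] ℝ).flip := by
    ext
    simp
  rw [this]
  exact VectorMeasure.integral_toSignedMeasure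

theorem isFiniteMeasure_variation (μ : SignedMeasure ℂ) : IsFiniteMeasure μ.variation := by
  rw [← SignedMeasure.totalVariation_eq_variation, SignedMeasure.totalVariation]
  infer_instance

/-- The polar decomposition of a signed measure. -/
theorem exists_density (μ : SignedMeasure ℂ) : ∃ h : ℂ → ℝ, Measurable h ∧
    (∀ x, h x = 1 ∨ h x = -1) ∧ μ Set.univ = ∫ x, h x ∂μ.variation ∧
    ∀ F : ℂ → ℝ, μ.integral F (ContinuousLinearMap.lsmul ℝ ℝ) =
      ∫ x, h x * F x ∂μ.variation := by
  classical
  obtain ⟨i, hi, hi2, hi3, hpos, hneg⟩ := μ.toJordanDecomposition_spec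
  have hfin := isFiniteMeasure_variation μ
  set j := μ.toJordanDecomposition with hj
  have hvar : μ.variation = j.posPart + j.negPart := by
    rw [← SignedMeasure.totalVariation_eq_variation, SignedMeasure.totalVariation]
  have hp0 : j.posPart iᶜ = 0 := by
    rw [hpos, SignedMeasure.toMeasureOfZeroLE_apply _ _ hi hi.compl]
    simp
  have hn0 : j.negPart i = 0 := by
    rw [hneg, SignedMeasure.toMeasureOfLEZero_apply _ _ hi.compl hi]
    simp
  have hp : j.posPart = μ.variation.restrict i := by
    rw [hvar, Measure.restrict_add, Measure.restrict_eq_zero.2 hn0, add_zero,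
      Measure.restrict_eq_self_of_ae_mem]
    exact hp0
  have hn : j.negPart = μ.variation.restrict iᶜ := by
    rw [hvar, Measure.restrict_add, Measure.restrict_eq_zero.2 hp0, zero_add,
      Measure.restrict_eq_self_of_ae_mem]
    rw [ae_iff]
    simpa using hn0
  have key : ∀ F : ℂ → ℝ, Integrable F μ.variation →
      ∫ x, (if x ∈ i then (1 : ℝ) else -1) * F x ∂μ.variation =
        ∫ x, F x ∂j.posPart - ∫ x, F x ∂j.negPart := by
    intro F hF
    have hFh : Integrable (fun x => (if x ∈ i then (1 : ℝ) else -1) * F x) μ.variation := by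
      refine hF.bdd_mul (c := 1) ?_ ?_
      · exact (Measurable.ite hi measurable_const measurable_const).aestronglyMeasurable
      · refine Eventually.of_forall fun x => ?_
        split_ifs <;> simp
    rw [← integral_add_compl hi hFh, hp, hn, sub_eq_add_neg, ← integral_neg]
    congr 1
    · exact setIntegral_congr_fun hi fun x hx => by simp [hx]
    · exact setIntegral_congr_fun hi.compl fun x hx => by
        have : x ∉ i := hx
        simp [this]
  refine ⟨fun x => if x ∈ i then 1 else -1, Measurable.ite hi measurable_const measurable_const,
    fun x => by by_cases hx : x ∈ i <;> simp [hx], ?_, fun F => ?_⟩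
  · have := key (fun _ => 1) (integrable_const _)
    simp only [mul_one] at this
    rw [this]
    conv_lhs => rw [← μ.toSignedMeasure_toJordanDecomposition]
    simp [JordanDecomposition.toSignedMeasure, hj]
  · by_cases hF : Integrable F μ.variation
    · rw [key F hF]
      have h1 : μ = j.posPart.toSignedMeasure - j.negPart.toSignedMeasure :=
        μ.toSignedMeasure_toJordanDecomposition.symm
      conv_lhs => rw [h1]
      have hFp : Integrable F j.posPart := hp ▸ hF.restrict
      have hFn : Integrable F j.negPart := hn ▸ hF.restrict
      rw [VectorMeasure.integral_sub_vectorMeasure, integral_lsmul_toSignedMeasure,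
        integral_lsmul_toSignedMeasure]
      · simpa [VectorMeasure.Integrable] using hFp
      · simpa [VectorMeasure.Integrable] using hFn
    -- For non-integrable `F` both integrals have the default value `0`, since multiplication by
    -- `±1` does not change integrability. The formula thus needs no hypothesis on `F`.
    · rw [VectorMeasure.integral_undef hF, integral_undef]
      intro hc
      apply hF
      have := hc.bdd_mul (c := 1) (f := fun x => if x ∈ i then (1 : ℝ) else -1)
        (Measurable.ite hi measurable_const measurable_const).aestronglyMeasurable
        (Eventually.of_forall fun x => by split_ifs <;> simp)
      refine this.congr (Eventually.of_forall fun x => ?_)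
      by_cases hx : x ∈ i <;> simp [hx]

end CriticalMeasure

namespace CriticalMeasure

/-! ### The first variation of the weighted energy -/

theorem measurable_absLogKernel : Measurable fun q : ℂ × ℂ => absLogKernel q.1 q.2 := by
  classical
  unfold absLogKernel
  refine Measurable.ite (measurableSet_eq_fun measurable_fst measurable_snd) measurable_const ?_
  exact (Real.measurable_log.comp (measurable_fst.sub measurable_snd).norm).abs.ennreal_ofReal

/-- The kernel is `+∞` on the diagonal, so an atom at `x` would make the inner integral infinite at
`x`, a point of positive mass. -/
theorem HasFiniteEnergy.singleton_eq_zero {μ : SignedMeasure ℂ} (hμ : HasFiniteEnergy μ) (x : ℂ) :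
    μ.variation {x} = 0 := by
  have hfin := isFiniteMeasure_variation μ
  have hae : ∀ᵐ z ∂μ.variation, ∫⁻ y, absLogKernel z y ∂μ.variation < ⊤ :=
    ae_lt_top measurable_absLogKernel.lintegral_prod_right' hμ.ne
  by_contra hx
  have hx' : ∫⁻ y, absLogKernel x y ∂μ.variation < ⊤ := by
    by_contra hcon
    exact hx (measure_mono_null (by simpa using hcon) (ae_iff.1 hae))
  have h1 : ∫⁻ y in {x}, absLogKernel x y ∂μ.variation ≤ ∫⁻ y, absLogKernel x y ∂μ.variation :=
    setLIntegral_le_lintegral _ _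
  rw [lintegral_singleton] at h1
  rw [absLogKernel, if_pos rfl, ENNReal.top_mul hx] at h1
  exact absurd (h1.trans_lt hx') (lt_irrefl _)

theorem HasFiniteEnergy.integrable_log {μ : SignedMeasure ℂ} (hμ : HasFiniteEnergy μ) :
    Integrable (fun q : ℂ × ℂ => Real.log (1 / ‖q.1 - q.2‖))
      (μ.variation.prod μ.variation) := by
  have hfin := isFiniteMeasure_variation μ
  refine ⟨?_, ?_⟩
  · exact (Real.measurable_log.comp
      ((measurable_fst.sub measurable_snd).norm.const_div 1)).aestronglyMeasurable
  · refine lt_of_le_of_lt ?_ hμ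
    rw [← lintegral_prod _ measurable_absLogKernel.aemeasurable]
    refine lintegral_mono fun q => ?_
    unfold absLogKernel
    split_ifs with h
    · exact le_top
    · dsimp only
      rw [one_div, Real.log_inv, ← ofReal_norm, norm_neg, Real.norm_eq_abs]

theorem energy_map {μ : SignedMeasure ℂ} {h : ℂ → ℝ}
    (hint : ∀ F : ℂ → ℝ, μ.integral F (ContinuousLinearMap.lsmul ℝ ℝ) =
      ∫ x, h x * F x ∂μ.variation) {φ : ℂ → ℂ} (hφ : MeasurableEmbedding φ) :
    energy (μ.map φ) = ∫ x, h x * ∫ y, h y * Real.log (1 / ‖φ x - φ y‖) ∂μ.variation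
      ∂μ.variation := by
  unfold energy
  rw [hφ.integral_map_vectorMeasure, hint]
  congr 1
  funext x
  rw [hφ.integral_map_vectorMeasure, hint]

/-- If two images coincide then `x - y = t (g y - g x)` has norm at most `‖x - y‖ / 2`, so the map
is injective; a continuous injection between Polish spaces is a measurable embedding. This allows
integrals against the image measure to be pulled back. -/
theorem measurableEmbedding_id_add_mul {g : ℂ → ℂ} {L : NNReal} (hg : LipschitzWith L g) {t : ℂ}
    (ht : ‖t‖ * L ≤ 1 / 2) : MeasurableEmbedding fun z => z + t * g z := by
  have hc : Continuous fun z => z + t * g z :=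
    continuous_id.add (continuous_const.mul hg.continuous)
  refine hc.measurableEmbedding fun x y hxy => ?_
  have h1 : x - y = t * (g y - g x) := by
    have : x + t * g x = y + t * g y := hxy
    linear_combination this
  have h2 : ‖x - y‖ ≤ 1 / 2 * ‖x - y‖ := by
    calc ‖x - y‖ = ‖t‖ * ‖g y - g x‖ := by rw [h1, norm_mul]
      _ ≤ ‖t‖ * (L * ‖x - y‖) := by
          have := hg.norm_sub_le y x
          rw [norm_sub_rev y x] at this
          gcongr
      _ = (‖t‖ * L) * ‖x - y‖ := by ring
      _ ≤ _ := by gcongr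
  have : ‖x - y‖ = 0 := by linarith [norm_nonneg (x - y)]
  exact sub_eq_zero.1 (norm_eq_zero.1 this)

/-- The difference quotient of `g`. -/
noncomputable def diffQuot (g : ℂ → ℂ) (q : ℂ × ℂ) : ℂ := (g q.1 - g q.2) / (q.1 - q.2)

theorem measurable_diffQuot {g : ℂ → ℂ} (hg : Continuous g) : Measurable (diffQuot g) := by
  unfold diffQuot
  have := hg.measurable
  fun_prop

theorem norm_diffQuot_le {g : ℂ → ℂ} {L : NNReal} (hg : LipschitzWith L g) (q : ℂ × ℂ) :
    ‖diffQuot g q‖ ≤ L := by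
  unfold diffQuot
  by_cases h : q.1 = q.2
  · simp [h]
  · rw [norm_div, div_le_iff₀ (norm_pos_iff.2 (sub_ne_zero.2 h))]
    exact hg.norm_sub_le _ _

/-- The bound is uniform in `q` and linear in `t`: it dominates the difference quotients in `t`. -/
theorem norm_log_one_add_mul_le {g : ℂ → ℂ} {L : NNReal} (hg : LipschitzWith L g) {t : ℂ}
    (ht : ‖t‖ * L ≤ 1 / 2) (q : ℂ × ℂ) :
    |Real.log ‖1 + t * diffQuot g q‖| ≤ 3 / 2 * (‖t‖ * L) := by
  have h0 : ‖t * diffQuot g q‖ ≤ ‖t‖ * L := by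
    rw [norm_mul]
    gcongr
    exact norm_diffQuot_le hg q
  rw [← Complex.log_re]
  exact (Complex.abs_re_le_norm _).trans
    ((Complex.norm_log_one_add_half_le_self (h0.trans ht)).trans (by gcongr))

/-- `x^t - y^t = (x - y) (1 + t (g x - g y) / (x - y))`, so the singular part of the kernel
separates from a bounded perturbation. -/
theorem log_norm_varied {g : ℂ → ℂ} {L : NNReal} (hg : LipschitzWith L g) {t : ℂ}
    (ht : ‖t‖ * L ≤ 1 / 2) {x y : ℂ} (hxy : x ≠ y) :
    Real.log (1 / ‖x + t * g x - (y + t * g y)‖) =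
      Real.log (1 / ‖x - y‖) - Real.log ‖1 + t * diffQuot g (x, y)‖ := by
  have h0 : x - y ≠ 0 := sub_ne_zero.2 hxy
  have h1 : x + t * g x - (y + t * g y) = (x - y) * (1 + t * diffQuot g (x, y)) := by
    unfold diffQuot
    field_simp
    ring
  have h2 : 1 + t * diffQuot g (x, y) ≠ 0 := by
    intro hc
    have h3 : ‖t * diffQuot g (x, y)‖ ≤ 1 / 2 := by
      rw [norm_mul]
      exact (mul_le_mul_of_nonneg_left (norm_diffQuot_le hg _) (norm_nonneg _)).trans ht
    have h4 : t * diffQuot g (x, y) = -1 := by linear_combination hc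
    rw [h4] at h3
    norm_num at h3
  rw [h1, norm_mul, one_div, one_div, Real.log_inv, Real.log_inv,
    Real.log_mul (norm_ne_zero_iff.2 h0) (norm_ne_zero_iff.2 h2)]
  ring

theorem energy_varied_eq {μ : SignedMeasure ℂ} (hμ : HasFiniteEnergy μ) {h : ℂ → ℝ}
    (hm : Measurable h) (h1 : ∀ x, h x = 1 ∨ h x = -1)
    (hint : ∀ F : ℂ → ℝ, μ.integral F (ContinuousLinearMap.lsmul ℝ ℝ) =
      ∫ x, h x * F x ∂μ.variation) {g : ℂ → ℂ} {L : NNReal} (hg : LipschitzWith L g) {t : ℂ}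
    (ht : ‖t‖ * L ≤ 1 / 2) :
    energy (μ.map fun z => z + t * g z) =
      (∫ q : ℂ × ℂ, h q.1 * h q.2 * Real.log (1 / ‖q.1 - q.2‖) ∂μ.variation.prod μ.variation) -
      ∫ q : ℂ × ℂ, h q.1 * h q.2 * Real.log ‖1 + t * diffQuot g q‖
        ∂μ.variation.prod μ.variation := by
  have hfin := isFiniteMeasure_variation μ
  have hb : ∀ x, ‖h x‖ ≤ 1 := fun x => by rcases h1 x with hx | hx <;> simp [hx]
  have hbb : ∀ q : ℂ × ℂ, ‖h q.1 * h q.2‖ ≤ 1 := fun q => by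
    rw [norm_mul]
    exact mul_le_one₀ (hb _) (norm_nonneg _) (hb _)
  have hmm : Measurable fun q : ℂ × ℂ => h q.1 * h q.2 :=
    (hm.comp measurable_fst).mul (hm.comp measurable_snd)
  have hI1 : Integrable (fun q : ℂ × ℂ => h q.1 * h q.2 * Real.log (1 / ‖q.1 - q.2‖))
      (μ.variation.prod μ.variation) :=
    hμ.integrable_log.bdd_mul (c := 1) hmm.aestronglyMeasurable (Eventually.of_forall hbb)
  have hmeas := measurable_diffQuot hg.continuous
  have hI2 : Integrable (fun q : ℂ × ℂ => h q.1 * h q.2 * Real.log ‖1 + t * diffQuot g q‖)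
      (μ.variation.prod μ.variation) := by
    refine Integrable.bdd_mul (c := 1) ?_ hmm.aestronglyMeasurable (Eventually.of_forall hbb)
    refine Integrable.of_bound (C := 3 / 2 * (‖t‖ * L)) ?_
      (Eventually.of_forall fun q => norm_log_one_add_mul_le hg ht q)
    exact (Real.measurable_log.comp
      ((hmeas.const_mul t).const_add 1).norm).aestronglyMeasurable
  rw [energy_map hint (measurableEmbedding_id_add_mul hg ht), ← integral_sub hI1 hI2]
  have hprod := integral_prod _ (hI1.sub hI2)
  simp only [Pi.sub_apply] at hprod
  rw [hprod]
  refine integral_congr_ae (Eventually.of_forall fun x => ?_)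
  dsimp only
  rw [← integral_const_mul]
  -- There are no atoms, so the diagonal, where the factorization of the kernel fails, may be
  -- discarded.
  have hne : ∀ᵐ y ∂μ.variation, y ≠ x := by
    rw [ae_iff]
    simpa using hμ.singleton_eq_zero x
  refine integral_congr_ae ?_
  filter_upwards [hne] with y hy
  rw [log_norm_varied hg ht (Ne.symm hy)]
  ring

theorem tendsto_log_one_add_div (d : ℂ) :
    Tendsto (fun t : ℝ => Real.log ‖1 + (t : ℂ) * d‖ / t) (𝓝[≠] 0) (𝓝 d.re) := by
  have h1 : HasDerivAt (fun t : ℝ => Complex.log (1 + (t : ℂ) * d)) d 0 := by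
    have h2 : HasDerivAt (fun t : ℝ => 1 + (t : ℂ) * d) d 0 := by
      have h3 : HasDerivAt (fun s : ℝ => (s : ℂ)) 1 0 := Complex.ofRealCLM.hasDerivAt
      simpa using (h3.mul_const d).const_add 1
    simpa using h2.clog_real (by simp)
  have h3 : HasDerivAt (fun t : ℝ => (Complex.log (1 + (t : ℂ) * d)).re) d.re 0 :=
    (Complex.reCLM.hasFDerivAt.comp_hasDerivAt (0 : ℝ) h1)
  have h4 := h3.tendsto_slope_zero
  refine h4.congr fun t => ?_
  simp [Complex.log_re, div_eq_inv_mul]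

/-- Dominated convergence: the integrand divided by `t` is bounded by `3 / 2 * L` and tends to the
real part of the difference quotient of `g`. Real `t` suffices, because the imaginary part is
recovered later from `I * g`. -/
theorem tendsto_energy_quotient {μ : SignedMeasure ℂ} (hμ : HasFiniteEnergy μ) {h : ℂ → ℝ}
    (hm : Measurable h) (h1 : ∀ x, h x = 1 ∨ h x = -1)
    (hint : ∀ F : ℂ → ℝ, μ.integral F (ContinuousLinearMap.lsmul ℝ ℝ) =
      ∫ x, h x * F x ∂μ.variation) {g : ℂ → ℂ} {L : NNReal} (hg : LipschitzWith L g) :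
    Tendsto (fun t : ℝ => (energy (μ.map fun z => z + (t : ℂ) * g z) -
      energy (μ.map fun z => z + 0 * g z)) / t) (𝓝[≠] 0)
      (𝓝 (-∫ q : ℂ × ℂ, h q.1 * h q.2 * (diffQuot g q).re ∂μ.variation.prod μ.variation)) := by
  have hfin := isFiniteMeasure_variation μ
  have hb : ∀ x, ‖h x‖ ≤ 1 := fun x => by rcases h1 x with hx | hx <;> simp [hx]
  have hbb : ∀ q : ℂ × ℂ, ‖h q.1 * h q.2‖ ≤ 1 := fun q => by
    rw [norm_mul]
    exact mul_le_one₀ (hb _) (norm_nonneg _) (hb _)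
  have hmm : Measurable fun q : ℂ × ℂ => h q.1 * h q.2 :=
    (hm.comp measurable_fst).mul (hm.comp measurable_snd)
  have hmeas := measurable_diffQuot hg.continuous
  have hsmall : ∀ᶠ t : ℝ in 𝓝[≠] 0, ‖(t : ℂ)‖ * L ≤ 1 / 2 ∧ t ≠ 0 := by
    refine Eventually.and ?_ self_mem_nhdsWithin
    have : Tendsto (fun t : ℝ => ‖(t : ℂ)‖ * L) (𝓝 0) (𝓝 0) := by
      have : Continuous fun t : ℝ => ‖(t : ℂ)‖ * L := by fun_prop
      simpa using this.tendsto 0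
    exact (this.eventually (ge_mem_nhds (by norm_num))).filter_mono nhdsWithin_le_nhds
  have hlim : Tendsto (fun t : ℝ => ∫ q : ℂ × ℂ, h q.1 * h q.2 *
      (Real.log ‖1 + (t : ℂ) * diffQuot g q‖ / t) ∂μ.variation.prod μ.variation) (𝓝[≠] 0)
      (𝓝 (∫ q : ℂ × ℂ, h q.1 * h q.2 * (diffQuot g q).re ∂μ.variation.prod μ.variation)) := by
    refine tendsto_integral_filter_of_dominated_convergence (fun _ => 3 / 2 * (L : ℝ)) ?_ ?_
      (integrable_const _) ?_
    · refine Eventually.of_forall fun t => ?_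
      exact (hmm.mul ((Real.measurable_log.comp
        ((hmeas.const_mul _).const_add 1).norm).div_const _)).aestronglyMeasurable
    · filter_upwards [hsmall] with t ht
      refine Eventually.of_forall fun q => ?_
      have h2 := norm_log_one_add_mul_le hg ht.1 q
      rw [norm_mul]
      have h3 : ‖Real.log ‖1 + (t : ℂ) * diffQuot g q‖ / t‖ ≤ 3 / 2 * L := by
        rw [norm_div, Real.norm_eq_abs, Real.norm_eq_abs, div_le_iff₀ (abs_pos.2 ht.2)]
        refine h2.trans (le_of_eq ?_)
        rw [Complex.norm_real, Real.norm_eq_abs]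
        ring
      calc _ ≤ 1 * (3 / 2 * (L : ℝ)) := by
            gcongr
            exact hbb q
        _ = _ := one_mul _
    · refine Eventually.of_forall fun q => ?_
      exact (tendsto_log_one_add_div _).const_mul _
  refine hlim.neg.congr' ?_
  filter_upwards [hsmall] with t ht
  rw [energy_varied_eq hμ hm h1 hint hg ht.1, energy_varied_eq hμ hm h1 hint hg (by simp)]
  have : ∫ q : ℂ × ℂ, h q.1 * h q.2 * (Real.log ‖1 + (t : ℂ) * diffQuot g q‖ / t)
      ∂μ.variation.prod μ.variation = (∫ q : ℂ × ℂ, h q.1 * h q.2 *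
      Real.log ‖1 + (t : ℂ) * diffQuot g q‖ ∂μ.variation.prod μ.variation) / t := by
    rw [← integral_div]
    congr 1
    funext q
    ring
  rw [this]
  simp
  ring

end CriticalMeasure

/-! ### The variation of the external field and the equation of a critical measure -/

namespace CriticalMeasure

variable {p : ℕ}

theorem measurable_fieldDeriv (a ρ : Fin (p + 1) → ℂ) : Measurable (fieldDeriv a ρ) := by
  unfold fieldDeriv
  fun_prop

/-- A Lipschitz `g` vanishing at `a k` satisfies `‖g x‖ ≤ L ‖x - a k‖`, and for small `t` the
displaced point stays at distance at least `‖x - a k‖ / 2` from `a k`. The zero of `g` therefore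
compensates the pole of `Φ'` along the whole segment, uniformly in `t`. -/
theorem norm_fieldDeriv_mul_le (a ρ : Fin (p + 1) → ℂ) {g : ℂ → ℂ} {L : NNReal}
    (hg : LipschitzWith L g) (hga : ∀ k, g (a k) = 0) {t : ℝ} (ht : |t| * L ≤ 1 / 2) (x : ℂ)
    {s : ℝ} (hs : s ∈ Set.Icc (0 : ℝ) 1) :
    ‖fieldDeriv a ρ (x + s * (t * g x)) * g x‖ ≤ ∑ k, ‖ρ k‖ * L := by
  unfold fieldDeriv
  rw [neg_mul, norm_neg, Finset.sum_mul]
  refine (norm_sum_le _ _).trans (Finset.sum_le_sum fun k _ => ?_)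
  have h1 : ‖g x‖ ≤ L * ‖x - a k‖ := by
    have := hg.norm_sub_le x (a k)
    rwa [hga k, sub_zero] at this
  by_cases hx : x = a k
  · rw [hx, hga k, mul_zero, norm_zero]
    positivity
  · have hx0 : 0 < ‖x - a k‖ := norm_pos_iff.2 (sub_ne_zero.2 hx)
    have h2 : ‖x - a k‖ / 2 ≤ ‖x + s * (t * g x) - a k‖ := by
      have h3 : ‖(s : ℂ) * (t * g x)‖ ≤ ‖x - a k‖ / 2 := by
        rw [norm_mul, norm_mul, Complex.norm_real, Complex.norm_real, Real.norm_eq_abs,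
          Real.norm_eq_abs, abs_of_nonneg hs.1]
        calc s * (|t| * ‖g x‖) ≤ 1 * (|t| * (L * ‖x - a k‖)) := by
              gcongr
              exact hs.2
          _ = (|t| * L) * ‖x - a k‖ := by ring
          _ ≤ 1 / 2 * ‖x - a k‖ := by gcongr
          _ = _ := by ring
      have h4 := norm_sub_norm_le (x - a k) (-((s : ℂ) * (t * g x)))
      rw [norm_neg] at h4
      have h5 : x - a k - -((s : ℂ) * (t * g x)) = x + s * (t * g x) - a k := by ring
      rw [h5] at h4
      linarith
    have h6 : 0 < ‖x + s * (t * g x) - a k‖ := lt_of_lt_of_le (by positivity) h2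
    rw [norm_mul, norm_div, norm_div, div_mul_eq_mul_div, div_le_iff₀ h6]
    have : ‖(2 : ℂ)‖ = 2 := by simp
    rw [this]
    calc ‖ρ k‖ / 2 * ‖g x‖ ≤ ‖ρ k‖ / 2 * (L * ‖x - a k‖) := by gcongr
      _ = ‖ρ k‖ * L * (‖x - a k‖ / 2) := by ring
      _ ≤ _ := by gcongr

theorem continuousAt_fieldDeriv (a ρ : Fin (p + 1) → ℂ) {x : ℂ} (hx : ∀ k, x ≠ a k) :
    ContinuousAt (fieldDeriv a ρ) x := by
  unfold fieldDeriv
  refine ContinuousAt.neg (tendsto_finsetSum _ fun k _ => ?_)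
  exact ContinuousAt.div continuousAt_const (by fun_prop) (sub_ne_zero.2 (hx k))

theorem fieldIncrement_eq (a ρ : Fin (p + 1) → ℂ) (g : ℂ → ℂ) (t : ℝ) (x : ℂ) :
    fieldIncrement a ρ x (t * g x) =
      (∫ s in Set.Ioc (0 : ℝ) 1, t * (fieldDeriv a ρ (x + s * (t * g x)) * g x)).re := by
  unfold fieldIncrement
  rw [intervalIntegral.integral_of_le zero_le_one]
  congr 2
  funext s
  ring

theorem measurable_fieldKernel (a ρ : Fin (p + 1) → ℂ) {g : ℂ → ℂ} (hg : Measurable g) (t : ℝ) :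
    Measurable fun q : ℂ × ℝ => fieldDeriv a ρ (q.1 + q.2 * (t * g q.1)) * g q.1 := by
  have h1 := hg.comp (measurable_fst : Measurable (Prod.fst : ℂ × ℝ → ℂ))
  refine Measurable.mul ((measurable_fieldDeriv a ρ).comp ?_) h1
  refine measurable_fst.add ?_
  exact (Complex.measurable_ofReal.comp measurable_snd).mul (h1.const_mul _)

theorem integrable_fieldKernel (a ρ : Fin (p + 1) → ℂ) (ν : Measure ℂ) [IsFiniteMeasure ν]
    {g : ℂ → ℂ} {L : NNReal} (hg : LipschitzWith L g) (hga : ∀ k, g (a k) = 0) {t : ℝ}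
    (ht : |t| * L ≤ 1 / 2) :
    Integrable (fun q : ℂ × ℝ => fieldDeriv a ρ (q.1 + q.2 * (t * g q.1)) * g q.1)
      (ν.prod (volume.restrict (Set.Ioc (0 : ℝ) 1))) := by
  refine Integrable.of_bound (C := ∑ k, ‖ρ k‖ * L)
    (measurable_fieldKernel a ρ hg.continuous.measurable t).aestronglyMeasurable ?_
  have : ∀ᵐ q : ℂ × ℝ ∂ν.prod (volume.restrict (Set.Ioc (0 : ℝ) 1)), q.2 ∈ Set.Ioc (0 : ℝ) 1 :=
    Measure.quasiMeasurePreserving_snd.ae (ae_restrict_mem measurableSet_Ioc)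
  filter_upwards [this] with q hq
  exact norm_fieldDeriv_mul_le a ρ hg hga ht q.1 (Set.Ioc_subset_Icc_self hq)

/-- The increment along the segment becomes an integral over `ν` times `(0, 1]`, so that the limit
`t → 0` is a single application of dominated convergence. -/
theorem integral_field_varied_sub {a ρ : Fin (p + 1) → ℂ} {μ : SignedMeasure ℂ}
    (hfield : μ.Integrable (field a ρ)) {h : ℂ → ℝ}
    (hm : Measurable h) (h1 : ∀ x, h x = 1 ∨ h x = -1)
    (hint : ∀ F : ℂ → ℝ, μ.integral F (ContinuousLinearMap.lsmul ℝ ℝ) =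
      ∫ x, h x * F x ∂μ.variation) {g : ℂ → ℂ} {L : NNReal} (hg : LipschitzWith L g)
    (hga : ∀ k, g (a k) = 0) {t : ℝ} (ht : |t| * L ≤ 1 / 2) :
    μ.integral (fun x => field a ρ x + fieldIncrement a ρ x (t * g x))
      (ContinuousLinearMap.lsmul ℝ ℝ) - μ.integral (field a ρ) (ContinuousLinearMap.lsmul ℝ ℝ) =
    t * (∫ q : ℂ × ℝ, (h q.1 : ℂ) * (fieldDeriv a ρ (q.1 + q.2 * (t * g q.1)) * g q.1)
      ∂μ.variation.prod (volume.restrict (Set.Ioc (0 : ℝ) 1))).re := by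
  have hfin := isFiniteMeasure_variation μ
  have hb : ∀ x, ‖h x‖ ≤ 1 := fun x => by rcases h1 x with hx | hx <;> simp [hx]
  have hK := integrable_fieldKernel a ρ μ.variation hg hga ht
  have hinc : Integrable (fun x => fieldIncrement a ρ x (t * g x)) μ.variation := by
    simp_rw [fieldIncrement_eq, integral_const_mul]
    exact (hK.integral_prod_left.const_mul (t : ℂ)).re
  have hf1 : Integrable (fun x => h x * field a ρ x) μ.variation :=
    Integrable.bdd_mul (c := 1) hfield hm.aestronglyMeasurable (Eventually.of_forall hb)
  have hf2 : Integrable (fun x => h x * fieldIncrement a ρ x (t * g x)) μ.variation :=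
    Integrable.bdd_mul (c := 1) hinc hm.aestronglyMeasurable (Eventually.of_forall hb)
  have hhK : Integrable (fun q : ℂ × ℝ =>
      (h q.1 : ℂ) * (fieldDeriv a ρ (q.1 + q.2 * (t * g q.1)) * g q.1))
      (μ.variation.prod (volume.restrict (Set.Ioc (0 : ℝ) 1))) :=
    Integrable.bdd_mul (c := 1) hK
      ((Complex.measurable_ofReal.comp (hm.comp measurable_fst)).aestronglyMeasurable)
      (Eventually.of_forall fun q => by simpa using hb q.1)
  rw [hint, hint]
  simp_rw [mul_add]
  rw [integral_add hf1 hf2, add_sub_cancel_left, integral_prod _ hhK]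
  simp_rw [integral_const_mul]
  have hre : (∫ x, (h x : ℂ) * (∫ s in Set.Ioc (0 : ℝ) 1,
      fieldDeriv a ρ (x + s * (t * g x)) * g x) ∂μ.variation).re =
      ∫ x, ((h x : ℂ) * (∫ s in Set.Ioc (0 : ℝ) 1,
        fieldDeriv a ρ (x + s * (t * g x)) * g x)).re ∂μ.variation := by
    refine (integral_re (𝕜 := ℂ) ?_).symm
    exact Integrable.bdd_mul (c := 1) hK.integral_prod_left
      (Complex.measurable_ofReal.comp hm).aestronglyMeasurable
      (Eventually.of_forall fun q => by simpa using hb q)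
  rw [hre, ← integral_const_mul]
  refine integral_congr_ae (Eventually.of_forall fun x => ?_)
  dsimp only
  rw [fieldIncrement_eq, integral_const_mul, Complex.re_ofReal_mul, Complex.re_ofReal_mul]
  ring

theorem tendsto_field_quotient {a ρ : Fin (p + 1) → ℂ} {μ : SignedMeasure ℂ}
    (hfield : μ.Integrable (field a ρ)) {h : ℂ → ℝ}
    (hm : Measurable h) (h1 : ∀ x, h x = 1 ∨ h x = -1)
    (hint : ∀ F : ℂ → ℝ, μ.integral F (ContinuousLinearMap.lsmul ℝ ℝ) =
      ∫ x, h x * F x ∂μ.variation) {g : ℂ → ℂ} {L : NNReal} (hg : LipschitzWith L g)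
    (hga : ∀ k, g (a k) = 0) :
    Tendsto (fun t : ℝ => (μ.integral (fun x => field a ρ x + fieldIncrement a ρ x (t * g x))
      (ContinuousLinearMap.lsmul ℝ ℝ) - μ.integral (field a ρ) (ContinuousLinearMap.lsmul ℝ ℝ)) / t)
      (𝓝[≠] 0) (𝓝 (∫ x, (h x : ℂ) * (fieldDeriv a ρ x * g x) ∂μ.variation).re) := by
  have hfin := isFiniteMeasure_variation μ
  have hb : ∀ x, ‖h x‖ ≤ 1 := fun x => by rcases h1 x with hx | hx <;> simp [hx]
  have hsmall : ∀ᶠ t : ℝ in 𝓝[≠] 0, |t| * L ≤ 1 / 2 ∧ t ≠ 0 := by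
    refine Eventually.and ?_ self_mem_nhdsWithin
    have : Tendsto (fun t : ℝ => |t| * L) (𝓝 0) (𝓝 0) := by
      have : Continuous fun t : ℝ => |t| * (L : ℝ) := by fun_prop
      simpa using this.tendsto 0
    exact (this.eventually (ge_mem_nhds (by norm_num))).filter_mono nhdsWithin_le_nhds
  have hlim : Tendsto (fun t : ℝ => ∫ q : ℂ × ℝ, (h q.1 : ℂ) *
      (fieldDeriv a ρ (q.1 + q.2 * (t * g q.1)) * g q.1)
        ∂μ.variation.prod (volume.restrict (Set.Ioc (0 : ℝ) 1))) (𝓝[≠] 0)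
      (𝓝 (∫ q : ℂ × ℝ, (h q.1 : ℂ) * (fieldDeriv a ρ q.1 * g q.1)
        ∂μ.variation.prod (volume.restrict (Set.Ioc (0 : ℝ) 1)))) := by
    refine tendsto_integral_filter_of_dominated_convergence (fun _ => ∑ k, ‖ρ k‖ * L) ?_ ?_
      (integrable_const _) ?_
    · refine Eventually.of_forall fun t => ?_
      exact ((Complex.measurable_ofReal.comp (hm.comp measurable_fst)).mul
        (measurable_fieldKernel a ρ hg.continuous.measurable t)).aestronglyMeasurable
    · filter_upwards [hsmall] with t ht
      have : ∀ᵐ q : ℂ × ℝ ∂μ.variation.prod (volume.restrict (Set.Ioc (0 : ℝ) 1)),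
          q.2 ∈ Set.Ioc (0 : ℝ) 1 :=
        Measure.quasiMeasurePreserving_snd.ae (ae_restrict_mem measurableSet_Ioc)
      filter_upwards [this] with q hq
      rw [norm_mul]
      calc _ ≤ 1 * (∑ k, ‖ρ k‖ * (L : ℝ)) := by
            gcongr
            · simpa using hb q.1
            · exact norm_fieldDeriv_mul_le a ρ hg hga ht.1 q.1 (Set.Ioc_subset_Icc_self hq)
        _ = _ := one_mul _
    · refine Eventually.of_forall fun q => Tendsto.const_mul _ ?_
      -- At a node `Φ'` is not continuous, but `g` vanishes there and the integrand is identically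
      -- `0`.
      by_cases hq : ∃ k, q.1 = a k
      · obtain ⟨k, hk⟩ := hq
        rw [hk, hga k]
        simp
      · push Not at hq
        refine Tendsto.mul_const _ ?_
        have hc : Tendsto (fun t : ℝ => q.1 + q.2 * ((t : ℂ) * g q.1)) (𝓝[≠] 0) (𝓝 q.1) := by
          have : Continuous fun t : ℝ => q.1 + q.2 * ((t : ℂ) * g q.1) := by fun_prop
          have h3 := this.tendsto 0
          simp only [Complex.ofReal_zero, zero_mul, mul_zero, add_zero] at h3
          exact h3.mono_left nhdsWithin_le_nhds
        exact (continuousAt_fieldDeriv a ρ hq).tendsto.comp hc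
  have hK0 : Integrable (fun q : ℂ × ℝ => (h q.1 : ℂ) * (fieldDeriv a ρ q.1 * g q.1))
      (μ.variation.prod (volume.restrict (Set.Ioc (0 : ℝ) 1))) := by
    have := integrable_fieldKernel a ρ μ.variation hg hga (t := 0) (by simp)
    simp only [Complex.ofReal_zero, zero_mul, mul_zero, add_zero] at this
    exact Integrable.bdd_mul (c := 1) this
      ((Complex.measurable_ofReal.comp (hm.comp measurable_fst)).aestronglyMeasurable)
      (Eventually.of_forall fun q => by simpa using hb q.1)
  have hval : ∫ q : ℂ × ℝ, (h q.1 : ℂ) * (fieldDeriv a ρ q.1 * g q.1)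
        ∂μ.variation.prod (volume.restrict (Set.Ioc (0 : ℝ) 1)) =
      ∫ x, (h x : ℂ) * (fieldDeriv a ρ x * g x) ∂μ.variation := by
    rw [integral_prod _ hK0]
    simp
  rw [hval] at hlim
  refine ((Complex.continuous_re.tendsto _).comp hlim).congr' ?_
  filter_upwards [hsmall] with t ht
  rw [integral_field_varied_sub hfield hm h1 hint hg hga ht.1, mul_div_cancel_left₀ _ ht.2]
  rfl

/-- The equation of a critical measure: the first variation of the weighted energy vanishes. -/
theorem IsCritical.integral_diffQuot {a ρ : Fin (p + 1) → ℂ} {μ : SignedMeasure ℂ}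
    (hμ : IsCritical a ρ μ) {h : ℂ → ℝ}
    (hm : Measurable h) (h1 : ∀ x, h x = 1 ∨ h x = -1)
    (hint : ∀ F : ℂ → ℝ, μ.integral F (ContinuousLinearMap.lsmul ℝ ℝ) =
      ∫ x, h x * F x ∂μ.variation) {g : ℂ → ℂ} (hg : ContDiff ℝ (⊤ : ℕ∞) g)
    (hgc : HasCompactSupport g) (hga : ∀ k, g (a k) = 0) :
    ∫ q : ℂ × ℂ, ((h q.1 * h q.2 : ℝ) : ℂ) * diffQuot g q ∂μ.variation.prod μ.variation =
      2 * ∫ x, (h x : ℂ) * (fieldDeriv a ρ x * g x) ∂μ.variation := by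
  have hfin := isFiniteMeasure_variation μ
  have hb : ∀ x, ‖h x‖ ≤ 1 := fun x => by rcases h1 x with hx | hx <;> simp [hx]
  have key : ∀ g : ℂ → ℂ, ContDiff ℝ (⊤ : ℕ∞) g → HasCompactSupport g → (∀ k, g (a k) = 0) →
      (∫ q : ℂ × ℂ, ((h q.1 * h q.2 : ℝ) : ℂ) * diffQuot g q
        ∂μ.variation.prod μ.variation).re =
      (2 * ∫ x, (h x : ℂ) * (fieldDeriv a ρ x * g x) ∂μ.variation).re := by
    intro g hg hgc hga
    obtain ⟨L, hL⟩ := hg.lipschitzWith_of_hasCompactSupport hgc (by simp)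
    have hA := tendsto_energy_quotient hμ.finite_energy hm h1 hint hL
    have hB := tendsto_field_quotient hμ.integrable_field hm h1 hint hL hga
    have hst := hμ.stationary g hg hga
    -- The limit over complex `t` is restricted to real `t`, where the two difference quotients have
    -- been computed.
    have hof : Tendsto (fun t : ℝ => (t : ℂ)) (𝓝[≠] 0) (𝓝[≠] 0) := by
      refine tendsto_nhdsWithin_iff.2 ⟨?_, ?_⟩
      · exact (Complex.continuous_ofReal.tendsto' 0 0 (by simp)).mono_left nhdsWithin_le_nhds
      · filter_upwards [self_mem_nhdsWithin] with t ht
        simpa using ht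
    have hst' := (Complex.continuous_re.tendsto _).comp (hst.comp hof)
    have hsum := hA.add (hB.const_mul 2)
    have heq := tendsto_nhds_unique hst' (hsum.congr fun t => ?_)
    · rw [Complex.zero_re] at heq
      have hI : Integrable (fun q : ℂ × ℂ => ((h q.1 * h q.2 : ℝ) : ℂ) * diffQuot g q)
          (μ.variation.prod μ.variation) := by
        refine Integrable.of_bound (C := 1 * L) ?_ (Eventually.of_forall fun q => ?_)
        · have := measurable_diffQuot hL.continuous
          exact (Measurable.mul (by fun_prop) this).aestronglyMeasurable
        · rw [norm_mul]
          gcongr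
          · rw [Complex.norm_real, norm_mul]
            exact mul_le_one₀ (hb _) (norm_nonneg _) (hb _)
          · exact norm_diffQuot_le hL q
      have hre : (∫ q : ℂ × ℂ, ((h q.1 * h q.2 : ℝ) : ℂ) * diffQuot g q
        ∂μ.variation.prod μ.variation).re = ∫ q : ℂ × ℂ, h q.1 * h q.2 * (diffQuot g q).re
          ∂μ.variation.prod μ.variation := by
        refine (integral_re (𝕜 := ℂ) hI).symm.trans (integral_congr_ae
          (Eventually.of_forall fun q => ?_))
        exact Complex.re_ofReal_mul _ _
      rw [hre]
      have h2 : (2 * ∫ x, (h x : ℂ) * (fieldDeriv a ρ x * g x) ∂μ.variation).re =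
          2 * (∫ x, (h x : ℂ) * (fieldDeriv a ρ x * g x) ∂μ.variation).re := by
        simp
      rw [h2]
      linarith
    · simp only [Function.comp_apply, variedEnergy]
      rw [Complex.div_ofReal_re, Complex.ofReal_re]
      simp only [fieldIncrement, zero_mul, mul_zero, intervalIntegral.integral_zero,
        Complex.zero_re, add_zero]
      ring
  apply Complex.ext
  · exact key g hg hgc hga
  -- Both sides are complex linear in `g`, so the real part of the identity for `I * g` is the
  -- imaginary part of the identity for `g`.
  · have h3 := key (fun z => Complex.I * g z) (contDiff_const.mul hg) hgc.mul_left
      (fun k => by simp [hga k])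
    have h4 : ∀ q, ((h q.1 * h q.2 : ℝ) : ℂ) * diffQuot (fun z => Complex.I * g z) q =
        Complex.I * (((h q.1 * h q.2 : ℝ) : ℂ) * diffQuot g q) := by
      intro q
      unfold diffQuot
      ring
    have h5 : ∀ x, (h x : ℂ) * (fieldDeriv a ρ x * (Complex.I * g x)) =
        Complex.I * ((h x : ℂ) * (fieldDeriv a ρ x * g x)) := fun x => by ring
    simp_rw [h4, h5, integral_const_mul, mul_left_comm 2 Complex.I, Complex.I_mul_re] at h3
    linarith

end CriticalMeasure

namespace CriticalMeasure

variable {p : ℕ}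

/-! ### The regularized Cauchy kernel -/

/-- The regularization `conj u / (|u|² + ε²)` of `1 / u`. -/
noncomputable def regInv (ε : ℝ) (u : ℂ) : ℂ :=
  ((‖u‖ ^ 2 + ε ^ 2)⁻¹ : ℝ) • (starRingEnd ℂ) u

theorem contDiff_regInv {ε : ℝ} (hε : 0 < ε) : ContDiff ℝ (⊤ : ℕ∞) (regInv ε) := by
  have h1 : ContDiff ℝ (⊤ : ℕ∞) fun u : ℂ => (‖u‖ ^ 2 + ε ^ 2)⁻¹ :=
    ((contDiff_norm_sq ℝ).add contDiff_const).inv fun u => by positivity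
  exact h1.fun_smul Complex.conjCLE.contDiff

theorem norm_regInv_le (ε : ℝ) (u : ℂ) : ‖regInv ε u‖ ≤ ‖u‖⁻¹ := by
  unfold regInv
  by_cases hu : u = 0
  · simp [hu]
  · have hu' : 0 < ‖u‖ := norm_pos_iff.2 hu
    rw [norm_smul, RCLike.norm_conj, Real.norm_of_nonneg (by positivity), inv_mul_le_iff₀
      (by positivity), ← div_eq_mul_inv, le_div_iff₀ hu']
    nlinarith [sq_nonneg ε]

/-- The regularization obeys the bound of `1 / u - 1 / v` itself, uniformly in `ε`. Clearing
denominators, this is `(|u||v| + ε²) |u||v| ≤ (|u|² + ε²) (|v|² + ε²)`. It dominates the difference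
quotients of the regularized test functions. -/
theorem norm_regInv_sub_le {ε : ℝ} (hε : 0 < ε) {u v : ℂ} (hu : u ≠ 0) (hv : v ≠ 0) :
    ‖regInv ε u - regInv ε v‖ ≤ ‖u - v‖ * (‖u‖⁻¹ * ‖v‖⁻¹) := by
  have hu' : 0 < ‖u‖ := norm_pos_iff.2 hu
  have hv' : 0 < ‖v‖ := norm_pos_iff.2 hv
  have hs : 0 < ‖u‖ ^ 2 + ε ^ 2 := by positivity
  have ht : 0 < ‖v‖ ^ 2 + ε ^ 2 := by positivity
  have hu2 : (‖u‖ : ℂ) ^ 2 = u * (starRingEnd ℂ) u := by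
    rw [Complex.mul_conj, Complex.normSq_eq_norm_sq]
    push_cast
    rfl
  have hv2 : (‖v‖ : ℂ) ^ 2 = v * (starRingEnd ℂ) v := by
    rw [Complex.mul_conj, Complex.normSq_eq_norm_sq]
    push_cast
    rfl
  have h1 : regInv ε u - regInv ε v =
      (((‖u‖ ^ 2 + ε ^ 2) * (‖v‖ ^ 2 + ε ^ 2))⁻¹ : ℝ) •
        ((starRingEnd ℂ) u * (starRingEnd ℂ) v * (v - u) +
          (ε : ℂ) ^ 2 * (starRingEnd ℂ) (u - v)) := by
    have hs' : (‖u‖ : ℂ) ^ 2 + (ε : ℂ) ^ 2 ≠ 0 := by exact_mod_cast hs.ne'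
    have ht' : (‖v‖ : ℂ) ^ 2 + (ε : ℂ) ^ 2 ≠ 0 := by exact_mod_cast ht.ne'
    unfold regInv
    simp only [Complex.real_smul, map_sub]
    push_cast
    field_simp
    rw [hu2, hv2]
    ring
  have h2 : ‖(starRingEnd ℂ) u * (starRingEnd ℂ) v * (v - u) +
      (ε : ℂ) ^ 2 * (starRingEnd ℂ) (u - v)‖ ≤ ‖u - v‖ * (‖u‖ * ‖v‖ + ε ^ 2) := by
    refine (norm_add_le _ _).trans (le_of_eq ?_)
    rw [norm_mul, norm_mul, norm_mul, RCLike.norm_conj, RCLike.norm_conj, RCLike.norm_conj,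
      norm_pow, Complex.norm_real, Real.norm_of_nonneg hε.le, norm_sub_rev v u]
    ring
  rw [h1, norm_smul, Real.norm_of_nonneg (by positivity)]
  calc _ ≤ ((‖u‖ ^ 2 + ε ^ 2) * (‖v‖ ^ 2 + ε ^ 2))⁻¹ * (‖u - v‖ * (‖u‖ * ‖v‖ + ε ^ 2)) := by
        gcongr
    _ = ‖u - v‖ * (((‖u‖ ^ 2 + ε ^ 2) * (‖v‖ ^ 2 + ε ^ 2))⁻¹ * (‖u‖ * ‖v‖ + ε ^ 2)) := by ring
    _ ≤ _ := by
        refine mul_le_mul_of_nonneg_left ?_ (norm_nonneg _)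
        rw [inv_mul_le_iff₀ (by positivity), ← mul_inv, ← div_eq_mul_inv,
          le_div_iff₀ (by positivity)]
        nlinarith [mul_pos hu' hv', sq_nonneg (‖u‖ - ‖v‖), sq_nonneg ε, sq_nonneg (ε ^ 2),
          mul_nonneg (sq_nonneg ε) (sq_nonneg (‖u‖ - ‖v‖)),
          mul_nonneg (sq_nonneg ε) (mul_pos hu' hv').le]

theorem tendsto_regInv (u : ℂ) :
    Tendsto (fun n : ℕ => regInv (1 / ((n : ℝ) + 1)) u) atTop (𝓝 u⁻¹) := by
  by_cases hu : u = 0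
  · simp [regInv, hu]
  · have h1 : Tendsto (fun n : ℕ => (‖u‖ ^ 2 + (1 / ((n : ℝ) + 1)) ^ 2)⁻¹) atTop
        (𝓝 (‖u‖ ^ 2 + 0 ^ 2)⁻¹) := by
      refine Tendsto.inv₀ (tendsto_const_nhds.add ?_) ?_
      · exact tendsto_one_div_add_atTop_nhds_zero_nat.pow 2
      · have : 0 < ‖u‖ := norm_pos_iff.2 hu
        positivity
    have h2 := h1.smul_const ((starRingEnd ℂ) u)
    have h3 : u⁻¹ = (‖u‖ ^ 2 + 0 ^ 2)⁻¹ • (starRingEnd ℂ) u := by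
      rw [Complex.inv_def, Complex.real_smul, Complex.normSq_eq_norm_sq]
      simp [mul_comm]
    rw [h3]
    exact h2

/-! ### The Cauchy transform -/

/-- The Cauchy transform of the measure with density `h` with respect to `ν`. -/
noncomputable def cauchy (ν : Measure ℂ) (h : ℂ → ℝ) (z : ℂ) : ℂ :=
  ∫ x, (h x : ℂ) * (x - z)⁻¹ ∂ν

/-- A finite measure with compact support and without atoms, together with a density of modulus
one. -/
structure IsPolar (ν : Measure ℂ) (h : ℂ → ℝ) : Prop where
  finite : IsFiniteMeasure ν
  compact : IsCompact ν.support
  noAtom : ∀ x, ν {x} = 0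
  measurable : Measurable h
  unit : ∀ x, h x = 1 ∨ h x = -1

namespace IsPolar

variable {ν : Measure ℂ} {h : ℂ → ℝ}

theorem norm_eq (H : IsPolar ν h) (x : ℂ) : ‖(h x : ℂ)‖ = 1 := by
  rcases H.unit x with hx | hx <;> simp [hx]

theorem ae_mem (_H : IsPolar ν h) : ∀ᵐ x ∂ν, x ∈ ν.support := Measure.support_mem_ae

theorem ae_ne (H : IsPolar ν h) (a : ℂ) : ∀ᵐ x ∂ν, x ≠ a := by
  rw [ae_iff]
  simpa using H.noAtom a

theorem exists_bound (H : IsPolar ν h) : ∃ r : ℝ, 0 < r ∧ ∀ x ∈ ν.support, ‖x‖ ≤ r := by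
  obtain ⟨r, hr⟩ := H.compact.isBounded.exists_norm_le
  exact ⟨max r 1, by positivity, fun x hx => (hr x hx).trans (le_max_left _ _)⟩

theorem integrable_mul {F : ℂ → ℂ} (H : IsPolar ν h) (hF : Integrable F ν) :
    Integrable (fun x => (h x : ℂ) * F x) ν :=
  Integrable.bdd_mul (c := 1) hF (Complex.measurable_ofReal.comp H.measurable).aestronglyMeasurable
    (Eventually.of_forall fun x => (H.norm_eq x).le)

theorem integrable_continuous {F : ℂ → ℂ} (H : IsPolar ν h) (hF : Continuous F) :
    Integrable F ν := by
  have := H.finite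
  obtain ⟨c, hc⟩ := H.compact.exists_bound_of_continuousOn hF.continuousOn
  refine Integrable.of_bound (C := c) hF.aestronglyMeasurable ?_
  filter_upwards [H.ae_mem] with x hx using hc x hx

/-- The moments of the measure. -/
noncomputable def moment (ν : Measure ℂ) (h : ℂ → ℝ) (i : ℕ) : ℂ := ∫ x, (h x : ℂ) * x ^ i ∂ν

/-- The polynomial part of the Cauchy transform of `x ^ n`. -/
noncomputable def cauchyPoly (ν : Measure ℂ) (h : ℂ → ℝ) (n : ℕ) : Polynomial ℂ :=
  ∑ i ∈ Finset.range n, Polynomial.C (moment ν h i) * Polynomial.X ^ (n - 1 - i)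

theorem integrable_pow_mul_inv (H : IsPolar ν h) {z : ℂ}
    (hz : Integrable (fun x => (x - z)⁻¹) ν) {F : ℂ → ℂ} (hF : Continuous F) :
    Integrable (fun x => (h x : ℂ) * (F x * (x - z)⁻¹)) ν := by
  refine H.integrable_mul ?_
  obtain ⟨c, hc⟩ := H.compact.exists_bound_of_continuousOn hF.continuousOn
  refine Integrable.bdd_mul (c := c) hz hF.aestronglyMeasurable ?_
  filter_upwards [H.ae_mem] with x hx using hc x hx

/-- Divide `x ^ n - z ^ n` by `x - z`: the quotient `∑ x ^ i z ^ (n - 1 - i)` integrates to a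
polynomial in `z` whose coefficients are moments. -/
theorem integral_pow_mul_inv (H : IsPolar ν h) {z : ℂ}
    (hz : Integrable (fun x => (x - z)⁻¹) ν) (n : ℕ) :
    ∫ x, (h x : ℂ) * (x ^ n * (x - z)⁻¹) ∂ν =
      z ^ n * cauchy ν h z + (cauchyPoly ν h n).eval z := by
  have h1 : ∀ᵐ x ∂ν, (h x : ℂ) * (x ^ n * (x - z)⁻¹) = z ^ n * ((h x : ℂ) * (x - z)⁻¹) +
      ∑ i ∈ Finset.range n, (h x : ℂ) * x ^ i * z ^ (n - 1 - i) := by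
    filter_upwards [H.ae_ne z] with x hx
    have hx0 : x - z ≠ 0 := sub_ne_zero.2 hx
    have h2 := (Commute.all x z).geom_sum₂_mul n
    have h3 : x ^ n = z ^ n + (∑ i ∈ Finset.range n, x ^ i * z ^ (n - 1 - i)) * (x - z) := by
      rw [h2]
      ring
    simp_rw [mul_assoc]
    rw [← Finset.mul_sum]
    field_simp
    rw [h3]
    ring
  rw [integral_congr_ae h1, integral_add, integral_const_mul, integral_finsetSum]
  · congr 1
    rw [cauchyPoly, Polynomial.eval_finsetSum]
    refine Finset.sum_congr rfl fun i _ => ?_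
    rw [integral_mul_const]
    simp [moment]
  · intro i _
    exact (H.integrable_mul (H.integrable_continuous (by fun_prop))).mul_const _
  · exact (H.integrable_mul hz).const_mul _
  · refine integrable_finsetSum _ fun i _ => ?_
    exact (H.integrable_mul (H.integrable_continuous (by fun_prop))).mul_const _

theorem exists_polynomial_integral_mul_inv (H : IsPolar ν h) (B : Polynomial ℂ) :
    ∃ Q : Polynomial ℂ, ∀ z, Integrable (fun x => (x - z)⁻¹) ν →
      ∫ x, (h x : ℂ) * (B.eval x * (x - z)⁻¹) ∂ν = B.eval z * cauchy ν h z + Q.eval z := by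
  induction B using Polynomial.induction_on' with
  | add A B hA hB =>
    obtain ⟨QA, hQA⟩ := hA
    obtain ⟨QB, hQB⟩ := hB
    refine ⟨QA + QB, fun z hz => ?_⟩
    simp_rw [Polynomial.eval_add, add_mul, mul_add]
    rw [integral_add (H.integrable_pow_mul_inv hz A.continuous)
      (H.integrable_pow_mul_inv hz B.continuous), hQA z hz, hQB z hz]
    ring
  | monomial n c =>
    refine ⟨Polynomial.C c * cauchyPoly ν h n, fun z hz => ?_⟩
    simp_rw [Polynomial.eval_monomial, mul_assoc, mul_left_comm _ c, integral_const_mul]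
    rw [H.integral_pow_mul_inv hz n]
    simp
    ring

theorem ae_prod_ne (H : IsPolar ν h) : ∀ᵐ q ∂ν.prod ν, q.1 ≠ q.2 := by
  have := H.finite
  rw [Measure.ae_prod_iff_ae_ae]
  · refine Eventually.of_forall fun x => ?_
    filter_upwards [H.ae_ne x] with y hy using hy.symm
  · exact (measurableSet_eq_fun measurable_fst measurable_snd).compl

theorem ae_prod_fst (H : IsPolar ν h) {P : ℂ → Prop} (hP : ∀ᵐ x ∂ν, P x) :
    ∀ᵐ q ∂ν.prod ν, P q.1 := by
  have := H.finite
  exact Measure.quasiMeasurePreserving_fst.ae hP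

theorem ae_prod_snd (H : IsPolar ν h) {P : ℂ → Prop} (hP : ∀ᵐ x ∂ν, P x) :
    ∀ᵐ q ∂ν.prod ν, P q.2 := by
  have := H.finite
  exact Measure.quasiMeasurePreserving_snd.ae hP

/-- The integrand of the limit of the equation of a critical measure. -/
noncomputable def limitKernel (h : ℂ → ℝ) (A : ℂ → ℂ) (z : ℂ) (q : ℂ × ℂ) : ℂ :=
  ((h q.1 * h q.2 : ℝ) : ℂ) *
    (diffQuot A q * (q.2 - z)⁻¹ - A q.1 * ((q.1 - z)⁻¹ * (q.2 - z)⁻¹))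

/-- The difference quotient of `x ^ n` is `∑ x ^ i y ^ (n - 1 - i)`, so the double integral is a sum
of products of single ones. The terms linear in `C`, one from this sum and one from the product `x ^
n / (x - z) · 1 / (y - z)`, cancel exactly; only `-z ^ n C²` and a polynomial remain. -/
theorem limitKernel_monomial (H : IsPolar ν h) {z : ℂ}
    (hz : Integrable (fun x => (x - z)⁻¹) ν) (n : ℕ) :
    Integrable (limitKernel h (fun x => x ^ n) z) (ν.prod ν) ∧
    ∫ q, limitKernel h (fun x => x ^ n) z q ∂ν.prod ν = -(z ^ n * cauchy ν h z ^ 2) +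
      (∑ i ∈ Finset.range n, Polynomial.C (moment ν h i) * cauchyPoly ν h (n - 1 - i)).eval z := by
  have := H.finite
  have h1 : ∀ᵐ q ∂ν.prod ν, limitKernel h (fun x => x ^ n) z q =
      (∑ i ∈ Finset.range n, ((h q.1 : ℂ) * q.1 ^ i) *
        ((h q.2 : ℂ) * (q.2 ^ (n - 1 - i) * (q.2 - z)⁻¹))) -
      ((h q.1 : ℂ) * (q.1 ^ n * (q.1 - z)⁻¹)) * ((h q.2 : ℂ) * (q.2 - z)⁻¹) := by
    filter_upwards [H.ae_prod_ne] with q hq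
    have hq0 : q.1 - q.2 ≠ 0 := sub_ne_zero.2 hq
    have h2 := (Commute.all q.1 q.2).geom_sum₂_mul n
    have h3 : diffQuot (fun x => x ^ n) q =
        ∑ i ∈ Finset.range n, q.1 ^ i * q.2 ^ (n - 1 - i) := by
      rw [diffQuot, ← h2]
      field_simp
    have h4 : (∑ i ∈ Finset.range n, ((h q.1 : ℂ) * q.1 ^ i) *
        ((h q.2 : ℂ) * (q.2 ^ (n - 1 - i) * (q.2 - z)⁻¹))) =
        (h q.1 : ℂ) * h q.2 * (∑ i ∈ Finset.range n, q.1 ^ i * q.2 ^ (n - 1 - i)) *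
          (q.2 - z)⁻¹ := by
      rw [Finset.mul_sum, Finset.sum_mul]
      exact Finset.sum_congr rfl fun i _ => by ring
    rw [limitKernel, h3, h4]
    push_cast
    ring
  have hI1 : ∀ i, Integrable (fun q : ℂ × ℂ => ((h q.1 : ℂ) * q.1 ^ i) *
        ((h q.2 : ℂ) * (q.2 ^ (n - 1 - i) * (q.2 - z)⁻¹))) (ν.prod ν) := fun i =>
    (H.integrable_mul (H.integrable_continuous (continuous_pow i))).mul_prod
      (H.integrable_pow_mul_inv hz (continuous_pow (n - 1 - i)))
  have hI2 : Integrable (fun q : ℂ × ℂ => ((h q.1 : ℂ) * (q.1 ^ n * (q.1 - z)⁻¹)) *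
      ((h q.2 : ℂ) * (q.2 - z)⁻¹)) (ν.prod ν) :=
    (H.integrable_pow_mul_inv hz (continuous_pow n)).mul_prod (H.integrable_mul hz)
  have hI3 := integrable_finsetSum (Finset.range n) (fun i _ => hI1 i)
  refine ⟨(hI3.sub hI2).congr ?_, ?_⟩
  · filter_upwards [h1] with q hq
    rw [hq]
    rfl
  · rw [integral_congr_ae h1, integral_sub hI3 hI2, integral_finsetSum _ fun i _ => hI1 i]
    have h5 := integral_prod_mul (μ := ν) (ν := ν)
      (fun x => (h x : ℂ) * (x ^ n * (x - z)⁻¹)) (fun x => (h x : ℂ) * (x - z)⁻¹)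
    have h6 : ∀ i, ∫ q : ℂ × ℂ, ((h q.1 : ℂ) * q.1 ^ i) *
        ((h q.2 : ℂ) * (q.2 ^ (n - 1 - i) * (q.2 - z)⁻¹)) ∂ν.prod ν =
        moment ν h i * (z ^ (n - 1 - i) * cauchy ν h z + (cauchyPoly ν h (n - 1 - i)).eval z) := by
      intro i
      rw [integral_prod_mul (μ := ν) (ν := ν) (fun x => (h x : ℂ) * x ^ i)
        (fun x => (h x : ℂ) * (x ^ (n - 1 - i) * (x - z)⁻¹)), H.integral_pow_mul_inv hz]
      rfl
    rw [h5, H.integral_pow_mul_inv hz, Finset.sum_congr rfl fun i _ => h6 i,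
      Polynomial.eval_finsetSum]
    have h7 : (cauchyPoly ν h n).eval z =
        ∑ i ∈ Finset.range n, moment ν h i * z ^ (n - 1 - i) := by
      simp [cauchyPoly, Polynomial.eval_finsetSum]
    have h8 : ∫ x, (h x : ℂ) * (x - z)⁻¹ ∂ν = cauchy ν h z := rfl
    rw [h8, h7]
    simp_rw [mul_add, Finset.sum_add_distrib, Polynomial.eval_mul, Polynomial.eval_C]
    have h9 : ∑ i ∈ Finset.range n, moment ν h i * (z ^ (n - 1 - i) * cauchy ν h z) =
        (∑ i ∈ Finset.range n, moment ν h i * z ^ (n - 1 - i)) * cauchy ν h z := by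
      rw [Finset.sum_mul]
      exact Finset.sum_congr rfl fun i _ => by ring
    rw [h9]
    ring

theorem exists_polynomial_limitKernel (H : IsPolar ν h) (A : Polynomial ℂ) :
    ∃ P : Polynomial ℂ, ∀ z, Integrable (fun x => (x - z)⁻¹) ν →
      Integrable (limitKernel h (fun x => A.eval x) z) (ν.prod ν) ∧
      ∫ q, limitKernel h (fun x => A.eval x) z q ∂ν.prod ν =
        -(A.eval z * cauchy ν h z ^ 2) + P.eval z := by
  induction A using Polynomial.induction_on' with
  | add A B hA hB =>
    obtain ⟨QA, hQA⟩ := hA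
    obtain ⟨QB, hQB⟩ := hB
    refine ⟨QA + QB, fun z hz => ?_⟩
    have h1 : limitKernel h (fun x => (A + B).eval x) z = fun q =>
        limitKernel h (fun x => A.eval x) z q + limitKernel h (fun x => B.eval x) z q := by
      funext q
      simp only [limitKernel, diffQuot, Polynomial.eval_add]
      ring
    rw [h1]
    refine ⟨(hQA z hz).1.add (hQB z hz).1, ?_⟩
    rw [integral_add (hQA z hz).1 (hQB z hz).1, (hQA z hz).2, (hQB z hz).2]
    simp
    ring
  | monomial n c =>
    refine ⟨Polynomial.C c * ∑ i ∈ Finset.range n, Polynomial.C (moment ν h i) *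
      cauchyPoly ν h (n - 1 - i), fun z hz => ?_⟩
    have h1 : limitKernel h (fun x => (Polynomial.monomial n c).eval x) z = fun q =>
        c * limitKernel h (fun x => x ^ n) z q := by
      funext q
      simp only [limitKernel, diffQuot, Polynomial.eval_monomial]
      ring
    obtain ⟨h2, h3⟩ := H.limitKernel_monomial hz n
    rw [h1]
    refine ⟨h2.const_mul c, ?_⟩
    rw [integral_const_mul, h3]
    simp
    ring

end IsPolar

end CriticalMeasure

namespace CriticalMeasure

variable {p : ℕ}

/-! ### The algebraic equation for the Cauchy transform -/

/-- The polynomial `A(z) = ∏ (z - a_k)`. -/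
noncomputable def polyA (a : Fin (p + 1) → ℂ) : Polynomial ℂ :=
  ∏ k, (Polynomial.X - Polynomial.C (a k))

/-- The polynomial `B = Φ' A`. -/
noncomputable def polyB (a ρ : Fin (p + 1) → ℂ) : Polynomial ℂ :=
  -∑ k, Polynomial.C (ρ k / 2) * ∏ j ∈ Finset.univ.erase k, (Polynomial.X - Polynomial.C (a j))

theorem polyA_eval (a : Fin (p + 1) → ℂ) (z : ℂ) : (polyA a).eval z = ∏ k, (z - a k) := by
  simp [polyA, Polynomial.eval_prod]

theorem polyA_eval_ne_zero {a : Fin (p + 1) → ℂ} {z : ℂ} (hz : ∀ k, z ≠ a k) :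
    (polyA a).eval z ≠ 0 := by
  rw [polyA_eval]
  exact Finset.prod_ne_zero_iff.2 fun k _ => sub_ne_zero.2 (hz k)

theorem fieldDeriv_mul_polyA (a ρ : Fin (p + 1) → ℂ) {z : ℂ} (hz : ∀ k, z ≠ a k) :
    fieldDeriv a ρ z * (polyA a).eval z = (polyB a ρ).eval z := by
  rw [polyA_eval, fieldDeriv, polyB, Polynomial.eval_neg, Polynomial.eval_finsetSum, neg_mul,
    Finset.sum_mul]
  congr 1
  refine Finset.sum_congr rfl fun k _ => ?_
  rw [← Finset.mul_prod_erase _ _ (Finset.mem_univ k)]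
  have := sub_ne_zero.2 (hz k)
  simp only [Polynomial.eval_mul, Polynomial.eval_C, Polynomial.eval_prod, Polynomial.eval_sub,
    Polynomial.eval_X]
  field_simp

theorem polyB_eval_self (a ρ : Fin (p + 1) → ℂ) (k : Fin (p + 1)) :
    (polyB a ρ).eval (a k) = -(ρ k / 2 * ∏ j ∈ Finset.univ.erase k, (a k - a j)) := by
  rw [polyB, Polynomial.eval_neg, Polynomial.eval_finsetSum]
  congr 1
  rw [Finset.sum_eq_single k]
  · simp [Polynomial.eval_prod]
  · intro j _ hj
    rw [Polynomial.eval_mul, Polynomial.eval_prod,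
      Finset.prod_eq_zero (i := k) (Finset.mem_erase.2 ⟨hj.symm, Finset.mem_univ _⟩) (by simp),
      mul_zero]
  · intro hk
    exact absurd (Finset.mem_univ k) hk

/-- The equation of a critical measure, for a measure in polar form. -/
def IsStationary (a ρ : Fin (p + 1) → ℂ) (ν : Measure ℂ) (h : ℂ → ℝ) : Prop :=
  ∀ g : ℂ → ℂ, ContDiff ℝ (⊤ : ℕ∞) g → HasCompactSupport g → (∀ k, g (a k) = 0) →
    ∫ q : ℂ × ℂ, ((h q.1 * h q.2 : ℝ) : ℂ) * diffQuot g q ∂ν.prod ν =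
      2 * ∫ x, (h x : ℂ) * (fieldDeriv a ρ x * g x) ∂ν

theorem IsCritical.isStationary {a ρ : Fin (p + 1) → ℂ} {μ : SignedMeasure ℂ}
    (hμ : IsCritical a ρ μ) {h : ℂ → ℝ}
    (hm : Measurable h) (h1 : ∀ x, h x = 1 ∨ h x = -1)
    (hint : ∀ F : ℂ → ℝ, μ.integral F (ContinuousLinearMap.lsmul ℝ ℝ) =
      ∫ x, h x * F x ∂μ.variation) : IsStationary a ρ μ.variation h :=
  fun _ hg hgc hga => hμ.integral_diffQuot hm h1 hint hg hgc hga

variable {a ρ : Fin (p + 1) → ℂ} {ν : Measure ℂ} {h : ℂ → ℝ}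

/-- The test functions approximate `A(x) / (x - z)`; the factor `A` makes them vanish at the nodes.
The difference quotient of the limit is the expression in `limitKernel`, and integrability of `1 /
(x - z)` gives a product majorant on the double integral. -/
theorem IsStationary.limit_equation (hst : IsStationary a ρ ν h) (H : IsPolar ν h) {z : ℂ}
    (hz : Integrable (fun x => (x - z)⁻¹) ν) :
    ∫ q, IsPolar.limitKernel h (fun x => (polyA a).eval x) z q ∂ν.prod ν =
      2 * ∫ x, (h x : ℂ) * ((polyB a ρ).eval x * (x - z)⁻¹) ∂ν := by
  have := H.finite
  obtain ⟨r, hr0, hr⟩ := H.exists_bound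
  -- A cut-off equal to `1` on the support makes the test functions compactly supported without
  -- changing any integral.
  let χ : ContDiffBump (0 : ℂ) := ⟨r, r + 1, hr0, by linarith⟩
  have hχ1 : ∀ x ∈ ν.support, χ x = 1 := fun x hx =>
    χ.one_of_mem_closedBall (by simpa using hr x hx)
  let F : ℂ → ℂ := fun x => (χ x : ℂ) * (polyA a).eval x
  have hχs : ContDiff ℝ (⊤ : ℕ∞) fun x => (χ x : ℂ) :=
    Complex.ofRealCLM.contDiff.comp χ.contDiff
  have hF : ContDiff ℝ (⊤ : ℕ∞) F := by
    refine hχs.mul ?_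
    have h1 : ContDiff ℂ (⊤ : ℕ∞) fun x => (polyA a).eval x :=
      (polyA a).differentiable.contDiff
    exact h1.restrict_scalars ℝ
  have hχc : HasCompactSupport fun x => (χ x : ℂ) :=
    χ.hasCompactSupport.comp_left Complex.ofReal_zero
  have hFc : HasCompactSupport F := hχc.mul_right
  have hFa : ∀ k, F (a k) = 0 := fun k => by
    have : (polyA a).eval (a k) = 0 := by
      rw [polyA_eval]
      exact Finset.prod_eq_zero (Finset.mem_univ k) (sub_self _)
    simp [F, this]
  have hFS : ∀ x ∈ ν.support, F x = (polyA a).eval x := fun x hx => by simp [F, hχ1 x hx]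
  obtain ⟨L, hL⟩ := hF.lipschitzWith_of_hasCompactSupport hFc (by simp)
  obtain ⟨M, hM⟩ := hFc.exists_bound_of_continuous hF.continuous
  let ε : ℕ → ℝ := fun n => 1 / ((n : ℝ) + 1)
  have hε : ∀ n, 0 < ε n := fun n => by positivity
  let g : ℕ → ℂ → ℂ := fun n x => F x * regInv (ε n) (x - z)
  have hg : ∀ n, ContDiff ℝ (⊤ : ℕ∞) (g n) := fun n =>
    hF.mul ((contDiff_regInv (hε n)).comp (contDiff_id.sub contDiff_const))
  have hgc : ∀ n, HasCompactSupport (g n) := fun n => hFc.mul_right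
  -- Discrete product rule: it separates the difference quotient of the regularized kernel, of size
  -- `1 / (|x - z||y - z|)`, from that of the Lipschitz function `F`.
  have hgq : ∀ n q, diffQuot (g n) q = F q.1 * ((regInv (ε n) (q.1 - z) -
      regInv (ε n) (q.2 - z)) / (q.1 - q.2)) + diffQuot F q * regInv (ε n) (q.2 - z) := by
    intro n q
    simp only [diffQuot, g]
    ring
  have hhh : ∀ q : ℂ × ℂ, ‖((h q.1 * h q.2 : ℝ) : ℂ)‖ = 1 := fun q => by
    rw [Complex.ofReal_mul, norm_mul, H.norm_eq, H.norm_eq, one_mul]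
  have hhm : Measurable fun q : ℂ × ℂ => ((h q.1 * h q.2 : ℝ) : ℂ) := by
    have := H.measurable
    fun_prop
  have hzn : Integrable (fun x => ‖x - z‖⁻¹) ν := by simpa using hz.norm
  have hLHS : Tendsto (fun n => ∫ q : ℂ × ℂ, ((h q.1 * h q.2 : ℝ) : ℂ) * diffQuot (g n) q
      ∂ν.prod ν) atTop
      (𝓝 (∫ q, IsPolar.limitKernel h (fun x => (polyA a).eval x) z q ∂ν.prod ν)) := by
    refine tendsto_integral_of_dominated_convergence
      (fun q => M * (‖q.1 - z‖⁻¹ * ‖q.2 - z‖⁻¹) + L * (1 * ‖q.2 - z‖⁻¹)) ?_ ?_ ?_ ?_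
    · intro n
      exact (hhm.mul (measurable_diffQuot (hg n).continuous)).aestronglyMeasurable
    · exact ((hzn.mul_prod hzn).const_mul M).add
        (((integrable_const (1 : ℝ)).mul_prod hzn).const_mul (L : ℝ))
    · intro n
      filter_upwards [H.ae_prod_fst (H.ae_ne z), H.ae_prod_snd (H.ae_ne z), H.ae_prod_ne]
        with q h1 h2 h3
      have h1' := sub_ne_zero.2 h1
      have h2' := sub_ne_zero.2 h2
      have h3' : 0 < ‖q.1 - q.2‖ := norm_pos_iff.2 (sub_ne_zero.2 h3)
      rw [norm_mul, hhh, one_mul, hgq]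
      refine (norm_add_le _ _).trans (add_le_add ?_ ?_)
      · rw [norm_mul, norm_div]
        refine mul_le_mul (hM _) ?_ (by positivity) ((norm_nonneg _).trans (hM 0))
        rw [div_le_iff₀ h3', mul_comm]
        have := norm_regInv_sub_le (hε n) h1' h2'
        rwa [sub_sub_sub_cancel_right] at this
      · rw [norm_mul, one_mul]
        gcongr
        · exact norm_diffQuot_le hL q
        · exact norm_regInv_le _ _
    · filter_upwards [H.ae_prod_fst (H.ae_ne z), H.ae_prod_snd (H.ae_ne z), H.ae_prod_ne,
        H.ae_prod_fst H.ae_mem, H.ae_prod_snd H.ae_mem] with q h1 h2 h3 h4 h5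
      have h1' := sub_ne_zero.2 h1
      have h2' := sub_ne_zero.2 h2
      have h3' := sub_ne_zero.2 h3
      have h6 : diffQuot F q = diffQuot (fun x => (polyA a).eval x) q := by
        simp only [diffQuot, hFS _ h4, hFS _ h5]
      simp_rw [hgq]
      unfold IsPolar.limitKernel
      refine Tendsto.const_mul _ ?_
      have h7 := ((((tendsto_regInv (q.1 - z)).sub (tendsto_regInv (q.2 - z))).div_const
        (q.1 - q.2)).const_mul (F q.1)).add
        ((tendsto_regInv (q.2 - z)).const_mul (diffQuot F q))
      have h8 : F q.1 * (((q.1 - z)⁻¹ - (q.2 - z)⁻¹) / (q.1 - q.2)) +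
          diffQuot F q * (q.2 - z)⁻¹ = diffQuot (fun x => (polyA a).eval x) q * (q.2 - z)⁻¹ -
          (polyA a).eval q.1 * ((q.1 - z)⁻¹ * (q.2 - z)⁻¹) := by
        rw [h6, hFS _ h4]
        have h9 : ((q.1 - z)⁻¹ - (q.2 - z)⁻¹) / (q.1 - q.2) =
            -((q.1 - z)⁻¹ * (q.2 - z)⁻¹) := by
          field_simp
          ring
        rw [h9]
        ring
      rw [← h8]
      exact h7
  have hRHS : Tendsto (fun n => 2 * ∫ x, (h x : ℂ) * (fieldDeriv a ρ x * g n x) ∂ν) atTop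
      (𝓝 (2 * ∫ x, (h x : ℂ) * ((polyB a ρ).eval x * (x - z)⁻¹) ∂ν)) := by
    refine Tendsto.const_mul _ (tendsto_integral_of_dominated_convergence
      (fun x => (∑ k, ‖ρ k‖ * L) * ‖x - z‖⁻¹) ?_ (hzn.const_mul _) ?_ ?_)
    · intro n
      exact ((Complex.measurable_ofReal.comp H.measurable).mul
        ((measurable_fieldDeriv a ρ).mul (hg n).continuous.measurable)).aestronglyMeasurable
    · intro n
      refine Eventually.of_forall fun x => ?_
      rw [norm_mul, H.norm_eq, one_mul]
      have h1 := norm_fieldDeriv_mul_le a ρ hL hFa (t := 0) (by simp) x (s := 0) (by simp)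
      simp only [Complex.ofReal_zero, zero_mul, add_zero] at h1
      calc ‖fieldDeriv a ρ x * g n x‖
          = ‖fieldDeriv a ρ x * F x‖ * ‖regInv (ε n) (x - z)‖ := by
            rw [← norm_mul, mul_assoc]
        _ ≤ _ := mul_le_mul h1 (norm_regInv_le _ _) (norm_nonneg _) (by positivity)
    · have hne : ∀ᵐ x ∂ν, ∀ k, x ≠ a k := ae_all_iff.2 fun k => H.ae_ne (a k)
      filter_upwards [H.ae_mem, hne] with x h1 h2
      refine Tendsto.const_mul _ ?_
      have h3 := (tendsto_regInv (x - z)).const_mul (fieldDeriv a ρ x * F x)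
      rw [hFS x h1, fieldDeriv_mul_polyA a ρ h2] at h3
      refine h3.congr fun n => ?_
      simp only [g]
      rw [← fieldDeriv_mul_polyA a ρ h2, hFS x h1]
      ring
  refine tendsto_nhds_unique hLHS (hRHS.congr fun n => ?_)
  rw [hst (g n) (hg n) (hgc n) fun k => by simp [g, hFa k]]

/-- The Cauchy transform of a critical measure satisfies a quadratic equation with polynomial
coefficients. -/
theorem IsStationary.exists_quadratic (hst : IsStationary a ρ ν h) (H : IsPolar ν h) :
    ∃ P : Polynomial ℂ, ∀ z, Integrable (fun x => (x - z)⁻¹) ν →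
      (polyA a).eval z * cauchy ν h z ^ 2 + 2 * (polyB a ρ).eval z * cauchy ν h z =
        P.eval z := by
  obtain ⟨P, hP⟩ := H.exists_polynomial_limitKernel (polyA a)
  obtain ⟨Q, hQ⟩ := H.exists_polynomial_integral_mul_inv (polyB a ρ)
  refine ⟨P - 2 * Q, fun z hz => ?_⟩
  have h1 := hst.limit_equation H hz
  rw [(hP z hz).2, hQ z hz] at h1
  simp only [Polynomial.eval_sub, Polynomial.eval_mul, Polynomial.eval_ofNat]
  linear_combination -h1

end CriticalMeasure

/-! ### The rational function of a critical measure, its poles and its expansion at infinity -/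

namespace CriticalMeasure

variable {p : ℕ}

/-! ### Rational functions -/

theorem value_eq (R : RatFunc ℂ) (z : ℂ) : value R z = R.num.eval z / R.denom.eval z := rfl

theorem num_denom_not_both_zero (R : RatFunc ℂ) (z : ℂ) :
    ¬(R.num.eval z = 0 ∧ R.denom.eval z = 0) := by
  rintro ⟨h1, h2⟩
  obtain ⟨u, v, huv⟩ := R.isCoprime_num_denom
  have := congrArg (Polynomial.eval z) huv
  simp [h1, h2] at this

section
variable {P Q : Polynomial ℂ} {R : RatFunc ℂ}

theorem value_of_eq_div (hQ : Q ≠ 0)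
    (hR : R = algebraMap _ _ P / algebraMap _ _ Q) {z : ℂ} (hz : Q.eval z ≠ 0) :
    value R z = P.eval z / Q.eval z := by
  have h1 := (RatFunc.num_mul_eq_mul_denom_iff hQ).2 hR
  have h2 := congrArg (Polynomial.eval z) h1
  simp only [Polynomial.eval_mul] at h2
  have h3 : R.denom.eval z ≠ 0 := by
    intro hc
    rw [hc, mul_zero] at h2
    exact num_denom_not_both_zero R z ⟨(mul_eq_zero.1 h2).resolve_right hz, hc⟩
  rw [value_eq, div_eq_div_iff h3 hz]
  exact h2

theorem order_of_eq_div (hQ : Q ≠ 0) (hP : P ≠ 0)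
    (hR : R = algebraMap _ _ P / algebraMap _ _ Q) (z : ℂ) :
    order R z = (P.rootMultiplicity z : ℤ) - Q.rootMultiplicity z := by
  have h1 := (RatFunc.num_mul_eq_mul_denom_iff hQ).2 hR
  have h2 := congrArg (Polynomial.rootMultiplicity z) h1
  have h4 : P * R.denom ≠ 0 := mul_ne_zero hP (RatFunc.denom_ne_zero R)
  have h3 : R.num * Q ≠ 0 := h1 ▸ h4
  rw [Polynomial.rootMultiplicity_mul h3, Polynomial.rootMultiplicity_mul h4] at h2
  unfold order
  omega

end

theorem order_neg_iff (R : RatFunc ℂ) (z : ℂ) : order R z < 0 ↔ R.denom.eval z = 0 := by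
  have hd := RatFunc.denom_ne_zero R
  constructor
  · intro h1
    by_contra h2
    have : R.denom.rootMultiplicity z = 0 := Polynomial.rootMultiplicity_eq_zero h2
    unfold order at h1
    omega
  · intro h1
    have h2 : R.num.rootMultiplicity z = 0 :=
      Polynomial.rootMultiplicity_eq_zero fun h3 => num_denom_not_both_zero R z ⟨h3, h1⟩
    have h3 : 0 < R.denom.rootMultiplicity z := (Polynomial.rootMultiplicity_pos hd).2 h1
    unfold order
    omega

theorem order_pos_iff {R : RatFunc ℂ} (hR : R ≠ 0) (z : ℂ) : 0 < order R z ↔ R.num.eval z = 0 := by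
  have hn := RatFunc.num_ne_zero hR
  constructor
  · intro h1
    by_contra h2
    have : R.num.rootMultiplicity z = 0 := Polynomial.rootMultiplicity_eq_zero h2
    unfold order at h1
    omega
  · intro h1
    have h2 : R.denom.rootMultiplicity z = 0 :=
      Polynomial.rootMultiplicity_eq_zero fun h3 => num_denom_not_both_zero R z ⟨h1, h3⟩
    have h3 : 0 < R.num.rootMultiplicity z := (Polynomial.rootMultiplicity_pos hn).2 h1
    unfold order
    omega

theorem order_zero_eq_zero (z : ℂ) : order 0 z = 0 := by
  simp [order]

theorem value_zero (z : ℂ) : value 0 z = 0 := by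
  simp [value]

theorem value_ne_zero_iff {R : RatFunc ℂ} (hR : R ≠ 0) (z : ℂ) :
    value R z ≠ 0 ↔ order R z = 0 := by
  rw [value_eq, div_ne_zero_iff]
  have h1 := order_neg_iff R z
  have h2 := order_pos_iff hR z
  constructor
  · rintro ⟨h3, h4⟩
    have := mt h1.1 h4
    have := mt h2.1 h3
    omega
  · intro h3
    exact ⟨fun h => by have := h2.2 h; omega, fun h => by have := h1.2 h; omega⟩

theorem differentiableAt_value {R : RatFunc ℂ} {z : ℂ} (hz : R.denom.eval z ≠ 0) :
    DifferentiableAt ℂ (value R) z :=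
  R.num.differentiable.differentiableAt.fun_div R.denom.differentiable.differentiableAt hz

theorem singularPoints_finite {R : RatFunc ℂ} (hR : R ≠ 0) : (singularPoints R).Finite := by
  have h1 : (((R.num * R.denom).roots.toFinset : Set ℂ)).Finite := Finset.finite_toSet _
  refine ((h1.image (fun z : ℂ => (z : OnePoint ℂ))).insert OnePoint.infty).subset ?_
  intro P hP
  induction P using OnePoint.rec with
  | infty => exact Set.mem_insert _ _
  | coe z =>
    refine Set.mem_insert_of_mem _ ⟨z, ?_, rfl⟩
    have h2 : order R z ≠ 0 := hP
    have h3 : R.num * R.denom ≠ 0 := mul_ne_zero (RatFunc.num_ne_zero hR) R.denom_ne_zero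
    simp only [Finset.mem_coe, Multiset.mem_toFinset, Polynomial.mem_roots h3, Polynomial.IsRoot,
      Polynomial.eval_mul, mul_eq_zero]
    rcases lt_or_gt_of_ne h2 with h4 | h4
    · exact Or.inr ((order_neg_iff R z).1 h4)
    · exact Or.inl ((order_pos_iff hR z).1 h4)

/-! ### Integrability of the Cauchy kernel -/

/-- In polar coordinates the Jacobian `r` cancels `1 / r`. -/
theorem lintegral_ball_inv_lt_top (M : ℝ) :
    ∫⁻ z in Metric.ball (0 : ℂ) M, ‖z‖ₑ⁻¹ < ⊤ := by
  rw [← lintegral_indicator Metric.isOpen_ball.measurableSet,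
    ← Complex.lintegral_comp_polarCoord_symm]
  have h1 : ∀ q ∈ Complex.polarCoord.target, ENNReal.ofReal q.1 •
      (Metric.ball (0 : ℂ) M).indicator (fun z => ‖z‖ₑ⁻¹) (Complex.polarCoord.symm q) ≤
      (Set.Ioo (0 : ℝ) M ×ˢ Set.Ioo (-Real.pi) Real.pi).indicator (fun _ => 1) q := by
    intro q hq
    rw [Complex.polarCoord_target] at hq
    have hn : ‖Complex.polarCoord.symm q‖ = q.1 := by
      rw [Complex.norm_polarCoord_symm, abs_of_pos hq.1]
    have hq0 : 0 < q.1 := hq.1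
    have hb : Complex.polarCoord.symm q ∈ Metric.ball (0 : ℂ) M ↔ q.1 < M := by
      rw [mem_ball_zero_iff, hn]
    by_cases hM : q.1 < M
    · have hm : q ∈ Set.Ioo (0 : ℝ) M ×ˢ Set.Ioo (-Real.pi) Real.pi := ⟨⟨hq.1, hM⟩, hq.2⟩
      rw [Set.indicator_of_mem (hb.2 hM), Set.indicator_of_mem hm, ← ofReal_norm, hn, smul_eq_mul,
        ENNReal.mul_inv_cancel (by simpa using hq0) ENNReal.ofReal_ne_top]
    · rw [Set.indicator_of_notMem (mt hb.1 hM)]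
      simp
  refine lt_of_le_of_lt (setLIntegral_mono' Complex.polarCoord.open_target.measurableSet h1) ?_
  refine lt_of_le_of_lt (setLIntegral_le_lintegral _ _) ?_
  rw [lintegral_indicator (measurableSet_Ioo.prod measurableSet_Ioo)]
  simp only [lintegral_const, one_mul, Measure.restrict_apply MeasurableSet.univ, Set.univ_inter]
  rw [Measure.volume_eq_prod, Measure.prod_prod, Real.volume_Ioo, Real.volume_Ioo]
  exact ENNReal.mul_lt_top ENNReal.ofReal_lt_top ENNReal.ofReal_lt_top

theorem lintegral_ball_inv_sub_le {M r : ℝ} {x : ℂ} (hx : ‖x‖ ≤ r) :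
    ∫⁻ z in Metric.ball (0 : ℂ) M, ‖(x - z)⁻¹‖ₑ ≤
      ∫⁻ z in Metric.ball (0 : ℂ) (r + M), ‖z‖ₑ⁻¹ := by
  rw [← lintegral_indicator Metric.isOpen_ball.measurableSet,
    ← lintegral_indicator Metric.isOpen_ball.measurableSet,
    ← lintegral_sub_left_eq_self
      (fun z => (Metric.ball (0 : ℂ) (r + M)).indicator (fun z => ‖z‖ₑ⁻¹) z) x]
  refine lintegral_mono fun z => ?_
  by_cases hz : z ∈ Metric.ball (0 : ℂ) M
  · have h1 : x - z ∈ Metric.ball (0 : ℂ) (r + M) := by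
      rw [mem_ball_zero_iff] at hz ⊢
      exact lt_of_le_of_lt (norm_sub_le _ _) (by linarith)
    rw [Set.indicator_of_mem hz, Set.indicator_of_mem h1]
    by_cases hxz : x - z = 0
    · simp [hxz]
    · rw [enorm_inv hxz]
  · rw [Set.indicator_of_notMem hz]
    exact zero_le

namespace IsPolar

variable {ν : Measure ℂ} {h : ℂ → ℝ}

theorem lintegral_lintegral_inv_lt_top (H : IsPolar ν h) (M : ℝ) :
    ∫⁻ x, ∫⁻ z in Metric.ball (0 : ℂ) M, ‖(x - z)⁻¹‖ₑ ∂volume ∂ν < ⊤ := by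
  have := H.finite
  obtain ⟨r, -, hr⟩ := H.exists_bound
  calc _ ≤ ∫⁻ _, (∫⁻ z in Metric.ball (0 : ℂ) (r + M), ‖z‖ₑ⁻¹) ∂ν := by
        refine lintegral_mono_ae ?_
        filter_upwards [H.ae_mem] with x hx using lintegral_ball_inv_sub_le (hr x hx)
    _ < ⊤ := by
        rw [lintegral_const]
        exact ENNReal.mul_lt_top (lintegral_ball_inv_lt_top _) (measure_lt_top _ _)

theorem measurable_inv_sub : Measurable fun q : ℂ × ℂ => (q.1 - q.2)⁻¹ := by
  fun_prop

theorem integrable_prod_inv (H : IsPolar ν h) (M : ℝ) :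
    Integrable (fun q : ℂ × ℂ => (q.1 - q.2)⁻¹)
      (ν.prod (volume.restrict (Metric.ball (0 : ℂ) M))) := by
  have := H.finite
  refine ⟨measurable_inv_sub.aestronglyMeasurable, ?_⟩
  unfold HasFiniteIntegral
  rw [lintegral_prod _ measurable_inv_sub.enorm.aemeasurable]
  exact H.lintegral_lintegral_inv_lt_top M

/-- By Tonelli, local integrability of `1 / |z|` in the plane passes to almost every `z`. This is
why the equation for the Cauchy transform holds almost everywhere, on the support as well. -/
theorem ae_integrable_inv (H : IsPolar ν h) :
    ∀ᵐ z : ℂ, Integrable (fun x => (x - z)⁻¹) ν := by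
  have := H.finite
  have h1 : ∀ n : ℕ, ∀ᵐ z : ℂ, z ∈ Metric.ball (0 : ℂ) n → Integrable (fun x => (x - z)⁻¹) ν := by
    intro n
    rw [← ae_restrict_iff' Metric.isOpen_ball.measurableSet]
    exact (H.integrable_prod_inv n).prod_left_ae
  rw [← ae_all_iff] at h1
  filter_upwards [h1] with z hz
  obtain ⟨n, hn⟩ := exists_nat_gt ‖z‖
  exact hz n (by simpa using hn)

theorem measurable_cauchy (H : IsPolar ν h) : Measurable (cauchy ν h) := by
  have := H.finite
  have h0 := H.measurable
  have h1 : StronglyMeasurable fun q : ℂ × ℂ => (h q.2 : ℂ) * (q.2 - q.1)⁻¹ := by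
    apply Measurable.stronglyMeasurable
    fun_prop
  exact h1.integral_prod_right.measurable

theorem exists_pos_dist (_H : IsPolar ν h) {z : ℂ} (hz : z ∉ ν.support) :
    ∃ δ > 0, ∀ w ∈ Metric.ball z δ, ∀ x ∈ ν.support, δ ≤ ‖x - w‖ := by
  obtain ⟨δ, hδ, hb⟩ := Metric.isOpen_iff.1 (Measure.isOpen_compl_support (μ := ν)) z hz
  refine ⟨δ / 2, by positivity, fun w hw x hx => ?_⟩
  by_contra hc
  push Not at hc
  refine hb (?_ : x ∈ Metric.ball z δ) hx
  rw [Metric.mem_ball] at hw ⊢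
  rw [← dist_eq_norm] at hc
  linarith [dist_triangle x w z]

theorem integrable_inv_of_notMem (H : IsPolar ν h) {z : ℂ} (hz : z ∉ ν.support) :
    Integrable (fun x => (x - z)⁻¹) ν := by
  have := H.finite
  obtain ⟨δ, hδ, hb⟩ := H.exists_pos_dist hz
  refine Integrable.of_bound (C := δ⁻¹) (by fun_prop) ?_
  filter_upwards [H.ae_mem] with x hx
  rw [norm_inv]
  exact inv_anti₀ hδ (hb z (Metric.mem_ball_self hδ) x hx)

theorem differentiableAt_cauchy (H : IsPolar ν h) {z : ℂ} (hz : z ∉ ν.support) :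
    DifferentiableAt ℂ (cauchy ν h) z := by
  have := H.finite
  have h0 := H.measurable
  obtain ⟨δ, hδ, hb⟩ := H.exists_pos_dist hz
  refine (hasDerivAt_integral_of_dominated_loc_of_deriv_le
    (F := fun w x => (h x : ℂ) * (x - w)⁻¹) (F' := fun w x => (h x : ℂ) * ((x - w) ^ 2)⁻¹)
    (bound := fun _ => (δ ^ 2)⁻¹) (s := Metric.ball z δ)
    (Metric.ball_mem_nhds z hδ) ?_ ?_ ?_ ?_ (integrable_const _) ?_).2.differentiableAt
  · exact Eventually.of_forall fun w => by fun_prop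
  · exact H.integrable_mul (H.integrable_inv_of_notMem hz)
  · fun_prop
  · filter_upwards [H.ae_mem] with x hx w hw
    rw [norm_mul, H.norm_eq, one_mul, norm_inv, norm_pow]
    have := hb w hw x hx
    gcongr
  · filter_upwards [H.ae_mem] with x hx w hw
    have h1 : x - w ≠ 0 := norm_pos_iff.1 (hδ.trans_le (hb w hw x hx))
    have h2 := ((((hasDerivAt_id w).const_sub x).inv h1).const_mul (h x : ℂ))
    refine h2.congr_deriv ?_
    simp

end IsPolar

/-! ### The rational function of a critical measure -/

/-- The function `C + Φ'`, where `C` is the Cauchy transform of the measure. -/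
noncomputable def critFun (a ρ : Fin (p + 1) → ℂ) (ν : Measure ℂ) (h : ℂ → ℝ) (z : ℂ) : ℂ :=
  cauchy ν h z + fieldDeriv a ρ z

/-- `R` is the rational function `(C + Φ')²` of the critical measure. -/
structure IsSquare (a ρ : Fin (p + 1) → ℂ) (ν : Measure ℂ) (h : ℂ → ℝ) (R : RatFunc ℂ) :
    Prop where
  sq_eq : ∀ z, (∀ k, z ≠ a k) → Integrable (fun x => (x - z)⁻¹) ν →
    critFun a ρ ν h z ^ 2 = value R z
  poles : ∀ z, order R z < 0 → z ∈ Set.range a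
  order_ge : ∀ j, ρ j = 0 → -1 ≤ order R (a j)
  order_eq : ∀ j, ρ j ≠ 0 → order R (a j) = -2
  residue : ∀ j, ρ j ≠ 0 → Tendsto (fun z => (z - a j) ^ 2 * value R z) (𝓝[≠] (a j))
    (𝓝 ((ρ j / 2) ^ 2))

theorem polyA_rootMultiplicity {a : Fin (p + 1) → ℂ} (ha : Function.Injective a)
    (j : Fin (p + 1)) : (polyA a).rootMultiplicity (a j) = 1 := by
  have h1 : ∏ k ∈ Finset.univ.erase j, (Polynomial.X - Polynomial.C (a k)) ≠ 0 :=
    Finset.prod_ne_zero_iff.2 fun k _ => Polynomial.X_sub_C_ne_zero _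
  have h2 : polyA a = (Polynomial.X - Polynomial.C (a j)) *
      ∏ k ∈ Finset.univ.erase j, (Polynomial.X - Polynomial.C (a k)) :=
    (Finset.mul_prod_erase _ _ (Finset.mem_univ j)).symm
  rw [h2, Polynomial.rootMultiplicity_mul (mul_ne_zero (Polynomial.X_sub_C_ne_zero _) h1),
    Polynomial.rootMultiplicity_X_sub_C_self, Polynomial.rootMultiplicity_eq_zero]
  rw [Polynomial.IsRoot, Polynomial.eval_prod]
  refine Finset.prod_ne_zero_iff.2 fun k hk => ?_
  simpa [sub_eq_zero] using fun hc => (Finset.mem_erase.1 hk).1 (ha hc).symm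

variable {a ρ : Fin (p + 1) → ℂ} {ν : Measure ℂ} {h : ℂ → ℝ}

/-- Multiply `A C² + 2 B C = P` by `A` and add `B²`: the left side becomes `(A (C + Φ'))²`, whence
`R = (P A + B²) / A²`. As the nodes are distinct, `A²` has a double zero at `a j`, where the
numerator equals `B(a j)²`. This is nonzero exactly when `ρ j ≠ 0`; otherwise the numerator vanishes
too and at most a simple pole is left. -/
theorem IsStationary.exists_isSquare (hst : IsStationary a ρ ν h) (H : IsPolar ν h)
    (ha : Function.Injective a) : ∃ R, IsSquare a ρ ν h R := by
  obtain ⟨P, hP⟩ := hst.exists_quadratic H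
  set A := polyA a with hA
  set B := polyB a ρ with hB
  have hA0 : A ≠ 0 := Finset.prod_ne_zero_iff.2 fun k _ => Polynomial.X_sub_C_ne_zero _
  have hQ0 : A ^ 2 ≠ 0 := pow_ne_zero _ hA0
  have hAa : ∀ j, A.eval (a j) = 0 := fun j => by
    rw [hA, polyA_eval]
    exact Finset.prod_eq_zero (Finset.mem_univ j) (sub_self _)
  have hcoef : ∀ j, ∏ k ∈ Finset.univ.erase j, (a j - a k) ≠ 0 := fun j =>
    Finset.prod_ne_zero_iff.2 fun k hk =>
      sub_ne_zero.2 fun hc => (Finset.mem_erase.1 hk).1 (ha hc).symm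
  obtain ⟨R, hR⟩ : ∃ R : RatFunc ℂ, R = algebraMap _ _ (P * A + B ^ 2) / algebraMap _ _ (A ^ 2) :=
    ⟨_, rfl⟩
  have hval : ∀ z, (∀ k, z ≠ a k) → value R z = (P * A + B ^ 2).eval z / (A ^ 2).eval z :=
    fun z hz => value_of_eq_div hQ0 hR (by
      rw [Polynomial.eval_pow]
      exact pow_ne_zero _ (polyA_eval_ne_zero hz))
  have hord : ∀ j, (A ^ 2).rootMultiplicity (a j) = 2 := fun j => by
    rw [sq, Polynomial.rootMultiplicity_mul (by rw [← sq]; exact hQ0),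
      polyA_rootMultiplicity ha]
  have hBne : ∀ j, ρ j ≠ 0 → (P * A + B ^ 2).eval (a j) ≠ 0 := by
    intro j hj
    rw [Polynomial.eval_add, Polynomial.eval_mul, hAa, mul_zero, zero_add, Polynomial.eval_pow, hB,
      polyB_eval_self]
    exact pow_ne_zero _ (neg_ne_zero.2 (mul_ne_zero (div_ne_zero hj two_ne_zero) (hcoef j)))
  refine ⟨R, ⟨?_, ?_, ?_, ?_, ?_⟩⟩
  · intro z hz hi
    have h1 := hP z hi
    have h2 := polyA_eval_ne_zero hz
    have h3 := fieldDeriv_mul_polyA a ρ hz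
    rw [hval z hz, critFun]
    rw [Polynomial.eval_add, Polynomial.eval_mul, Polynomial.eval_pow, Polynomial.eval_pow,
      eq_div_iff (pow_ne_zero _ h2), ← h1, hB, ← h3, ← hA]
    ring
  · intro z hz
    by_contra hc
    have hz' : ∀ k, z ≠ a k := fun k hk => hc ⟨k, hk.symm⟩
    by_cases hN : P * A + B ^ 2 = 0
    · have : R = 0 := by rw [hR, hN]; simp
      rw [this, order_zero_eq_zero] at hz
      exact lt_irrefl _ hz
    · rw [order_of_eq_div hQ0 hN hR] at hz
      have : (A ^ 2).rootMultiplicity z = 0 := Polynomial.rootMultiplicity_eq_zero (by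
        rw [Polynomial.IsRoot, Polynomial.eval_pow]
        exact pow_ne_zero _ (polyA_eval_ne_zero hz'))
      omega
  · intro j hj
    by_cases hN : P * A + B ^ 2 = 0
    · have : R = 0 := by rw [hR, hN]; simp
      rw [this, order_zero_eq_zero]
      norm_num
    · rw [order_of_eq_div hQ0 hN hR, hord]
      have : 0 < (P * A + B ^ 2).rootMultiplicity (a j) := by
        rw [Polynomial.rootMultiplicity_pos hN, Polynomial.IsRoot, Polynomial.eval_add,
          Polynomial.eval_mul, hAa, mul_zero, zero_add, Polynomial.eval_pow, hB,
          polyB_eval_self, hj]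
        simp
      omega
  · intro j hj
    have hN : P * A + B ^ 2 ≠ 0 := fun hc => hBne j hj (by rw [hc, Polynomial.eval_zero])
    rw [order_of_eq_div hQ0 hN hR, hord, Polynomial.rootMultiplicity_eq_zero (hBne j hj)]
    norm_num
  · intro j hj
    have h1 : Tendsto (fun z => (P * A + B ^ 2).eval z /
        (∏ k ∈ Finset.univ.erase j, (z - a k)) ^ 2) (𝓝[≠] (a j))
        (𝓝 ((P * A + B ^ 2).eval (a j) / (∏ k ∈ Finset.univ.erase j, (a j - a k)) ^ 2)) := by
      have hc : ContinuousAt (fun z => (P * A + B ^ 2).eval z /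
        (∏ k ∈ Finset.univ.erase j, (z - a k)) ^ 2) (a j) :=
        ContinuousAt.div (P * A + B ^ 2).continuous.continuousAt (by fun_prop)
          (pow_ne_zero _ (hcoef j))
      exact hc.tendsto.mono_left nhdsWithin_le_nhds
    have h2 : (P * A + B ^ 2).eval (a j) / (∏ k ∈ Finset.univ.erase j, (a j - a k)) ^ 2 =
        (ρ j / 2) ^ 2 := by
      rw [Polynomial.eval_add, Polynomial.eval_mul, hAa, mul_zero, zero_add, Polynomial.eval_pow,
        hB, polyB_eval_self, neg_sq, mul_pow, mul_div_cancel_right₀ _ (pow_ne_zero _ (hcoef j))]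
    rw [h2] at h1
    refine h1.congr' ?_
    have h3 : ∀ᶠ z in 𝓝[≠] (a j), ∀ k, z ≠ a k := by
      rw [eventually_all]
      intro k
      by_cases hk : a k = a j
      · rw [hk]
        exact self_mem_nhdsWithin
      · exact mem_nhdsWithin_of_mem_nhds (isOpen_ne.mem_nhds (Ne.symm hk))
    filter_upwards [h3] with z hz
    rw [hval z hz, Polynomial.eval_pow, hA, polyA_eval,
      ← Finset.mul_prod_erase _ _ (Finset.mem_univ j)]
    have := sub_ne_zero.2 (hz j)
    have h5 : ∏ k ∈ Finset.univ.erase j, (z - a k) ≠ 0 :=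
      Finset.prod_ne_zero_iff.2 fun k _ => sub_ne_zero.2 (hz k)
    field_simp

end CriticalMeasure

namespace CriticalMeasure

variable {p : ℕ} {a ρ : Fin (p + 1) → ℂ} {ν : Measure ℂ} {h : ℂ → ℝ} {R : RatFunc ℂ}

/-! ### The function `C + Φ'` off the support -/

theorem differentiableAt_fieldDeriv {z : ℂ} (hz : ∀ k, ρ k ≠ 0 → z ≠ a k) :
    DifferentiableAt ℂ (fieldDeriv a ρ) z := by
  have h1 : fieldDeriv a ρ = fun z => -∑ k, (ρ k / 2) / (z - a k) := rfl
  rw [h1]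
  refine DifferentiableAt.fun_neg (DifferentiableAt.fun_sum fun k _ => ?_)
  by_cases hk : ρ k = 0
  · simp [hk]
  · exact (differentiableAt_const _).fun_div (by fun_prop) (sub_ne_zero.2 (hz k hk))

theorem IsPolar.differentiableAt_critFun (H : IsPolar ν h) {z : ℂ} (hz : ∀ k, ρ k ≠ 0 → z ≠ a k)
    (hs : z ∉ ν.support) : DifferentiableAt ℂ (critFun a ρ ν h) z :=
  (H.differentiableAt_cauchy hs).fun_add (differentiableAt_fieldDeriv hz)

theorem IsSquare.ne_of_order (hR : IsSquare a ρ ν h R) {z : ℂ} (hz : order R z = 0) :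
    ∀ k, ρ k ≠ 0 → z ≠ a k := by
  rintro k hk rfl
  rw [hR.order_eq k hk] at hz
  norm_num at hz

theorem eventually_ne_nodes (a : Fin (p + 1) → ℂ) (z : ℂ) : ∀ᶠ w in 𝓝[≠] z, ∀ k, w ≠ a k := by
  rw [eventually_all]
  intro k
  by_cases hk : a k = z
  · rw [hk]
    exact self_mem_nhdsWithin
  · exact mem_nhdsWithin_of_mem_nhds (isOpen_ne.mem_nhds (Ne.symm hk))

/-- By continuity the identity extends from punctured neighbourhoods to nodes with zero charge off
the support. -/
theorem IsSquare.sq_eq_of_notMem (hR : IsSquare a ρ ν h R) (H : IsPolar ν h) {z : ℂ}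
    (hz : order R z = 0) (hs : z ∉ ν.support) : critFun a ρ ν h z ^ 2 = value R z := by
  have h1 : Tendsto (fun w => critFun a ρ ν h w ^ 2) (𝓝[≠] z) (𝓝 (critFun a ρ ν h z ^ 2)) :=
    ((H.differentiableAt_critFun (hR.ne_of_order hz) hs).continuousAt.pow 2).tendsto.mono_left
      nhdsWithin_le_nhds
  have hd : R.denom.eval z ≠ 0 := fun hc => by
    have := (order_neg_iff R z).2 hc
    omega
  have h2 : Tendsto (value R) (𝓝[≠] z) (𝓝 (value R z)) :=
    (differentiableAt_value hd).continuousAt.tendsto.mono_left nhdsWithin_le_nhds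
  refine tendsto_nhds_unique (h1.congr' ?_) h2
  filter_upwards [eventually_ne_nodes a z,
    mem_nhdsWithin_of_mem_nhds (Measure.isOpen_compl_support.mem_nhds hs)] with w hw hw'
  exact hR.sq_eq w hw (H.integrable_inv_of_notMem hw')

theorem IsSquare.ae_sq_eq (hR : IsSquare a ρ ν h R) (H : IsPolar ν h) :
    ∀ᵐ z : ℂ, critFun a ρ ν h z ^ 2 = value R z := by
  have h1 : ∀ᵐ z : ℂ, ∀ k, z ≠ a k := ae_all_iff.2 fun k => by
    rw [ae_iff]
    simp
  filter_upwards [h1, H.ae_integrable_inv] with z hz hz'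
  exact hR.sq_eq z hz hz'

/-! ### The behaviour at infinity -/

/-- `1 / (x - z) + 1 / z = x / ((x - z) z)` is `O(|z|⁻²)` uniformly for `x` in a bounded set;
integrate over `μ` and sum over the nodes. -/
theorem exists_critFun_asymptotic (H : IsPolar ν h) (a ρ : Fin (p + 1) → ℂ) :
    ∃ K M : ℝ, 0 < K ∧ 0 < M ∧ ∀ z, M ≤ ‖z‖ → z ∉ ν.support ∧ (∀ k, z ≠ a k) ∧
      ‖critFun a ρ ν h z + (((∫ x, h x ∂ν : ℝ) : ℂ) + 1 / 2 * ∑ j, ρ j) / z‖ ≤ K / ‖z‖ ^ 2 := by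
  have := H.finite
  obtain ⟨r, hr0, hr⟩ := H.exists_bound
  obtain ⟨s, hs⟩ := (Set.finite_range a).isBounded.exists_norm_le
  set t := max r s with ht
  have ht0 : 0 < t := lt_max_of_lt_left hr0
  have hbound : ∀ x z : ℂ, ‖x‖ ≤ t → 2 * t ≤ ‖z‖ → x - z ≠ 0 ∧ z ≠ 0 ∧
      ‖(x - z)⁻¹ + z⁻¹‖ ≤ 2 * t / ‖z‖ ^ 2 := by
    intro x z hx hz
    have hz0 : 0 < ‖z‖ := by linarith
    have h1 : ‖z‖ / 2 ≤ ‖x - z‖ := by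
      have := norm_sub_norm_le z x
      rw [norm_sub_rev] at this
      linarith
    have h2 : 0 < ‖x - z‖ := by linarith
    have h3 : x - z ≠ 0 := norm_pos_iff.1 h2
    have h4 : z ≠ 0 := norm_pos_iff.1 hz0
    refine ⟨h3, h4, ?_⟩
    have h5 : (x - z)⁻¹ + z⁻¹ = x / ((x - z) * z) := by
      field_simp
      ring
    rw [h5, norm_div, norm_mul, div_le_div_iff₀ (by positivity) (by positivity)]
    calc ‖x‖ * ‖z‖ ^ 2 ≤ t * ‖z‖ ^ 2 := by gcongr
      _ = 2 * t * (‖z‖ / 2 * ‖z‖) := by ring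
      _ ≤ _ := by gcongr
  have hint1 : Integrable (fun x => (h x : ℂ)) ν := by
    simpa using H.integrable_mul (integrable_const (1 : ℂ))
  refine ⟨2 * t * (ν.real Set.univ + ∑ k, ‖ρ k / 2‖) + 1, 2 * t + 1, by positivity, by positivity,
    fun z hz => ?_⟩
  have hz' : 2 * t ≤ ‖z‖ := by linarith
  have hzs : z ∉ ν.support := fun hc => by
    have := (hr z hc).trans (le_max_left r s)
    linarith
  have hak : ∀ k, ‖a k‖ ≤ t := fun k => (hs _ ⟨k, rfl⟩).trans (le_max_right r s)
  have hza : ∀ k, z ≠ a k := fun k hc => by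
    have := hak k
    rw [← hc] at this
    linarith
  refine ⟨hzs, hza, ?_⟩
  have h1 : cauchy ν h z + ((∫ x, h x ∂ν : ℝ) : ℂ) / z =
      ∫ x, (h x : ℂ) * ((x - z)⁻¹ + z⁻¹) ∂ν := by
    simp_rw [mul_add]
    rw [integral_add (H.integrable_mul (H.integrable_inv_of_notMem hzs)) (hint1.mul_const _),
      integral_mul_const, integral_complex_ofReal, div_eq_mul_inv]
    rfl
  have h2 : ‖cauchy ν h z + ((∫ x, h x ∂ν : ℝ) : ℂ) / z‖ ≤
      2 * t / ‖z‖ ^ 2 * ν.real Set.univ := by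
    rw [h1]
    refine norm_integral_le_of_norm_le_const ?_
    filter_upwards [H.ae_mem] with x hx
    rw [norm_mul, H.norm_eq, one_mul]
    exact (hbound x z ((hr x hx).trans (le_max_left r s)) hz').2.2
  have h3 : fieldDeriv a ρ z + (1 / 2 * ∑ j, ρ j) / z =
      ∑ k, ρ k / 2 * ((a k - z)⁻¹ + z⁻¹) := by
    rw [fieldDeriv, ← Finset.sum_neg_distrib, Finset.mul_sum, Finset.sum_div,
      ← Finset.sum_add_distrib]
    refine Finset.sum_congr rfl fun k _ => ?_
    have h5 := sub_ne_zero.2 (hza k)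
    have h6 := (hbound (a k) z (hak k) hz').1
    have h7 := (hbound (a k) z (hak k) hz').2.1
    rw [← neg_sub (a k) z]
    field_simp
  have h4 : ‖fieldDeriv a ρ z + (1 / 2 * ∑ j, ρ j) / z‖ ≤
      ∑ k, ‖ρ k / 2‖ * (2 * t / ‖z‖ ^ 2) := by
    rw [h3]
    refine (norm_sum_le _ _).trans (Finset.sum_le_sum fun k _ => ?_)
    rw [norm_mul]
    gcongr
    exact (hbound (a k) z (hak k) hz').2.2
  have h5 : critFun a ρ ν h z + (((∫ x, h x ∂ν : ℝ) : ℂ) + 1 / 2 * ∑ j, ρ j) / z =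
      (cauchy ν h z + ((∫ x, h x ∂ν : ℝ) : ℂ) / z) +
        (fieldDeriv a ρ z + (1 / 2 * ∑ j, ρ j) / z) := by
    rw [critFun]
    ring
  rw [h5]
  refine (norm_add_le _ _).trans ((add_le_add h2 h4).trans ?_)
  rw [← Finset.sum_mul]
  have hz0 : 0 < ‖z‖ ^ 2 := by
    have : 0 < ‖z‖ := by linarith
    positivity
  rw [le_div_iff₀ hz0]
  have h8 : (2 * t / ‖z‖ ^ 2 * ν.real Set.univ + (∑ k, ‖ρ k / 2‖) * (2 * t / ‖z‖ ^ 2)) * ‖z‖ ^ 2 =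
      2 * t * (ν.real Set.univ + ∑ k, ‖ρ k / 2‖) := by
    have hz1 : ‖z‖ ^ 2 ≠ 0 := hz0.ne'
    generalize ‖z‖ ^ 2 = w at hz1
    field_simp
  rw [h8]
  linarith

/-- With `f = C + Φ'`, the difference `f² - (κ / z)²` factors into `f + κ / z = O(z⁻²)` and `f - κ /
z = O(z⁻¹)`. -/
theorem IsSquare.isBigO (hR : IsSquare a ρ ν h R) (H : IsPolar ν h) :
    (fun z : ℂ => value R z - ((((∫ x, h x ∂ν : ℝ) : ℂ) + 1 / 2 * ∑ j, ρ j) / z) ^ 2)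
      =O[cocompact ℂ] fun z : ℂ => (z ^ 3)⁻¹ := by
  obtain ⟨K, M, hK, hM, hb⟩ := exists_critFun_asymptotic H a ρ
  set κ : ℂ := ((∫ x, h x ∂ν : ℝ) : ℂ) + 1 / 2 * ∑ j, ρ j
  refine Asymptotics.IsBigO.of_bound (K * (K / M + 2 * ‖κ‖)) ?_
  have h1 : ∀ᶠ z : ℂ in cocompact ℂ, M ≤ ‖z‖ :=
    (tendsto_norm_cocompact_atTop (E := ℂ)).eventually_ge_atTop M
  filter_upwards [h1] with z hz
  obtain ⟨hs, hza, hbz⟩ := hb z hz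
  have hz0 : 0 < ‖z‖ := hM.trans_le hz
  rw [← hR.sq_eq z hza (H.integrable_inv_of_notMem hs)]
  have h2 : critFun a ρ ν h z ^ 2 - (κ / z) ^ 2 =
      (critFun a ρ ν h z + κ / z) * ((critFun a ρ ν h z + κ / z) - 2 * κ / z) := by ring
  have h3 : ‖(critFun a ρ ν h z + κ / z) - 2 * κ / z‖ ≤ (K / M + 2 * ‖κ‖) / ‖z‖ := by
    refine (norm_sub_le _ _).trans ?_
    rw [add_div (K / M), norm_div, norm_mul, Complex.norm_ofNat]
    refine add_le_add (hbz.trans ?_) le_rfl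
    rw [div_div, sq]
    exact div_le_div_of_nonneg_left hK.le (by positivity)
      (mul_le_mul_of_nonneg_right hz hz0.le)
  rw [h2, norm_mul, norm_inv, norm_pow]
  calc _ ≤ K / ‖z‖ ^ 2 * ((K / M + 2 * ‖κ‖) / ‖z‖) := by gcongr
    _ = _ := by
      field_simp

/-! ### The logarithmic potential -/

/-- The total potential of the measure in the external field, for real charges. -/
noncomputable def potential (a ρ : Fin (p + 1) → ℂ) (ν : Measure ℂ) (h : ℂ → ℝ) (z : ℂ) : ℝ :=
  -(∫ x, h x * Real.log ‖x - z‖ ∂ν) - ∑ k, (ρ k).re / 2 * Real.log ‖z - a k‖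

/-- The real-linear map `v ↦ Re (c v)`. -/
noncomputable def reMul : ℂ →L[ℝ] ℂ →L[ℝ] ℝ :=
  (ContinuousLinearMap.compL ℝ ℂ ℂ ℝ Complex.reCLM).comp (ContinuousLinearMap.mul ℝ ℂ)

theorem reMul_apply (c v : ℂ) : reMul c v = (c * v).re := rfl

theorem norm_reMul_le (c : ℂ) : ‖reMul c‖ ≤ ‖c‖ := by
  refine ContinuousLinearMap.opNorm_le_bound _ (norm_nonneg _) fun v => ?_
  rw [reMul_apply, ← norm_mul]
  exact Complex.abs_re_le_norm _

/-- The holomorphic function `log (w / z)` has no cut near `w = z`, and its real part is `log ‖w‖`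
up to a constant. -/
theorem hasFDerivAt_log_norm {z : ℂ} (hz : z ≠ 0) :
    HasFDerivAt (fun w : ℂ => Real.log ‖w‖) (reMul z⁻¹) z := by
  have h1 : HasDerivAt (fun w : ℂ => Complex.log (w / z)) z⁻¹ z := by
    have h2 := ((hasDerivAt_id z).div_const z).clog (by simp [hz])
    simpa [hz] using h2
  have h3 : HasFDerivAt (fun w : ℂ => (Complex.log (w / z)).re) (reMul z⁻¹) z := by
    have h4 := Complex.reCLM.hasFDerivAt.comp z (h1.hasFDerivAt.restrictScalars ℝ)
    refine h4.congr_fderiv ?_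
    ext v
    simp [reMul_apply, mul_comm]
  have h5 := h3.add_const (Real.log ‖z‖)
  refine h5.congr_of_eventuallyEq ?_
  filter_upwards [isOpen_ne.mem_nhds hz] with w hw
  have hw0 : ‖w‖ ≠ 0 := norm_ne_zero_iff.2 hw
  have hz0 : ‖z‖ ≠ 0 := norm_ne_zero_iff.2 hz
  rw [Complex.log_re, norm_div, Real.log_div hw0 hz0]
  ring

/-- Real charges make the potential single-valued although a primitive of `C + Φ'` is not; the
potential is locally the real part of such a primitive. -/
theorem IsPolar.hasFDerivAt_potential (H : IsPolar ν h) (hρ : ∀ k, (ρ k).im = 0) {z : ℂ}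
    (hz : ∀ k, ρ k ≠ 0 → z ≠ a k) (hs : z ∉ ν.support) :
    HasFDerivAt (potential a ρ ν h) (reMul (critFun a ρ ν h z)) z := by
  have := H.finite
  have h0 := H.measurable
  obtain ⟨δ, hδ, hb⟩ := H.exists_pos_dist hs
  obtain ⟨r, hr0, hr⟩ := H.exists_bound
  have hder : ∀ w ∈ Metric.ball z δ, ∀ x ∈ ν.support, HasFDerivAt
      (fun w => h x * Real.log ‖x - w‖) (h x • reMul (-(x - w)⁻¹)) w := by
    intro w hw x hx
    have h1 : x - w ≠ 0 := norm_pos_iff.1 (hδ.trans_le (hb w hw x hx))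
    have h2 := (hasFDerivAt_log_norm h1).comp w ((hasFDerivAt_id (𝕜 := ℝ) w).const_sub x)
    refine (h2.const_mul (h x)).congr_fderiv ?_
    ext v
    simp [reMul_apply]
  have hIlog : Integrable (fun x => h x * Real.log ‖x - z‖) ν := by
    refine Integrable.of_bound (C := |Real.log δ| + |Real.log (r + ‖z‖)|) (by fun_prop) ?_
    filter_upwards [H.ae_mem] with x hx
    have h1 := hb z (Metric.mem_ball_self hδ) x hx
    have h2 : ‖x - z‖ ≤ r + ‖z‖ := (norm_sub_le _ _).trans (by linarith [hr x hx])
    have h3 := Real.log_le_log hδ h1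
    have h4 := Real.log_le_log (hδ.trans_le h1) h2
    have h5 : |h x| = 1 := by rcases H.unit x with hx | hx <;> simp [hx]
    rw [norm_mul, Real.norm_eq_abs, h5, one_mul, Real.norm_eq_abs, abs_le]
    constructor
    · linarith [neg_abs_le (Real.log δ), abs_nonneg (Real.log (r + ‖z‖))]
    · linarith [le_abs_self (Real.log (r + ‖z‖)), abs_nonneg (Real.log δ)]
  have hmeas : AEStronglyMeasurable (fun x => h x • reMul (-(x - z)⁻¹)) ν := by
    have h1 : Measurable fun x : ℂ => -(x - z)⁻¹ := by fun_prop
    exact (h0.aestronglyMeasurable).smul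
      ((reMul.continuous.measurable.comp h1).aestronglyMeasurable)
  have hbound : ∀ w ∈ Metric.ball z δ, ∀ x ∈ ν.support,
      ‖h x • reMul (-(x - w)⁻¹)‖ ≤ δ⁻¹ := by
    intro w hw x hx
    have h5 : |h x| = 1 := by rcases H.unit x with hx | hx <;> simp [hx]
    rw [norm_smul, Real.norm_eq_abs, h5, one_mul]
    refine (norm_reMul_le _).trans ?_
    rw [norm_neg, norm_inv]
    exact inv_anti₀ hδ (hb w hw x hx)
  have h1 : HasFDerivAt (fun w => ∫ x, h x * Real.log ‖x - w‖ ∂ν)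
      (∫ x, h x • reMul (-(x - z)⁻¹) ∂ν) z := by
    refine hasFDerivAt_integral_of_dominated_of_fderiv_le (bound := fun _ => δ⁻¹)
      (F := fun w x => h x * Real.log ‖x - w‖) (F' := fun w x => h x • reMul (-(x - w)⁻¹))
      (Metric.ball_mem_nhds z hδ) ?_ hIlog hmeas ?_ (integrable_const _) ?_
    · exact Eventually.of_forall fun w => by fun_prop
    · filter_upwards [H.ae_mem] with x hx w hw using hbound w hw x hx
    · filter_upwards [H.ae_mem] with x hx w hw using hder w hw x hx
  have h2 : ∫ x, h x • reMul (-(x - z)⁻¹) ∂ν = reMul (-cauchy ν h z) := by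
    have h3 := reMul.integral_comp_comm
      ((H.integrable_mul (H.integrable_inv_of_notMem hs)).neg)
    have h4 : ∫ x, (-fun x => (h x : ℂ) * (x - z)⁻¹) x ∂ν = -cauchy ν h z := by
      simp only [Pi.neg_apply, integral_neg]
      rfl
    rw [h4] at h3
    rw [← h3]
    refine integral_congr_ae (Eventually.of_forall fun x => ?_)
    dsimp only
    rw [← map_smul]
    congr 1
    simp
  rw [h2] at h1
  have h3 : HasFDerivAt (fun w => ∑ k, (ρ k).re / 2 * Real.log ‖w - a k‖)
      (∑ k, ((ρ k).re / 2) • reMul (z - a k)⁻¹) z := by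
    refine HasFDerivAt.fun_sum fun k _ => ?_
    by_cases hk : ρ k = 0
    · simp [hk]
      exact hasFDerivAt_const _ _
    · have h4 := (hasFDerivAt_log_norm (sub_ne_zero.2 (hz k hk))).comp z
        ((hasFDerivAt_id (𝕜 := ℝ) z).sub_const (a k))
      exact h4.const_mul _
  refine (h1.neg.sub h3).congr_fderiv ?_
  ext v
  simp only [critFun, fieldDeriv, sub_apply, neg_apply,
    reMul_apply, sum_apply, smul_apply, smul_eq_mul]
  rw [add_mul, neg_mul, neg_mul, Complex.add_re, Complex.neg_re, Complex.neg_re, neg_neg,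
    Finset.sum_mul, Complex.re_sum, sub_eq_add_neg]
  congr 2
  refine Finset.sum_congr rfl fun k _ => ?_
  have h6 : ρ k / 2 = (((ρ k).re / 2 : ℝ) : ℂ) := by
    apply Complex.ext <;> simp [hρ k]
  have h7 : ρ k / 2 / (z - a k) * v = (((ρ k).re / 2 : ℝ) : ℂ) * ((z - a k)⁻¹ * v) := by
    rw [h6]
    ring
  rw [h7, Complex.re_ofReal_mul]

end CriticalMeasure

/-! ### The measure in a natural parameter: a sign function and its jumps -/

namespace CriticalMeasure

/-! ### The Cauchy–Pompeiu formula -/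

/-- The operator `2 ∂̄ = ∂_x + i ∂_y`. -/
noncomputable def dbar (g : ℂ → ℂ) (z : ℂ) : ℂ := fderiv ℝ g z 1 + Complex.I * fderiv ℝ g z Complex.I

variable {g : ℂ → ℂ}

theorem continuous_dbar (hg : ContDiff ℝ (⊤ : ℕ∞) g) : Continuous (dbar g) := by
  have := hg.continuous_fderiv (by simp)
  unfold dbar
  fun_prop

theorem hasCompactSupport_dbar (hc : HasCompactSupport g) : HasCompactSupport (dbar g) := by
  refine HasCompactSupport.mono (hc.fderiv (𝕜 := ℝ)) fun z hz => ?_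
  rw [Function.mem_support] at hz ⊢
  intro h0
  exact hz (by simp [dbar, h0])

/-- This is `e^{-iθ} (∂_x + i ∂_y) = ∂_r + (i / r) ∂_θ`, with the angular derivative expressed as
the derivative in direction `i e^{iθ}`. -/
theorem dbar_polar (x : ℂ) (r θ : ℝ) :
    Complex.exp (-(θ * Complex.I)) * dbar g (x + r * Complex.exp (θ * Complex.I)) =
      fderiv ℝ g (x + r * Complex.exp (θ * Complex.I)) (Complex.exp (θ * Complex.I)) +
      Complex.I * fderiv ℝ g (x + r * Complex.exp (θ * Complex.I))
        (Complex.I * Complex.exp (θ * Complex.I)) := by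
  set L := fderiv ℝ g (x + r * Complex.exp (θ * Complex.I)) with hL
  have h1 : Complex.exp (-(θ * Complex.I)) = Complex.cos θ - Complex.sin θ * Complex.I := by
    rw [← neg_mul, Complex.exp_mul_I, Complex.cos_neg, Complex.sin_neg]
    ring
  have h2 : Complex.exp (θ * Complex.I) =
      (Real.cos θ) • (1 : ℂ) + (Real.sin θ) • Complex.I := by
    rw [Complex.exp_mul_I, Complex.real_smul, Complex.real_smul]
    push_cast
    ring
  have h3 : Complex.I * Complex.exp (θ * Complex.I) =
      (-Real.sin θ) • (1 : ℂ) + (Real.cos θ) • Complex.I := by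
    rw [h2]
    simp only [Complex.real_smul]
    push_cast
    linear_combination (Complex.sin θ) * Complex.I_sq
  rw [dbar, ← hL, h3, h1, h2]
  simp only [map_add, map_smul]
  simp only [Complex.real_smul]
  push_cast
  linear_combination (-Complex.sin θ * L Complex.I) * Complex.I_sq

theorem hasDerivAt_radial (hg : ContDiff ℝ (⊤ : ℕ∞) g) (x : ℂ) (r θ : ℝ) :
    HasDerivAt (fun r : ℝ => g (x + r * Complex.exp (θ * Complex.I)))
      (fderiv ℝ g (x + r * Complex.exp (θ * Complex.I)) (Complex.exp (θ * Complex.I))) r := by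
  have h1 : HasDerivAt (fun r : ℝ => x + r * Complex.exp (θ * Complex.I))
      (Complex.exp (θ * Complex.I)) r := by
    have h2 : HasDerivAt (fun s : ℝ => (s : ℂ)) 1 r := Complex.ofRealCLM.hasDerivAt
    simpa using (h2.mul_const (Complex.exp (θ * Complex.I))).const_add x
  exact ((hg.differentiable (by simp)).differentiableAt.hasFDerivAt).comp_hasDerivAt r h1

theorem hasDerivAt_angular (hg : ContDiff ℝ (⊤ : ℕ∞) g) (x : ℂ) (r θ : ℝ) :
    HasDerivAt (fun θ : ℝ => g (x + r * Complex.exp (θ * Complex.I)))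
      (r • fderiv ℝ g (x + r * Complex.exp (θ * Complex.I))
        (Complex.I * Complex.exp (θ * Complex.I))) θ := by
  have h1 : HasDerivAt (fun θ : ℝ => x + r * Complex.exp (θ * Complex.I))
      (r • (Complex.I * Complex.exp (θ * Complex.I))) θ := by
    have h2 : HasDerivAt (fun s : ℝ => (s : ℂ)) 1 θ := Complex.ofRealCLM.hasDerivAt
    refine ((((h2.mul_const Complex.I).cexp).const_mul (r : ℂ)).const_add x).congr_deriv ?_
    rw [Complex.real_smul]
    ring
  have h3 := ((hg.differentiable (by simp)).differentiableAt.hasFDerivAt).comp_hasDerivAt θ h1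
  rwa [map_smul] at h3

/-- In polar coordinates about `x` the Jacobian cancels the modulus of the kernel, leaving minus the
radial derivative of `g` and `-i` times its angular derivative. The radial derivative integrates to
`-g x` on every ray, which produces `2π g x`; the angular one integrates to `0` on every circle. -/
theorem integral_dbar_mul_inv (hg : ContDiff ℝ (⊤ : ℕ∞) g) (hc : HasCompactSupport g) (x : ℂ) :
    ∫ z, dbar g z * (x - z)⁻¹ = 2 * Real.pi * g x := by
  obtain ⟨M, hM0, hM⟩ : ∃ M : ℝ, 0 < M ∧ ∀ u : ℂ, M ≤ ‖u‖ → x + u ∉ tsupport g := by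
    obtain ⟨M, hM⟩ := hc.isCompact.isBounded.exists_norm_le
    refine ⟨max M 0 + ‖x‖ + 1, by positivity, fun u hu hmem => ?_⟩
    have h1 := hM _ hmem
    have h2 : ‖u‖ ≤ ‖x + u‖ + ‖x‖ := by
      have := norm_sub_le (x + u) x
      simpa using this
    linarith [le_max_left M 0]
  have hfd := hg.continuous_fderiv (by simp)
  obtain ⟨K, hK⟩ := (hc.fderiv (𝕜 := ℝ)).exists_bound_of_continuous hfd
  have hK0 : 0 ≤ K := (norm_nonneg _).trans (hK 0)
  have hfd0 : ∀ u : ℂ, M ≤ ‖u‖ → fderiv ℝ g (x + u) = 0 := fun u hu => by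
    by_contra hne
    exact hM u hu (support_fderiv_subset ℝ hne)
  have hexp : ∀ θ : ℝ, ‖Complex.exp (θ * Complex.I)‖ = 1 := Complex.norm_exp_ofReal_mul_I
  have hrn : ∀ r θ : ℝ, 0 < r → ‖(r : ℂ) * Complex.exp (θ * Complex.I)‖ = r := fun r θ hr => by
    rw [norm_mul, hexp, mul_one, Complex.norm_real, Real.norm_of_nonneg hr.le]
  let T : Set (ℝ × ℝ) := Set.Ioi (0 : ℝ) ×ˢ Set.Ioo (-Real.pi) Real.pi
  have hTm : MeasurableSet T := measurableSet_Ioi.prod measurableSet_Ioo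
  have hInt : ∀ G : ℝ × ℝ → ℂ, Continuous G → (∀ q, 0 < q.1 → ‖G q‖ ≤ K) →
      (∀ q, 0 < q.1 → M ≤ q.1 → G q = 0) → IntegrableOn G T := by
    intro G hG hb h0
    have hsub : IntegrableOn G (Set.Ioc (0 : ℝ) M ×ˢ Set.Ioo (-Real.pi) Real.pi) := by
      refine (Measure.integrableOn_of_bounded (M := K) ?_ hG.aestronglyMeasurable ?_)
      · rw [Measure.volume_eq_prod, Measure.prod_prod, Real.volume_Ioc, Real.volume_Ioo]
        exact (ENNReal.mul_lt_top ENNReal.ofReal_lt_top ENNReal.ofReal_lt_top).ne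
      · refine (ae_restrict_iff' (measurableSet_Ioc.prod measurableSet_Ioo)).2
          (Eventually.of_forall fun q hq => hb q hq.1.1)
    refine hsub.of_forall_sdiff_eq_zero hTm fun q hq => ?_
    refine h0 q hq.1.1 ?_
    by_contra hlt
    push Not at hlt
    exact hq.2 ⟨⟨hq.1.1, hlt.le⟩, hq.1.2⟩
  let A : ℝ × ℝ → ℂ := fun q => fderiv ℝ g (x + q.1 * Complex.exp (q.2 * Complex.I))
    (Complex.exp (q.2 * Complex.I))
  let B : ℝ × ℝ → ℂ := fun q => fderiv ℝ g (x + q.1 * Complex.exp (q.2 * Complex.I))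
    (Complex.I * Complex.exp (q.2 * Complex.I))
  have hAi : IntegrableOn A T := by
    refine hInt A (by fun_prop) (fun q hq => ?_) fun q hq hMq => ?_
    · exact ((fderiv ℝ g _).le_opNorm _).trans (by rw [hexp, mul_one]; exact hK _)
    · simp only [A]
      rw [hfd0 _ (by rw [hrn _ _ hq]; exact hMq)]
      rfl
  have hBi : IntegrableOn B T := by
    refine hInt B (by fun_prop) (fun q hq => ?_) fun q hq hMq => ?_
    · exact ((fderiv ℝ g _).le_opNorm _).trans (by simpa [hexp] using hK _)
    · simp only [B]
      rw [hfd0 _ (by rw [hrn _ _ hq]; exact hMq)]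
      rfl
  have hA : ∫ q in T, A q = -(2 * Real.pi * g x) := by
    have h1 : ∫ q in T, A q = ∫ θ in Set.Ioo (-Real.pi) Real.pi, ∫ r in Set.Ioi (0 : ℝ), A (r, θ) := by
      have h2 := hAi
      rw [IntegrableOn, Measure.volume_eq_prod, ← Measure.prod_restrict] at h2
      rw [Measure.volume_eq_prod, ← Measure.prod_restrict, integral_prod_symm _ h2]
    have h3 : ∀ θ : ℝ, ∫ r in Set.Ioi (0 : ℝ), A (r, θ) = -g x := by
      intro θ
      have h5 : Tendsto (fun r : ℝ => g (x + r * Complex.exp (θ * Complex.I))) atTop (𝓝 0) := by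
        refine tendsto_const_nhds.congr' ?_
        filter_upwards [eventually_ge_atTop M] with r hr
        by_contra hne
        exact hM _ (by rw [hrn _ _ (hM0.trans_le hr)]; exact hr)
          (subset_tsupport _ (Ne.symm hne))
      have h6 : IntegrableOn (fun r => A (r, θ)) (Set.Ioi 0) := by
        have h7 : IntegrableOn (fun r => A (r, θ)) (Set.Ioc 0 M) :=
          (Continuous.integrableOn_Ioc (by simp only [A]; fun_prop))
        refine h7.of_forall_sdiff_eq_zero measurableSet_Ioi fun r hr => ?_
        have hMr : M ≤ r := by
          by_contra hlt
          push Not at hlt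
          exact hr.2 ⟨hr.1, hlt.le⟩
        simp only [A]
        rw [hfd0 _ (by rw [hrn _ _ hr.1]; exact hMr)]
        rfl
      have h8 := integral_Ioi_of_hasDerivAt_of_tendsto'
        (fun r _ => hasDerivAt_radial hg x r θ) h6 h5
      simp only [A]
      rw [h8]
      simp
    rw [h1]
    simp_rw [h3]
    rw [setIntegral_const, Real.volume_real_Ioo_of_le (by linarith [Real.pi_pos]),
      Complex.real_smul]
    push_cast
    ring
  -- `r • B` is the derivative in `θ` of a function with equal values at `-π` and `π`.
  have hB : ∫ q in T, B q = 0 := by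
    rw [Measure.volume_eq_prod, setIntegral_prod _ (by rwa [← Measure.volume_eq_prod])]
    refine setIntegral_eq_zero_of_forall_eq_zero fun r hr => ?_
    have hr0 : r ≠ 0 := (Set.mem_Ioi.1 hr).ne'
    have h1 : ∫ θ in (-Real.pi)..Real.pi, r • B (r, θ) = 0 := by
      have h2 := intervalIntegral.integral_eq_sub_of_hasDerivAt
        (fun θ (_ : θ ∈ Set.uIcc (-Real.pi) Real.pi) => hasDerivAt_angular hg x r θ)
        (Continuous.intervalIntegrable (by fun_prop) _ _)
      simp only [B]
      rw [h2]
      simp [Complex.exp_neg]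
    rw [intervalIntegral.integral_smul, intervalIntegral.integral_of_le
      (by linarith [Real.pi_pos]), integral_Ioc_eq_integral_Ioo] at h1
    exact (smul_eq_zero.1 h1).resolve_left hr0
  have h1 : ∫ z, dbar g z * (x - z)⁻¹ = ∫ u, dbar g (x + u) * (-u)⁻¹ := by
    rw [← integral_add_left_eq_self (fun z => dbar g z * (x - z)⁻¹) x]
    simp
  rw [h1, ← Complex.integral_comp_polarCoord_symm, polarCoord_target]
  have h2 : ∀ q ∈ T, q.1 • (dbar g (x + Complex.polarCoord.symm q) *
      (-Complex.polarCoord.symm q)⁻¹) = -(A q + Complex.I * B q) := by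
    intro q hq
    have hq0 : (q.1 : ℂ) ≠ 0 := Complex.ofReal_ne_zero.2 (Set.mem_Ioi.1 hq.1).ne'
    have h3 : Complex.polarCoord.symm q = q.1 * Complex.exp (q.2 * Complex.I) := by
      rw [Complex.polarCoord_symm_apply, Complex.exp_mul_I]
      push_cast
      rfl
    have h4 := dbar_polar (g := g) x q.1 q.2
    simp only [A, B]
    rw [← h4, h3, Complex.exp_neg, Complex.real_smul]
    have := Complex.exp_ne_zero (q.2 * Complex.I)
    field_simp
  rw [setIntegral_congr_fun hTm h2, integral_neg, integral_add hAi (hBi.const_mul _),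
    integral_const_mul, hA, hB]
  ring

variable {p : ℕ} {a ρ : Fin (p + 1) → ℂ} {ν : Measure ℂ} {h : ℂ → ℝ}

theorem integrable_dbar_mul_inv (hg : ContDiff ℝ (⊤ : ℕ∞) g) (hc : HasCompactSupport g) (x : ℂ) :
    Integrable fun z => dbar g z * (x - z)⁻¹ := by
  obtain ⟨M, hM⟩ := (hasCompactSupport_dbar hc).isCompact.isBounded.exists_norm_le
  obtain ⟨K, hK⟩ := (hasCompactSupport_dbar hc).exists_bound_of_continuous (continuous_dbar hg)
  have h1 : IntegrableOn (fun z => dbar g z * (x - z)⁻¹) (Metric.ball 0 (M + 1)) := by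
    refine Integrable.bdd_mul (c := K) ⟨by fun_prop, ?_⟩
      (continuous_dbar hg).aestronglyMeasurable (Eventually.of_forall hK)
    exact (lintegral_ball_inv_sub_le le_rfl).trans_lt (lintegral_ball_inv_lt_top _)
  refine (integrableOn_iff_integrable_of_support_subset fun z hz => ?_).1 h1
  have : dbar g z ≠ 0 := left_ne_zero_of_mul hz
  rw [mem_ball_zero_iff]
  linarith [hM z (subset_tsupport _ this)]

theorem IsPolar.integral_dbar_mul_cauchy (H : IsPolar ν h) (hg : ContDiff ℝ (⊤ : ℕ∞) g)
    (hc : HasCompactSupport g) :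
    Integrable (fun z => dbar g z * cauchy ν h z) ∧
    ∫ z, dbar g z * cauchy ν h z = 2 * Real.pi * ∫ x, (h x : ℂ) * g x ∂ν := by
  have := H.finite
  have h0 := H.measurable
  obtain ⟨M, hM⟩ := (hasCompactSupport_dbar hc).isCompact.isBounded.exists_norm_le
  obtain ⟨K, hK⟩ := (hasCompactSupport_dbar hc).exists_bound_of_continuous (continuous_dbar hg)
  have hcd := (continuous_dbar hg).measurable
  have hsupp : ∀ z, z ∉ Metric.ball (0 : ℂ) (M + 1) → dbar g z = 0 := fun z hz => by
    by_contra hne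
    refine hz ?_
    rw [mem_ball_zero_iff]
    linarith [hM z (subset_tsupport _ hne)]
  have hI : Integrable (fun q : ℂ × ℂ => ((h q.1 : ℂ) * dbar g q.2) * (q.1 - q.2)⁻¹)
      (ν.prod (volume.restrict (Metric.ball (0 : ℂ) (M + 1)))) := by
    refine Integrable.bdd_mul (c := K) (H.integrable_prod_inv (M + 1)) (by fun_prop)
      (Eventually.of_forall fun q => ?_)
    rw [norm_mul, H.norm_eq, one_mul]
    exact hK _
  have h1 : (fun z => dbar g z * cauchy ν h z) =
      fun z => ∫ x, ((h x : ℂ) * dbar g z) * (x - z)⁻¹ ∂ν := by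
    funext z
    rw [cauchy, ← integral_const_mul]
    congr 1
    funext x
    ring
  have h2 : IntegrableOn (fun z => dbar g z * cauchy ν h z) (Metric.ball 0 (M + 1)) := by
    rw [h1]
    exact hI.integral_prod_right
  refine ⟨(integrableOn_iff_integrable_of_support_subset fun z hz => ?_).1 h2, ?_⟩
  · by_contra hz'
    exact left_ne_zero_of_mul hz (hsupp z hz')
  · rw [← setIntegral_eq_integral_of_forall_compl_eq_zero
      (s := Metric.ball (0 : ℂ) (M + 1)) (fun z hz => by rw [hsupp z hz, zero_mul]), h1,
      (integral_integral_swap hI).symm, ← integral_const_mul]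
    refine integral_congr_ae (Eventually.of_forall fun x => ?_)
    dsimp only
    have h3 : ∫ z in Metric.ball (0 : ℂ) (M + 1), ((h x : ℂ) * dbar g z) * (x - z)⁻¹ =
        ∫ z, (h x : ℂ) * (dbar g z * (x - z)⁻¹) := by
      rw [setIntegral_eq_integral_of_forall_compl_eq_zero
        (s := Metric.ball (0 : ℂ) (M + 1)) (fun z hz => by rw [hsupp z hz, mul_zero, zero_mul])]
      congr 1
      funext z
      ring
    rw [h3, integral_const_mul, integral_dbar_mul_inv hg hc]
    ring

/-- Weak form of the equation `∂̄ (C + Φ') = - π μ`. -/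
theorem IsPolar.integral_dbar_mul_critFun (H : IsPolar ν h) (hg : ContDiff ℝ (⊤ : ℕ∞) g)
    (hc : HasCompactSupport g) (ha : ∀ k, ρ k ≠ 0 → g (a k) = 0) :
    ∫ z, dbar g z * critFun a ρ ν h z = 2 * Real.pi * ∫ x, (h x : ℂ) * g x ∂ν := by
  have h1 : ∀ z, dbar g z * critFun a ρ ν h z = dbar g z * cauchy ν h z +
      ∑ k, ρ k / 2 * (dbar g z * (a k - z)⁻¹) := by
    intro z
    rw [critFun, fieldDeriv, mul_add, ← Finset.sum_neg_distrib, Finset.mul_sum]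
    congr 1
    refine Finset.sum_congr rfl fun k _ => ?_
    rw [← neg_sub z (a k), inv_neg]
    ring
  simp_rw [h1]
  obtain ⟨h2, h3⟩ := H.integral_dbar_mul_cauchy hg hc
  have h4 : ∀ k, Integrable fun z => ρ k / 2 * (dbar g z * (a k - z)⁻¹) := fun k =>
    (integrable_dbar_mul_inv hg hc (a k)).const_mul _
  rw [integral_add h2 (integrable_finsetSum _ fun k _ => h4 k), h3,
    integral_finsetSum _ fun k _ => h4 k, Finset.sum_eq_zero, add_zero]
  intro k _
  rw [integral_const_mul, integral_dbar_mul_inv hg hc]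
  by_cases hk : ρ k = 0
  · simp [hk]
  · simp [ha k hk]

end CriticalMeasure

namespace CriticalMeasure

/-! ### Natural parameters -/

/-- `e` is a natural parameter of `-R(z) dz²` on an open subset of `ℂ`, up to the factor `i`: an
injective primitive of a branch of `√R`. -/
structure IsNatural (R : RatFunc ℂ) (e : OpenPartialHomeomorph ℂ ℂ) : Prop where
  hasDerivAt : ∀ z ∈ e.source, HasDerivAt e (deriv e z) z
  sq_deriv : ∀ z ∈ e.source, deriv e z ^ 2 = value R z
  deriv_ne_zero : ∀ z ∈ e.source, deriv e z ≠ 0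

variable {p : ℕ} {a ρ : Fin (p + 1) → ℂ} {ν : Measure ℂ} {h : ℂ → ℝ} {R : RatFunc ℂ}
  {e : OpenPartialHomeomorph ℂ ℂ}

theorem order_eq_zero_of_value_ne_zero {z : ℂ} (hz : value R z ≠ 0) : order R z = 0 := by
  by_cases hR : R = 0
  · rw [hR, value_zero] at hz
    exact absurd rfl hz
  · exact (value_ne_zero_iff hR z).1 hz

theorem IsNatural.value_ne_zero (he : IsNatural R e) {z : ℂ} (hz : z ∈ e.source) :
    value R z ≠ 0 := by
  rw [← he.sq_deriv z hz]
  exact pow_ne_zero 2 (he.deriv_ne_zero z hz)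

theorem IsNatural.differentiableOn (he : IsNatural R e) : DifferentiableOn ℂ e e.source :=
  fun z hz => (he.hasDerivAt z hz).differentiableAt.differentiableWithinAt

theorem IsNatural.contDiffAt (he : IsNatural R e) {z : ℂ} (hz : z ∈ e.source)
    (n : WithTop ℕ∞) : ContDiffAt ℝ n e z :=
  ((he.differentiableOn.contDiffOn e.open_source).contDiffAt
    (e.open_source.mem_nhds hz)).restrict_scalars ℝ

theorem det_smul_one (d : ℂ) : (d • (1 : ℂ →L[ℝ] ℂ)).det = ‖d‖ ^ 2 := by
  have h1 : ((d • (1 : ℂ →L[ℝ] ℂ) : ℂ →L[ℝ] ℂ) : ℂ →ₗ[ℝ] ℂ) = Algebra.lmul ℝ ℂ d := by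
    ext
    simp
  rw [ContinuousLinearMap.det, h1, ← Algebra.norm_apply, Algebra.norm_complex_apply,
    Complex.normSq_eq_norm_sq]

theorem integral_target_eq {e : OpenPartialHomeomorph ℂ ℂ} (he : IsNatural R e) (F : ℂ → ℂ) :
    ∫ w in e.target, F w = ∫ z in e.source, ((‖deriv e z‖ ^ 2 : ℝ) : ℂ) * F (e z) := by
  rw [← e.image_source_eq_target, integral_image_eq_integral_abs_det_fderiv_smul volume
    e.open_source.measurableSet
    (fun z hz => ((he.hasDerivAt z hz).complexToReal_fderiv).hasFDerivWithinAt) e.injOn]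
  refine setIntegral_congr_fun e.open_source.measurableSet fun z _ => ?_
  rw [det_smul_one, abs_of_nonneg (by positivity), Complex.real_smul]

/-- The function `√R⁻¹ (C + Φ')` in a natural parameter. It takes the values `± 1`. -/
noncomputable def branch (a ρ : Fin (p + 1) → ℂ) (ν : Measure ℂ) (h : ℂ → ℝ)
    (e : OpenPartialHomeomorph ℂ ℂ) (w : ℂ) : ℂ :=
  e.target.indicator (fun w => critFun a ρ ν h (e.symm w) / deriv e (e.symm w)) w

theorem IsPolar.measurable_critFun (H : IsPolar ν h) : Measurable (critFun a ρ ν h) := by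
  have := H.measurable_cauchy
  unfold critFun fieldDeriv
  fun_prop

theorem IsPolar.aestronglyMeasurable_branch (H : IsPolar ν h) :
    AEStronglyMeasurable (branch a ρ ν h e) volume := by
  have h1 : Measurable fun z => critFun a ρ ν h z / deriv e z :=
    H.measurable_critFun.div (measurable_deriv e)
  have h2 : AEMeasurable e.symm (volume.restrict e.target) :=
    e.continuousOn_symm.aemeasurable e.open_target.measurableSet
  have h3 := (aemeasurable_indicator_iff e.open_target.measurableSet).2 (h1.comp_aemeasurable h2)
  exact h3.aestronglyMeasurable

/-- The exceptional null set in the `z`-plane is carried by the differentiable map `e` to a null set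
in the `w`-plane. -/
theorem IsSquare.ae_branch_sq (hR : IsSquare a ρ ν h R) (H : IsPolar ν h) (he : IsNatural R e) :
    ∀ᵐ w, w ∈ e.target → branch a ρ ν h e w ^ 2 = 1 := by
  have h1 : volume (e '' (e.source ∩ {z | ¬ critFun a ρ ν h z ^ 2 = value R z})) = 0 := by
    refine addHaar_image_eq_zero_of_differentiableOn_of_addHaar_eq_zero volume ?_ ?_
    · exact (he.differentiableOn.mono Set.inter_subset_left).restrictScalars ℝ
    · exact measure_mono_null Set.inter_subset_right (ae_iff.1 (hR.ae_sq_eq H))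
  rw [ae_iff]
  refine measure_mono_null (fun w hw => ?_) h1
  simp only [Set.mem_ofPred_eq, Classical.not_imp] at hw
  have hs := e.map_target hw.1
  refine ⟨e.symm w, ⟨hs, fun hc => hw.2 ?_⟩, e.right_inv hw.1⟩
  rw [branch, Set.indicator_of_mem hw.1, div_pow, hc, he.sq_deriv _ hs,
    div_self (he.value_ne_zero hs)]

/-- The transplantation of a function with compact support in the target of `e`. -/
noncomputable def pullback {F : Type*} [Zero F] (e : OpenPartialHomeomorph ℂ ℂ) (u : ℂ → F) :
    ℂ → F :=
  e.source.indicator fun z => u (e z)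

section

variable {F : Type*} [NormedAddCommGroup F] {u : ℂ → F}

theorem pullback_eq_zero {z : ℂ} (hz : z ∉ e.symm '' tsupport u) : pullback e u z = 0 := by
  by_cases hs : z ∈ e.source
  · rw [pullback, Set.indicator_of_mem hs]
    by_contra hne
    exact hz ⟨e z, subset_tsupport _ hne, e.left_inv hs⟩
  · exact Set.indicator_of_notMem hs _

theorem isCompact_image_tsupport (hc : HasCompactSupport u) (hs : tsupport u ⊆ e.target) :
    IsCompact (e.symm '' tsupport u) :=
  hc.isCompact.image_of_continuousOn (e.continuousOn_symm.mono hs)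

theorem pullback_eventuallyEq_zero (hc : HasCompactSupport u) (hs : tsupport u ⊆ e.target) {z : ℂ}
    (hz : z ∉ e.source) : pullback e u =ᶠ[𝓝 z] fun _ => 0 := by
  have h1 : z ∉ e.symm '' tsupport u := by
    rintro ⟨w, hw, rfl⟩
    exact hz (e.map_target (hs hw))
  filter_upwards [(isCompact_image_tsupport hc hs).isClosed.isOpen_compl.mem_nhds h1] with w hw
  exact pullback_eq_zero hw

theorem pullback_eventuallyEq {z : ℂ} (hz : z ∈ e.source) :
    pullback e u =ᶠ[𝓝 z] fun z => u (e z) := by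
  filter_upwards [e.open_source.mem_nhds hz] with w hw
  exact Set.indicator_of_mem hw _

theorem contDiff_pullback [NormedSpace ℝ F] (he : ∀ z ∈ e.source, ContDiffAt ℝ (⊤ : ℕ∞) e z)
    (hu : ContDiff ℝ (⊤ : ℕ∞) u) (hc : HasCompactSupport u) (hs : tsupport u ⊆ e.target) :
    ContDiff ℝ (⊤ : ℕ∞) (pullback e u) := by
  refine contDiff_iff_contDiffAt.2 fun z => ?_
  by_cases hz : z ∈ e.source
  · exact (hu.contDiffAt.comp z (he z hz)).congr_of_eventuallyEq (pullback_eventuallyEq hz)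
  · exact contDiffAt_const.congr_of_eventuallyEq (pullback_eventuallyEq_zero hc hs hz)

theorem hasCompactSupport_pullback (hc : HasCompactSupport u) (hs : tsupport u ⊆ e.target) :
    HasCompactSupport (pullback e u) :=
  HasCompactSupport.intro (isCompact_image_tsupport hc hs) fun _ hz => pullback_eq_zero hz

theorem tsupport_pullback_subset (hc : HasCompactSupport u) (hs : tsupport u ⊆ e.target) :
    tsupport (pullback e u) ⊆ e.symm '' tsupport u :=
  closure_minimal (fun z hz => by
    by_contra hz'
    exact hz (pullback_eq_zero hz')) (isCompact_image_tsupport hc hs).isClosed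

end

section

variable {u : ℂ → ℂ}

/-- Chain rule for `∂_x + i ∂_y`: composition with a holomorphic map of derivative `d` multiplies it
by the conjugate of `d`. -/
theorem dbar_comp (L : ℂ →L[ℝ] ℂ) (d : ℂ) :
    L d + Complex.I * L (d * Complex.I) = (starRingEnd ℂ) d * (L 1 + Complex.I * L Complex.I) := by
  have h1 : d = d.re • (1 : ℂ) + d.im • Complex.I := by
    simp [Complex.real_smul, Complex.re_add_im]
  have h2 : d * Complex.I = (-d.im) • (1 : ℂ) + d.re • Complex.I := by
    apply Complex.ext <;> simp
  have h3 : (starRingEnd ℂ) d = d.re - d.im * Complex.I := by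
    apply Complex.ext <;> simp
  rw [h2, h3]
  nth_rewrite 1 [h1]
  simp only [map_add, map_smul]
  simp only [Complex.real_smul]
  push_cast
  linear_combination (d.im * L Complex.I) * Complex.I_sq

theorem IsNatural.dbar_pullback (he : IsNatural R e) (hu : ContDiff ℝ (⊤ : ℕ∞) u) {z : ℂ}
    (hz : z ∈ e.source) :
    dbar (pullback e u) z = (starRingEnd ℂ) (deriv e z) * dbar u (e z) := by
  have h1 : HasFDerivAt (fun z => u (e z)) ((fderiv ℝ u (e z)).comp
      (deriv e z • (1 : ℂ →L[ℝ] ℂ))) z :=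
    (hu.differentiable (by simp)).differentiableAt.hasFDerivAt.comp z
      (he.hasDerivAt z hz).complexToReal_fderiv
  rw [dbar, ((pullback_eventuallyEq hz).fderiv_eq).trans h1.fderiv, dbar, ← dbar_comp]
  simp

/-- The Jacobian `|e'|²` is the product of `e'` and its conjugate: the conjugate is the factor of
the chain rule, and `e'` cancels the denominator of `branch`. So the equation for `∂̄` keeps its
form in the new coordinate. -/
theorem IsPolar.integral_dbar_mul_branch (H : IsPolar ν h) (hR : IsSquare a ρ ν h R)
    (he : IsNatural R e) (hu : ContDiff ℝ (⊤ : ℕ∞) u) (hc : HasCompactSupport u)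
    (hs : tsupport u ⊆ e.target) :
    ∫ w, dbar u w * branch a ρ ν h e w = 2 * Real.pi * ∫ x, (h x : ℂ) * pullback e u x ∂ν := by
  rw [← H.integral_dbar_mul_critFun (a := a) (ρ := ρ) (contDiff_pullback (fun _ hz => he.contDiffAt hz _) hu hc hs)
    (hasCompactSupport_pullback hc hs)]
  · have h1 : ∀ w, w ∉ e.target → dbar u w * branch a ρ ν h e w = 0 := fun w hw => by
      rw [branch, Set.indicator_of_notMem hw, mul_zero]
    have h2 : ∀ z, z ∉ e.source → dbar (pullback e u) z * critFun a ρ ν h z = 0 := fun z hz => by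
      rw [dbar, (pullback_eventuallyEq_zero hc hs hz).fderiv_eq]
      simp
    rw [← setIntegral_eq_integral_of_forall_compl_eq_zero h1,
      ← setIntegral_eq_integral_of_forall_compl_eq_zero h2, integral_target_eq he]
    refine setIntegral_congr_fun e.open_source.measurableSet fun z hz => ?_
    have hd := he.deriv_ne_zero z hz
    rw [he.dbar_pullback hu hz, branch, Set.indicator_of_mem (e.map_source hz), e.left_inv hz]
    push_cast
    rw [← Complex.conj_mul']
    field_simp
  · intro k hk
    refine Set.indicator_of_notMem (fun hmem => ?_) _
    exact hR.ne_of_order (order_eq_zero_of_value_ne_zero (he.value_ne_zero hmem)) k hk rfl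

end

/-- The real part of `branch`, with values `± 1` almost everywhere on the target of `e`. -/
noncomputable def signFun (a ρ : Fin (p + 1) → ℂ) (ν : Measure ℂ) (h : ℂ → ℝ)
    (e : OpenPartialHomeomorph ℂ ℂ) (w : ℂ) : ℝ := (branch a ρ ν h e w).re

theorem IsSquare.ae_signFun (hR : IsSquare a ρ ν h R) (H : IsPolar ν h) (he : IsNatural R e) :
    ∀ᵐ w, branch a ρ ν h e w = signFun a ρ ν h e w ∧
      (w ∈ e.target → signFun a ρ ν h e w = 1 ∨ signFun a ρ ν h e w = -1) ∧
      ‖signFun a ρ ν h e w‖ ≤ 1 := by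
  filter_upwards [hR.ae_branch_sq H he] with w hw
  unfold signFun
  by_cases hwt : w ∈ e.target
  · rcases mul_self_eq_one_iff.1 ((pow_two _).symm.trans (hw hwt)) with h1 | h1 <;> simp [h1]
  · rw [branch, Set.indicator_of_notMem hwt]
    simp [hwt]

theorem IsSquare.locallyIntegrable_signFun (hR : IsSquare a ρ ν h R) (H : IsPolar ν h)
    (he : IsNatural R e) : LocallyIntegrable (signFun a ρ ν h e) volume := by
  have h1 : AEStronglyMeasurable (signFun a ρ ν h e) volume :=
    Complex.continuous_re.comp_aestronglyMeasurable H.aestronglyMeasurable_branch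
  refine fun w => ⟨Metric.ball w 1, Metric.ball_mem_nhds w one_pos, ?_⟩
  refine Measure.integrableOn_of_bounded (M := 1) measure_ball_lt_top.ne h1
    (ae_restrict_of_ae ?_)
  filter_upwards [hR.ae_signFun H he] with w hw using hw.2.2

/-- In a natural parameter, `∂_x s = - 2 π μ` and `∂_y s = 0` for the sign function `s`. -/
theorem IsSquare.integral_fderiv_mul_signFun (hR : IsSquare a ρ ν h R) (H : IsPolar ν h)
    (he : IsNatural R e) {u : ℂ → ℝ} (hu : ContDiff ℝ (⊤ : ℕ∞) u) (hc : HasCompactSupport u)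
    (hs : tsupport u ⊆ e.target) :
    ∫ w, fderiv ℝ u w 1 * signFun a ρ ν h e w =
        2 * Real.pi * ∫ x, h x * pullback e u x ∂ν ∧
      ∫ w, fderiv ℝ u w Complex.I * signFun a ρ ν h e w = 0 := by
  have hu' : ContDiff ℝ (⊤ : ℕ∞) fun w => (u w : ℂ) := Complex.ofRealCLM.contDiff.comp hu
  have hsupp : tsupport (fun w => (u w : ℂ)) = tsupport u := by
    unfold tsupport
    congr 1
    ext w
    simp
  have hc' : HasCompactSupport fun w => (u w : ℂ) := by
    unfold HasCompactSupport
    rw [hsupp]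
    exact hc
  have key := H.integral_dbar_mul_branch hR he hu' hc' (hsupp ▸ hs)
  have hloc := hR.locallyIntegrable_signFun H he
  have hfd : ∀ v : ℂ, Integrable fun w => fderiv ℝ u w v * signFun a ρ ν h e w := by
    intro v
    have h1 : Continuous fun w => fderiv ℝ u w v := (hu.continuous_fderiv (by simp)).clm_apply
      continuous_const
    refine (hloc.integrable_smul_left_of_hasCompactSupport h1 ?_)
    exact HasCompactSupport.mono (hc.fderiv (𝕜 := ℝ)) fun w hw => by
      rw [Function.mem_support] at hw ⊢
      intro h0
      exact hw (by simp [h0])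
  -- The test function and the sign function are real, so real and imaginary parts of one complex
  -- equation are the equations for `∂_x` and `∂_y`.
  have h1 : ∀ᵐ w, dbar (fun w => (u w : ℂ)) w * branch a ρ ν h e w =
      ((fderiv ℝ u w 1 * signFun a ρ ν h e w : ℝ) : ℂ) +
        Complex.I * ((fderiv ℝ u w Complex.I * signFun a ρ ν h e w : ℝ) : ℂ) := by
    filter_upwards [hR.ae_signFun H he] with w hw
    have h2 : HasFDerivAt (fun w => (u w : ℂ)) (Complex.ofRealCLM.comp (fderiv ℝ u w)) w :=
      Complex.ofRealCLM.hasFDerivAt.comp w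
        (hu.differentiable (by simp)).differentiableAt.hasFDerivAt
    rw [dbar, h2.fderiv, hw.1]
    simp
    ring
  rw [integral_congr_ae h1, integral_add (hfd 1).ofReal ((hfd Complex.I).ofReal.const_mul _),
    integral_const_mul, integral_complex_ofReal, integral_complex_ofReal] at key
  have h2 : (∫ x, (h x : ℂ) * pullback e (fun w => (u w : ℂ)) x ∂ν) =
      ((∫ x, h x * pullback e u x ∂ν : ℝ) : ℂ) := by
    rw [← integral_complex_ofReal]
    congr 1
    funext x
    by_cases hx : x ∈ e.source <;> simp [pullback, hx]
  rw [h2] at key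
  constructor
  · have := congrArg Complex.re key
    simpa using this
  · have := congrArg Complex.im key
    simpa using this

end CriticalMeasure

namespace CriticalMeasure

variable {p : ℕ} {a ρ : Fin (p + 1) → ℂ} {ν : Measure ℂ} {h : ℂ → ℝ} {R : RatFunc ℂ}
  {e : OpenPartialHomeomorph ℂ ℂ}

/-! ### Mollification of the sign function -/

/-- A sequence of mollifiers. -/
noncomputable def bump (n : ℕ) : ContDiffBump (0 : ℂ) where
  rIn := 1 / (2 * (n + 1))
  rOut := 1 / (n + 1)
  rIn_pos := by positivity
  rIn_lt_rOut := by
    apply one_div_lt_one_div_of_lt (by positivity)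
    have : (0 : ℝ) ≤ n := Nat.cast_nonneg n
    linarith

/-- The mollified sign function. -/
noncomputable def mollify (f : ℂ → ℝ) (n : ℕ) : ℂ → ℝ :=
  convolution ((bump n).normed volume) f (ContinuousLinearMap.lsmul ℝ ℝ) volume

theorem tendsto_bump_rOut : Tendsto (fun n => (bump n).rOut) atTop (𝓝 0) :=
  tendsto_one_div_add_atTop_nhds_zero_nat

theorem ae_tendsto_mollify {f : ℂ → ℝ} (hf : LocallyIntegrable f volume) :
    ∀ᵐ w, Tendsto (fun n => mollify f n w) atTop (𝓝 (f w)) := by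
  -- The constant `2` is the ratio of outer to inner radius of the mollifiers.
  refine ContDiffBump.ae_convolution_tendsto_right_of_locallyIntegrable (K := 2) tendsto_bump_rOut
    (Eventually.of_forall fun n => ?_) hf
  simp only [bump]
  apply le_of_eq
  field_simp

theorem hasFDerivAt_mollify {f : ℂ → ℝ} (hf : LocallyIntegrable f volume) (n : ℕ) (w : ℂ) :
    HasFDerivAt (mollify f n) (fderiv ℝ (mollify f n) w) w ∧ ∀ v, fderiv ℝ (mollify f n) w v =
      ∫ t, fderiv ℝ ((bump n).normed volume) (w - t) v * f t := by
  have h1 := (bump n).hasCompactSupport_normed (μ := volume)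
  have h2 : ContDiff ℝ 1 ((bump n).normed (volume : Measure ℂ)) := (bump n).contDiff_normed
  have h3 := h1.hasFDerivAt_convolution_left (ContinuousLinearMap.lsmul ℝ ℝ) h2 hf w
  refine ⟨h3.differentiableAt.hasFDerivAt, fun v => ?_⟩
  rw [mollify, h3.fderiv, convolution]
  have h4 : Integrable (fun t => (((ContinuousLinearMap.lsmul ℝ ℝ).precompL ℂ)
      (fderiv ℝ ((bump n).normed (volume : Measure ℂ)) t)) (f (w - t))) volume :=
    (HasCompactSupport.convolutionExists_left _ (h1.fderiv (𝕜 := ℝ))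
      (h2.continuous_fderiv (by simp)) hf w)
  rw [ContinuousLinearMap.integral_apply h4, ← integral_sub_left_eq_self _ volume w]
  simp [ContinuousLinearMap.precompL_apply]

theorem continuous_fderiv_mollify {f : ℂ → ℝ} (hf : LocallyIntegrable f volume) (n : ℕ) :
    Continuous (fderiv ℝ (mollify f n)) := by
  have h1 := (bump n).hasCompactSupport_normed (μ := (volume : Measure ℂ))
  have h2 : ContDiff ℝ 1 ((bump n).normed (volume : Measure ℂ)) := (bump n).contDiff_normed
  exact (h1.contDiff_convolution_left (ContinuousLinearMap.lsmul ℝ ℝ) h2 hf).continuous_fderiv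
    (by simp)

/-- The derivative falls on the mollifier, and the translated mollifier is an admissible test
function as soon as its ball lies in the target of the chart. The sign changes because
differentiation is in `t` rather than in `w - t`. -/
theorem IsSquare.fderiv_mollify (hR : IsSquare a ρ ν h R) (H : IsPolar ν h)
    (he : IsNatural R e) {n : ℕ} {w : ℂ} (hw : Metric.closedBall w (bump n).rOut ⊆ e.target) :
    fderiv ℝ (mollify (signFun a ρ ν h e) n) w Complex.I = 0 ∧
      fderiv ℝ (mollify (signFun a ρ ν h e) n) w 1 =
        -(2 * Real.pi * ∫ x, h x * pullback e (fun t => (bump n).normed volume (w - t)) x ∂ν) := by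
  obtain ⟨-, h1⟩ := hasFDerivAt_mollify (hR.locallyIntegrable_signFun H he) n w
  have h2 : ContDiff ℝ (⊤ : ℕ∞) ((bump n).normed (volume : Measure ℂ)) := (bump n).contDiff_normed
  set u : ℂ → ℝ := fun t => (bump n).normed volume (w - t) with hu
  have hu1 : ContDiff ℝ (⊤ : ℕ∞) u := h2.comp (contDiff_const.sub contDiff_id)
  have hsupp : Function.support u ⊆ Metric.closedBall w (bump n).rOut := fun t ht => by
    have h3 : w - t ∈ Function.support ((bump n).normed (volume : Measure ℂ)) := ht
    rw [ContDiffBump.support_normed_eq, mem_ball_zero_iff] at h3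
    rw [mem_closedBall_iff_norm, norm_sub_rev]
    exact h3.le
  have hts : tsupport u ⊆ Metric.closedBall w (bump n).rOut :=
    closure_minimal hsupp Metric.isClosed_closedBall
  have hu2 : HasCompactSupport u :=
    HasCompactSupport.of_support_subset_isCompact (isCompact_closedBall _ _) hsupp
  obtain ⟨h4, h5⟩ := hR.integral_fderiv_mul_signFun H he hu1 hu2 (hts.trans hw)
  have h6 : ∀ t v, fderiv ℝ ((bump n).normed (volume : Measure ℂ)) (w - t) v =
      -fderiv ℝ u t v := by
    intro t v
    have h7 : HasFDerivAt u ((fderiv ℝ ((bump n).normed (volume : Measure ℂ)) (w - t)).comp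
        (-ContinuousLinearMap.id ℝ ℂ)) t :=
      ((h2.differentiable (by simp)).differentiableAt.hasFDerivAt).comp t
        ((hasFDerivAt_id t).const_sub w)
    rw [h7.fderiv]
    simp
  constructor
  · rw [h1]
    simp_rw [h6, neg_mul]
    rw [integral_neg, h5, neg_zero]
  · rw [h1]
    simp_rw [h6, neg_mul]
    rw [integral_neg, h4]

/-- The open rectangle `(x₁, x₂) × (-b, b)`. -/
def rect (x₁ x₂ b : ℝ) : Set ℂ := Set.Ioo x₁ x₂ ×ℂ Set.Ioo (-b) b

theorem mem_rect {x₁ x₂ b : ℝ} {w : ℂ} :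
    w ∈ rect x₁ x₂ b ↔ (x₁ < w.re ∧ w.re < x₂) ∧ (-b < w.im ∧ w.im < b) := Iff.rfl

theorem isOpen_rect (x₁ x₂ b : ℝ) : IsOpen (rect x₁ x₂ b) := isOpen_Ioo.reProdIm isOpen_Ioo

theorem closedBall_subset_rect {x₁ x₂ b r : ℝ} {w : ℂ} (h1 : x₁ < w.re - r) (h2 : w.re + r < x₂)
    (h3 : -b < w.im - r) (h4 : w.im + r < b) : Metric.closedBall w r ⊆ rect x₁ x₂ b := by
  intro z hz
  rw [mem_closedBall_iff_norm] at hz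
  have h5 := abs_le.1 ((Complex.abs_re_le_norm (z - w)).trans hz)
  have h6 := abs_le.1 ((Complex.abs_im_le_norm (z - w)).trans hz)
  rw [Complex.sub_re] at h5
  rw [Complex.sub_im] at h6
  exact mem_rect.2 ⟨⟨by linarith, by linarith⟩, by linarith, by linarith⟩

theorem eq_of_hasDerivAt_zero {f : ℝ → ℝ} {s t : ℝ} (hf : ∀ x ∈ Set.uIcc s t, HasDerivAt f 0 x) :
    f s = f t := by
  have h1 := intervalIntegral.integral_eq_sub_of_hasDerivAt hf
    (intervalIntegrable_const)
  simp at h1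
  linarith

theorem hasDerivAt_vertical {f : ℂ → ℝ} {L : ℂ →L[ℝ] ℝ} {x y : ℝ} (hf : HasFDerivAt f L ⟨x, y⟩) :
    HasDerivAt (fun y : ℝ => f ⟨x, y⟩) (L Complex.I) y := by
  have h1 : HasDerivAt (fun y : ℝ => (⟨x, y⟩ : ℂ)) Complex.I y := by
    have h2 : HasDerivAt (fun s : ℝ => (s : ℂ)) 1 y := Complex.ofRealCLM.hasDerivAt
    have h3 := (h2.mul_const Complex.I).const_add (x : ℂ)
    simp only [one_mul] at h3
    refine h3.congr_of_eventuallyEq (Eventually.of_forall fun s => ?_)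
    exact Complex.mk_eq_add_mul_I x s
  exact hf.comp_hasDerivAt y h1

theorem hasDerivAt_horizontal {f : ℂ → ℝ} {L : ℂ →L[ℝ] ℝ} {x y : ℝ}
    (hf : HasFDerivAt f L ⟨x, y⟩) : HasDerivAt (fun x : ℝ => f ⟨x, y⟩) (L 1) x := by
  have h1 : HasDerivAt (fun x : ℝ => (⟨x, y⟩ : ℂ)) 1 x := by
    have h2 : HasDerivAt (fun s : ℝ => (s : ℂ)) 1 x := Complex.ofRealCLM.hasDerivAt
    refine (h2.add_const (y * Complex.I)).congr_of_eventuallyEq (Eventually.of_forall fun s => ?_)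
    exact Complex.mk_eq_add_mul_I s y
  exact hf.comp_hasDerivAt x h1

/-- The `y`-derivative of the mollified sign function vanishes, so within the rectangle, up to a
margin of the radius of the mollifier, it depends on `x` only. -/
theorem IsSquare.mollify_vertical (hR : IsSquare a ρ ν h R) (H : IsPolar ν h)
    (he : IsNatural R e) {x₁ x₂ b : ℝ} (hrect : rect x₁ x₂ b ⊆ e.target) {n : ℕ} {x y y' : ℝ}
    (h1 : x₁ < x - (bump n).rOut) (h2 : x + (bump n).rOut < x₂)
    (h3 : |y| + (bump n).rOut < b) (h4 : |y'| + (bump n).rOut < b) :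
    mollify (signFun a ρ ν h e) n ⟨x, y⟩ = mollify (signFun a ρ ν h e) n ⟨x, y'⟩ := by
  refine eq_of_hasDerivAt_zero (f := fun y => mollify (signFun a ρ ν h e) n ⟨x, y⟩) fun t ht => ?_
  have h5 := hasDerivAt_vertical
    (hasFDerivAt_mollify (hR.locallyIntegrable_signFun H he) n ⟨x, t⟩).1
  rw [(hR.fderiv_mollify H he ?_).1] at h5
  · exact h5
  · refine (closedBall_subset_rect h1 h2 ?_ ?_).trans hrect <;>
    · rcases Set.mem_uIcc.1 ht with ht | ht <;>
      linarith [abs_lt.1 (lt_sub_iff_add_lt.2 h3), abs_lt.1 (lt_sub_iff_add_lt.2 h4), ht.1, ht.2,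
        (abs_lt.1 (lt_sub_iff_add_lt.2 h3)).1, (abs_lt.1 (lt_sub_iff_add_lt.2 h4)).1,
        (abs_lt.1 (lt_sub_iff_add_lt.2 h3)).2, (abs_lt.1 (lt_sub_iff_add_lt.2 h4)).2]

theorem bump_mass (n : ℕ) (w : ℂ) :
    ∫⁻ t, ENNReal.ofReal ((bump n).normed volume (t - w)) = 1 := by
  rw [lintegral_sub_right_eq_self (fun t => ENNReal.ofReal ((bump n).normed volume t)) w,
    ← ofReal_integral_eq_lintegral_ofReal (bump n).integrable_normed
      (Eventually.of_forall fun t => (bump n).nonneg_normed t), (bump n).integral_normed,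
    ENNReal.ofReal_one]

theorem lintegral_lintegral_complex (f : ℂ → ENNReal) (hf : Measurable f) :
    ∫⁻ y : ℝ, ∫⁻ x : ℝ, f ⟨x, y⟩ = ∫⁻ w, f w := by
  rw [← Complex.volume_preserving_equiv_real_prod.symm.lintegral_comp hf,
    Measure.volume_eq_prod, lintegral_prod_symm]
  · rfl
  · exact (hf.comp Complex.measurableEquivRealProd.symm.measurable).aemeasurable

end CriticalMeasure

namespace CriticalMeasure

variable {p : ℕ} {a ρ : Fin (p + 1) → ℂ} {ν : Measure ℂ} {h : ℂ → ℝ} {R : RatFunc ℂ}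
  {e : OpenPartialHomeomorph ℂ ℂ}

/-! ### The support in a natural parameter -/

/-- Integrate `|∂_x F|` over the strip `s ≤ x ≤ t`, `|y| ≤ b / 2`. Because `F` does not depend on
`y`, the result is at least `b |F(t) - F(s)|`; because `∂_x F` is `-2π` times a mollified measure
and the mollifier has mass one, it is at most `2π` times the mass of the rectangle. -/
theorem IsSquare.mass_bound (hR : IsSquare a ρ ν h R) (H : IsPolar ν h)
    (he : IsNatural R e) {x₁ x₂ b : ℝ} (hrect : rect x₁ x₂ b ⊆ e.target) {n : ℕ} {s t : ℝ}
    (h1 : x₁ < s - (bump n).rOut) (hst : s ≤ t) (h2 : t + (bump n).rOut < x₂)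
    (h3 : b / 2 + (bump n).rOut < b) :
    ENNReal.ofReal b * ENNReal.ofReal |mollify (signFun a ρ ν h e) n ⟨t, 0⟩ -
      mollify (signFun a ρ ν h e) n ⟨s, 0⟩| ≤
      ENNReal.ofReal (2 * Real.pi) * ν (e.source ∩ e ⁻¹' rect x₁ x₂ b) := by
  have := H.finite
  set F := mollify (signFun a ρ ν h e) n with hF
  have hloc := hR.locallyIntegrable_signFun H he
  have hr0 : 0 < (bump n).rOut := (bump n).rOut_pos
  have hb : 0 < b := by linarith
  have hVo : IsOpen (e.source ∩ e ⁻¹' rect x₁ x₂ b) :=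
    e.continuousOn.isOpen_inter_preimage e.open_source (isOpen_rect _ _ _)
  set V := e.source ∩ e ⁻¹' rect x₁ x₂ b with hV
  have hball : ∀ w : ℂ, s ≤ w.re → w.re ≤ t → |w.im| ≤ b / 2 →
      Metric.closedBall w (bump n).rOut ⊆ rect x₁ x₂ b := fun w h4 h5 h6 => by
    have := abs_le.1 h6
    exact closedBall_subset_rect (by linarith) (by linarith) (by linarith) (by linarith)
  have hbound : ∀ w : ℂ, s ≤ w.re → w.re ≤ t → |w.im| ≤ b / 2 →
      ‖fderiv ℝ F w 1‖ₑ ≤ ENNReal.ofReal (2 * Real.pi) *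
        ∫⁻ z in V, ENNReal.ofReal ((bump n).normed volume (w - e z)) ∂ν := by
    intro w h4 h5 h6
    have h7 := hball w h4 h5 h6
    rw [(hR.fderiv_mollify H he (h7.trans hrect)).2, enorm_neg, enorm_mul]
    refine mul_le_mul' (le_of_eq ?_) ((enorm_integral_le_lintegral_enorm _).trans ?_)
    · rw [Real.enorm_of_nonneg (by positivity)]
    · rw [← lintegral_indicator hVo.measurableSet]
      refine lintegral_mono fun z => ?_
      have h8 : ‖h z‖ₑ = 1 := by rcases H.unit z with hx | hx <;> simp [hx]
      rw [enorm_mul, h8, one_mul]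
      by_cases hz : z ∈ V
      · rw [Set.indicator_of_mem hz, pullback, Set.indicator_of_mem hz.1,
          Real.enorm_of_nonneg ((bump n).nonneg_normed _)]
      · rw [Set.indicator_of_notMem hz, pullback]
        by_cases hs : z ∈ e.source
        · rw [Set.indicator_of_mem hs]
          have h9 : w - e z ∉ Function.support ((bump n).normed (volume : Measure ℂ)) := by
            rw [ContDiffBump.support_normed_eq, mem_ball_zero_iff]
            intro hlt
            refine hz ⟨hs, h7 ?_⟩
            rw [mem_closedBall_iff_norm, norm_sub_rev]
            exact hlt.le
          rw [Function.notMem_support.1 h9]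
          simp
        · rw [Set.indicator_of_notMem hs]
          simp
  have hcont := continuous_fderiv_mollify hloc n
  have hpt : ∀ y ∈ Set.Icc (-(b / 2)) (b / 2), ENNReal.ofReal |F ⟨t, 0⟩ - F ⟨s, 0⟩| ≤
      ∫⁻ x in Set.Icc s t, ‖fderiv ℝ F ⟨x, y⟩ 1‖ₑ := by
    intro y hy
    have hy' : |y| ≤ b / 2 := abs_le.2 hy
    have h4 : ∫ x in s..t, fderiv ℝ F ⟨x, y⟩ 1 = F ⟨t, y⟩ - F ⟨s, y⟩ := by
      refine intervalIntegral.integral_eq_sub_of_hasDerivAt (f := fun x => F ⟨x, y⟩)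
        (fun x _ => hasDerivAt_horizontal (hasFDerivAt_mollify hloc n ⟨x, y⟩).1) ?_
      refine Continuous.intervalIntegrable ?_ _ _
      have : Continuous fun x : ℝ => (⟨x, y⟩ : ℂ) := by
        simp_rw [Complex.mk_eq_add_mul_I]
        fun_prop
      exact (hcont.comp this).clm_apply continuous_const
    have h5 : ∀ x, s ≤ x → x ≤ t → F ⟨x, y⟩ = F ⟨x, 0⟩ := fun x hx hx' =>
      hR.mollify_vertical H he hrect (by linarith) (by linarith) (by linarith)
        (by rw [abs_zero]; linarith)
    rw [← h5 t hst le_rfl, ← h5 s le_rfl hst, ← h4, intervalIntegral.integral_of_le hst,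
      ← Real.norm_eq_abs, ofReal_norm]
    exact (enorm_integral_le_lintegral_enorm _).trans
      (lintegral_mono_set Set.Ioc_subset_Icc_self)
  have hmeasz : AEMeasurable e (ν.restrict V) :=
    (e.continuousOn.mono Set.inter_subset_left).aemeasurable hVo.measurableSet
  have hcb : Continuous ((bump n).normed (volume : Measure ℂ)) := (bump n).continuous_normed
  have hmeas : AEMeasurable (fun q : ℂ × ℂ => ENNReal.ofReal
      ((bump n).normed volume (q.1 - e q.2))) (volume.prod (ν.restrict V)) := by
    have h4 : AEMeasurable (fun q : ℂ × ℂ => e q.2) (volume.prod (ν.restrict V)) :=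
      hmeasz.comp_quasiMeasurePreserving Measure.quasiMeasurePreserving_snd
    exact (hcb.measurable.comp_aemeasurable (measurable_fst.aemeasurable.sub h4)).ennreal_ofReal
  have hset : MeasurableSet {w : ℂ | (s ≤ w.re ∧ w.re ≤ t) ∧ |w.im| ≤ b / 2} := by
    refine IsClosed.measurableSet ?_
    exact ((isClosed_le continuous_const Complex.continuous_re).inter
      (isClosed_le Complex.continuous_re continuous_const)).inter
      (isClosed_le (Complex.continuous_im.abs) continuous_const)
  set Q : Set ℂ := {w : ℂ | (s ≤ w.re ∧ w.re ≤ t) ∧ |w.im| ≤ b / 2} with hQ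
  calc ENNReal.ofReal b * ENNReal.ofReal |F ⟨t, 0⟩ - F ⟨s, 0⟩|
      = ∫⁻ y in Set.Icc (-(b / 2)) (b / 2), ENNReal.ofReal |F ⟨t, 0⟩ - F ⟨s, 0⟩| := by
        rw [setLIntegral_const, Real.volume_Icc, mul_comm]
        congr 2
        ring
    _ ≤ ∫⁻ y in Set.Icc (-(b / 2)) (b / 2), ∫⁻ x in Set.Icc s t, ‖fderiv ℝ F ⟨x, y⟩ 1‖ₑ :=
        setLIntegral_mono' measurableSet_Icc hpt
    _ = ∫⁻ y : ℝ, ∫⁻ x : ℝ, Q.indicator (fun w => ‖fderiv ℝ F w 1‖ₑ) ⟨x, y⟩ := by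
        rw [← lintegral_indicator measurableSet_Icc]
        refine lintegral_congr fun y => ?_
        by_cases hy : y ∈ Set.Icc (-(b / 2)) (b / 2)
        · rw [Set.indicator_of_mem hy, ← lintegral_indicator measurableSet_Icc]
          refine lintegral_congr fun x => ?_
          by_cases hx : x ∈ Set.Icc s t
          · rw [Set.indicator_of_mem hx, Set.indicator_of_mem]
            exact ⟨hx, abs_le.2 hy⟩
          · rw [Set.indicator_of_notMem hx, Set.indicator_of_notMem]
            exact fun hc => hx hc.1
        · rw [Set.indicator_of_notMem hy]
          symm
          rw [lintegral_eq_zero_iff' ?_]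
          · refine Eventually.of_forall fun x => ?_
            exact Set.indicator_of_notMem (fun hc => hy (abs_le.1 hc.2)) _
          · have h6 : (fun x : ℝ => Q.indicator (fun w => ‖fderiv ℝ F w 1‖ₑ) ⟨x, y⟩) =
                fun _ => 0 := by
              funext x
              exact Set.indicator_of_notMem (fun hc => hy (abs_le.1 hc.2)) _
            rw [h6]
            exact aemeasurable_const
    _ = ∫⁻ w, Q.indicator (fun w => ‖fderiv ℝ F w 1‖ₑ) w :=
        lintegral_lintegral_complex _
          ((hcont.clm_apply continuous_const).measurable.enorm.indicator hset)
    _ ≤ ∫⁻ w, ENNReal.ofReal (2 * Real.pi) *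
          ∫⁻ z in V, ENNReal.ofReal ((bump n).normed volume (w - e z)) ∂ν := by
        refine lintegral_mono fun w => ?_
        by_cases hw : w ∈ Q
        · rw [Set.indicator_of_mem hw]
          exact hbound w hw.1.1 hw.1.2 hw.2
        · rw [Set.indicator_of_notMem hw]
          exact zero_le
    _ = ENNReal.ofReal (2 * Real.pi) * ν V := by
        rw [lintegral_const_mul' _ _ ENNReal.ofReal_ne_top, lintegral_lintegral_swap hmeas]
        simp_rw [bump_mass]
        rw [setLIntegral_const, one_mul]

theorem IsNatural.contDiffAt_symm (he : IsNatural R e) {w : ℂ} (hw : w ∈ e.target) :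
    ContDiffAt ℝ (⊤ : ℕ∞) e.symm w := by
  have hz := e.map_target hw
  have h1 : ContDiffAt ℂ (⊤ : ℕ∞) e (e.symm w) :=
    (he.differentiableOn.contDiffOn e.open_source).contDiffAt (e.open_source.mem_nhds hz)
  exact (e.contDiffAt_symm_deriv (he.deriv_ne_zero _ hz) hw (he.hasDerivAt _ hz)
    h1).restrict_scalars ℝ

theorem integral_fderiv_eq_zero {u : ℂ → ℝ} (hu : ContDiff ℝ (⊤ : ℕ∞) u)
    (hc : HasCompactSupport u) (v : ℂ) : ∫ w, fderiv ℝ u w v = 0 := by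
  have h1 := integral_bilinear_fderiv_right_eq_neg_left_of_integrable (μ := (volume : Measure ℂ))
    (f := fun _ => (1 : ℝ)) (g := u) (v := v) (B := ContinuousLinearMap.lsmul ℝ ℝ)
  have h2 : Continuous fun w => fderiv ℝ u w v :=
    (hu.continuous_fderiv (by simp)).clm_apply continuous_const
  have h3 : HasCompactSupport fun w => fderiv ℝ u w v :=
    HasCompactSupport.mono (hc.fderiv (𝕜 := ℝ)) fun w hw => by
      rw [Function.mem_support] at hw ⊢
      intro h0
      exact hw (by simp [h0])
  have h4 := h1 (by simp) (by simpa using h2.integrable_of_hasCompactSupport h3)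
    (by simpa using hu.continuous.integrable_of_hasCompactSupport hc)
    (fun _ _ => differentiableAt_const _) (fun _ _ => (hu.differentiable (by simp)).differentiableAt)
  simpa using h4

/-- Where the sign function is constant there is no mass. -/
theorem IsSquare.disjoint_support_of_ae_eq (hR : IsSquare a ρ ν h R) (H : IsPolar ν h)
    (he : IsNatural R e) {U : Set ℂ} (hU : IsOpen U) (hUt : U ⊆ e.target) {c : ℝ}
    (hc : ∀ᵐ w, w ∈ U → signFun a ρ ν h e w = c) :
    ∀ z ∈ e.source, e z ∈ U → z ∉ ν.support := by
  have := H.finite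
  have hVo : IsOpen (e.source ∩ e ⁻¹' U) := e.continuousOn.isOpen_inter_preimage e.open_source hU
  have h1 : ∀ᵐ x ∂ν, x ∈ e.source ∩ e ⁻¹' U → h x = 0 := by
    have hi : Integrable h ν := by
      refine Integrable.of_bound H.measurable.aestronglyMeasurable 1 (Eventually.of_forall fun x => ?_)
      rcases H.unit x with hx | hx <;> simp [hx]
    refine IsOpen.ae_eq_zero_of_integral_contDiff_smul_eq_zero hVo
      (hi.locallyIntegrable.locallyIntegrableOn _) fun g hg hgc hgs => ?_
    have hgs' : tsupport g ⊆ e.symm.target := hgs.trans Set.inter_subset_left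
    have hu1 := contDiff_pullback (e := e.symm) (fun w hw => he.contDiffAt_symm hw) hg hgc hgs'
    have hu2 := hasCompactSupport_pullback (e := e.symm) hgc hgs'
    have hu3 : tsupport (pullback e.symm g) ⊆ U := by
      refine (tsupport_pullback_subset hgc hgs').trans ?_
      rintro _ ⟨z, hz, rfl⟩
      exact (hgs hz).2
    have h2 := (hR.integral_fderiv_mul_signFun H he hu1 hu2 (hu3.trans hUt)).1
    have h3 : ∫ w, fderiv ℝ (pullback e.symm g) w 1 * signFun a ρ ν h e w =
        ∫ w, fderiv ℝ (pullback e.symm g) w 1 * c := by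
      refine integral_congr_ae ?_
      filter_upwards [hc] with w hw
      by_cases hwU : w ∈ U
      · rw [hw hwU]
      · have h4 : fderiv ℝ (pullback e.symm g) w = 0 := by
          by_contra hne
          exact hwU (hu3 (support_fderiv_subset ℝ hne))
        simp [h4]
    rw [h3, integral_mul_const, integral_fderiv_eq_zero hu1 hu2, zero_mul] at h2
    have h5 : ∀ x, h x * pullback e (pullback e.symm g) x = g x • h x := by
      intro x
      rw [smul_eq_mul, mul_comm]
      congr 1
      by_cases hx : x ∈ e.source
      · rw [pullback, Set.indicator_of_mem hx, pullback,
          Set.indicator_of_mem (s := e.symm.source) (e.map_source hx), e.left_inv hx]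
      · rw [pullback, Set.indicator_of_notMem hx]
        by_contra hne
        exact hx (hgs (subset_tsupport _ (Ne.symm hne))).1
    simp_rw [h5] at h2
    have h6 : (2 : ℝ) * Real.pi ≠ 0 := by positivity
    exact (mul_eq_zero.1 h2.symm).resolve_left h6
  -- The density is `±1` everywhere, so its vanishing almost everywhere on a set means that the set
  -- has no mass.
  have h2 : ν (e.source ∩ e ⁻¹' U) = 0 := by
    refine measure_mono_null ?_ (ae_iff.1 h1)
    intro x hx hc
    have := hc hx
    rcases H.unit x with hx | hx <;> rw [hx] at this <;> norm_num at this
  intro z hz hzU hzs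
  exact ((Measure.mem_support_iff_forall z).1 hzs _ (hVo.mem_nhds ⟨hz, hzU⟩)).ne' h2

/-- If no point of `U` satisfies `P` then `U` is null and any constant serves. -/
theorem exists_ae_eq_const {f : ℂ → ℝ} {U : Set ℂ} {P : ℂ → Prop} (hP : ∀ᵐ w, P w)
    (hf : ∀ w ∈ U, ∀ w' ∈ U, P w → P w' → f w = f w') : ∃ c, ∀ᵐ w, w ∈ U → f w = c := by
  by_cases hex : ∃ w ∈ U, P w
  · obtain ⟨w, hw, hPw⟩ := hex
    refine ⟨f w, ?_⟩
    filter_upwards [hP] with w' hw' hU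
    exact hf w' hU w hw hw' hPw
  · push Not at hex
    refine ⟨0, ?_⟩
    filter_upwards [hP] with w' hw' hU
    exact absurd hw' (hex w' hU)

/-- The mass of a rectangle that meets the support is bounded below. -/
theorem IsSquare.le_measure_of_mem_support (hR : IsSquare a ρ ν h R) (H : IsPolar ν h)
    (he : IsNatural R e) {x₁ x₂ b : ℝ} (hrect : rect x₁ x₂ b ⊆ e.target) {z : ℂ}
    (hz : z ∈ e.source) (hzr : e z ∈ rect x₁ x₂ b) (hzs : z ∈ ν.support) :
    ENNReal.ofReal b ≤ ENNReal.ofReal (2 * Real.pi) * ν (e.source ∩ e ⁻¹' rect x₁ x₂ b) := by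
  by_contra hlt
  push Not at hlt
  have hloc := hR.locallyIntegrable_signFun H he
  obtain ⟨c, hc⟩ := exists_ae_eq_const (U := rect x₁ x₂ b) (f := signFun a ρ ν h e)
    ((ae_tendsto_mollify hloc).and (hR.ae_signFun H he)) (by
    -- With mass below `b / (2π)` the bound forbids the mollified sign function to vary by more than
    -- `1`. Its limits are `±1`, and two signs at distance at most `1` coincide; so the sign is
    -- constant and there is no mass at all.
    have key : ∀ w ∈ rect x₁ x₂ b, ∀ w' ∈ rect x₁ x₂ b, w.re ≤ w'.re →
        Tendsto (fun n => mollify (signFun a ρ ν h e) n w) atTop (𝓝 (signFun a ρ ν h e w)) →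
        Tendsto (fun n => mollify (signFun a ρ ν h e) n w') atTop (𝓝 (signFun a ρ ν h e w')) →
        |signFun a ρ ν h e w' - signFun a ρ ν h e w| ≤ 1 := by
      intro w hw w' hw' hle ht ht'
      obtain ⟨⟨a1, a2⟩, a3, a4⟩ := mem_rect.1 hw
      obtain ⟨⟨b1, b2⟩, b3, b4⟩ := mem_rect.1 hw'
      have hb : 0 < b := by linarith
      refine le_of_tendsto (ht'.sub ht).abs ?_
      have hd : 0 < min (min (w.re - x₁) (x₂ - w'.re))
          (min (b / 2) (min (b - |w.im|) (b - |w'.im|))) := by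
        have := abs_lt.2 ⟨a3, a4⟩
        have := abs_lt.2 ⟨b3, b4⟩
        simp only [lt_min_iff]
        refine ⟨⟨?_, ?_⟩, ?_, ?_, ?_⟩ <;> linarith
      filter_upwards [tendsto_bump_rOut.eventually_lt_const hd] with n hn
      simp only [lt_min_iff] at hn
      obtain ⟨⟨n1, n2⟩, n3, n4, n5⟩ := hn
      have hr0 : 0 < (bump n).rOut := (bump n).rOut_pos
      have e1 : mollify (signFun a ρ ν h e) n w = mollify (signFun a ρ ν h e) n ⟨w.re, 0⟩ :=
        hR.mollify_vertical H he hrect (x := w.re) (y := w.im) (by linarith) (by linarith)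
          (by linarith) (by rw [abs_zero]; linarith)
      have e2 : mollify (signFun a ρ ν h e) n w' = mollify (signFun a ρ ν h e) n ⟨w'.re, 0⟩ :=
        hR.mollify_vertical H he hrect (x := w'.re) (y := w'.im) (by linarith) (by linarith)
          (by linarith) (by rw [abs_zero]; linarith)
      have hm := hR.mass_bound H he hrect (n := n) (s := w.re) (t := w'.re) (by linarith) hle
        (by linarith) (by linarith)
      rw [e1, e2]
      by_contra hgt
      push Not at hgt
      have h1 : ENNReal.ofReal b * 1 ≤ ENNReal.ofReal b *
          ENNReal.ofReal |mollify (signFun a ρ ν h e) n ⟨w'.re, 0⟩ -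
            mollify (signFun a ρ ν h e) n ⟨w.re, 0⟩| := by
        gcongr
        rw [← ENNReal.ofReal_one]
        exact ENNReal.ofReal_le_ofReal hgt.le
      rw [mul_one] at h1
      exact absurd (h1.trans hm) (not_le.2 hlt)
    have sgn : ∀ x y : ℝ, (x = 1 ∨ x = -1) → (y = 1 ∨ y = -1) → |y - x| ≤ 1 → x = y := by
      rintro x y (rfl | rfl) (rfl | rfl) hxy <;> first | rfl | (norm_num at hxy)
    rintro w hw w' hw' ⟨ht, -, hs, -⟩ ⟨ht', -, hs', -⟩
    rcases le_total w.re w'.re with hle | hle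
    · exact sgn _ _ (hs (hrect hw)) (hs' (hrect hw')) (key w hw w' hw' hle ht ht')
    · exact (sgn _ _ (hs' (hrect hw')) (hs (hrect hw)) (key w' hw' w hw hle ht' ht)).symm)
  exact hR.disjoint_support_of_ae_eq H he (isOpen_rect _ _ _) hrect hc z hz hzr hzs

/-- In a natural parameter the support is invariant under vertical translations. -/
theorem IsSquare.mem_support_vertical (hR : IsSquare a ρ ν h R) (H : IsPolar ν h)
    (he : IsNatural R e) {x₁ x₂ b : ℝ} (hrect : rect x₁ x₂ b ⊆ e.target) {w w' : ℂ}
    (hw : w ∈ rect x₁ x₂ b) (hw' : w' ∈ rect x₁ x₂ b) (hre : w.re = w'.re)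
    (hs : e.symm w ∈ ν.support) : e.symm w' ∈ ν.support := by
  by_contra hns
  have hloc := hR.locallyIntegrable_signFun H he
  have h1 : e.symm.source ∩ e.symm ⁻¹' ν.supportᶜ ∩ rect x₁ x₂ b ∈ 𝓝 w' :=
    (((e.symm.continuousOn.isOpen_inter_preimage e.symm.open_source
      Measure.isOpen_compl_support).inter (isOpen_rect _ _ _)).mem_nhds ⟨⟨hrect hw', hns⟩, hw'⟩)
  obtain ⟨δ, hδ, hball⟩ := Metric.mem_nhds_iff.1 h1
  obtain ⟨⟨a1, a2⟩, a3, a4⟩ := mem_rect.1 hw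
  obtain ⟨⟨b1, b2⟩, b3, b4⟩ := mem_rect.1 hw'
  -- Near `w'` there is no mass, so at the height of `w'` the mollified sign function is constant in
  -- `x` over a thin strip. Independence of `y` spreads this over the full height of the strip,
  -- which contains `w`.
  set y₁ := max x₁ (w'.re - δ / 2) with hy₁
  set y₂ := min x₂ (w'.re + δ / 2) with hy₂
  have hy1 : y₁ < w'.re := max_lt b1 (by linarith)
  have hy2 : w'.re < y₂ := lt_min b2 (by linarith)
  have hx1 : x₁ ≤ y₁ := le_max_left _ _
  have hx2 : y₂ ≤ x₂ := min_le_left _ _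
  have hsub : rect y₁ y₂ b ⊆ rect x₁ x₂ b := fun z hz => by
    obtain ⟨⟨c1, c2⟩, c3, c4⟩ := mem_rect.1 hz
    exact mem_rect.2 ⟨⟨by linarith, by linarith⟩, c3, c4⟩
  obtain ⟨c, hc⟩ := exists_ae_eq_const (U := rect y₁ y₂ b) (f := signFun a ρ ν h e)
    (ae_tendsto_mollify hloc) (by
    intro v hv v' hv' ht ht'
    obtain ⟨⟨c1, c2⟩, c3, c4⟩ := mem_rect.1 hv
    obtain ⟨⟨d1, d2⟩, d3, d4⟩ := mem_rect.1 hv'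
    refine tendsto_nhds_unique ht (ht'.congr' ?_)
    have hd : 0 < min (min (δ / 2) (b - |w'.im|)) (min (min (v.re - y₁) (y₂ - v.re))
        (min (min (v'.re - y₁) (y₂ - v'.re)) (min (b - |v.im|) (b - |v'.im|)))) := by
      have := abs_lt.2 ⟨c3, c4⟩
      have := abs_lt.2 ⟨d3, d4⟩
      have := abs_lt.2 ⟨b3, b4⟩
      simp only [lt_min_iff]
      refine ⟨⟨?_, ?_⟩, ⟨?_, ?_⟩, ⟨?_, ?_⟩, ?_, ?_⟩ <;> linarith
    filter_upwards [tendsto_bump_rOut.eventually_lt_const hd] with n hn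
    simp only [lt_min_iff] at hn
    obtain ⟨⟨n1, n2⟩, ⟨n3, n4⟩, ⟨n5, n6⟩, n7, n8⟩ := hn
    have hr0 : 0 < (bump n).rOut := (bump n).rOut_pos
    have e1 : mollify (signFun a ρ ν h e) n v = mollify (signFun a ρ ν h e) n ⟨v.re, w'.im⟩ :=
      hR.mollify_vertical H he hrect (x := v.re) (y := v.im) (by linarith) (by linarith)
        (by linarith) (by linarith)
    have e2 : mollify (signFun a ρ ν h e) n v' = mollify (signFun a ρ ν h e) n ⟨v'.re, w'.im⟩ :=
      hR.mollify_vertical H he hrect (x := v'.re) (y := v'.im) (by linarith) (by linarith)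
        (by linarith) (by linarith)
    rw [e1, e2]
    refine eq_of_hasDerivAt_zero
      (f := fun x => mollify (signFun a ρ ν h e) n ⟨x, w'.im⟩) fun x hx => ?_
    have hx3 : y₁ < x ∧ x < y₂ := by
      rcases Set.mem_uIcc.1 hx with hx | hx <;> constructor <;> linarith [hx.1, hx.2]
    have hx4 : w'.re - δ / 2 < x := (le_max_right _ _).trans_lt hx3.1
    have hx5 : x < w'.re + δ / 2 := hx3.2.trans_le (min_le_right _ _)
    have hsub' : Metric.closedBall (⟨x, w'.im⟩ : ℂ) (bump n).rOut ⊆ Metric.ball w' δ := by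
      refine Metric.closedBall_subset_ball' ?_
      have h2 : dist (⟨x, w'.im⟩ : ℂ) w' = |x - w'.re| := by
        rw [dist_eq_norm]
        have : (⟨x, w'.im⟩ : ℂ) - w' = ((x - w'.re : ℝ) : ℂ) := by
          apply Complex.ext <;> simp
        rw [this, Complex.norm_real, Real.norm_eq_abs]
      have h3 : |x - w'.re| < δ / 2 := abs_lt.2 ⟨by linarith, by linarith⟩
      rw [h2]
      linarith
    have h5 := hasDerivAt_horizontal (hasFDerivAt_mollify hloc n ⟨x, w'.im⟩).1
    rw [(hR.fderiv_mollify H he ((hsub'.trans hball).trans fun z hz => hz.1.1)).2] at h5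
    convert h5 using 1
    rw [integral_eq_zero_of_ae, mul_zero, neg_zero]
    filter_upwards [H.ae_mem] with z hz
    by_cases hzs : z ∈ e.source
    · have h9 : (⟨x, w'.im⟩ : ℂ) - e z ∉
          Function.support ((bump n).normed (volume : Measure ℂ)) := by
        rw [ContDiffBump.support_normed_eq, mem_ball_zero_iff]
        intro hlt
        have h10 : e z ∈ Metric.closedBall (⟨x, w'.im⟩ : ℂ) (bump n).rOut := by
          rw [mem_closedBall_iff_norm, norm_sub_rev]
          exact hlt.le
        have h11 := (hball (hsub' h10)).1.2
        rw [Set.mem_preimage, e.left_inv hzs] at h11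
        exact h11 hz
      rw [pullback, Set.indicator_of_mem hzs, Function.notMem_support.1 h9]
      simp
    · rw [pullback, Set.indicator_of_notMem hzs]
      simp)
  refine hR.disjoint_support_of_ae_eq H he (isOpen_rect _ _ _) (hsub.trans hrect) hc (e.symm w)
    (e.map_target (hrect hw)) ?_ hs
  rw [e.right_inv (hrect hw)]
  exact mem_rect.2 ⟨⟨by rw [hre]; exact hy1, by rw [hre]; exact hy2⟩, a3, a4⟩

/-- In a natural parameter, a half-strip meets the support in finitely many vertical segments. -/
theorem IsSquare.finite_support_horizontal (hR : IsSquare a ρ ν h R) (H : IsPolar ν h)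
    (he : IsNatural R e) {I : Set ℝ} (hI : IsOpen I) {b : ℝ} (hb : 0 < b)
    (hbox : I ×ℂ Set.Ioo (-b) b ⊆ e.target) :
    {x : ℝ | x ∈ I ∧ e.symm x ∈ ν.support}.Finite := by
  have := H.finite
  by_contra hinf
  have hpi : 0 < 2 * Real.pi := by positivity
  -- Each line of the support costs mass at least `b / (2π)` in a rectangle around it, however thin.
  -- `N` disjoint rectangles would exceed the total mass.
  obtain ⟨N, hN⟩ : ∃ N : ℕ, ENNReal.ofReal (2 * Real.pi) * ν Set.univ < N * ENNReal.ofReal b := by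
    obtain ⟨N, hN⟩ := ENNReal.exists_nat_gt (r := ENNReal.ofReal (2 * Real.pi) * ν Set.univ /
      ENNReal.ofReal b) (ENNReal.div_ne_top (ENNReal.mul_ne_top ENNReal.ofReal_ne_top
        (measure_ne_top _ _)) (by simpa using hb))
    exact ⟨N, (ENNReal.div_lt_iff (Or.inl (by simpa using hb)) (Or.inl ENNReal.ofReal_ne_top)).1 hN⟩
  obtain ⟨t, ht, htN⟩ := Set.Infinite.exists_subset_card_eq hinf N
  obtain ⟨δ, hδ, hdis⟩ : ∃ δ > 0, (∀ x ∈ t, Set.Ioo (x - δ) (x + δ) ⊆ I) ∧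
      ∀ x ∈ t, ∀ y ∈ t, x ≠ y → 2 * δ ≤ |x - y| := by
    have h1 : ∀ᶠ δ in 𝓝[>] (0 : ℝ), ∀ x ∈ t, Set.Ioo (x - δ) (x + δ) ⊆ I := by
      rw [Filter.eventually_all_finset]
      intro x hx
      obtain ⟨r, hr, hball⟩ := Metric.isOpen_iff.1 hI x (ht hx).1
      filter_upwards [Ioo_mem_nhdsGT hr] with δ hδ
      rw [← Real.ball_eq_Ioo]
      exact (Metric.ball_subset_ball hδ.2.le).trans hball
    have h2 : ∀ᶠ δ in 𝓝[>] (0 : ℝ), ∀ x ∈ t, ∀ y ∈ t, x ≠ y → 2 * δ ≤ |x - y| := by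
      rw [Filter.eventually_all_finset]
      intro x _
      rw [Filter.eventually_all_finset]
      intro y _
      by_cases hxy : x = y
      · simp [hxy]
      · have : 0 < |x - y| / 2 := by
          have := abs_pos.2 (sub_ne_zero.2 hxy)
          positivity
        filter_upwards [Ioo_mem_nhdsGT this] with δ hδ _
        linarith [hδ.2]
    obtain ⟨δ, h3, h4, h5⟩ :=
      ((eventually_mem_nhdsWithin (a := (0 : ℝ)) (s := Set.Ioi 0)).and (h1.and h2)).exists
    exact ⟨δ, h3, h4, h5⟩
  let V : ℝ → Set ℂ := fun x => e.source ∩ e ⁻¹' rect (x - δ) (x + δ) b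
  have hsub : ∀ x ∈ t, rect (x - δ) (x + δ) b ⊆ e.target := fun x hx w hw =>
    hbox ⟨hdis.1 x hx hw.1, hw.2⟩
  have hV : ∀ x ∈ t, ENNReal.ofReal b ≤ ENNReal.ofReal (2 * Real.pi) * ν (V x) := by
    intro x hx
    have hxr : (x : ℂ) ∈ rect (x - δ) (x + δ) b :=
      mem_rect.2 ⟨⟨by simp [hδ], by simp [hδ]⟩, by simp [hb], by simp [hb]⟩
    refine hR.le_measure_of_mem_support H he (hsub x hx) (e.map_target (hsub x hx hxr)) ?_ (ht hx).2
    rw [e.right_inv (hsub x hx hxr)]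
    exact hxr
  have hdisj : (t : Set ℝ).PairwiseDisjoint V := by
    intro x hx y hy hxy
    refine Set.disjoint_left.2 fun z hz hz' => ?_
    obtain ⟨⟨a1, a2⟩, -⟩ := mem_rect.1 hz.2
    obtain ⟨⟨b1, b2⟩, -⟩ := mem_rect.1 hz'.2
    have h1 := hdis.2 x hx y hy hxy
    have h2 : |x - y| < 2 * δ := abs_lt.2 ⟨by linarith, by linarith⟩
    linarith
  have hVm : ∀ x ∈ t, MeasurableSet (V x) := fun x _ =>
    (e.continuousOn.isOpen_inter_preimage e.open_source (isOpen_rect _ _ _)).measurableSet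
  have hsum : (N : ENNReal) * ENNReal.ofReal b ≤ ENNReal.ofReal (2 * Real.pi) * ν Set.univ := by
    calc (N : ENNReal) * ENNReal.ofReal b = ∑ x ∈ t, ENNReal.ofReal b := by
          rw [Finset.sum_const, htN, nsmul_eq_mul]
      _ ≤ ∑ x ∈ t, ENNReal.ofReal (2 * Real.pi) * ν (V x) := Finset.sum_le_sum hV
      _ = ENNReal.ofReal (2 * Real.pi) * ν (⋃ x ∈ t, V x) := by
          rw [← Finset.mul_sum, measure_biUnion_finset hdisj hVm]
      _ ≤ _ := by
          gcongr
          exact Set.subset_univ _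
  exact absurd hsum (not_le.2 hN)

end CriticalMeasure

/-! ### Flat charts, vertical curves and trajectories on the Riemann sphere -/

namespace CriticalMeasure

/-! ### The inversion of the Riemann sphere -/

/-- The inverse of the coordinate `w = 1 / z` on the Riemann sphere. -/
noncomputable def invSphere (w : ℂ) : OnePoint ℂ :=
  open Classical in if w = 0 then OnePoint.infty else ((w⁻¹ : ℂ) : OnePoint ℂ)

theorem invSphere_zero : invSphere 0 = OnePoint.infty := if_pos rfl

theorem invSphere_of_ne {w : ℂ} (hw : w ≠ 0) : invSphere w = ((w⁻¹ : ℂ) : OnePoint ℂ) := if_neg hw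

theorem invSphere_inv {w : ℂ} (hw : w ≠ 0) : invSphere w⁻¹ = (w : OnePoint ℂ) := by
  rw [invSphere_of_ne (inv_ne_zero hw), inv_inv]

theorem invSphere_coordW {P : OnePoint ℂ} (hP : P ≠ ((0 : ℂ) : OnePoint ℂ)) :
    invSphere (coordW P) = P := by
  induction P using OnePoint.rec with
  | infty => exact invSphere_zero
  | coe z =>
    have hz : z ≠ 0 := fun hc => hP (by rw [hc])
    exact invSphere_inv hz

theorem continuous_invSphere : Continuous invSphere := by
  refine continuous_iff_continuousAt.2 fun w => ?_
  by_cases hw : w = 0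
  · rw [hw, continuousAt_iff_punctured_nhds, invSphere_zero]
    have h1 : Tendsto (fun w : ℂ => ((w⁻¹ : ℂ) : OnePoint ℂ)) (𝓝[≠] 0) (𝓝 OnePoint.infty) := by
      have h2 := OnePoint.tendsto_coe_infty (X := ℂ)
      rw [coclosedCompact_eq_cocompact, ← Metric.cobounded_eq_cocompact] at h2
      exact h2.comp tendsto_inv₀_nhdsNE_zero
    refine h1.congr' ?_
    filter_upwards [self_mem_nhdsWithin] with z hz
    exact (invSphere_of_ne hz).symm
  · have h1 : ContinuousAt (fun w : ℂ => ((w⁻¹ : ℂ) : OnePoint ℂ)) w :=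
      OnePoint.continuous_coe.continuousAt.comp (continuousAt_inv₀ hw)
    refine h1.congr ?_
    filter_upwards [isOpen_ne.mem_nhds hw] with z hz
    exact (invSphere_of_ne hz).symm

/-- The inversion `z ↦ 1 / z` of the Riemann sphere. -/
noncomputable def inversion (P : OnePoint ℂ) : OnePoint ℂ := P.elim ((0 : ℂ) : OnePoint ℂ) invSphere

theorem inversion_inversion (P : OnePoint ℂ) : inversion (inversion P) = P := by
  induction P using OnePoint.rec with
  | infty => exact invSphere_zero
  | coe z =>
    change inversion (invSphere z) = z
    by_cases hz : z = 0
    · rw [hz, invSphere_zero]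
      rfl
    · rw [invSphere_of_ne hz]
      exact invSphere_inv hz

theorem continuous_inversion : Continuous inversion := by
  rw [OnePoint.continuous_iff]
  refine ⟨?_, continuous_invSphere⟩
  rw [coclosedCompact_eq_cocompact, ← Metric.cobounded_eq_cocompact]
  have h1 : Tendsto (fun w : ℂ => ((w⁻¹ : ℂ) : OnePoint ℂ)) (Bornology.cobounded ℂ)
      (𝓝 ((0 : ℂ) : OnePoint ℂ)) :=
    (OnePoint.continuous_coe.tendsto 0).comp tendsto_inv₀_cobounded
  refine h1.congr' ?_
  filter_upwards [(Metric.isBounded_iff_subset_closedBall (0 : ℂ)).2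
    ⟨0, (Set.singleton_subset_iff.2 (Metric.mem_closedBall_self le_rfl))⟩] with z hz
  exact (invSphere_of_ne hz).symm

theorem isOpenEmbedding_invSphere : Topology.IsOpenEmbedding invSphere := by
  let J : OnePoint ℂ ≃ₜ OnePoint ℂ :=
    { toFun := inversion
      invFun := inversion
      left_inv := inversion_inversion
      right_inv := inversion_inversion
      continuous_toFun := continuous_inversion
      continuous_invFun := continuous_inversion }
  exact J.isOpenEmbedding.comp OnePoint.isOpenEmbedding_coe

/-- The rational function `R(1 / w) w⁻⁴`. -/
theorem exists_inverted {R : RatFunc ℂ} (hR : R ≠ 0) : ∃ R' : RatFunc ℂ, R' ≠ 0 ∧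
    (∀ w, w ≠ 0 → value R' w ≠ 0 → value R' w = value R w⁻¹ / w ^ 4) ∧
    order R' 0 = qdOrder R OnePoint.infty ∧
    (value R' 0 ≠ 0 → value R' 0 = -coeffAtInfty R) := by
  have hn : R.num ≠ 0 := RatFunc.num_ne_zero hR
  have hd : R.denom ≠ 0 := R.denom_ne_zero
  set n := R.num.natDegree with hn'
  set m := R.denom.natDegree with hm'
  -- `f.reverse` at `w` is `f(1 / w) w ^ deg f`. Clearing the powers of `w` in `R(1 / w) w⁻⁴` leaves
  -- the exponents `m` in the numerator and `n + 4` in the denominator.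
  set P : Polynomial ℂ := R.num.reverse * Polynomial.X ^ m with hP
  set Q : Polynomial ℂ := R.denom.reverse * Polynomial.X ^ (n + 4) with hQ
  have hrn : R.num.reverse ≠ 0 := by simpa using hn
  have hrd : R.denom.reverse ≠ 0 := by simpa using hd
  have hP0 : P ≠ 0 := mul_ne_zero hrn (pow_ne_zero _ Polynomial.X_ne_zero)
  have hQ0 : Q ≠ 0 := mul_ne_zero hrd (pow_ne_zero _ Polynomial.X_ne_zero)
  have hrn0 : R.num.reverse.eval 0 ≠ 0 := by
    rw [← Polynomial.coeff_zero_eq_eval_zero, Polynomial.coeff_zero_reverse]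
    simpa using hn
  have hrd0 : R.denom.reverse.eval 0 ≠ 0 := by
    rw [← Polynomial.coeff_zero_eq_eval_zero, Polynomial.coeff_zero_reverse]
    simpa using hd
  have hrev : ∀ (f : Polynomial ℂ) (w : ℂ), w ≠ 0 →
      f.reverse.eval w = f.eval w⁻¹ * w ^ f.natDegree := by
    intro f w hw
    let := invertibleOfNonzero (inv_ne_zero hw)
    have h1 := Polynomial.eval₂_reverse_mul_pow (RingHom.id ℂ) w⁻¹ f
    rw [invOf_eq_inv, inv_inv] at h1
    simp only [Polynomial.eval₂_id] at h1
    rw [← h1, mul_assoc, ← mul_pow, inv_mul_cancel₀ hw, one_pow, mul_one]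
  have hroot : ∀ (f : Polynomial ℂ), f.eval 0 ≠ 0 → ∀ k : ℕ,
      (f * Polynomial.X ^ k).rootMultiplicity 0 = k := by
    intro f hf k
    have hf0 : f ≠ 0 := by
      rintro rfl
      simp at hf
    rw [Polynomial.rootMultiplicity_mul (mul_ne_zero hf0 (pow_ne_zero _ Polynomial.X_ne_zero)),
      Polynomial.rootMultiplicity_eq_zero hf, zero_add]
    have := Polynomial.rootMultiplicity_X_sub_C_pow (0 : ℂ) k
    simpa using this
  set R' : RatFunc ℂ := algebraMap _ _ P / algebraMap _ _ Q with hR'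
  have hR'0 : R' ≠ 0 := by
    rw [hR']
    refine div_ne_zero ?_ ?_
    · simpa using hP0
    · simpa using hQ0
  have hord : order R' 0 = qdOrder R OnePoint.infty := by
    rw [order_of_eq_div hQ0 hP0 hR', hroot _ hrn0, hroot _ hrd0]
    change _ = -R.intDegree - 4
    rw [RatFunc.intDegree]
    push_cast
    ring
  refine ⟨R', hR'0, fun w hw hv => ?_, hord, fun hv => ?_⟩
  · have hQw : Q.eval w ≠ 0 := by
      intro hc
      have h1 := (RatFunc.num_mul_eq_mul_denom_iff hQ0).2 hR'
      have h2 : R'.num.eval w * Q.eval w = P.eval w * R'.denom.eval w := by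
        rw [← Polynomial.eval_mul, ← Polynomial.eval_mul, h1]
      rw [hc, mul_zero] at h2
      rcases mul_eq_zero.1 h2.symm with h3 | h3
      · rw [hP, Polynomial.eval_mul, hrev _ _ hw] at h3
        rw [hQ, Polynomial.eval_mul, hrev _ _ hw] at hc
        simp [hw] at h3 hc
        exact num_denom_not_both_zero R w⁻¹ ⟨h3, hc⟩
      · rw [value_eq, h3, div_zero] at hv
        exact hv rfl
    rw [value_of_eq_div hQ0 hR' hQw, value_eq, hP, hQ, Polynomial.eval_mul, Polynomial.eval_mul,
      hrev _ _ hw, hrev _ _ hw, ← hn', ← hm']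
    simp only [Polynomial.eval_pow, Polynomial.eval_X]
    have : R.denom.eval w⁻¹ ≠ 0 := by
      rw [hQ, Polynomial.eval_mul, hrev _ _ hw] at hQw
      exact left_ne_zero_of_mul (left_ne_zero_of_mul hQw)
    field_simp
    ring
  -- At a regular point `m = n + 4`, the powers of `w` cancel, and the value at `0` is the quotient
  -- of the leading coefficients.
  · have h1 := order_eq_zero_of_value_ne_zero hv
    rw [hord] at h1
    have h2 : R.intDegree = -4 := by
      change -R.intDegree - 4 = 0 at h1
      omega
    have h3 : m = n + 4 := by
      rw [RatFunc.intDegree] at h2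
      omega
    have h4 : R' = algebraMap _ _ R.num.reverse / algebraMap _ _ R.denom.reverse := by
      rw [hR', hP, hQ, ← h3, map_mul, map_mul, mul_div_mul_right]
      simpa using fun hc => absurd hc RatFunc.X_ne_zero
    rw [value_of_eq_div hrd h4 hrd0, coeffAtInfty, if_pos h2, neg_neg]
    rw [← Polynomial.coeff_zero_eq_eval_zero, ← Polynomial.coeff_zero_eq_eval_zero,
      Polynomial.coeff_zero_reverse, Polynomial.coeff_zero_reverse]

/-! ### Natural parameters on the Riemann sphere -/

/-- `e` is, up to the factor `i`, a natural parameter of `-R(z) dz²` on an open subset of the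
Riemann sphere. -/
structure IsFlat (R : RatFunc ℂ) (e : OpenPartialHomeomorph (OnePoint ℂ) ℂ) : Prop where
  finite : ∀ z : ℂ, (z : OnePoint ℂ) ∈ e.source →
    ∃ d, d ≠ 0 ∧ d ^ 2 = value R z ∧ HasDerivAt (fun z : ℂ => e z) d z
  infinite : OnePoint.infty ∈ e.source →
    ∃ d, d ≠ 0 ∧ d ^ 2 = -coeffAtInfty R ∧ HasDerivAt (fun w : ℂ => e (invSphere w)) d 0

/-- The chart of the Riemann sphere induced by a chart of the plane. -/
noncomputable def liftChart {ψ : ℂ → OnePoint ℂ} (hψ : Topology.IsOpenEmbedding ψ)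
    (e : OpenPartialHomeomorph ℂ ℂ) : OpenPartialHomeomorph (OnePoint ℂ) ℂ :=
  (hψ.toOpenPartialHomeomorph ψ).symm.trans e

section

variable {ψ : ℂ → OnePoint ℂ} (hψ : Topology.IsOpenEmbedding ψ) (e : OpenPartialHomeomorph ℂ ℂ)

theorem liftChart_apply (z : ℂ) : liftChart hψ e (ψ z) = e z := by
  simp [liftChart, hψ.toOpenPartialHomeomorph_left_inv]

theorem liftChart_target : (liftChart hψ e).target = e.target := by
  simp [liftChart]

theorem liftChart_source : (liftChart hψ e).source = ψ '' e.source := by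
  ext P
  simp only [liftChart, OpenPartialHomeomorph.trans_source, OpenPartialHomeomorph.symm_source,
    hψ.toOpenPartialHomeomorph_target, Set.mem_inter_iff, Set.mem_preimage, Set.mem_image,
    Set.mem_range]
  constructor
  · rintro ⟨⟨z, rfl⟩, hz⟩
    rw [hψ.toOpenPartialHomeomorph_left_inv] at hz
    exact ⟨z, hz, rfl⟩
  · rintro ⟨z, hz, rfl⟩
    refine ⟨⟨z, rfl⟩, ?_⟩
    rwa [hψ.toOpenPartialHomeomorph_left_inv]

theorem mem_liftChart_source {z : ℂ} : ψ z ∈ (liftChart hψ e).source ↔ z ∈ e.source := by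
  rw [liftChart_source]
  exact hψ.injective.mem_set_image

end

variable {R : RatFunc ℂ} {e : OpenPartialHomeomorph ℂ ℂ}

theorem IsNatural.isFlat (he : IsNatural R e) :
    IsFlat R (liftChart OnePoint.isOpenEmbedding_coe e) where
  finite z hz := by
    rw [mem_liftChart_source] at hz
    refine ⟨deriv e z, he.deriv_ne_zero z hz, he.sq_deriv z hz, ?_⟩
    simp_rw [liftChart_apply]
    exact he.hasDerivAt z hz
  infinite hi := by
    rw [liftChart_source] at hi
    obtain ⟨z, -, hz⟩ := hi
    exact absurd hz (OnePoint.coe_ne_infty z)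

theorem IsNatural.isFlat_inverted {R' : RatFunc ℂ}
    (h1 : ∀ w, w ≠ 0 → value R' w ≠ 0 → value R' w = value R w⁻¹ / w ^ 4)
    (h2 : value R' 0 ≠ 0 → value R' 0 = -coeffAtInfty R) (he : IsNatural R' e) :
    IsFlat R (liftChart isOpenEmbedding_invSphere e) where
  finite z hz := by
    have hz0 : z ≠ 0 := by
      rintro rfl
      rw [liftChart_source] at hz
      obtain ⟨w, -, hw⟩ := hz
      by_cases hw0 : w = 0
      · rw [hw0, invSphere_zero] at hw
        exact OnePoint.infty_ne_coe _ hw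
      · rw [invSphere_of_ne hw0] at hw
        exact inv_ne_zero hw0 (OnePoint.coe_injective hw)
    rw [← invSphere_inv hz0, mem_liftChart_source] at hz
    have h3 : HasDerivAt (fun z => e z⁻¹) (deriv e z⁻¹ * (-(z ^ 2)⁻¹)) z :=
      (he.hasDerivAt _ hz).comp z (hasDerivAt_inv hz0)
    refine ⟨deriv e z⁻¹ * (-(z ^ 2)⁻¹), ?_, ?_, ?_⟩
    · exact mul_ne_zero (he.deriv_ne_zero _ hz) (neg_ne_zero.2 (inv_ne_zero (pow_ne_zero 2 hz0)))
    · have h4 := h1 _ (inv_ne_zero hz0) (he.value_ne_zero hz)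
      rw [inv_inv] at h4
      rw [mul_pow, he.sq_deriv _ hz, h4]
      field_simp
    · refine h3.congr_of_eventuallyEq ?_
      filter_upwards [isOpen_ne.mem_nhds hz0] with w hw
      rw [← invSphere_inv hw, liftChart_apply]
  infinite hi := by
    rw [← invSphere_zero, mem_liftChart_source] at hi
    refine ⟨deriv e 0, he.deriv_ne_zero _ hi, ?_, ?_⟩
    · rw [he.sq_deriv _ hi]
      exact h2 (he.value_ne_zero hi)
    · simp_rw [liftChart_apply]
      exact he.hasDerivAt _ hi

/-- The restriction to the plane of a chart of the Riemann sphere. -/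
noncomputable def planeChart (e : OpenPartialHomeomorph (OnePoint ℂ) ℂ) :
    OpenPartialHomeomorph ℂ ℂ :=
  (OnePoint.isOpenEmbedding_coe.toOpenPartialHomeomorph ((↑) : ℂ → OnePoint ℂ)).trans e

theorem planeChart_apply (e : OpenPartialHomeomorph (OnePoint ℂ) ℂ) (z : ℂ) :
    planeChart e z = e (z : OnePoint ℂ) := by
  simp [planeChart]

theorem mem_planeChart_source {e : OpenPartialHomeomorph (OnePoint ℂ) ℂ} {z : ℂ} :
    z ∈ (planeChart e).source ↔ (z : OnePoint ℂ) ∈ e.source := by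
  simp [planeChart]

theorem mem_planeChart_target {e : OpenPartialHomeomorph (OnePoint ℂ) ℂ} {w : ℂ} :
    w ∈ (planeChart e).target ↔ w ∈ e.target ∧ e.symm w ≠ OnePoint.infty := by
  simp [planeChart, OnePoint.ne_infty_iff_exists]

theorem planeChart_symm_apply {e : OpenPartialHomeomorph (OnePoint ℂ) ℂ} {w : ℂ}
    (hw : w ∈ (planeChart e).target) : (((planeChart e).symm w : ℂ) : OnePoint ℂ) = e.symm w := by
  have h1 := (planeChart e).map_target hw
  have h2 := (planeChart e).right_inv hw
  rw [planeChart_apply] at h2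
  rw [← e.left_inv (mem_planeChart_source.1 h1), h2]

theorem IsFlat.isNatural {e : OpenPartialHomeomorph (OnePoint ℂ) ℂ} (he : IsFlat R e) :
    IsNatural R (planeChart e) := by
  have h1 : ∀ z ∈ (planeChart e).source, ∃ d, d ≠ 0 ∧ d ^ 2 = value R z ∧
      HasDerivAt (planeChart e) d z := by
    intro z hz
    obtain ⟨d, h1, h2, h3⟩ := he.finite z (mem_planeChart_source.1 hz)
    refine ⟨d, h1, h2, h3.congr_of_eventuallyEq (Eventually.of_forall fun w => ?_)⟩
    exact planeChart_apply e w
  refine ⟨fun z hz => ?_, fun z hz => ?_, fun z hz => ?_⟩ <;> obtain ⟨d, h1, h2, h3⟩ := h1 z hz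
  · rw [h3.deriv]
    exact h3
  · rw [h3.deriv, h2]
  · rw [h3.deriv]
    exact h1

end CriticalMeasure

namespace CriticalMeasure

variable {R : RatFunc ℂ} {e e₁ e₂ : OpenPartialHomeomorph (OnePoint ℂ) ℂ} {γ γ₁ γ₂ : ℝ → OnePoint ℂ}
  {D : Set ℝ}

/-! ### Compatibility of natural parameters -/

/-- The exceptional point `c` is removable by continuity. The derivative is then continuous with
square one on a connected set, hence constantly `1` or `-1`. -/
theorem eqOn_of_deriv_sq_eq_one {f : ℂ → ℂ} {w₀ c : ℂ} {r : ℝ} (hr : 0 < r)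
    (hf : ContinuousOn f (Metric.ball w₀ r))
    (hd : ∀ w ∈ Metric.ball w₀ r, w ≠ c → ∃ d, d ^ 2 = 1 ∧ HasDerivAt f d w) :
    ∃ ε b : ℂ, (ε = 1 ∨ ε = -1) ∧ ∀ w ∈ Metric.ball w₀ r, f w = ε * w + b := by
  set B := Metric.ball w₀ r with hB
  have hBo : IsOpen B := Metric.isOpen_ball
  have h1 : DifferentiableOn ℂ f (B \ {c}) := fun w hw => by
    obtain ⟨d, -, h⟩ := hd w hw.1 hw.2
    exact h.differentiableAt.differentiableWithinAt
  have h2 : DifferentiableOn ℂ f B := by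
    by_cases hc : c ∈ B
    · exact (Complex.differentiableOn_compl_singleton_and_continuousAt_iff (hBo.mem_nhds hc)).1
        ⟨h1, hf.continuousAt (hBo.mem_nhds hc)⟩
    · rwa [Set.sdiff_singleton_eq_self hc] at h1
  have h3 : ContinuousOn (deriv f) B := (h2.deriv hBo).continuousOn
  have h4 : Set.EqOn (deriv f ^ 2) ((fun _ => (1 : ℂ)) ^ 2) B := by
    intro w hw
    have h5 : ∀ᶠ v in 𝓝[≠] w, deriv f v ^ 2 = 1 := by
      have h6 : ∀ᶠ v in 𝓝[≠] w, v ≠ c := by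
        by_cases hwc : w = c
        · rw [← hwc]
          exact self_mem_nhdsWithin
        · exact mem_nhdsWithin_of_mem_nhds (isOpen_ne.mem_nhds hwc)
      filter_upwards [mem_nhdsWithin_of_mem_nhds (hBo.mem_nhds hw), h6] with v hv hvc
      obtain ⟨d, hd1, hd2⟩ := hd v hv hvc
      rw [hd2.deriv, hd1]
    have h7 : Tendsto (fun v => deriv f v ^ 2) (𝓝[≠] w) (𝓝 (deriv f w ^ 2)) :=
      ((h3.continuousAt (hBo.mem_nhds hw)).pow 2).tendsto.mono_left nhdsWithin_le_nhds
    have h8 := tendsto_nhds_unique (h7.congr' h5) tendsto_const_nhds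
    simpa using h8
  have hpre : IsPreconnected B := (convex_ball w₀ r).isPreconnected
  have h5 : ∃ ε : ℂ, (ε = 1 ∨ ε = -1) ∧ ∀ w ∈ B, deriv f w = ε := by
    rcases hpre.eq_or_eq_neg_of_sq_eq h3 continuousOn_const h4 (fun _ => one_ne_zero) with h | h
    · exact ⟨1, Or.inl rfl, h⟩
    · exact ⟨-1, Or.inr rfl, h⟩
  obtain ⟨ε, hε, h6⟩ := h5
  have hw₀ : w₀ ∈ B := Metric.mem_ball_self hr
  refine ⟨ε, f w₀ - ε * w₀, hε, fun w hw => ?_⟩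
  have h7 : DifferentiableOn ℂ (fun w => f w - ε * w) B := h2.fun_sub (by fun_prop)
  have h8 := hBo.is_const_of_deriv_eq_zero hpre h7 (fun v hv => by
    have h9 := (h2.differentiableAt (hBo.mem_nhds hv)).hasDerivAt.fun_sub
      ((hasDerivAt_id v).const_mul ε)
    simp only [id, mul_one, h6 v hv, sub_self] at h9
    exact h9.deriv) hw hw₀
  linear_combination h8

/-- The derivatives of both charts square to `R`, so the derivative of the transition map squares to
one. The image of `∞`, where the coordinate `z` is unavailable, is the exceptional point; if `∞` is
outside the chart this value is harmless. -/
theorem IsFlat.compat (h₁ : IsFlat R e₁) (h₂ : IsFlat R e₂) {P : OnePoint ℂ} (hP₁ : P ∈ e₁.source)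
    (hP₂ : P ∈ e₂.source) : ∃ ε b : ℂ, (ε = 1 ∨ ε = -1) ∧
      ∀ᶠ Q in 𝓝 P, Q ∈ e₁.source ∧ Q ∈ e₂.source ∧ e₂ Q = ε * e₁ Q + b := by
  have hO : IsOpen (e₁.symm.source ∩ e₁.symm ⁻¹' e₂.source) :=
    e₁.symm.continuousOn.isOpen_inter_preimage e₁.symm.open_source e₂.open_source
  have hmem : e₁ P ∈ e₁.symm.source ∩ e₁.symm ⁻¹' e₂.source :=
    ⟨e₁.map_source hP₁, by rwa [Set.mem_preimage, e₁.left_inv hP₁]⟩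
  obtain ⟨r, hr, hball⟩ := Metric.isOpen_iff.1 hO _ hmem
  obtain ⟨ε, b, hε, hb⟩ := eqOn_of_deriv_sq_eq_one (f := fun w => e₂ (e₁.symm w)) (w₀ := e₁ P)
    (c := e₁ OnePoint.infty) hr
    (e₂.continuousOn.comp (e₁.symm.continuousOn.mono fun w hw => (hball hw).1)
      fun w hw => (hball hw).2) (by
    intro w hw hwc
    have hw1 : w ∈ e₁.target := (hball hw).1
    have hne : e₁.symm w ≠ OnePoint.infty := fun hc => hwc (by rw [← hc, e₁.right_inv hw1])
    have hwt : w ∈ (planeChart e₁).target := mem_planeChart_target.2 ⟨hw1, hne⟩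
    have hs1 := (planeChart e₁).map_target hwt
    have hsymm := planeChart_symm_apply hwt
    have hs2 : (planeChart e₁).symm w ∈ (planeChart e₂).source := by
      rw [mem_planeChart_source, hsymm]
      exact (hball hw).2
    have hd1 := (planeChart e₁).hasDerivAt_symm hwt (h₁.isNatural.deriv_ne_zero _ hs1)
      (h₁.isNatural.hasDerivAt _ hs1)
    have hd2 := (h₂.isNatural.hasDerivAt _ hs2).comp w hd1
    refine ⟨_, ?_, hd2.congr_of_eventuallyEq ?_⟩
    · rw [mul_pow, inv_pow, h₁.isNatural.sq_deriv _ hs1, h₂.isNatural.sq_deriv _ hs2]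
      exact mul_inv_cancel₀ (h₁.isNatural.value_ne_zero hs1)
    · filter_upwards [(planeChart e₁).open_target.mem_nhds hwt] with v hv
      rw [Function.comp_apply, planeChart_apply, planeChart_symm_apply hv])
  refine ⟨ε, b, hε, ?_⟩
  filter_upwards [e₁.open_source.mem_nhds hP₁, e₂.open_source.mem_nhds hP₂,
    (e₁.continuousAt hP₁).preimage_mem_nhds (Metric.ball_mem_nhds _ hr)] with Q hQ1 hQ2 hQ
  refine ⟨hQ1, hQ2, ?_⟩
  have := hb _ hQ
  rwa [e₁.left_inv hQ1] at this

/-! ### Vertical curves -/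

/-- Near `t` the curve `γ` is, in a natural parameter `e`, a vertical line traversed with unit
speed. -/
def VertAt (R : RatFunc ℂ) (γ : ℝ → OnePoint ℂ) (t : ℝ) : Prop :=
  ∃ e, IsFlat R e ∧ ∃ (ε : ℝ) (c : ℂ), (ε = 1 ∨ ε = -1) ∧
    ∀ᶠ s in 𝓝 t, γ s ∈ e.source ∧ e (γ s) = c + (ε * s : ℝ) * Complex.I

/-- `γ` is a vertical curve on `D`. -/
def VertOn (R : RatFunc ℂ) (γ : ℝ → OnePoint ℂ) (D : Set ℝ) : Prop := ∀ t ∈ D, VertAt R γ t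

/-- Transition maps `w ↦ ±w + b` preserve vertical lines and unit speed, so the condition may be
read in any flat chart at the point. -/
theorem VertAt.chart {t : ℝ} (h : VertAt R γ t) (he : IsFlat R e) (ht : γ t ∈ e.source) :
    ∃ (ε : ℝ) (c : ℂ), (ε = 1 ∨ ε = -1) ∧
      ∀ᶠ s in 𝓝 t, γ s ∈ e.source ∧ e (γ s) = c + (ε * s : ℝ) * Complex.I := by
  obtain ⟨e₁, he₁, ε₁, c₁, hε₁, h1⟩ := h
  have hcont : ContinuousAt γ t := by
    have h2 : ContinuousAt (fun s : ℝ => e₁.symm (c₁ + (ε₁ * s : ℝ) * Complex.I)) t := by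
      have h3 : c₁ + (ε₁ * t : ℝ) * Complex.I ∈ e₁.target := by
        rw [← h1.self_of_nhds.2]
        exact e₁.map_source h1.self_of_nhds.1
      exact ContinuousAt.comp (f := fun s : ℝ => c₁ + (ε₁ * s : ℝ) * Complex.I)
        (e₁.continuousAt_symm h3) (by fun_prop)
    refine h2.congr ?_
    filter_upwards [h1] with s hs
    rw [← hs.2, e₁.left_inv hs.1]
  obtain ⟨ε, b, hε, hb⟩ := he₁.compat he h1.self_of_nhds.1 ht
  have key : ∀ ε' : ℝ, (ε' : ℂ) = ε → ∃ (ε : ℝ) (c : ℂ), (ε = 1 ∨ ε = -1) ∧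
      ∀ᶠ s in 𝓝 t, γ s ∈ e.source ∧ e (γ s) = c + (ε * s : ℝ) * Complex.I := by
    intro ε' hε'
    refine ⟨ε' * ε₁, ε * c₁ + b, ?_, ?_⟩
    · have h5 : ε' = 1 ∨ ε' = -1 := by
        rcases hε with h | h <;> rw [h] at hε'
        · exact Or.inl (by exact_mod_cast hε')
        · exact Or.inr (by exact_mod_cast hε')
      rcases h5 with rfl | rfl <;> rcases hε₁ with rfl | rfl <;> norm_num
    · filter_upwards [h1, hcont hb] with s hs hs'
      refine ⟨hs'.2.1, ?_⟩
      rw [hs'.2.2, hs.2, ← hε']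
      push_cast
      ring
  rcases hε with h | h
  · exact key 1 (by rw [h, Complex.ofReal_one])
  · exact key (-1) (by rw [h, Complex.ofReal_neg, Complex.ofReal_one])

/-- A version of `VertAt.chart` normalized at `t`. -/
theorem VertAt.chart' {t : ℝ} (h : VertAt R γ t) (he : IsFlat R e) (ht : γ t ∈ e.source) :
    ∃ ε : ℝ, (ε = 1 ∨ ε = -1) ∧
      ∀ᶠ s in 𝓝 t, γ s ∈ e.source ∧ e (γ s) = e (γ t) + (ε * (s - t) : ℝ) * Complex.I := by
  obtain ⟨ε, c, hε, h1⟩ := h.chart he ht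
  refine ⟨ε, hε, ?_⟩
  have h2 := h1.self_of_nhds.2
  filter_upwards [h1] with s hs
  refine ⟨hs.1, ?_⟩
  rw [hs.2, h2]
  push_cast
  ring

theorem VertAt.continuousAt {t : ℝ} (h : VertAt R γ t) : ContinuousAt γ t := by
  obtain ⟨e₁, he₁, ε₁, c₁, hε₁, h1⟩ := h
  have h2 : ContinuousAt (fun s : ℝ => e₁.symm (c₁ + (ε₁ * s : ℝ) * Complex.I)) t := by
    have h3 : c₁ + (ε₁ * t : ℝ) * Complex.I ∈ e₁.target := by
      rw [← h1.self_of_nhds.2]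
      exact e₁.map_source h1.self_of_nhds.1
    exact ContinuousAt.comp (f := fun s : ℝ => c₁ + (ε₁ * s : ℝ) * Complex.I)
      (e₁.continuousAt_symm h3) (by fun_prop)
  refine h2.congr ?_
  filter_upwards [h1] with s hs
  rw [← hs.2, e₁.left_inv hs.1]

theorem VertAt.congr {t : ℝ} (h : VertAt R γ₁ t) (h' : γ₂ =ᶠ[𝓝 t] γ₁) : VertAt R γ₂ t := by
  obtain ⟨e₁, he₁, ε₁, c₁, hε₁, h1⟩ := h
  refine ⟨e₁, he₁, ε₁, c₁, hε₁, ?_⟩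
  filter_upwards [h1, h'] with s hs hs'
  rwa [hs']

theorem vertAt_symm (he : IsFlat R e) {ε : ℝ} (hε : ε = 1 ∨ ε = -1) {c : ℂ} {t : ℝ}
    (ht : c + (ε * t : ℝ) * Complex.I ∈ e.target) :
    VertAt R (fun s => e.symm (c + (ε * s : ℝ) * Complex.I)) t := by
  refine ⟨e, he, ε, c, hε, ?_⟩
  have h1 : ContinuousAt (fun s : ℝ => c + (ε * s : ℝ) * Complex.I) t := by fun_prop
  filter_upwards [h1.preimage_mem_nhds (e.open_target.mem_nhds ht)] with s hs
  exact ⟨e.map_target hs, e.right_inv hs⟩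

/-- Vertical curves may be reparametrized by `s ↦ δ s + b`, `δ = ± 1`. -/
theorem VertAt.comp_affine {δ b t : ℝ} (hδ : δ = 1 ∨ δ = -1) (h : VertAt R γ (δ * t + b)) :
    VertAt R (fun s => γ (δ * s + b)) t := by
  obtain ⟨e₁, he₁, ε₁, c₁, hε₁, h1⟩ := h
  refine ⟨e₁, he₁, ε₁ * δ, c₁ + (ε₁ * b : ℝ) * Complex.I, ?_, ?_⟩
  · rcases hδ with rfl | rfl <;> rcases hε₁ with rfl | rfl <;> norm_num
  · have h2 : ContinuousAt (fun s : ℝ => δ * s + b) t := by fun_prop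
    filter_upwards [h2.eventually h1] with s hs
    refine ⟨hs.1, ?_⟩
    rw [hs.2]
    push_cast
    ring

theorem affine_unique {ε₁ ε₂ t : ℝ} {c₁ c₂ : ℂ}
    (h : ∀ᶠ s in 𝓝 t, c₁ + (ε₁ * s : ℝ) * Complex.I = c₂ + (ε₂ * s : ℝ) * Complex.I) :
    ε₁ = ε₂ ∧ c₁ = c₂ := by
  have h1 : ∃ s, s ≠ t ∧ c₁ + (ε₁ * s : ℝ) * Complex.I = c₂ + (ε₂ * s : ℝ) * Complex.I := by
    obtain ⟨s, hs1, hs2⟩ := ((eventually_mem_nhdsWithin (a := t) (s := {t}ᶜ)).and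
      (h.filter_mono nhdsWithin_le_nhds)).exists
    exact ⟨s, hs1, hs2⟩
  obtain ⟨s, hs, hs'⟩ := h1
  have ht := h.self_of_nhds
  have e1 := congrArg Complex.im hs'
  have e2 := congrArg Complex.im ht
  simp at e1 e2
  have h3 : (ε₁ - ε₂) * (s - t) = 0 := by linear_combination e1 - e2
  have h4 : ε₁ = ε₂ := sub_eq_zero.1 ((mul_eq_zero.1 h3).resolve_right (sub_ne_zero.2 hs))
  refine ⟨h4, ?_⟩
  rw [h4] at ht
  exact add_right_cancel ht

/-- Unique continuation. The times at which the two germs agree form an open set. It is closed in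
`D`: at a limit point both curves are affine in a common chart, and affine functions that agree near
some time agree. -/
theorem VertOn.eqOn (h₁ : VertOn R γ₁ D) (h₂ : VertOn R γ₂ D) (hD : D.OrdConnected) {t₀ : ℝ}
    (ht₀ : t₀ ∈ D) (h : γ₁ =ᶠ[𝓝 t₀] γ₂) : Set.EqOn γ₁ γ₂ D := by
  have hsub : D ⊆ {t | γ₁ =ᶠ[𝓝 t] γ₂} := by
    refine hD.isPreconnected.subset_of_closure_inter_subset isOpen_setOfPred_eventually_nhds
      ⟨t₀, ht₀, h⟩ ?_
    rintro t ⟨htc, htD⟩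
    have heq : γ₁ t = γ₂ t := by
      by_contra hne
      have h1 : ∀ᶠ s in 𝓝 t, γ₁ s ≠ γ₂ s :=
        ((h₁ t htD).continuousAt.prodMk (h₂ t htD).continuousAt).preimage_mem_nhds
          (isClosed_diagonal.isOpen_compl.mem_nhds hne)
      obtain ⟨s, hs1, hs2⟩ := mem_closure_iff_nhds.1 htc _ h1
      exact hs1 (hs2 : γ₁ =ᶠ[𝓝 s] γ₂).self_of_nhds
    obtain ⟨e, he, ε₁, c₁, hε₁, h1⟩ := h₁ t htD
    obtain ⟨ε₂, c₂, hε₂, h2⟩ := (h₂ t htD).chart he (heq ▸ h1.self_of_nhds.1)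
    obtain ⟨s, hs1, hs2⟩ := mem_closure_iff_nhds.1 htc _
      (h1.eventually_nhds.and h2.eventually_nhds)
    obtain ⟨rfl, rfl⟩ := affine_unique (t := s) (ε₁ := ε₁) (ε₂ := ε₂) (c₁ := c₁) (c₂ := c₂) (by
      filter_upwards [hs1.1, hs1.2, hs2] with v hv1 hv2 hv3
      rw [← hv1.2, ← hv2.2, hv3])
    change γ₁ =ᶠ[𝓝 t] γ₂
    filter_upwards [h1, h2] with v hv1 hv2
    rw [← e.left_inv hv1.1, ← e.left_inv hv2.1, hv1.2, hv2.2]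
  exact fun t ht => (hsub ht : γ₁ =ᶠ[𝓝 t] γ₂).self_of_nhds

/-! ### Maximal vertical curves -/

/-- `γ` is a vertical curve on the open interval `D`, and cannot be extended. -/
structure IsMaxCurve (R : RatFunc ℂ) (γ : ℝ → OnePoint ℂ) (D : Set ℝ) : Prop where
  isOpen : IsOpen D
  ordConnected : D.OrdConnected
  nonempty : D.Nonempty
  vert : VertOn R γ D
  maximal : ∀ γ' D', IsOpen D' → D'.OrdConnected → VertOn R γ' D' →
    ∀ t ∈ D, t ∈ D' → γ' =ᶠ[𝓝 t] γ → D' ⊆ D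

/-- As for an ordinary differential equation, all vertical continuations of one germ through `P`
agree on overlaps, so they glue to a curve on the union of their domains. -/
theorem exists_isMaxCurve (he : IsFlat R e) {P : OnePoint ℂ} (hP : P ∈ e.source) :
    ∃ γ D, IsMaxCurve R γ D ∧ 0 ∈ D ∧ γ 0 = P := by
  classical
  set γ₀ : ℝ → OnePoint ℂ := fun s => e.symm (e P + ((1 : ℝ) * s : ℝ) * Complex.I) with hγ₀
  let F : (ℝ → OnePoint ℂ) × Set ℝ → Prop := fun q =>
    IsOpen q.2 ∧ q.2.OrdConnected ∧ (0 : ℝ) ∈ q.2 ∧ VertOn R q.1 q.2 ∧ q.1 =ᶠ[𝓝 0] γ₀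
  have huniq : ∀ q q', F q → F q' → Set.EqOn q.1 q'.1 (q.2 ∩ q'.2) := by
    rintro ⟨δ, D⟩ ⟨δ', D'⟩ ⟨h1, h2, h3, h4, h5⟩ ⟨h1', h2', h3', h4', h5'⟩
    exact VertOn.eqOn (fun t ht => h4 t ht.1) (fun t ht => h4' t ht.2) (h2.inter h2') ⟨h3, h3'⟩
      (h5.trans h5'.symm)
  let D : Set ℝ := ⋃ q ∈ {q | F q}, q.2
  have hD : ∀ t, t ∈ D ↔ ∃ q, F q ∧ t ∈ q.2 := fun t => by simp [D]
  let γ : ℝ → OnePoint ℂ := fun t => if h : ∃ q, F q ∧ t ∈ q.2 then h.choose.1 t else P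
  have hγ : ∀ q, F q → Set.EqOn γ q.1 q.2 := by
    intro q hq t ht
    have hex : ∃ q, F q ∧ t ∈ q.2 := ⟨q, hq, ht⟩
    simp only [γ, dif_pos hex]
    exact huniq _ _ hex.choose_spec.1 hq ⟨hex.choose_spec.2, ht⟩
  have hbase : ∃ q, F q := by
    have h1 : IsOpen {s : ℝ | e P + ((1 : ℝ) * s : ℝ) * Complex.I ∈ e.target} :=
      e.open_target.preimage (by fun_prop)
    have h2 : (0 : ℝ) ∈ {s : ℝ | e P + ((1 : ℝ) * s : ℝ) * Complex.I ∈ e.target} := by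
      simpa using e.map_source hP
    obtain ⟨r, hr, hball⟩ := Metric.isOpen_iff.1 h1 0 h2
    refine ⟨(γ₀, Metric.ball 0 r), Metric.isOpen_ball, ?_, Metric.mem_ball_self hr, ?_,
      EventuallyEq.rfl⟩
    · exact (convex_ball _ _).ordConnected
    · exact fun t ht => vertAt_symm he (Or.inl rfl) (hball ht)
  have h0D : (0 : ℝ) ∈ D := by
    obtain ⟨q, hq⟩ := hbase
    exact (hD 0).2 ⟨q, hq, hq.2.2.1⟩
  have hDo : IsOpen D := isOpen_biUnion fun q hq => hq.1
  have hDc : D.OrdConnected := by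
    refine IsPreconnected.ordConnected ?_
    refine isPreconnected_of_forall 0 fun t ht => ?_
    obtain ⟨q, hq, htq⟩ := (hD t).1 ht
    exact ⟨q.2, fun s hs => (hD s).2 ⟨q, hq, hs⟩, hq.2.2.1, htq, hq.2.1.isPreconnected⟩
  have hev : ∀ q, F q → ∀ t ∈ q.2, γ =ᶠ[𝓝 t] q.1 := fun q hq t ht => by
    filter_upwards [hq.1.mem_nhds ht] with s hs
    exact hγ q hq hs
  have hv : VertOn R γ D := fun t ht => by
    obtain ⟨q, hq, htq⟩ := (hD t).1 ht
    exact (hq.2.2.2.1 t htq).congr (hev q hq t htq)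
  have hγ0 : γ =ᶠ[𝓝 0] γ₀ := by
    obtain ⟨q, hq⟩ := hbase
    exact (hev q hq 0 hq.2.2.1).trans hq.2.2.2.2
  refine ⟨γ, D, ⟨hDo, hDc, ⟨0, h0D⟩, hv, ?_⟩, h0D, ?_⟩
  · intro γ' D' hDo' hDc' hv' t ht ht' heq
    -- An extension glued to `γ` is itself one of the continuations of the germ, so its domain is
    -- already part of the union.
    let δ : ℝ → OnePoint ℂ := fun s => if s ∈ D then γ s else γ' s
    have hδ1 : Set.EqOn δ γ D := fun s hs => if_pos hs
    have hδ2 : Set.EqOn δ γ' D' := fun s hs => by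
      by_cases hsD : s ∈ D
      · rw [hδ1 hsD]
        exact VertOn.eqOn (fun t ht => hv t ht.1) (fun t ht => hv' t ht.2) (hDc.inter hDc')
          ⟨ht, ht'⟩ heq.symm ⟨hsD, hs⟩
      · exact if_neg hsD
    have hF : F (δ, D ∪ D') := by
      refine ⟨hDo.union hDo', ?_, Or.inl h0D, ?_, ?_⟩
      · exact (hDc.isPreconnected.union t ht ht' hDc'.isPreconnected).ordConnected
      · rintro s (hs | hs)
        · refine (hv s hs).congr ?_
          filter_upwards [hDo.mem_nhds hs] with v hv using hδ1 hv
        · refine (hv' s hs).congr ?_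
          filter_upwards [hDo'.mem_nhds hs] with v hv using hδ2 hv
      · refine EventuallyEq.trans ?_ hγ0
        filter_upwards [hDo.mem_nhds h0D] with v hv using hδ1 hv
    exact fun s hs => (hD s).2 ⟨_, hF, Or.inr hs⟩
  · rw [hγ0.self_of_nhds]
    simp [hγ₀, e.left_inv hP]

/-- A maximal curve follows a vertical segment of a chart. -/
theorem IsMaxCurve.follow (hM : IsMaxCurve R γ D) (he : IsFlat R e) {t τ ε : ℝ} (ht : t ∈ D)
    (hε : ε = 1 ∨ ε = -1) (hrel : ∀ᶠ s in 𝓝 t, γ s ∈ e.source ∧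
      e (γ s) = e (γ t) + (ε * (s - t) : ℝ) * Complex.I)
    (hseg : ∀ s ∈ Set.uIcc 0 τ, e (γ t) + (ε * s : ℝ) * Complex.I ∈ e.target) :
    t + τ ∈ D ∧ γ (t + τ) = e.symm (e (γ t) + (ε * τ : ℝ) * Complex.I) := by
  set c : ℂ := e (γ t) - (ε * t : ℝ) * Complex.I with hc
  set η : ℝ → OnePoint ℂ := fun s => e.symm (c + (ε * s : ℝ) * Complex.I) with hη
  have hcs : ∀ s : ℝ, c + (ε * s : ℝ) * Complex.I =
      e (γ t) + (ε * (s - t) : ℝ) * Complex.I := fun s => by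
    rw [hc]
    push_cast
    ring
  set J : Set ℝ := {s | c + (ε * s : ℝ) * Complex.I ∈ e.target} with hJ
  have hJo : IsOpen J := e.open_target.preimage (by fun_prop)
  have hsub : Set.uIcc t (t + τ) ⊆ J := by
    intro s hs
    rw [hJ, Set.mem_ofPred_eq, hcs]
    refine hseg _ ?_
    rcases Set.mem_uIcc.1 hs with hs | hs
    · exact Set.mem_uIcc.2 (Or.inl ⟨by linarith, by linarith⟩)
    · exact Set.mem_uIcc.2 (Or.inr ⟨by linarith, by linarith⟩)
  set D' := connectedComponentIn J t with hD'
  have hsub' : Set.uIcc t (t + τ) ⊆ D' :=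
    isPreconnected_uIcc.subset_connectedComponentIn Set.left_mem_uIcc hsub
  have hD'o : IsOpen D' := hJo.connectedComponentIn
  have hD'c : D'.OrdConnected := isPreconnected_connectedComponentIn.ordConnected
  have hv : VertOn R η D' := fun s hs =>
    vertAt_symm he hε (connectedComponentIn_subset J t hs)
  have heq : η =ᶠ[𝓝 t] γ := by
    filter_upwards [hrel] with s hs
    rw [hη]
    simp only
    rw [hcs, ← hs.2, e.left_inv hs.1]
  have h1 : D' ⊆ D := hM.maximal η D' hD'o hD'c hv t ht (hsub' Set.left_mem_uIcc) heq
  have h2 := VertOn.eqOn (fun s hs => hM.vert s (h1 hs)) hv hD'c (hsub' Set.left_mem_uIcc) heq.symm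
    (hsub' Set.right_mem_uIcc)
  refine ⟨h1 (hsub' Set.right_mem_uIcc), ?_⟩
  rw [h2, hη]
  simp only
  rw [hcs, add_sub_cancel_left]

end CriticalMeasure

namespace CriticalMeasure

variable {R : RatFunc ℂ} {e : OpenPartialHomeomorph (OnePoint ℂ) ℂ} {γ η : ℝ → OnePoint ℂ}
  {D : Set ℝ} {Y : Set (OnePoint ℂ)}

/-! ### Existence of natural parameters -/

/-- Near `a` the quotient `f / f a` is close to `1`, away from the cut of the logarithm. -/
theorem exists_sqrt_of_ne_zero {f : ℂ → ℂ} {a : ℂ} (hf : ∀ᶠ z in 𝓝 a, DifferentiableAt ℂ f z)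
    (ha : f a ≠ 0) : ∃ r > 0, ∃ g : ℂ → ℂ, DifferentiableOn ℂ g (Metric.ball a r) ∧
      ∀ z ∈ Metric.ball a r, g z ^ 2 = f z := by
  obtain ⟨c, hc⟩ := IsAlgClosed.exists_pow_nat_eq (f a) (n := 2) (by norm_num)
  have h1 : ∀ᶠ z in 𝓝 a, f z / f a ∈ Complex.slitPlane := by
    have h2 : ContinuousAt (fun z => f z / f a) a :=
      (hf.self_of_nhds.continuousAt).div_const _
    refine h2.preimage_mem_nhds (Complex.isOpen_slitPlane.mem_nhds ?_)
    rw [div_self ha]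
    exact Complex.one_mem_slitPlane
  obtain ⟨r, hr, hball⟩ := Metric.mem_nhds_iff.1 (hf.and h1)
  refine ⟨r, hr, fun z => Complex.exp (1 / 2 * Complex.log (f z / f a)) * c, fun z hz => ?_,
    fun z hz => ?_⟩
  · obtain ⟨h2, h3⟩ := hball hz
    exact ((((h2.div_const _).clog h3).const_mul _).cexp.mul_const _).differentiableWithinAt
  · obtain ⟨h2, h3⟩ := hball hz
    rw [mul_pow, ← Complex.exp_nat_mul, hc]
    have h4 : ((2 : ℕ) : ℂ) * (1 / 2 * Complex.log (f z / f a)) = Complex.log (f z / f a) := by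
      push_cast
      ring
    rw [h4, Complex.exp_log (Complex.slitPlane_ne_zero h3), div_mul_cancel₀ _ ha]

theorem exists_openPartialHomeomorph {W : ℂ → ℂ} {U : Set ℂ} (hU : IsOpen U)
    (hW : DifferentiableOn ℂ W U) {a : ℂ} (ha : a ∈ U) (hd : deriv W a ≠ 0) :
    ∃ e : OpenPartialHomeomorph ℂ ℂ, a ∈ e.source ∧ e.source ⊆ U ∧ ∀ z, e z = W z := by
  have h1 : HasStrictDerivAt W (deriv W a) a :=
    (hW.analyticAt (hU.mem_nhds ha)).hasStrictDerivAt
  let e₀ := (h1.hasStrictFDerivAt_equiv hd).toOpenPartialHomeomorph W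
  have h2 : a ∈ e₀.source := (h1.hasStrictFDerivAt_equiv hd).mem_toOpenPartialHomeomorph_source
  refine ⟨e₀.restrOpen U hU, ?_, ?_, fun z => rfl⟩
  · rw [OpenPartialHomeomorph.restrOpen_source]
    exact ⟨h2, ha⟩
  · rw [OpenPartialHomeomorph.restrOpen_source]
    exact Set.inter_subset_right

theorem isNatural_of_hasDerivAt {e : OpenPartialHomeomorph ℂ ℂ} {g : ℂ → ℂ}
    (h1 : ∀ z ∈ e.source, HasDerivAt e (g z) z) (h2 : ∀ z ∈ e.source, g z ^ 2 = value R z)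
    (h3 : ∀ z ∈ e.source, value R z ≠ 0) : IsNatural R e := by
  refine ⟨fun z hz => ?_, fun z hz => ?_, fun z hz hc => ?_⟩
  · rw [(h1 z hz).deriv]
    exact h1 z hz
  · rw [(h1 z hz).deriv]
    exact h2 z hz
  · rw [(h1 z hz).deriv] at hc
    refine h3 z hz ?_
    rw [← h2 z hz, hc]
    ring

theorem denom_ne_zero_of_value {z : ℂ} (hz : value R z ≠ 0) : R.denom.eval z ≠ 0 := fun hc =>
  hz (by rw [value_eq, hc, div_zero])

theorem isOpen_value_ne_zero (R : RatFunc ℂ) : IsOpen {z | value R z ≠ 0} := by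
  refine isOpen_iff_mem_nhds.2 fun z hz => ?_
  exact (differentiableAt_value (denom_ne_zero_of_value hz)).continuousAt.eventually_ne hz

/-- A primitive of a holomorphic square root of `R`, made invertible by the inverse function
theorem. -/
theorem exists_isNatural {a : ℂ} (ha : value R a ≠ 0) :
    ∃ e, IsNatural R e ∧ a ∈ e.source := by
  have hO := isOpen_value_ne_zero R
  obtain ⟨r, hr, g, hg, hg2⟩ := exists_sqrt_of_ne_zero (f := value R) (a := a) (by
    filter_upwards [hO.mem_nhds ha] with z hz
    exact differentiableAt_value (denom_ne_zero_of_value hz)) ha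
  obtain ⟨W, hW⟩ := hg.isExactOn_ball
  have hWd : DifferentiableOn ℂ W (Metric.ball a r) := fun z hz =>
    (hW z hz).differentiableAt.differentiableWithinAt
  have hab := Metric.mem_ball_self (x := a) hr
  obtain ⟨e, he1, he2, he3⟩ := exists_openPartialHomeomorph
    (Metric.isOpen_ball.inter hO) (hWd.mono Set.inter_subset_left) ⟨hab, ha⟩ (by
      rw [(hW a hab).deriv]
      intro hc
      refine ha ?_
      rw [← hg2 a hab, hc]
      ring)
  have he4 : ⇑e = W := funext he3
  refine ⟨e, isNatural_of_hasDerivAt (g := g) (fun z hz => ?_) (fun z hz => hg2 z (he2 hz).1)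
    (fun z hz => (he2 hz).2), he1⟩
  rw [he4]
  exact hW z (he2 hz).1

/-- Every regular point lies in the domain of a natural parameter. -/
theorem exists_isFlat (hR : R ≠ 0) {P : OnePoint ℂ} (hP : qdOrder R P = 0) :
    ∃ e, IsFlat R e ∧ P ∈ e.source := by
  induction P using OnePoint.rec with
  | infty =>
    obtain ⟨R', hR'0, h1, h2, h3⟩ := exists_inverted hR
    rw [hP] at h2
    obtain ⟨e, he, h0⟩ := exists_isNatural ((value_ne_zero_iff hR'0 0).2 h2)
    refine ⟨_, he.isFlat_inverted h1 h3, ?_⟩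
    rwa [← invSphere_zero, mem_liftChart_source]
  | coe z =>
    obtain ⟨e, he, hz⟩ := exists_isNatural ((value_ne_zero_iff hR z).2 hP)
    exact ⟨_, he.isFlat, (mem_liftChart_source _ _).2 hz⟩

theorem IsFlat.qdOrder_eq_zero (he : IsFlat R e) {P : OnePoint ℂ} (hP : P ∈ e.source) :
    R ≠ 0 ∧ qdOrder R P = 0 := by
  induction P using OnePoint.rec with
  | infty =>
    obtain ⟨d, h1, h2, -⟩ := he.infinite hP
    have h3 : coeffAtInfty R ≠ 0 := fun hc => by
      rw [hc, neg_zero] at h2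
      exact h1 (pow_eq_zero_iff (two_ne_zero) |>.1 h2)
    have h4 : R.intDegree = -4 := by
      by_contra hne
      exact h3 (if_neg hne)
    refine ⟨?_, ?_⟩
    · rintro rfl
      simp at h4
    · change -R.intDegree - 4 = 0
      omega
  | coe z =>
    obtain ⟨d, h1, h2, -⟩ := he.finite z hP
    have h3 : value R z ≠ 0 := h2 ▸ pow_ne_zero 2 h1
    refine ⟨?_, order_eq_zero_of_value_ne_zero h3⟩
    rintro rfl
    exact h3 (value_zero z)

/-! ### Saturated sets -/

/-- A set is saturated if it contains, together with a point, the vertical segments through this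
point. -/
def IsSaturated (R : RatFunc ℂ) (Y : Set (OnePoint ℂ)) : Prop :=
  ∀ e, IsFlat R e → ∀ (w : ℂ) (τ : ℝ), (∀ s ∈ Set.uIcc 0 τ, w + (s : ℝ) * Complex.I ∈ e.target) →
    e.symm w ∈ Y → e.symm (w + (τ : ℝ) * Complex.I) ∈ Y

theorem IsSaturated.iff (hY : IsSaturated R Y) (he : IsFlat R e) {w : ℂ} {τ : ℝ}
    (h : ∀ s ∈ Set.uIcc 0 τ, w + (s : ℝ) * Complex.I ∈ e.target) :
    e.symm w ∈ Y ↔ e.symm (w + (τ : ℝ) * Complex.I) ∈ Y := by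
  refine ⟨hY e he w τ h, fun h1 => ?_⟩
  have h2 := hY e he (w + (τ : ℝ) * Complex.I) (-τ) (fun s hs => ?_) h1
  · have h3 : w + (τ : ℝ) * Complex.I + ((-τ : ℝ) : ℂ) * Complex.I = w := by
      push_cast
      ring
    rwa [h3] at h2
  · have h3 : w + (τ : ℝ) * Complex.I + (s : ℝ) * Complex.I =
        w + ((τ + s : ℝ) : ℂ) * Complex.I := by
      push_cast
      ring
    rw [h3]
    refine h _ ?_
    rcases Set.mem_uIcc.1 hs with hs | hs
    · exact Set.mem_uIcc.2 (Or.inr ⟨by linarith, by linarith⟩)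
    · exact Set.mem_uIcc.2 (Or.inl ⟨by linarith, by linarith⟩)

/-- `γ` stays locally on vertical lines. -/
def StraightAt (R : RatFunc ℂ) (γ : ℝ → OnePoint ℂ) (t : ℝ) : Prop :=
  ∃ e, IsFlat R e ∧ γ t ∈ e.source ∧ ContinuousAt γ t ∧ ∀ᶠ s in 𝓝 t, (e (γ s)).re = (e (γ t)).re

theorem StraightAt.eventually_iff {t : ℝ} (h : StraightAt R γ t) (hY : IsSaturated R Y) :
    ∀ᶠ s in 𝓝 t, (γ s ∈ Y ↔ γ t ∈ Y) := by
  obtain ⟨e, he, ht, hc, h1⟩ := h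
  obtain ⟨r, hr, hball⟩ := Metric.isOpen_iff.1 e.open_target _ (e.map_source ht)
  have h2 : ContinuousAt (fun s => e (γ s)) t := ContinuousAt.comp (e.continuousAt ht) hc
  filter_upwards [h1, h2.preimage_mem_nhds (Metric.ball_mem_nhds _ hr),
    hc.preimage_mem_nhds (e.open_source.mem_nhds ht)] with s hs1 hs2 hs3
  set τ := (e (γ s)).im - (e (γ t)).im with hτ
  have h3 : e (γ s) = e (γ t) + (τ : ℝ) * Complex.I := by
    apply Complex.ext <;> simp [hs1, hτ]
  have h4 := hY.iff he (w := e (γ t)) (τ := τ) (fun v hv => hball ?_)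
  · rw [← h3, e.left_inv ht, e.left_inv hs3] at h4
    exact h4.symm
  · have h5 : ‖((τ : ℝ) : ℂ) * Complex.I‖ < r := by
      have : ‖e (γ s) - e (γ t)‖ < r := mem_ball_iff_norm.1 hs2
      rw [h3, add_sub_cancel_left] at this
      exact this
    rw [mem_ball_iff_norm, add_sub_cancel_left]
    refine lt_of_le_of_lt ?_ h5
    simp only [norm_mul, Complex.norm_I, mul_one, Complex.norm_real, Real.norm_eq_abs]
    rcases Set.mem_uIcc.1 hv with hv | hv
    · rw [abs_of_nonneg hv.1, abs_of_nonneg (hv.1.trans hv.2)]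
      exact hv.2
    · rw [abs_of_nonpos hv.2, abs_of_nonpos (hv.1.trans hv.2)]
      linarith

/-- Membership in a saturated set is locally constant along a straight curve, and the parameter
interval is connected. Neither speed nor orientation matters, so this applies to arbitrary
parametrizations. -/
theorem IsSaturated.mem_of_straight (hY : IsSaturated R Y) (hD : D.OrdConnected)
    (h : ∀ t ∈ D, StraightAt R γ t) {t₀ : ℝ} (ht₀ : t₀ ∈ D) (h0 : γ t₀ ∈ Y) :
    ∀ t ∈ D, γ t ∈ Y := by
  have hsub : D ⊆ {t | ∀ᶠ s in 𝓝 t, γ s ∈ Y} := by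
    refine hD.isPreconnected.subset_of_closure_inter_subset isOpen_setOfPred_eventually_nhds
      ⟨t₀, ht₀, ?_⟩ ?_
    · change ∀ᶠ s in 𝓝 t₀, γ s ∈ Y
      filter_upwards [(h t₀ ht₀).eventually_iff hY] with s hs using hs.2 h0
    · rintro t ⟨htc, htD⟩
      have h1 := (h t htD).eventually_iff hY
      obtain ⟨s, hs1, hs2⟩ := mem_closure_iff_nhds.1 htc _ h1
      change ∀ᶠ s in 𝓝 t, γ s ∈ Y
      have h2 : γ t ∈ Y := hs1.1 (hs2 : ∀ᶠ v in 𝓝 s, γ v ∈ Y).self_of_nhds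
      filter_upwards [h1] with v hv using hv.2 h2
  exact fun t ht => (hsub ht : ∀ᶠ s in 𝓝 t, γ s ∈ Y).self_of_nhds

/-- A maximal curve cannot stop inside a chart: it follows the vertical segment as far as the chart
allows. -/
theorem IsMaxCurve.isSaturated (hM : IsMaxCurve R γ D) : IsSaturated R (γ '' D) := by
  rintro e he w τ hseg ⟨t, ht, htw⟩
  have hw : w ∈ e.target := by simpa using hseg 0 Set.left_mem_uIcc
  have hts : γ t ∈ e.source := htw ▸ e.map_target hw
  obtain ⟨ε, hε, hrel⟩ := (hM.vert t ht).chart' he hts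
  have hew : e (γ t) = w := by rw [htw, e.right_inv hw]
  have hε2 : ε * ε = 1 := by rcases hε with rfl | rfl <;> norm_num
  obtain ⟨h1, h2⟩ := hM.follow (τ := ε * τ) he ht hε hrel (fun s hs => by
    rw [hew]
    refine hseg _ ?_
    rcases hε with rfl | rfl
    · simpa using hs
    · rcases Set.mem_uIcc.1 hs with hs | hs
      · exact Set.mem_uIcc.2 (Or.inr ⟨by linarith, by linarith⟩)
      · exact Set.mem_uIcc.2 (Or.inl ⟨by linarith, by linarith⟩))
  refine ⟨_, h1, ?_⟩
  rw [h2, hew, ← mul_assoc, hε2, one_mul]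

end CriticalMeasure

namespace CriticalMeasure

variable {R : RatFunc ℂ} {e : OpenPartialHomeomorph (OnePoint ℂ) ℂ} {γ η : ℝ → OnePoint ℂ}
  {D : Set ℝ} {Y : Set (OnePoint ℂ)}

/-! ### Horizontal arcs -/

theorem coe_coordZ {P : OnePoint ℂ} (hP : P ≠ OnePoint.infty) : ((coordZ P : ℂ) : OnePoint ℂ) = P := by
  induction P using OnePoint.rec with
  | infty => exact absurd rfl hP
  | coe z => rfl

theorem re_eq_zero_of_sq {z : ℂ} (h : 0 < -z ^ 2) : z.re = 0 := by
  rw [Complex.lt_def] at h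
  obtain ⟨h1, h2⟩ := h
  rw [Complex.zero_re, Complex.neg_re, sq, Complex.mul_re] at h1
  rw [Complex.zero_im, Complex.neg_im, sq, Complex.mul_im] at h2
  by_contra hne
  have h3 : z.re * z.im = 0 := by linarith
  have h4 : z.im = 0 := (mul_eq_zero.1 h3).resolve_left hne
  rw [h4] at h1
  nlinarith [mul_self_nonneg z.re]

/-- Since `e'² = R`, the condition says `-(e' z')² > 0`, so the velocity in the chart is purely
imaginary. -/
theorem IsHorizontal.hasDerivAt_re {α β : ℝ} (hη : IsHorizontal R α β η) (he : IsFlat R e) {s : ℝ}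
    (hs : s ∈ Set.Ioo α β) (hse : η s ∈ e.source) (hsi : η s ≠ OnePoint.infty) :
    HasDerivAt (fun s => (e (η s)).re) 0 s := by
  obtain ⟨h1, h2⟩ := hη.finite s hs hsi
  have h3 : HasDerivAt (fun s => coordZ (η s)) (deriv (fun s => coordZ (η s)) s) s :=
    (h1.differentiableAt (by simp)).hasDerivAt
  have hsz : coordZ (η s) ∈ (planeChart e).source := by
    rw [mem_planeChart_source, coe_coordZ hsi]
    exact hse
  have h4 := he.isNatural.hasDerivAt _ hsz
  have h5 : HasDerivAt (fun s => planeChart e (coordZ (η s)))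
      (deriv (planeChart e) (coordZ (η s)) * deriv (fun s => coordZ (η s)) s) s := by
    have := h4.scomp s h3
    rwa [smul_eq_mul, mul_comm] at this
  have h6 : HasDerivAt (fun s => (planeChart e (coordZ (η s))).re)
      (deriv (planeChart e) (coordZ (η s)) * deriv (fun s => coordZ (η s)) s).re s :=
    Complex.reCLM.hasFDerivAt.comp_hasDerivAt s h5
  rw [re_eq_zero_of_sq] at h6
  · refine h6.congr_of_eventuallyEq ?_
    have hc := hη.continuousOn.continuousAt (Ioo_mem_nhds hs.1 hs.2)
    filter_upwards [hc.preimage_mem_nhds (isOpen_ne.mem_nhds hsi)] with v hv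
    rw [planeChart_apply, coe_coordZ hv]
  · rw [mul_pow, he.isNatural.sq_deriv _ hsz, ← neg_mul]
    exact h2

/-- The exceptional time accommodates a passage through `∞`, where the coordinate `z` has no
derivative to offer. -/
theorem eventually_eq_of_hasDerivAt_punctured {f : ℝ → ℝ} {t : ℝ}
    (hc : ∀ᶠ s in 𝓝 t, ContinuousAt f s) (hd : ∀ᶠ s in 𝓝[≠] t, HasDerivAt f 0 s) :
    ∀ᶠ s in 𝓝 t, f s = f t := by
  rw [eventually_nhdsWithin_iff] at hd
  obtain ⟨r, hr, hball⟩ := Metric.mem_nhds_iff.1 (hc.and hd)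
  filter_upwards [Metric.ball_mem_nhds t hr] with s hs
  have hsub : Set.uIcc t s ⊆ Metric.ball t r :=
    (convex_ball t r).ordConnected.uIcc_subset (Metric.mem_ball_self hr) hs
  have h1 := integral_eq_of_hasDerivAt_off_countable f (fun _ => 0) (a := t) (b := s) (s := {t})
    (Set.countable_singleton t) (fun v hv => (hball (hsub hv)).1.continuousWithinAt)
    (fun v hv => (hball (hsub (Set.uIoo_subset_uIcc_self hv.1))).2 hv.2)
    intervalIntegrable_const
  rw [intervalIntegral.integral_zero] at h1
  linarith

theorem IsHorizontal.straightAt {α β : ℝ} (hη : IsHorizontal R α β η) {t : ℝ}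
    (ht : t ∈ Set.Ioo α β) : StraightAt R η t := by
  have hO : Set.Ioo α β ∈ 𝓝 t := Ioo_mem_nhds ht.1 ht.2
  have hc : ∀ s ∈ Set.Ioo α β, ContinuousAt η s := fun s hs =>
    hη.continuousOn.continuousAt (Ioo_mem_nhds hs.1 hs.2)
  have hpt : ∃ e, IsFlat R e ∧ η t ∈ e.source := by
    by_cases hti : η t = OnePoint.infty
    · have h1 := (hη.infinite t ht hti).2
      have h2 : R.intDegree = -4 := by
        by_contra hne
        rw [coeffAtInfty, if_neg hne, zero_mul] at h1
        exact lt_irrefl _ h1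
      have hR : R ≠ 0 := by
        rintro rfl
        simp at h2
      refine exists_isFlat hR ?_
      rw [hti]
      change -R.intDegree - 4 = 0
      omega
    · have h1 := (hη.finite t ht hti).2
      have h2 : value R (coordZ (η t)) ≠ 0 := fun hc => by
        rw [hc, neg_zero, zero_mul] at h1
        exact lt_irrefl _ h1
      have hR : R ≠ 0 := by
        rintro rfl
        exact h2 (value_zero _)
      refine exists_isFlat hR ?_
      rw [← coe_coordZ hti]
      exact order_eq_zero_of_value_ne_zero h2
  obtain ⟨e, he, hte⟩ := hpt
  refine ⟨e, he, hte, hc t ht, ?_⟩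
  have hsrc : ∀ᶠ s in 𝓝 t, η s ∈ e.source :=
    (hc t ht).preimage_mem_nhds (e.open_source.mem_nhds hte)
  refine eventually_eq_of_hasDerivAt_punctured (f := fun s => (e (η s)).re) ?_ ?_
  · filter_upwards [hO, hsrc] with s hs hs'
    exact Complex.continuous_re.continuousAt.comp
      (ContinuousAt.comp (e.continuousAt hs') (hc s hs))
  -- The coordinate `w` has nonzero derivative along the arc at `∞`, so passages through `∞` are
  -- isolated.
  · have hne : ∀ᶠ s in 𝓝[≠] t, η s ≠ OnePoint.infty := by
      by_cases hti : η t = OnePoint.infty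
      · obtain ⟨h1, h2⟩ := hη.infinite t ht hti
        have h3 : HasDerivAt (fun s => coordW (η s)) (deriv (fun s => coordW (η s)) t) t :=
          (h1.differentiableAt (by simp)).hasDerivAt
        have h4 : deriv (fun s => coordW (η s)) t ≠ 0 := fun hc => by
          rw [hc] at h2
          simp at h2
        filter_upwards [h3.eventually_ne h4 (c := coordW OnePoint.infty)] with s hs hc
        exact hs (by rw [hc])
      · exact mem_nhdsWithin_of_mem_nhds ((hc t ht).preimage_mem_nhds (isOpen_ne.mem_nhds hti))
    filter_upwards [mem_nhdsWithin_of_mem_nhds hO, mem_nhdsWithin_of_mem_nhds hsrc, hne]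
      with s hs hs' hsi
    exact hη.hasDerivAt_re he hs hs' hsi

theorem IsSaturated.image_subset (hY : IsSaturated R Y) {α β : ℝ} (hη : IsHorizontal R α β η)
    {P : OnePoint ℂ} (hP : P ∈ η '' Set.Ioo α β) (hPY : P ∈ Y) : η '' Set.Ioo α β ⊆ Y := by
  obtain ⟨t, ht, rfl⟩ := hP
  rintro _ ⟨s, hs, rfl⟩
  exact hY.mem_of_straight Set.ordConnected_Ioo (fun v hv => hη.straightAt hv) ht hPY s hs

/-! ### Vertical curves are horizontal arcs -/

theorem contDiffAt_symm_comp {f : OpenPartialHomeomorph ℂ ℂ} (hf : DifferentiableOn ℂ f f.source)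
    {z d : ℂ} (hz : z ∈ f.source) (hd : HasDerivAt f d z) (hd0 : d ≠ 0) {g : ℝ → ℂ} {t : ℝ}
    (hg : ContDiffAt ℝ 1 g t) (hgt : g t = f z) :
    ContDiffAt ℝ 1 (fun s => f.symm (g s)) t ∧ deriv (fun s => f.symm (g s)) t = deriv g t / d := by
  have hw : f z ∈ f.target := f.map_source hz
  have hsz : f.symm (f z) = z := f.left_inv hz
  have hd' : HasDerivAt f d (f.symm (f z)) := hsz.symm ▸ hd
  have h1 : ContDiffAt ℂ 1 f (f.symm (f z)) := by
    rw [hsz]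
    exact (hf.contDiffOn f.open_source).contDiffAt (f.open_source.mem_nhds hz)
  have h2 : ContDiffAt ℝ 1 f.symm (g t) := by
    rw [hgt]
    exact (f.contDiffAt_symm_deriv hd0 hw hd' h1).restrict_scalars ℝ
  refine ⟨h2.comp t hg, ?_⟩
  have h3 : HasDerivAt f.symm d⁻¹ (g t) := by
    rw [hgt]
    exact f.hasDerivAt_symm hw hd0 hd'
  have h4 : HasDerivAt g (deriv g t) t := (hg.differentiableAt (by simp)).hasDerivAt
  have h5 := h3.scomp t h4
  rw [smul_eq_mul] at h5
  exact h5.deriv.trans (div_eq_mul_inv _ _).symm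

/-- The chart in the coordinate `w = 1 / z` at infinity. -/
noncomputable def inftyChart (e : OpenPartialHomeomorph (OnePoint ℂ) ℂ) :
    OpenPartialHomeomorph ℂ ℂ :=
  (isOpenEmbedding_invSphere.toOpenPartialHomeomorph invSphere).trans e

theorem inftyChart_apply (z : ℂ) : inftyChart e z = e (invSphere z) := by
  simp [inftyChart]

theorem mem_inftyChart_source {z : ℂ} : z ∈ (inftyChart e).source ↔ invSphere z ∈ e.source := by
  simp [inftyChart]

theorem IsFlat.differentiableOn_inftyChart (he : IsFlat R e) :
    DifferentiableOn ℂ (inftyChart e) (inftyChart e).source := by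
  intro z hz
  rw [mem_inftyChart_source] at hz
  refine DifferentiableAt.differentiableWithinAt ?_
  by_cases hz0 : z = 0
  · rw [hz0, invSphere_zero] at hz
    obtain ⟨d, -, -, h⟩ := he.infinite hz
    rw [hz0]
    refine h.differentiableAt.congr_of_eventuallyEq (Eventually.of_forall fun w => ?_)
    exact inftyChart_apply w
  · rw [invSphere_of_ne hz0] at hz
    obtain ⟨d, -, -, h⟩ := he.finite _ hz
    have h2 : DifferentiableAt ℂ (fun w : ℂ => e ((w⁻¹ : ℂ) : OnePoint ℂ)) z :=
      h.differentiableAt.comp z (differentiableAt_inv hz0)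
    refine h2.congr_of_eventuallyEq ?_
    filter_upwards [isOpen_ne.mem_nhds hz0] with w hw
    rw [inftyChart_apply, invSphere_of_ne hw]

theorem pos_of_sq_eq {ε τ : ℝ} (hε : ε = 1 ∨ ε = -1) (hτ : τ ≠ 0) {d v : ℂ} (hd0 : d ≠ 0)
    (hd : d ^ 2 = v) : 0 < -v * (((ε * τ : ℝ) : ℂ) * Complex.I / d) ^ 2 := by
  have h1 : -v * (((ε * τ : ℝ) : ℂ) * Complex.I / d) ^ 2 = ((τ ^ 2 : ℝ) : ℂ) := by
    have h2 : ((ε : ℝ) : ℂ) ^ 2 = 1 := by rcases hε with rfl | rfl <;> simp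
    rw [← hd, div_pow, mul_pow, Complex.I_sq]
    push_cast
    field_simp
    linear_combination h2
  rw [h1]
  exact Complex.zero_lt_real.2 (by positivity)

/-- The reparametrization `φ` permits a curve with unbounded time domain to be presented on a
bounded interval. -/
theorem VertOn.isHorizontal (h : VertOn R γ D) {α β : ℝ} (hαβ : α < β) {φ : ℝ → ℝ}
    (hφD : ∀ s ∈ Set.Ioo α β, φ s ∈ D) (hφ : ∀ s ∈ Set.Ioo α β, ContDiffAt ℝ 1 φ s)
    (hφ' : ∀ s ∈ Set.Ioo α β, deriv φ s ≠ 0) : IsHorizontal R α β (fun s => γ (φ s)) := by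
  have hcont : ∀ s ∈ Set.Ioo α β, ContinuousAt (fun s => γ (φ s)) s := fun s hs =>
    ContinuousAt.comp (h _ (hφD s hs)).continuousAt (hφ s hs).continuousAt
  have hg : ∀ (ε : ℝ) (c : ℂ), ∀ s ∈ Set.Ioo α β,
      ContDiffAt ℝ 1 (fun s => c + ((ε * φ s : ℝ) : ℂ) * Complex.I) s ∧
      deriv (fun s => c + ((ε * φ s : ℝ) : ℂ) * Complex.I) s =
        ((ε * deriv φ s : ℝ) : ℂ) * Complex.I := by
    intro ε c s hs
    have h1 := hφ s hs
    constructor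
    · exact contDiffAt_const.add ((Complex.ofRealCLM.contDiff.contDiffAt.comp s
        (contDiffAt_const.mul h1)).mul contDiffAt_const)
    · have h2 : HasDerivAt φ (deriv φ s) s := (h1.differentiableAt (by simp)).hasDerivAt
      exact (((h2.const_mul ε).ofReal_comp.mul_const Complex.I).const_add c).deriv
  refine ⟨hαβ, fun s hs => (hcont s hs).continuousWithinAt, fun t ht hti => ?_, fun t ht hti => ?_⟩
  · obtain ⟨e, he, ε, c, hε, h1⟩ := h _ (hφD t ht)
    obtain ⟨h2, h3⟩ := hg ε c t ht
    have ht0 := h1.self_of_nhds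
    have hzs : coordZ (γ (φ t)) ∈ (planeChart e).source := by
      rw [mem_planeChart_source, coe_coordZ hti]
      exact ht0.1
    obtain ⟨h4, h5⟩ := contDiffAt_symm_comp he.isNatural.differentiableOn hzs
      (he.isNatural.hasDerivAt _ hzs) (he.isNatural.deriv_ne_zero _ hzs) h2
      (by rw [planeChart_apply, coe_coordZ hti, ht0.2])
    have h6 : (fun s => coordZ (γ (φ s))) =ᶠ[𝓝 t]
        fun s => (planeChart e).symm (c + ((ε * φ s : ℝ) : ℂ) * Complex.I) := by
      filter_upwards [(hφ t ht).continuousAt.eventually h1,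
        (hcont t ht).preimage_mem_nhds (isOpen_ne.mem_nhds hti)] with s hs hsi
      have hsi' : γ (φ s) ≠ OnePoint.infty := hsi
      rw [← hs.2, ← coe_coordZ hsi', ← planeChart_apply, (planeChart e).left_inv]
      · rfl
      · rw [mem_planeChart_source, coe_coordZ hsi']
        exact hs.1
    refine ⟨h4.congr_of_eventuallyEq h6, ?_⟩
    rw [h6.deriv_eq, h5, h3]
    exact pos_of_sq_eq hε (hφ' t ht) (he.isNatural.deriv_ne_zero _ hzs) (he.isNatural.sq_deriv _ hzs)
  · obtain ⟨e, he, ε, c, hε, h1⟩ := h _ (hφD t ht)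
    obtain ⟨h2, h3⟩ := hg ε c t ht
    have ht0 := h1.self_of_nhds
    rw [hti] at ht0
    obtain ⟨d, hd0, hd2, hd⟩ := he.infinite ht0.1
    have hzs : (0 : ℂ) ∈ (inftyChart e).source := by
      rw [mem_inftyChart_source, invSphere_zero]
      exact ht0.1
    have hd' : HasDerivAt (inftyChart e) d 0 :=
      hd.congr_of_eventuallyEq (Eventually.of_forall fun w => inftyChart_apply w)
    obtain ⟨h4, h5⟩ := contDiffAt_symm_comp he.differentiableOn_inftyChart hzs hd' hd0 h2
      (by rw [inftyChart_apply, invSphere_zero, ht0.2])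
    have h6 : (fun s => coordW (γ (φ s))) =ᶠ[𝓝 t]
        fun s => (inftyChart e).symm (c + ((ε * φ s : ℝ) : ℂ) * Complex.I) := by
      have h7 : γ (φ t) ≠ ((0 : ℂ) : OnePoint ℂ) := by
        have hti' : γ (φ t) = OnePoint.infty := hti
        rw [hti']
        exact OnePoint.infty_ne_coe 0
      filter_upwards [(hφ t ht).continuousAt.eventually h1,
        (hcont t ht).preimage_mem_nhds (isOpen_ne.mem_nhds h7)] with s hs hsi
      have hsi' : γ (φ s) ≠ ((0 : ℂ) : OnePoint ℂ) := hsi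
      rw [← hs.2]
      nth_rewrite 2 [← invSphere_coordW hsi']
      rw [← inftyChart_apply, (inftyChart e).left_inv]
      rw [mem_inftyChart_source, invSphere_coordW hsi']
      exact hs.1
    refine ⟨h4.congr_of_eventuallyEq h6, ?_⟩
    rw [h6.deriv_eq, h5, h3]
    have := pos_of_sq_eq hε (hφ' t ht) hd0 hd2
    rwa [neg_neg] at this

theorem eq_Ioo_of_isOpen {s : Set ℝ} (ho : IsOpen s) (hc : s.OrdConnected) (hne : s.Nonempty)
    (hb : BddBelow s) (ha : BddAbove s) : ∃ α β, α < β ∧ s = Set.Ioo α β := by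
  have h1 := IsConnected.Ioo_csInf_csSup_subset ⟨hne, hc.isPreconnected⟩ hb ha
  have h2 : s ⊆ Set.Ioo (sInf s) (sSup s) := by
    intro x hx
    obtain ⟨r, hr, hball⟩ := Metric.isOpen_iff.1 ho x hx
    rw [Real.ball_eq_Ioo] at hball
    have h3 := csInf_le hb (hball ⟨by linarith, by linarith⟩ : x - r / 2 ∈ s)
    have h4 := le_csSup ha (hball ⟨by linarith, by linarith⟩ : x + r / 2 ∈ s)
    exact ⟨by linarith, by linarith⟩
  obtain ⟨x, hx⟩ := hne
  exact ⟨_, _, (h2 hx).1.trans (h2 hx).2, h2.antisymm h1⟩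

/-- The endpoints of a horizontal arc are real numbers, whereas `D` may be unbounded; the
substitution `t = tan s` maps it from a bounded interval. -/
theorem IsMaxCurve.isHorizontalArc (hM : IsMaxCurve R γ D) : IsHorizontalArc R (γ '' D) := by
  have hcos : ∀ s ∈ Real.arctan '' D, 0 < Real.cos s := by
    rintro _ ⟨t, -, rfl⟩
    exact Real.cos_arctan_pos t
  have ho : IsOpen (Real.arctan '' D) := by
    have h1 : Real.arctan '' D = Set.Ioo (-(Real.pi / 2)) (Real.pi / 2) ∩ Real.tan ⁻¹' D := by
      ext s
      constructor
      · rintro ⟨t, ht, rfl⟩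
        refine ⟨Real.arctan_mem_Ioo t, ?_⟩
        rwa [Set.mem_preimage, Real.tan_arctan]
      · rintro ⟨hs, hs'⟩
        exact ⟨_, hs', Real.arctan_tan hs.1 hs.2⟩
    rw [h1]
    exact Real.continuousOn_tan_Ioo.isOpen_inter_preimage isOpen_Ioo hM.isOpen
  obtain ⟨α, β, hαβ, hI⟩ := eq_Ioo_of_isOpen ho
    (hM.ordConnected.isPreconnected.image _ Real.continuous_arctan.continuousOn).ordConnected
    (hM.nonempty.image _)
    ⟨-(Real.pi / 2), by rintro _ ⟨t, -, rfl⟩; exact (Real.neg_pi_div_two_lt_arctan t).le⟩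
    ⟨Real.pi / 2, by rintro _ ⟨t, -, rfl⟩; exact (Real.arctan_lt_pi_div_two t).le⟩
  refine ⟨α, β, fun s => γ (Real.tan s), hM.vert.isHorizontal hαβ (fun s hs => ?_) (fun s hs => ?_)
    (fun s hs => ?_), ?_⟩
  · rw [← hI] at hs
    obtain ⟨t, ht, rfl⟩ := hs
    rwa [Real.tan_arctan]
  · rw [← hI] at hs
    exact Real.contDiffAt_tan.2 (hcos s hs).ne'
  · rw [← hI] at hs
    rw [Real.deriv_tan]
    have := hcos s hs
    positivity
  · rw [← hI, Set.image_image]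
    simp_rw [Real.tan_arctan]

/-! ### Trajectories -/

/-- The image of a maximal curve is saturated, so it absorbs every horizontal arc that meets it; it
is also a horizontal arc itself. Hence such images are exactly the maximal arcs. -/
theorem isTrajectory_iff {T : Set (OnePoint ℂ)} :
    IsTrajectory R T ↔ ∃ γ D, IsMaxCurve R γ D ∧ T = γ '' D := by
  constructor
  · rintro ⟨⟨α, β, η, hη, rfl⟩, hmax⟩
    obtain ⟨t, ht⟩ := Set.nonempty_Ioo.2 hη.lt
    obtain ⟨e, he, hte, -, -⟩ := hη.straightAt ht
    obtain ⟨γ, D, hM, h0, hγ0⟩ := exists_isMaxCurve he hte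
    have h1 : η '' Set.Ioo α β ⊆ γ '' D :=
      hM.isSaturated.image_subset hη ⟨t, ht, rfl⟩ ⟨0, h0, hγ0⟩
    exact ⟨γ, D, hM, h1.antisymm (hmax hM.isHorizontalArc h1)⟩
  · rintro ⟨γ, D, hM, rfl⟩
    refine ⟨hM.isHorizontalArc, ?_⟩
    rintro _ ⟨α, β, η, hη, rfl⟩ hsub
    obtain ⟨t, ht⟩ := hM.nonempty
    exact hM.isSaturated.image_subset hη (hsub ⟨t, ht, rfl⟩) ⟨t, ht, rfl⟩

theorem IsMaxCurve.isTrajectory (hM : IsMaxCurve R γ D) : IsTrajectory R (γ '' D) :=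
  isTrajectory_iff.2 ⟨γ, D, hM, rfl⟩

/-- Two trajectories with a common point coincide. -/
theorem IsTrajectory.eq_of_mem {T T' : Set (OnePoint ℂ)} (hT : IsTrajectory R T)
    (hT' : IsTrajectory R T') {P : OnePoint ℂ} (hP : P ∈ T) (hP' : P ∈ T') : T = T' := by
  obtain ⟨γ, D, hM, rfl⟩ := isTrajectory_iff.1 hT
  obtain ⟨α, β, η, hη, rfl⟩ := hT'.1
  have h1 := hM.isSaturated.image_subset hη hP' hP
  exact (hT'.2 hT.1 h1).antisymm h1

theorem IsTrajectory.subset_of_saturated {T : Set (OnePoint ℂ)} (hT : IsTrajectory R T)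
    (hY : IsSaturated R Y) {P : OnePoint ℂ} (hP : P ∈ T) (hPY : P ∈ Y) : T ⊆ Y := by
  obtain ⟨α, β, η, hη, rfl⟩ := hT.1
  exact hY.image_subset hη hP hPY

theorem IsMaxCurve.notMem_singularPoints (hM : IsMaxCurve R γ D) {t : ℝ} (ht : t ∈ D) :
    qdOrder R (γ t) = 0 := by
  obtain ⟨e, he, ε, c, hε, h⟩ := hM.vert t ht
  exact (he.qdOrder_eq_zero h.self_of_nhds.1).2

end CriticalMeasure

namespace CriticalMeasure

variable {p : ℕ} {a ρ : Fin (p + 1) → ℂ} {ν : Measure ℂ} {h : ℂ → ℝ} {R : RatFunc ℂ}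

/-! ### The support is a union of trajectories -/

/-- The chart `z ↦ e z + c`. -/
noncomputable def shiftChart {X : Type*} [TopologicalSpace X] (e : OpenPartialHomeomorph X ℂ)
    (c : ℂ) : OpenPartialHomeomorph X ℂ :=
  e.trans (Homeomorph.addRight c).toOpenPartialHomeomorph

section

variable {X : Type*} [TopologicalSpace X] {e : OpenPartialHomeomorph X ℂ} {c : ℂ}

theorem shiftChart_apply (x : X) : shiftChart e c x = e x + c := rfl

theorem shiftChart_source : (shiftChart e c).source = e.source := by
  simp [shiftChart]

theorem shiftChart_symm_apply (w : ℂ) : (shiftChart e c).symm w = e.symm (w - c) := by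
  simp [shiftChart, sub_eq_add_neg, Homeomorph.addRight_symm]

theorem mem_shiftChart_target {w : ℂ} : w ∈ (shiftChart e c).target ↔ w - c ∈ e.target := by
  simp [shiftChart, sub_eq_add_neg, Homeomorph.addRight_symm]

end

theorem IsNatural.shiftChart {e : OpenPartialHomeomorph ℂ ℂ} (he : IsNatural R e) (c : ℂ) :
    IsNatural R (shiftChart e c) := by
  refine isNatural_of_hasDerivAt (g := deriv e) (fun z hz => ?_) (fun z hz => ?_) fun z hz => ?_ <;>
    rw [shiftChart_source] at hz
  · exact (he.hasDerivAt z hz).add_const c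
  · exact he.sq_deriv z hz
  · exact he.value_ne_zero hz

theorem IsFlat.shiftChart {e : OpenPartialHomeomorph (OnePoint ℂ) ℂ} (he : IsFlat R e) (c : ℂ) :
    IsFlat R (shiftChart e c) where
  finite z hz := by
    rw [shiftChart_source] at hz
    obtain ⟨d, h1, h2, h3⟩ := he.finite z hz
    exact ⟨d, h1, h2, h3.add_const c⟩
  infinite hi := by
    rw [shiftChart_source] at hi
    obtain ⟨d, h1, h2, h3⟩ := he.infinite hi
    exact ⟨d, h1, h2, h3.add_const c⟩

theorem isClosed_coe_support (H : IsPolar ν h) :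
    IsClosed ((fun z : ℂ => (z : OnePoint ℂ)) '' ν.support) :=
  (H.compact.image OnePoint.continuous_coe).isClosed

theorem coe_mem_support_iff {z : ℂ} :
    (z : OnePoint ℂ) ∈ (fun z : ℂ => (z : OnePoint ℂ)) '' ν.support ↔ z ∈ ν.support :=
  OnePoint.coe_injective.mem_set_image

/-- A chart at a point of the support, centred at this point. -/
theorem IsSquare.eventually_mem_support (hR : IsSquare a ρ ν h R) (H : IsPolar ν h)
    {e : OpenPartialHomeomorph (OnePoint ℂ) ℂ} (he : IsFlat R e) {w : ℂ} (hw : w ∈ e.target)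
    (hs : e.symm w ∈ (fun z : ℂ => (z : OnePoint ℂ)) '' ν.support) :
    ∀ᶠ τ in 𝓝 (0 : ℝ), e.symm (w + (τ : ℝ) * Complex.I) ∈
      (fun z : ℂ => (z : OnePoint ℂ)) '' ν.support := by
  have hne : e.symm w ≠ OnePoint.infty := by
    obtain ⟨z, -, hz⟩ := hs
    rw [← hz]
    exact OnePoint.coe_ne_infty z
  set f := shiftChart (planeChart e) (-w) with hf
  have hfn : IsNatural R f := he.isNatural.shiftChart _
  have h0 : (0 : ℂ) ∈ f.target := by
    rw [hf, mem_shiftChart_target, zero_sub, neg_neg]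
    exact mem_planeChart_target.2 ⟨hw, hne⟩
  obtain ⟨r, hr, hball⟩ := Metric.isOpen_iff.1 f.open_target _ h0
  have hrect : rect (-(r / 2)) (r / 2) (r / 2) ⊆ f.target := by
    intro v hv
    obtain ⟨⟨h1, h2⟩, h3, h4⟩ := mem_rect.1 hv
    refine hball (mem_ball_zero_iff.2 ((Complex.norm_le_abs_re_add_abs_im v).trans_lt ?_))
    have := abs_lt.2 ⟨h1, h2⟩
    have := abs_lt.2 ⟨h3, h4⟩
    linarith
  have hcoe : ∀ v ∈ f.target, ((f.symm v : ℂ) : OnePoint ℂ) = e.symm (w + v) := by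
    intro v hv
    rw [hf, mem_shiftChart_target] at hv
    rw [hf, shiftChart_symm_apply, planeChart_symm_apply hv]
    congr 1
    ring
  have h0r : (0 : ℂ) ∈ rect (-(r / 2)) (r / 2) (r / 2) :=
    mem_rect.2 ⟨⟨by simpa using hr, by simpa using hr⟩, by simpa using hr, by simpa using hr⟩
  filter_upwards [Metric.ball_mem_nhds (0 : ℝ) (half_pos hr)] with τ hτ
  rw [mem_ball_zero_iff, Real.norm_eq_abs, abs_lt] at hτ
  have hτr : (τ : ℂ) * Complex.I ∈ rect (-(r / 2)) (r / 2) (r / 2) :=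
    mem_rect.2 ⟨⟨by simpa using hr, by simpa using hr⟩, by simpa using hτ.1, by simpa using hτ.2⟩
  rw [← hcoe _ (hrect hτr)]
  refine coe_mem_support_iff.2 (hR.mem_support_vertical H hfn hrect h0r hτr (by simp) ?_)
  refine coe_mem_support_iff.1 ?_
  rwa [hcoe 0 h0, add_zero]

/-- Along a vertical segment of a chart the times spent in the support form a set that is open, by
local invariance, and closed, because the support is compact and hence closed in the sphere. -/
theorem IsSquare.isSaturated_support (hR : IsSquare a ρ ν h R) (H : IsPolar ν h) :
    IsSaturated R ((fun z : ℂ => (z : OnePoint ℂ)) '' ν.support) := by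
  intro e he w τ hseg hw
  set S := (fun z : ℂ => (z : OnePoint ℂ)) '' ν.support with hS
  have hSc : IsClosed S := isClosed_coe_support H
  have hcont : ∀ s ∈ Set.uIcc 0 τ, ContinuousAt
      (fun s : ℝ => e.symm (w + (s : ℝ) * Complex.I)) s := fun s hs =>
    ContinuousAt.comp (f := fun s : ℝ => w + (s : ℝ) * Complex.I)
      (e.continuousAt_symm (hseg s hs)) (by fun_prop)
  have hloc : ∀ s ∈ Set.uIcc 0 τ, e.symm (w + (s : ℝ) * Complex.I) ∈ S →
      ∀ᶠ v in 𝓝 s, e.symm (w + (v : ℝ) * Complex.I) ∈ S := by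
    intro s hs hsS
    have h1 := hR.eventually_mem_support H he (hseg s hs) hsS
    have h2 : Tendsto (fun v : ℝ => v - s) (𝓝 s) (𝓝 0) := by
      have : Continuous fun v : ℝ => v - s := by fun_prop
      simpa using this.tendsto s
    filter_upwards [h2.eventually h1] with v hv
    have h3 : w + (s : ℝ) * Complex.I + ((v - s : ℝ) : ℂ) * Complex.I =
        w + (v : ℝ) * Complex.I := by
      push_cast
      ring
    rwa [h3] at hv
  have hsub : Set.uIcc 0 τ ⊆ {s | ∀ᶠ v in 𝓝 s, e.symm (w + ((v : ℝ) : ℂ) * Complex.I) ∈ S} := by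
    refine isPreconnected_uIcc.subset_of_closure_inter_subset isOpen_setOfPred_eventually_nhds
      ⟨0, Set.left_mem_uIcc, hloc 0 Set.left_mem_uIcc (by simpa using hw)⟩ ?_
    rintro s ⟨hsc, hs⟩
    refine hloc s hs ?_
    by_contra hns
    obtain ⟨v, hv1, hv2⟩ := mem_closure_iff_nhds.1 hsc _
      ((hcont s hs).preimage_mem_nhds (hSc.isOpen_compl.mem_nhds hns))
    exact hv1 (hv2 : ∀ᶠ u in 𝓝 v, e.symm (w + ((u : ℝ) : ℂ) * Complex.I) ∈ S).self_of_nhds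
  exact (hsub Set.right_mem_uIcc :
    ∀ᶠ v in 𝓝 τ, e.symm (w + ((v : ℝ) : ℂ) * Complex.I) ∈ S).self_of_nhds

/-- The trajectories that meet the support. -/
def supportTrajectories (R : RatFunc ℂ) (ν : Measure ℂ) : Set (Set (OnePoint ℂ)) :=
  {T | IsTrajectory R T ∧ ∃ z ∈ ν.support, (z : OnePoint ℂ) ∈ T}

theorem IsTrajectory.qdOrder_eq_zero {T : Set (OnePoint ℂ)} (hT : IsTrajectory R T)
    {P : OnePoint ℂ} (hP : P ∈ T) : qdOrder R P = 0 := by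
  obtain ⟨γ, D, hM, rfl⟩ := isTrajectory_iff.1 hT
  obtain ⟨t, ht, rfl⟩ := hP
  exact hM.notMem_singularPoints ht

theorem exists_isTrajectory (hR0 : R ≠ 0) {P : OnePoint ℂ} (hP : qdOrder R P = 0) :
    ∃ T, IsTrajectory R T ∧ P ∈ T := by
  obtain ⟨e, he, hPe⟩ := exists_isFlat hR0 hP
  obtain ⟨γ, D, hM, h0, hγ⟩ := exists_isMaxCurve he hPe
  exact ⟨_, hM.isTrajectory, 0, h0, hγ⟩

theorem IsSquare.trajectory_subset_support (hR : IsSquare a ρ ν h R) (H : IsPolar ν h)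
    {T : Set (OnePoint ℂ)} (hT : T ∈ supportTrajectories R ν) :
    T ⊆ (fun z : ℂ => (z : OnePoint ℂ)) '' ν.support := by
  obtain ⟨hT, z, hz, hzT⟩ := hT
  exact hT.subset_of_saturated (hR.isSaturated_support H) hzT ⟨z, hz, rfl⟩

/-- If `R = 0` then the measure vanishes. -/
theorem IsSquare.support_eq_empty (hR : IsSquare a ρ ν h 0) (H : IsPolar ν h) :
    ν.support = ∅ := by
  have := H.finite
  have h1 : ∀ᵐ z : ℂ, critFun a ρ ν h z = 0 := by
    filter_upwards [hR.ae_sq_eq H] with z hz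
    rw [value_zero] at hz
    exact pow_eq_zero_iff two_ne_zero |>.1 hz
  have hU : IsOpen (Set.range a)ᶜ := (Set.finite_range a).isClosed.isOpen_compl
  have h2 : ∀ᵐ x ∂ν, x ∈ (Set.range a)ᶜ → h x = 0 := by
    have hi : Integrable h ν := by
      refine Integrable.of_bound H.measurable.aestronglyMeasurable 1 (Eventually.of_forall fun x => ?_)
      rcases H.unit x with hx | hx <;> simp [hx]
    refine IsOpen.ae_eq_zero_of_integral_contDiff_smul_eq_zero hU
      (hi.locallyIntegrable.locallyIntegrableOn _) fun g hg hgc hgs => ?_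
    have hg' : ContDiff ℝ (⊤ : ℕ∞) fun w => (g w : ℂ) := Complex.ofRealCLM.contDiff.comp hg
    have hgc' : HasCompactSupport fun w => (g w : ℂ) := hgc.comp_left (g := ((↑) : ℝ → ℂ)) rfl
    have h3 := H.integral_dbar_mul_critFun (a := a) (ρ := ρ) hg' hgc' (fun k _ => by
      by_contra hne
      exact hgs (subset_tsupport _ (by simpa using hne)) ⟨k, rfl⟩)
    rw [integral_eq_zero_of_ae (by
      filter_upwards [h1] with z hz
      rw [hz, mul_zero]
      rfl)] at h3
    have h4 : ∫ x, (h x : ℂ) * (g x : ℂ) ∂ν = 0 := by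
      refine (mul_eq_zero.1 h3.symm).resolve_left ?_
      simp
    have h5 : ∫ x, (h x : ℂ) * (g x : ℂ) ∂ν = ((∫ x, g x • h x ∂ν : ℝ) : ℂ) := by
      rw [← integral_complex_ofReal]
      congr 1
      funext x
      rw [smul_eq_mul, mul_comm]
      push_cast
      rfl
    rw [h5] at h4
    exact_mod_cast h4
  have h3 : ν = 0 := by
    rw [← Measure.measure_univ_eq_zero]
    -- `C + Φ' = 0` almost everywhere, so the weak equation gives zero mass off the nodes; the nodes
    -- are not atoms.
    have h4 : ν (Set.range a)ᶜ = 0 := by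
      refine measure_mono_null ?_ (ae_iff.1 h2)
      intro x hx hc
      have := hc hx
      rcases H.unit x with hx | hx <;> rw [hx] at this <;> norm_num at this
    have h5 : ν (Set.range a) = 0 := by
      rw [← Set.iUnion_singleton_eq_range]
      exact measure_iUnion_null fun k => H.noAtom _
    rw [← Set.union_compl_self (Set.range a)]
    exact measure_union_null h5 h4
  rw [h3]
  exact Measure.support_zero

theorem IsSquare.sUnion_supportTrajectories (hR : IsSquare a ρ ν h R) (H : IsPolar ν h) :
    ⋃₀ supportTrajectories R ν =
      (fun z : ℂ => (z : OnePoint ℂ)) '' ν.support \ singularPoints R := by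
  ext P
  constructor
  · rintro ⟨T, hT, hP⟩
    refine ⟨hR.trajectory_subset_support H hT hP, fun hc => hc ?_⟩
    exact hT.1.qdOrder_eq_zero hP
  · rintro ⟨⟨z, hz, rfl⟩, hP⟩
    have hP' : qdOrder R (z : OnePoint ℂ) = 0 := not_not.1 hP
    have hR0 : R ≠ 0 := by
      rintro rfl
      rw [hR.support_eq_empty H] at hz
      exact hz
    obtain ⟨T, hT, hPT⟩ := exists_isTrajectory hR0 hP'
    exact ⟨T, ⟨hT, z, hz, hPT⟩, hPT⟩

/-- The singular points are finite in number and none is an atom, so every neighbourhood of a point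
of the support contains regular points of the support. -/
theorem IsSquare.closure_sUnion_supportTrajectories (hR : IsSquare a ρ ν h R) (H : IsPolar ν h) :
    closure (⋃₀ supportTrajectories R ν) = (fun z : ℂ => (z : OnePoint ℂ)) '' ν.support := by
  rw [hR.sUnion_supportTrajectories H]
  refine (closure_minimal Set.sdiff_subset (isClosed_coe_support H)).antisymm ?_
  rintro _ ⟨z, hz, rfl⟩
  have hR0 : R ≠ 0 := by
    rintro rfl
    rw [hR.support_eq_empty H] at hz
    exact hz
  have hfin : ((fun z : ℂ => (z : OnePoint ℂ)) ⁻¹' singularPoints R).Finite :=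
    (singularPoints_finite hR0).preimage (OnePoint.coe_injective.injOn)
  refine mem_closure_iff_nhds.2 fun U hU => ?_
  have hU' := OnePoint.continuous_coe.continuousAt.preimage_mem_nhds hU
  have h1 := (Measure.mem_support_iff_forall z).1 hz _ hU'
  by_contra hemp
  refine h1.ne' ?_
  have h2 : (fun z : ℂ => (z : OnePoint ℂ)) ⁻¹' U ⊆
      ν.supportᶜ ∪ (fun z : ℂ => (z : OnePoint ℂ)) ⁻¹' singularPoints R := by
    intro w hw
    by_contra hc
    simp only [Set.mem_union, Set.mem_compl_iff, not_or, not_not] at hc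
    exact hemp ⟨w, hw, ⟨w, hc.1, rfl⟩, hc.2⟩
  refine measure_mono_null h2 (measure_union_null (ae_iff.1 H.ae_mem) ?_)
  rw [← Set.biUnion_of_singleton ((fun z : ℂ => (z : OnePoint ℂ)) ⁻¹' singularPoints R)]
  exact (measure_biUnion_null_iff hfin.countable).2 fun x _ => H.noAtom x

end CriticalMeasure

/-! ### Closed trajectories, singular points and the ends of trajectories -/

namespace CriticalMeasure

variable {R : RatFunc ℂ} {e : OpenPartialHomeomorph (OnePoint ℂ) ℂ} {γ : ℝ → OnePoint ℂ}
  {D : Set ℝ}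

/-! ### Closed trajectories -/

theorem IsMaxCurve.comp_affine (hM : IsMaxCurve R γ D) {δ : ℝ} (hδ : δ = 1 ∨ δ = -1) (b : ℝ) :
    IsMaxCurve R (fun s => γ (δ * s + b)) {s | δ * s + b ∈ D} := by
  have hδ2 : δ * δ = 1 := by rcases hδ with rfl | rfl <;> norm_num
  have hinv : ∀ s, δ * (δ * s + -(δ * b)) + b = s := fun s => by
    linear_combination (s - b) * hδ2
  have hinv' : ∀ s, δ * (δ * s + b) + -(δ * b) = s := fun s => by
    linear_combination s * hδ2
  have hord : ∀ (E : Set ℝ) (c : ℝ), E.OrdConnected → {s | δ * s + c ∈ E}.OrdConnected := by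
    intro E c hE
    refine ⟨fun x hx y hy z hz => ?_⟩
    have hx' : δ * x + c ∈ E := hx
    have hy' : δ * y + c ∈ E := hy
    change δ * z + c ∈ E
    rcases hδ with rfl | rfl
    · exact hE.out hx' hy' ⟨by linarith [hz.1], by linarith [hz.2]⟩
    · exact hE.out hy' hx' ⟨by linarith [hz.2], by linarith [hz.1]⟩
  refine ⟨hM.isOpen.preimage (by fun_prop), hord D b hM.ordConnected, ?_,
    fun t ht => (hM.vert _ ht).comp_affine hδ, ?_⟩
  · obtain ⟨t, ht⟩ := hM.nonempty
    exact ⟨δ * t + -(δ * b), by rwa [Set.mem_ofPred_eq, hinv]⟩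
  · intro γ' D' hDo hDc hv t ht ht' heq
    have h1 := hM.maximal (fun s => γ' (δ * s + -(δ * b))) {s | δ * s + -(δ * b) ∈ D'}
      (hDo.preimage (by fun_prop)) (hord D' _ hDc) (fun s hs => (hv _ hs).comp_affine hδ)
      (δ * t + b) ht (by rwa [Set.mem_ofPred_eq, hinv']) (by
        have h2 : Tendsto (fun s => δ * s + -(δ * b)) (𝓝 (δ * t + b)) (𝓝 t) := by
          have : Continuous fun s => δ * s + -(δ * b) := by fun_prop
          simpa [hinv'] using this.tendsto (δ * t + b)
        filter_upwards [h2.eventually heq] with s hs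
        rw [hs, hinv])
    intro s hs
    refine h1 ?_
    rwa [Set.mem_ofPred_eq, hinv']

theorem VertAt.locally_injective {t : ℝ} (h : VertAt R γ t) :
    ∃ r > 0, ∀ s ∈ Metric.ball t r, ∀ s' ∈ Metric.ball t r, γ s = γ s' → s = s' := by
  obtain ⟨e, he, ε, c, hε, h1⟩ := h
  obtain ⟨r, hr, hball⟩ := Metric.mem_nhds_iff.1 h1
  refine ⟨r, hr, fun s hs s' hs' heq => ?_⟩
  have h2 := (hball hs).2
  rw [heq, (hball hs').2] at h2
  have h3 := congrArg Complex.im h2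
  simp at h3
  rcases hε with rfl | rfl <;> norm_num at h3 <;> exact h3.symm

/-- If a maximal curve takes the same value twice then it is periodic. -/
theorem IsMaxCurve.periodic (hM : IsMaxCurve R γ D) {t₁ t₂ : ℝ} (h₁ : t₁ ∈ D) (h₂ : t₂ ∈ D)
    (hne : t₁ ≠ t₂) (heq : γ t₁ = γ t₂) :
    D = Set.univ ∧ ∀ s, γ (s + (t₁ - t₂)) = γ s := by
  obtain ⟨e, he, ε₁, c₁, hε₁, hv₁⟩ := hM.vert t₁ h₁
  have hs₁ := hv₁.self_of_nhds.1
  obtain ⟨ε₂, c₂, hε₂, hv₂⟩ := (hM.vert t₂ h₂).chart he (heq ▸ hs₁)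
  have hε₁2 : ε₁ * ε₁ = 1 := by rcases hε₁ with rfl | rfl <;> norm_num
  -- `δ` compares the directions of the two passages. The curve coincides near `t₂` with its image
  -- under the affine change of time `s ↦ δ s + b` taking `t₂` to `t₁`; by maximality and unique
  -- continuation it does so on all of `D`.
  set δ := ε₁ * ε₂ with hδ'
  have hδ : δ = 1 ∨ δ = -1 := by
    rw [hδ']
    rcases hε₁ with rfl | rfl <;> rcases hε₂ with rfl | rfl <;> norm_num
  set b := t₁ - δ * t₂ with hb
  have hM' := hM.comp_affine hδ b
  have hbt : δ * t₂ + b = t₁ := by rw [hb]; ring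
  have hc : c₁ + (ε₁ * t₁ : ℝ) * Complex.I = c₂ + (ε₂ * t₂ : ℝ) * Complex.I := by
    rw [← hv₁.self_of_nhds.2, ← hv₂.self_of_nhds.2, heq]
  have hloc : (fun s => γ (δ * s + b)) =ᶠ[𝓝 t₂] γ := by
    have h3 : Tendsto (fun s => δ * s + b) (𝓝 t₂) (𝓝 t₁) := by
      have : Continuous fun s => δ * s + b := by fun_prop
      simpa [hbt] using this.tendsto t₂
    filter_upwards [h3.eventually hv₁, hv₂] with s hs hs'
    rw [← e.left_inv hs.1, ← e.left_inv hs'.1, hs.2, hs'.2]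
    congr 1
    have h4 : ε₁ * (δ * s + b) = ε₁ * t₁ + ε₂ * (s - t₂) := by
      rw [hb, hδ']
      linear_combination (ε₂ * (s - t₂)) * hε₁2
    rw [h4]
    push_cast at hc ⊢
    linear_combination hc
  have hsub1 : {s | δ * s + b ∈ D} ⊆ D :=
    hM.maximal _ _ hM'.isOpen hM'.ordConnected hM'.vert t₂ h₂ (by
      rw [Set.mem_ofPred_eq, hbt]
      exact h₁) hloc
  have hsub2 : D ⊆ {s | δ * s + b ∈ D} :=
    hM'.maximal _ _ hM.isOpen hM.ordConnected hM.vert t₂ (by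
      rw [Set.mem_ofPred_eq, hbt]
      exact h₁) h₂ hloc.symm
  have hD := VertOn.eqOn (fun t ht => hM'.vert t (hsub2 ht)) hM.vert hM.ordConnected h₂ hloc
  rcases hδ with h | h
  · rw [h] at hsub1 hsub2 hD
    have hb' : b = t₁ - t₂ := by rw [hb, h]; ring
    rw [hb'] at hsub1 hsub2 hD
    -- An interval invariant under a nonzero translation and its inverse is the whole line.
    have hup : ∀ n : ℕ, ∀ t ∈ D, t + n * (t₁ - t₂) ∈ D := by
      intro n
      induction n with
      | zero => intro t ht; simpa using ht
      | succ n ih =>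
        intro t ht
        have := hsub2 (ih t ht)
        rw [Set.mem_ofPred_eq] at this
        convert this using 1
        push_cast
        ring
    have hdown : ∀ n : ℕ, ∀ t ∈ D, t - n * (t₁ - t₂) ∈ D := by
      intro n
      induction n with
      | zero => intro t ht; simpa using ht
      | succ n ih =>
        intro t ht
        refine hsub1 ?_
        rw [Set.mem_ofPred_eq]
        convert ih t ht using 1
        push_cast
        ring
    have huniv : D = Set.univ := by
      refine Set.eq_univ_of_forall fun t => ?_
      obtain ⟨n, hn⟩ := exists_nat_gt (|t - t₁| / |t₁ - t₂|)
      have hpos : 0 < |t₁ - t₂| := abs_pos.2 (sub_ne_zero.2 hne)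
      rw [div_lt_iff₀ hpos] at hn
      have h5 := abs_lt.1 hn
      rcases abs_cases (t₁ - t₂) with ⟨h6, -⟩ | ⟨h6, -⟩
      · rw [h6] at h5
        exact hM.ordConnected.out (hdown n _ h₁) (hup n _ h₁) ⟨by linarith, by linarith⟩
      · rw [h6] at h5
        exact hM.ordConnected.out (hup n _ h₁) (hdown n _ h₁) ⟨by linarith, by linarith⟩
    refine ⟨huniv, fun s => ?_⟩
    have := hD (huniv ▸ Set.mem_univ s : s ∈ D)
    simpa using this
  -- Opposite directions would make the curve symmetric about the midpoint `(t₁ + t₂) / 2`,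
  -- contradicting local injectivity there.
  · exfalso
    rw [h] at hD
    have hb' : b = t₁ + t₂ := by rw [hb, h]; ring
    rw [hb'] at hD
    have hm : (t₁ + t₂) / 2 ∈ D := by
      rcases le_total t₁ t₂ with hle | hle
      · exact hM.ordConnected.out h₁ h₂ ⟨by linarith, by linarith⟩
      · exact hM.ordConnected.out h₂ h₁ ⟨by linarith, by linarith⟩
    obtain ⟨r, hr, hinj⟩ := (hM.vert _ hm).locally_injective
    obtain ⟨r', hr', hball⟩ := Metric.isOpen_iff.1 hM.isOpen _ hm
    set q := min r r' / 2 with hq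
    have hq0 : 0 < q := half_pos (lt_min hr hr')
    have hq1 : q < r := by linarith [min_le_left r r']
    have hq2 : q < r' := by linarith [min_le_right r r']
    have hmem : (t₁ + t₂) / 2 + q ∈ D := hball (by
      rw [mem_ball_iff_norm, add_sub_cancel_left, Real.norm_of_nonneg hq0.le]
      exact hq2)
    have h6 := hD hmem
    have h7 := hinj _ (by
      rw [mem_ball_iff_norm]
      have : -1 * ((t₁ + t₂) / 2 + q) + (t₁ + t₂) - (t₁ + t₂) / 2 = -q := by ring
      rw [this, norm_neg, Real.norm_of_nonneg hq0.le]
      exact hq1) _ (by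
      rw [mem_ball_iff_norm, add_sub_cancel_left, Real.norm_of_nonneg hq0.le]
      exact hq1) h6
    linarith

/-- The periods form a nontrivial subgroup of `ℝ`. It is not dense, by local injectivity, hence it
is generated by some `g ≠ 0`. Two times with equal value differ by a period, so the curve factors
injectively through the circle `AddCircle g`. -/
theorem IsMaxCurve.isClosedTrajectory (hM : IsMaxCurve R γ D) (hinj : ¬ Set.InjOn γ D) :
    IsClosedTrajectory R (γ '' D) := by
  refine ⟨hM.isTrajectory, ?_⟩
  simp only [Set.InjOn, not_forall] at hinj
  obtain ⟨t₁, h₁, t₂, h₂, heq, hne⟩ := hinj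
  obtain ⟨hD, hper⟩ := hM.periodic h₁ h₂ hne heq
  subst hD
  have hcont : Continuous γ := continuous_iff_continuousAt.2 fun t =>
    (hM.vert t (Set.mem_univ t)).continuousAt
  let G : AddSubgroup ℝ :=
    { carrier := {τ | ∀ s, γ (s + τ) = γ s}
      zero_mem' := fun s => by rw [add_zero]
      add_mem' := fun {x y} hx hy s => by
        rw [← add_assoc]
        exact (hy _).trans (hx s)
      neg_mem' := fun {x} hx s => by
        have := hx (s + -x)
        rw [neg_add_cancel_right] at this
        exact this.symm }
  have hG : ∀ τ, τ ∈ G ↔ ∀ s, γ (s + τ) = γ s := fun τ => Iff.rfl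
  rcases AddSubgroup.dense_or_cyclic G with hdense | ⟨g, hg⟩
  · exfalso
    obtain ⟨r, hr, hloc⟩ := (hM.vert 0 (Set.mem_univ _)).locally_injective
    obtain ⟨τ, hτ, hτG⟩ := hdense.exists_mem_open isOpen_Ioo (Set.nonempty_Ioo.2 hr)
    have h3 := (hG τ).1 hτ 0
    rw [zero_add] at h3
    have := hloc τ (by
      rw [mem_ball_zero_iff, Real.norm_of_nonneg hτG.1.le]
      exact hτG.2) 0 (Metric.mem_ball_self hr) h3
    exact hτG.1.ne' this
  · rw [← AddSubgroup.zmultiples_eq_closure] at hg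
    have hg0 : g ≠ 0 := by
      rintro rfl
      rw [AddSubgroup.zmultiples_zero_eq_bot] at hg
      have h3 : t₁ - t₂ ∈ G := hper
      rw [hg, AddSubgroup.mem_bot] at h3
      exact hne (sub_eq_zero.1 h3)
    have hgper : Function.Periodic γ g := by
      have : g ∈ G := by
        rw [hg]
        exact AddSubgroup.mem_zmultiples g
      exact this
    let F : AddCircle g → OnePoint ℂ := hgper.lift
    have hF : Continuous F := continuous_coinduced_dom.2 hcont
    have hFinj : Function.Injective F := by
      intro x y
      refine QuotientAddGroup.induction_on x fun s => QuotientAddGroup.induction_on y fun t => ?_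
      intro hst
      have hst' : γ s = γ t := hst
      rw [QuotientAddGroup.eq, ← hg]
      by_cases hne : s = t
      · rw [hne, neg_add_cancel]
        exact G.zero_mem
      · have h4 := (hM.periodic (Set.mem_univ t) (Set.mem_univ s) (Ne.symm hne) hst'.symm).2
        have h5 : t - s ∈ G := h4
        rwa [neg_add_eq_sub]
    refine ⟨F ∘ (AddCircle.homeomorphCircle hg0).symm,
      hF.comp (AddCircle.homeomorphCircle hg0).symm.continuous,
      hFinj.comp (AddCircle.homeomorphCircle hg0).symm.injective, ?_⟩
    rw [Set.range_comp, (AddCircle.homeomorphCircle hg0).symm.surjective.range_eq, Set.image_univ,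
      Set.image_univ]
    ext P
    constructor
    · rintro ⟨x, rfl⟩
      refine QuotientAddGroup.induction_on x fun s => ?_
      exact ⟨s, rfl⟩
    · rintro ⟨s, rfl⟩
      exact ⟨(s : AddCircle g), rfl⟩

end CriticalMeasure

namespace CriticalMeasure

variable {R : RatFunc ℂ}

/-! ### Local forms at singular points -/

theorem polynomial_factor {P : Polynomial ℂ} (hP : P ≠ 0) (a : ℂ) : ∃ Q : Polynomial ℂ,
    Q.eval a ≠ 0 ∧ ∀ z, P.eval z = (z - a) ^ P.rootMultiplicity a * Q.eval z := by
  obtain ⟨Q, hQ1, hQ2⟩ := P.exists_eq_pow_rootMultiplicity_mul_and_not_dvd hP a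
  refine ⟨Q, fun hc => hQ2 (Polynomial.dvd_iff_isRoot.2 hc), fun z => ?_⟩
  nth_rewrite 1 [hQ1]
  simp

theorem exists_local_factor (hR : R ≠ 0) (a : ℂ) : ∃ u : ℂ → ℂ,
    (∀ᶠ z in 𝓝 a, DifferentiableAt ℂ u z) ∧ u a ≠ 0 ∧
      ∀ z, z ≠ a → value R z = (z - a) ^ order R a * u z := by
  obtain ⟨N, hN1, hN2⟩ := polynomial_factor (RatFunc.num_ne_zero hR) a
  obtain ⟨M, hM1, hM2⟩ := polynomial_factor R.denom_ne_zero a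
  refine ⟨fun z => N.eval z / M.eval z, ?_, div_ne_zero hN1 hM1, fun z hz => ?_⟩
  · have h1 : ∀ᶠ z in 𝓝 a, M.eval z ≠ 0 := M.continuous.continuousAt.eventually_ne hM1
    filter_upwards [h1] with z hz
    exact N.differentiableAt.fun_div M.differentiableAt hz
  · have hz' : z - a ≠ 0 := sub_ne_zero.2 hz
    rw [value_eq, hN2, hM2, order, zpow_sub₀ hz', zpow_natCast, zpow_natCast, mul_div_mul_comm]

/-- Put `z - a = s²` and `n = order R a + 1 ≥ 0`. Then `√R dz = 2 s ^ n √u ds` is holomorphic in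
`s`, and its primitive `Y` with `Y 0 = 0` satisfies `Y (-s) = (-1) ^ (n + 1) Y s`. Hence `Y²` does
not depend on the choice of `s` and is a function of `z`, although `Y` need not be. -/
theorem exists_sqrt_form {a : ℂ} (hR : R ≠ 0) (ha : -1 ≤ order R a) :
    ∃ V ∈ 𝓝 a, ∃ G : ℂ → ℂ, Tendsto G (𝓝 a) (𝓝 0) ∧
      ∀ z ∈ V, z ≠ a → ∃ e, IsNatural R e ∧ z ∈ e.source ∧ ∀ w ∈ e.source, e w ^ 2 = G w := by
  obtain ⟨u, hu, hua, hval⟩ := exists_local_factor hR a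
  obtain ⟨n, hn⟩ : ∃ n : ℕ, (n : ℤ) = order R a + 1 := ⟨(order R a + 1).toNat, by omega⟩
  have hval' : ∀ z, z ≠ a → value R z * (z - a) = (z - a) ^ n * u z := by
    intro z hz
    have hz' : z - a ≠ 0 := sub_ne_zero.2 hz
    rw [hval z hz, ← zpow_natCast, hn, zpow_add₀ hz', zpow_one]
    ring
  obtain ⟨r, hr, g, hg, hg2⟩ := exists_sqrt_of_ne_zero hu hua
  have hu0 : ∀ᶠ z in 𝓝 a, u z ≠ 0 := hu.self_of_nhds.continuousAt.eventually_ne hua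
  obtain ⟨r', hr', hball'⟩ := Metric.mem_nhds_iff.1 hu0
  set r₀ := min r r' with hr₀
  have hr₀0 : 0 < r₀ := lt_min hr hr'
  set q : ℝ := Real.sqrt r₀ with hq
  have hq0 : 0 < q := Real.sqrt_pos.2 hr₀0
  have hmaps : ∀ s : ℂ, s ∈ Metric.ball (0 : ℂ) q → a + s ^ 2 ∈ Metric.ball a r := by
    intro s hs
    rw [mem_ball_zero_iff] at hs
    rw [mem_ball_iff_norm, add_sub_cancel_left, norm_pow]
    have : ‖s‖ ^ 2 < q ^ 2 := by gcongr
    rw [Real.sq_sqrt hr₀0.le] at this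
    exact this.trans_le (min_le_left _ _)
  have hdiff : DifferentiableOn ℂ (fun s => 2 * s ^ n * g (a + s ^ 2)) (Metric.ball 0 q) := by
    refine DifferentiableOn.fun_mul (by fun_prop) ?_
    exact hg.comp (by fun_prop) hmaps
  obtain ⟨Y, hY0, hY⟩ := hdiff.isExactOn_ball.with_val_at 0 0
  have hYeven : ∀ s ∈ Metric.ball (0 : ℂ) q, Y (-s) = (-1) ^ (n + 1) * Y s := by
    have hd : ∀ s ∈ Metric.ball (0 : ℂ) q,
        HasDerivAt (fun s => Y (-s) - (-1) ^ (n + 1) * Y s) 0 s := by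
      intro s hs
      have hs' : -s ∈ Metric.ball (0 : ℂ) q := by
        rw [mem_ball_zero_iff, norm_neg]
        exact mem_ball_zero_iff.1 hs
      have h1 := ((hY _ hs').comp s (hasDerivAt_neg s)).fun_sub
        ((hY s hs).const_mul ((-1 : ℂ) ^ (n + 1)))
      refine h1.congr_deriv ?_
      rw [neg_sq, neg_pow s n]
      ring
    intro s hs
    have h1 := Metric.isOpen_ball.is_const_of_deriv_eq_zero (convex_ball (0 : ℂ) q).isPreconnected
      (fun s hs => (hd s hs).differentiableAt.differentiableWithinAt)
      (fun s hs => (hd s hs).deriv) hs (Metric.mem_ball_self hq0)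
    simp only [neg_zero, hY0, mul_zero, sub_zero] at h1
    exact sub_eq_zero.1 h1
  have hYsq : ∀ s ∈ Metric.ball (0 : ℂ) q, Y (-s) ^ 2 = Y s ^ 2 := by
    intro s hs
    rw [hYeven s hs, mul_pow, ← pow_mul, mul_comm (n + 1) 2, pow_mul]
    norm_num
  -- An arbitrary square root, without continuity: only `Y²` is used, which is insensitive to its
  -- sign.
  choose σ hσ using fun z : ℂ => IsAlgClosed.exists_pow_nat_eq (z - a) (n := 2) (by norm_num)
  have hσball : ∀ z s : ℂ, ‖z - a‖ < r₀ → s ^ 2 = z - a → s ∈ Metric.ball (0 : ℂ) q := by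
    intro z s hz hs
    rw [mem_ball_zero_iff]
    refine lt_of_pow_lt_pow_left₀ 2 hq0.le ?_
    rw [Real.sq_sqrt hr₀0.le, ← norm_pow, hs]
    exact hz
  have hG : ∀ z s : ℂ, ‖z - a‖ < r₀ → s ^ 2 = z - a → Y s ^ 2 = Y (σ z) ^ 2 := by
    intro z s hz hs
    have h1 : s ^ 2 = σ z ^ 2 := by rw [hs, hσ]
    rcases sq_eq_sq_iff_eq_or_eq_neg.1 h1 with h | h
    · rw [h]
    · rw [h, hYsq _ (hσball z _ hz (hσ z))]
  refine ⟨Metric.ball a r₀, Metric.ball_mem_nhds _ hr₀0, fun z => Y (σ z) ^ 2, ?_, ?_⟩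
  · have h1 : Tendsto σ (𝓝 a) (𝓝 0) := by
      rw [tendsto_zero_iff_norm_tendsto_zero]
      have h2 : ∀ z, ‖σ z‖ = Real.sqrt ‖z - a‖ := fun z => by
        rw [← hσ z, norm_pow, Real.sqrt_sq (norm_nonneg _)]
      simp_rw [h2]
      have h3 : Continuous fun z : ℂ => Real.sqrt ‖z - a‖ := by fun_prop
      simpa using h3.tendsto a
    have h2 : ContinuousAt Y 0 := (hY 0 (Metric.mem_ball_self hq0)).continuousAt
    have h3 := (h2.tendsto.comp h1).pow 2
    rw [hY0] at h3
    simpa using h3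
  · intro z hz hza
    have hza' : z - a ≠ 0 := sub_ne_zero.2 hza
    obtain ⟨t, ht, s, hs, hs2⟩ := exists_sqrt_of_ne_zero (f := fun w => w - a) (a := z)
      (Eventually.of_forall fun w => by fun_prop) hza'
    set U : Set ℂ := (Metric.ball z t ∩ Metric.ball a r₀) ∩ {a}ᶜ with hU
    have hUo : IsOpen U := (Metric.isOpen_ball.inter Metric.isOpen_ball).inter
      isOpen_compl_singleton
    have hzU : z ∈ U := ⟨⟨Metric.mem_ball_self ht, hz⟩, hza⟩
    have hsd : ∀ w ∈ U, HasDerivAt s (1 / (2 * s w)) w := by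
      intro w hw
      have hd := (hs.differentiableAt (Metric.isOpen_ball.mem_nhds hw.1.1)).hasDerivAt
      have h1 : HasDerivAt (fun w => s w ^ 2) (2 * s w * deriv s w) w := by
        simpa using hd.fun_pow 2
      have h2 : HasDerivAt (fun w => s w ^ 2) 1 w := by
        refine ((hasDerivAt_id w).sub_const a).congr_of_eventuallyEq ?_
        filter_upwards [Metric.isOpen_ball.mem_nhds hw.1.1] with v hv using hs2 v hv
      have h3 := h1.unique h2
      have h4 : s w ≠ 0 := fun hc => by
        rw [hc] at h3
        simp at h3
      have h5 : deriv s w = 1 / (2 * s w) := by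
        field_simp
        linear_combination h3
      rwa [← h5]
    have hsball : ∀ w ∈ U, s w ∈ Metric.ball (0 : ℂ) q := fun w hw =>
      hσball w _ (mem_ball_iff_norm.1 hw.1.2) (hs2 w hw.1.1)
    have hW : ∀ w ∈ U, HasDerivAt (fun w => Y (s w))
        (2 * s w ^ n * g (a + s w ^ 2) * (1 / (2 * s w))) w := fun w hw =>
      (hY _ (hsball w hw)).comp w (hsd w hw)
    have hsq : ∀ w ∈ U, (2 * s w ^ n * g (a + s w ^ 2) * (1 / (2 * s w))) ^ 2 = value R w ∧
        value R w ≠ 0 := by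
      intro w hw
      have hwa : w ≠ a := hw.2
      have hwa' : w - a ≠ 0 := sub_ne_zero.2 hwa
      have h1 : s w ^ 2 = w - a := hs2 w hw.1.1
      have h2 : s w ≠ 0 := fun hc => by
        rw [hc] at h1
        exact hwa' (by rw [← h1]; ring)
      have h3 : a + s w ^ 2 = w := by rw [h1]; ring
      have h4 := hg2 _ (hmaps _ (hsball w hw))
      rw [h3] at h4
      have h5 := hval' w hwa
      have h6 : u w ≠ 0 := hball' (Metric.ball_subset_ball (min_le_right _ _) hw.1.2)
      constructor
      · rw [h3]
        refine mul_right_cancel₀ hwa' ?_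
        rw [h5, ← h4]
        have h7 : (s w ^ n) ^ 2 = (w - a) ^ n := by rw [← pow_mul, mul_comm, pow_mul, h1]
        rw [← h7, ← h1]
        field_simp
      · intro hc
        rw [hc, zero_mul] at h5
        exact mul_ne_zero (pow_ne_zero n hwa') h6 h5.symm
    obtain ⟨e, he1, he2, he3⟩ := exists_openPartialHomeomorph hUo
      (fun w hw => (hW w hw).differentiableAt.differentiableWithinAt) hzU (by
        rw [(hW z hzU).deriv]
        intro hc
        have := hsq z hzU
        rw [hc] at this
        exact this.2 (by rw [← this.1]; ring))
    have he4 : ⇑e = fun w => Y (s w) := funext he3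
    refine ⟨e, isNatural_of_hasDerivAt
      (g := fun w => 2 * s w ^ n * g (a + s w ^ 2) * (1 / (2 * s w)))
      (fun w hw => ?_) (fun w hw => (hsq w (he2 hw)).1) (fun w hw => (hsq w (he2 hw)).2), he1,
      fun w hw => ?_⟩
    · rw [he4]
      exact hW w (he2 hw)
    · rw [he3]
      exact hG w _ (mem_ball_iff_norm.1 (he2 hw).1.2) (hs2 w (he2 hw).1.1)

/-- The local coordinate in which a double pole takes the form `c² w⁻² dw²`. -/
theorem exists_double_pole_chart {a : ℂ} {c : ℝ} (hc : 0 < c) (hR : R ≠ 0) (ha : order R a = -2)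
    (hlim : Tendsto (fun z => (z - a) ^ 2 * value R z) (𝓝[≠] a) (𝓝 ((c : ℂ) ^ 2))) :
    ∃ f : OpenPartialHomeomorph ℂ ℂ, a ∈ f.source ∧ f a = 0 ∧
      (∀ z ∈ f.source, DifferentiableAt ℂ f z) ∧
      ∀ z ∈ f.source, z ≠ a → (c * (deriv f z / f z)) ^ 2 = value R z ∧ value R z ≠ 0 := by
  obtain ⟨u, hu, hua, hval⟩ := exists_local_factor hR a
  have hval' : ∀ z, z ≠ a → (z - a) ^ 2 * value R z = u z := by
    intro z hz
    have hz' : z - a ≠ 0 := sub_ne_zero.2 hz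
    rw [hval z hz, ha, ← zpow_natCast, ← mul_assoc, ← zpow_add₀ hz']
    norm_num
  have hc0 : (c : ℂ) ≠ 0 := Complex.ofReal_ne_zero.2 hc.ne'
  have huc : u a = (c : ℂ) ^ 2 := by
    have h1 : Tendsto u (𝓝[≠] a) (𝓝 (u a)) :=
      hu.self_of_nhds.continuousAt.tendsto.mono_left nhdsWithin_le_nhds
    refine tendsto_nhds_unique h1 (hlim.congr' ?_)
    filter_upwards [self_mem_nhdsWithin] with z hz using hval' z hz
  obtain ⟨r, hr, g₀, hg₀, hg₀2⟩ := exists_sqrt_of_ne_zero hu hua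
  have hab := Metric.mem_ball_self (x := a) hr
  -- The sign of the square root `g` of `u` is normalized to `g a = c`; this makes `(g - c) / (z -
  -- a)` holomorphic.
  obtain ⟨g, hg, hg2, hga⟩ : ∃ g : ℂ → ℂ, DifferentiableOn ℂ g (Metric.ball a r) ∧
      (∀ z ∈ Metric.ball a r, g z ^ 2 = u z) ∧ g a = c := by
    have h1 : g₀ a ^ 2 = (c : ℂ) ^ 2 := by rw [hg₀2 a hab, huc]
    rcases sq_eq_sq_iff_eq_or_eq_neg.1 h1 with h | h
    · exact ⟨g₀, hg₀, hg₀2, h⟩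
    · refine ⟨fun z => -g₀ z, hg₀.fun_neg, fun z hz => ?_, ?_⟩
      · rw [neg_sq, hg₀2 z hz]
      · change -g₀ a = c
        rw [h, neg_neg]
  have hu0 : ∀ᶠ z in 𝓝 a, u z ≠ 0 := hu.self_of_nhds.continuousAt.eventually_ne hua
  -- The coordinate sought is `W = (z - a) exp m` with `c W' / W = g / (z - a)`; this means `m' = (g
  -- - g a) / (c (z - a))`, which is the quotient `dslope g a / c`.
  have hds : DifferentiableOn ℂ (fun z => dslope g a z / c) (Metric.ball a r) :=
    ((Complex.differentiableOn_dslope (Metric.isOpen_ball.mem_nhds hab)).2 hg).div_const _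
  obtain ⟨m, hm⟩ := hds.isExactOn_ball
  set W : ℂ → ℂ := fun z => (z - a) * Complex.exp (m z) with hW
  have hWd : ∀ z ∈ Metric.ball a r, HasDerivAt W
      (1 * Complex.exp (m z) + (z - a) * (Complex.exp (m z) * (dslope g a z / c))) z := fun z hz =>
    ((hasDerivAt_id z).sub_const a).fun_mul (hm z hz).cexp
  obtain ⟨r', hr', hball'⟩ := Metric.mem_nhds_iff.1 hu0
  obtain ⟨f, hf1, hf2, hf3⟩ := exists_openPartialHomeomorph
    (Metric.isOpen_ball.inter (Metric.isOpen_ball (x := a) (ε := r')))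
    (fun z hz => (hWd z hz.1).differentiableAt.differentiableWithinAt)
    ⟨hab, Metric.mem_ball_self hr'⟩ (by
      rw [(hWd a hab).deriv]
      simp [Complex.exp_ne_zero])
  have hf4 : ⇑f = W := funext hf3
  refine ⟨f, hf1, by rw [hf3, hW]; simp, fun z hz => ?_, fun z hz hza => ?_⟩
  · rw [hf4]
    exact (hWd z (hf2 hz).1).differentiableAt
  · have hza' : z - a ≠ 0 := sub_ne_zero.2 hza
    have h1 := hg2 z (hf2 hz).1
    have h2 := hval' z hza
    have h3 : u z ≠ 0 := hball' (hf2 hz).2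
    have h4 := Complex.exp_ne_zero (m z)
    constructor
    · rw [hf4, (hWd z (hf2 hz).1).deriv, hW]
      simp only
      rw [dslope_of_ne _ hza, slope_def_field, hga]
      have h5 : (c : ℂ) * ((1 * Complex.exp (m z) + (z - a) *
          (Complex.exp (m z) * ((g z - c) / (z - a) / c))) / ((z - a) * Complex.exp (m z))) =
          g z / (z - a) := by
        field_simp
        ring
      rw [h5, div_pow, h1, ← h2]
      field_simp
    · intro hc'
      rw [hc', mul_zero] at h2
      exact h3 h2.symm

/-- Strip charts at a double pole. -/
theorem exists_strip_chart {f : OpenPartialHomeomorph ℂ ℂ} {a : ℂ} {c : ℝ} (hc : 0 < c)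
    (ha : f a = 0) (hfd : ∀ z ∈ f.source, DifferentiableAt ℂ f z)
    (hf : ∀ z ∈ f.source, z ≠ a → (c * (deriv f z / f z)) ^ 2 = value R z ∧ value R z ≠ 0) :
    ∃ e, IsNatural R e ∧ (∀ z, z ∈ e.source ↔ z ∈ f.source ∧ f z ∈ Complex.slitPlane) ∧
      (∀ z, e z = Complex.log (f z) * c) ∧
      ∀ w : ℂ, |w.im| < c * Real.pi → Complex.exp (w / c) ∈ f.target → w ∈ e.target := by
  have hc0 : (c : ℂ) ≠ 0 := Complex.ofReal_ne_zero.2 hc.ne'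
  -- The natural parameter is `c log f`, on the preimage of the slit plane.
  set e : OpenPartialHomeomorph ℂ ℂ := (f.trans Complex.expOpenPartialHomeomorph.symm).trans
    (Homeomorph.mulRight₀ (c : ℂ) hc0).toOpenPartialHomeomorph with he
  have hsrc : ∀ z, z ∈ e.source ↔ z ∈ f.source ∧ f z ∈ Complex.slitPlane := by
    intro z
    simp [he, Complex.expOpenPartialHomeomorph]
  have happ : ∀ z, e z = Complex.log (f z) * c := fun z => rfl
  have he' : ⇑e = fun z => Complex.log (f z) * c := funext happ
  refine ⟨e, isNatural_of_hasDerivAt (g := fun z => c * (deriv f z / f z)) (fun z hz => ?_)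
    (fun z hz => ?_) (fun z hz => ?_), hsrc, happ, fun w hw hwt => ?_⟩
  · obtain ⟨h1, h2⟩ := (hsrc z).1 hz
    rw [he', mul_comm (c : ℂ)]
    exact ((hfd z h1).hasDerivAt.clog h2).mul_const _
  · obtain ⟨h1, h2⟩ := (hsrc z).1 hz
    refine (hf z h1 ?_).1
    rintro rfl
    exact Complex.slitPlane_ne_zero h2 ha
  · obtain ⟨h1, h2⟩ := (hsrc z).1 hz
    refine (hf z h1 ?_).2
    rintro rfl
    exact Complex.slitPlane_ne_zero h2 ha
  · have h1 : (w / c).im = w.im / c := by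
      rw [Complex.div_ofReal_im]
    have h2 : |(w / c).im| < Real.pi := by
      rw [h1, abs_div, abs_of_pos hc, div_lt_iff₀ hc, mul_comm]
      exact hw
    have h3 := abs_lt.1 h2
    have h4 : w = Complex.log (Complex.exp (w / c)) * c := by
      rw [Complex.log_exp h3.1 h3.2.le]
      field_simp
    have h5 : f.symm (Complex.exp (w / c)) ∈ e.source := by
      rw [hsrc, f.right_inv hwt]
      refine ⟨f.map_target hwt, ?_⟩
      exact Complex.expOpenPartialHomeomorph.map_source (x := w / c) (by
        simp [Complex.expOpenPartialHomeomorph]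
        exact ⟨by simpa using h3.1, by simpa using h3.2⟩)
    have h6 := e.map_source h5
    rwa [happ, f.right_inv hwt, ← h4] at h6

end CriticalMeasure

namespace CriticalMeasure

variable {R : RatFunc ℂ}

/-! ### Local forms on the Riemann sphere -/

/-- `c` is the leading coefficient of `R(z) dz²` at a double pole `P`. -/
def HasDoubleCoeff (R : RatFunc ℂ) (P : OnePoint ℂ) (c : ℂ) : Prop :=
  P.elim (Tendsto (fun z => z ^ 2 * value R z) (cocompact ℂ) (𝓝 c))
    fun a => Tendsto (fun z => (z - a) ^ 2 * value R z) (𝓝[≠] a) (𝓝 c)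

theorem eventually_value_ne_zero (hR : R ≠ 0) (a : ℂ) : ∀ᶠ z in 𝓝[≠] a, value R z ≠ 0 := by
  obtain ⟨u, hu, hua, hval⟩ := exists_local_factor hR a
  have hu0 : ∀ᶠ z in 𝓝 a, u z ≠ 0 := hu.self_of_nhds.continuousAt.eventually_ne hua
  filter_upwards [self_mem_nhdsWithin, nhdsWithin_le_nhds hu0] with z hz hz'
  rw [hval z hz]
  exact mul_ne_zero (zpow_ne_zero _ (sub_ne_zero.2 hz)) hz'

/-- A coordinate at a point of the sphere. -/
theorem exists_coordinate (hR : R ≠ 0) (P : OnePoint ℂ) :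
    ∃ (R' : RatFunc ℂ) (ψ : ℂ → OnePoint ℂ) (a : ℂ) (hψ : Topology.IsOpenEmbedding ψ),
      R' ≠ 0 ∧ ψ a = P ∧ order R' a = qdOrder R P ∧
      (∀ e, IsNatural R' e → IsFlat R (liftChart hψ e)) ∧
      (OnePoint.infty ∈ Set.range ψ → P = OnePoint.infty) ∧
      ∀ c, HasDoubleCoeff R P c →
        Tendsto (fun z => (z - a) ^ 2 * value R' z) (𝓝[≠] a) (𝓝 c) := by
  induction P using OnePoint.rec with
  | infty =>
    obtain ⟨R', hR'0, h1, h2, h3⟩ := exists_inverted hR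
    refine ⟨R', invSphere, 0, isOpenEmbedding_invSphere, hR'0, invSphere_zero, h2,
      fun e he => he.isFlat_inverted h1 h3, fun _ => rfl, fun c hc => ?_⟩
    have hc' : Tendsto (fun z => z ^ 2 * value R z) (cocompact ℂ) (𝓝 c) := hc
    rw [← Metric.cobounded_eq_cocompact] at hc'
    refine (hc'.comp tendsto_inv₀_nhdsNE_zero).congr' ?_
    filter_upwards [self_mem_nhdsWithin, eventually_value_ne_zero hR'0 0] with w hw hv
    have hw' : w ≠ 0 := hw
    simp only [Function.comp_apply]
    rw [h1 w hw hv, sub_zero]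
    field_simp
  | coe z =>
    exact ⟨R, _, z, OnePoint.isOpenEmbedding_coe, hR, rfl, rfl, fun e he => he.isFlat,
      fun ⟨w, hw⟩ => absurd hw (OnePoint.coe_ne_infty w), fun c hc => hc⟩

/-- At a finite critical point, the square of a suitable natural parameter is single-valued. -/
theorem exists_sqrt_form_sphere (hR : R ≠ 0) {P : OnePoint ℂ} (hP : -1 ≤ qdOrder R P) :
    ∃ V ∈ 𝓝 P, ∃ G : OnePoint ℂ → ℂ, Tendsto G (𝓝[≠] P) (𝓝 0) ∧
      ∀ Q ∈ V, Q ≠ P → ∃ e, IsFlat R e ∧ Q ∈ e.source ∧ ∀ Q' ∈ e.source, e Q' ^ 2 = G Q' := by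
  obtain ⟨R', ψ, a, hψ, hR'0, rfl, hord, hflat, -, -⟩ := exists_coordinate hR P
  obtain ⟨V, hV, G, hG, hVG⟩ := exists_sqrt_form hR'0 (hord ▸ hP)
  have hinv : ∀ z, Function.invFun ψ (ψ z) = z := Function.leftInverse_invFun hψ.injective
  refine ⟨ψ '' V, hψ.image_mem_nhds.2 hV, G ∘ Function.invFun ψ, ?_, ?_⟩
  · refine Tendsto.mono_left ?_ nhdsWithin_le_nhds
    rw [← hψ.map_nhds_eq, tendsto_map'_iff]
    refine hG.congr fun z => ?_
    simp [hinv]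
  · rintro _ ⟨z, hz, rfl⟩ hne
    obtain ⟨e, he, hze, heG⟩ := hVG z hz fun hc => hne (congrArg ψ hc)
    refine ⟨_, hflat e he, (mem_liftChart_source _ _).2 hze, fun Q' hQ' => ?_⟩
    rw [liftChart_source] at hQ'
    obtain ⟨w, hw, rfl⟩ := hQ'
    rw [liftChart_apply, heG w hw]
    simp [hinv]

/-- A double pole with positive leading coefficient is covered by two half-infinite strips. -/
theorem exists_double_form {P : OnePoint ℂ} {c : ℝ} (hc : 0 < c) (hR : R ≠ 0)
    (hP : qdOrder R P = -2) (hlim : HasDoubleCoeff R P ((c : ℂ) ^ 2)) :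
    ∃ V ∈ 𝓝 P, ∃ (N : OnePoint ℂ → ℝ) (r b : ℝ) (e : Bool → OpenPartialHomeomorph (OnePoint ℂ) ℂ),
      0 < b ∧ Tendsto N (𝓝[≠] P) atBot ∧ (∀ i, IsFlat R (e i)) ∧
      (∀ i, ∀ Q ∈ (e i).source, (e i Q).re = N Q) ∧
      (∀ i, ∀ w : ℂ, w.re < r → |w.im| < b → w ∈ (e i).target) ∧
      (∀ i, OnePoint.infty ∈ (e i).source → P = OnePoint.infty) ∧
      ∀ Q ∈ V, Q ≠ P → ∃ i, Q ∈ (e i).source ∧ N Q < r ∧ |(e i Q).im| < b := by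
  obtain ⟨R', ψ, a, hψ, hR'0, rfl, hord, hflat, hinfty, hcoef⟩ := exists_coordinate hR P
  obtain ⟨f, haf, hfa, hfd, hf⟩ := exists_double_pole_chart hc hR'0 (hord.trans hP) (hcoef _ hlim)
  have hinv : ∀ z, Function.invFun ψ (ψ z) = z := Function.leftInverse_invFun hψ.injective
  -- The slit planes of `f` and `-f` together cover a punctured neighbourhood. Both logarithms have
  -- real part `log ‖f‖`, so the two strips share the function `N`.
  set F : Bool → OpenPartialHomeomorph ℂ ℂ := fun i =>
    bif i then f else f.trans (Homeomorph.neg ℂ).toOpenPartialHomeomorph with hF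
  have hFs : ∀ i, (F i).source = f.source := by rintro (_ | _) <;> simp [hF]
  have hFv : ∀ i z, F i z = (bif i then 1 else -1) * f z := by rintro (_ | _) z <;> simp [hF]
  have hFt : ∀ i (w : ℂ), w ∈ (F i).target ↔ (bif i then 1 else -1) * w ∈ f.target := by
    rintro (_ | _) w <;> simp [hF]
  have hFn : ∀ i z, ‖F i z‖ = ‖f z‖ := by
    intro i z
    rw [hFv, norm_mul]
    cases i <;> simp
  have hex : ∀ i, ∃ e, IsNatural R' e ∧
      (∀ z, z ∈ e.source ↔ z ∈ (F i).source ∧ F i z ∈ Complex.slitPlane) ∧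
      (∀ z, e z = Complex.log (F i z) * c) ∧
      ∀ w : ℂ, |w.im| < c * Real.pi → Complex.exp (w / c) ∈ (F i).target → w ∈ e.target := by
    intro i
    have hfun : ⇑(F i) = fun z => (bif i then 1 else -1) * f z := funext (hFv i)
    have hFd : ∀ z ∈ (F i).source, DifferentiableAt ℂ (F i) z := fun z hz => by
      rw [hfun]
      rw [hFs] at hz
      exact (hfd z hz).const_mul _
    refine exists_strip_chart (a := a) hc (by rw [hFv, hfa, mul_zero]) hFd fun z hz hza => ?_
    rw [hFs] at hz
    obtain ⟨h1, h2⟩ := hf z hz hza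
    refine ⟨?_, h2⟩
    rw [← h1, hfun, deriv_const_mul _ (hfd z hz)]
    cases i <;> simp
  choose e he hes hev het using hex
  have h0 : (0 : ℂ) ∈ f.target := hfa ▸ f.map_source haf
  obtain ⟨δ, hδ, hball⟩ := Metric.isOpen_iff.1 f.open_target 0 h0
  have hfc : ContinuousAt f a := f.continuousAt haf
  have hfc' : Tendsto f (𝓝[≠] a) (𝓝[≠] 0) := by
    refine tendsto_nhdsWithin_iff.2 ⟨?_, ?_⟩
    · rw [← hfa]
      exact hfc.tendsto.mono_left nhdsWithin_le_nhds
    · filter_upwards [self_mem_nhdsWithin, nhdsWithin_le_nhds (f.open_source.mem_nhds haf)]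
        with z hz hzs hc'
      exact hz (f.injOn hzs haf (hc'.trans hfa.symm))
  have hV : f.source ∩ f ⁻¹' Metric.ball 0 δ ∈ 𝓝 a := inter_mem (f.open_source.mem_nhds haf)
    (hfc.preimage_mem_nhds (by rw [hfa]; exact Metric.ball_mem_nhds _ hδ))
  have hre : ∀ i z, (e i z).re = c * Real.log ‖f z‖ := by
    intro i z
    rw [hev, Complex.re_mul_ofReal, Complex.log_re, hFn, mul_comm]
  refine ⟨ψ '' (f.source ∩ f ⁻¹' Metric.ball 0 δ), hψ.image_mem_nhds.2 hV,
    fun Q => c * Real.log ‖f (Function.invFun ψ Q)‖, c * Real.log δ, c * Real.pi,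
    fun i => liftChart hψ (e i), by positivity, ?_, fun i => hflat _ (he i), ?_, ?_, ?_, ?_⟩
  · have h1 : Tendsto (fun z => c * Real.log ‖f z‖) (𝓝[≠] a) atBot :=
      ((Real.tendsto_log_nhdsGT_zero.comp tendsto_norm_nhdsNE_zero).comp hfc').const_mul_atBot hc
    have h2 : 𝓝[≠] (ψ a) ≤ Filter.map ψ (𝓝[≠] a) := by
      intro s hs
      rw [mem_map, mem_nhdsWithin_iff_eventually] at hs
      rw [mem_nhdsWithin_iff_eventually, ← hψ.map_nhds_eq, eventually_map]
      filter_upwards [hs] with z hz hz'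
      exact hz fun hc' => hz' (congrArg ψ hc')
    refine Tendsto.mono_left ?_ h2
    rw [tendsto_map'_iff]
    refine h1.congr fun z => ?_
    simp [hinv]
  · intro i Q hQ
    rw [liftChart_source] at hQ
    obtain ⟨z, hz, rfl⟩ := hQ
    rw [liftChart_apply, hre]
    simp only [hinv]
  · intro i w hw hw'
    rw [liftChart_target]
    refine het i w hw' ?_
    rw [hFt]
    refine hball (mem_ball_zero_iff.2 ?_)
    have h1 : ‖(bif i then 1 else -1 : ℂ)‖ = 1 := by cases i <;> simp
    rw [norm_mul, h1, one_mul, Complex.norm_exp, Complex.div_ofReal_re,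
      ← Real.lt_log_iff_exp_lt hδ, div_lt_iff₀ hc, mul_comm]
    exact hw
  · intro i hi
    rw [liftChart_source] at hi
    obtain ⟨z, -, hz⟩ := hi
    exact hinfty ⟨z, hz⟩
  · rintro _ ⟨z, ⟨hz1, hz2⟩, rfl⟩ hne
    have hza : z ≠ a := fun hc' => hne (congrArg ψ hc')
    have hfz : f z ≠ 0 := fun hc' => hza (f.injOn hz1 haf (hc'.trans hfa.symm))
    obtain ⟨i, hi, him⟩ : ∃ i, F i z ∈ Complex.slitPlane ∧ |(Complex.log (F i z)).im| < Real.pi := by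
      obtain ⟨i, hi⟩ : ∃ i, F i z ∈ Complex.slitPlane := by
        by_cases h1 : f z ∈ Complex.slitPlane
        · exact ⟨true, by rw [hFv]; simpa using h1⟩
        · refine ⟨false, ?_⟩
          rw [hFv, Complex.mem_slitPlane_iff]
          rw [Complex.mem_slitPlane_iff, not_or, not_lt, not_not] at h1
          left
          have : (f z).re ≠ 0 := fun h2 => hfz (Complex.ext h2 h1.2)
          have := lt_of_le_of_ne h1.1 this
          simpa using this
      refine ⟨i, hi, ?_⟩
      rw [Complex.log_im, abs_lt]
      exact ⟨Complex.neg_pi_lt_arg _, lt_of_le_of_ne (Complex.arg_le_pi _)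
        (Complex.mem_slitPlane_iff_arg.1 hi).1⟩
    refine ⟨i, (mem_liftChart_source _ _).2 ((hes i z).2 ⟨by rw [hFs]; exact hz1, hi⟩), ?_, ?_⟩
    · simp only [hinv]
      have h3 : ‖f z‖ < δ := mem_ball_zero_iff.1 hz2
      have h4 := Real.log_lt_log (norm_pos_iff.2 hfz) h3
      exact mul_lt_mul_of_pos_left h4 hc
    · rw [liftChart_apply, hev, Complex.im_mul_ofReal, abs_mul, abs_of_pos hc, mul_comm]
      exact mul_lt_mul_of_pos_left him hc

variable {p : ℕ} {a ρ : Fin (p + 1) → ℂ} {ν : Measure ℂ} {h : ℂ → ℝ}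

/-- For real charges the singular points are finite critical points or double poles with positive
leading coefficients. -/
theorem IsSquare.singular_dichotomy (hR : IsSquare a ρ ν h R) (H : IsPolar ν h) (hR0 : R ≠ 0)
    (hρ : ∀ j, (ρ j).im = 0) (P : OnePoint ℂ) :
    -1 ≤ qdOrder R P ∨
      qdOrder R P = -2 ∧ ∃ c : ℝ, 0 < c ∧ HasDoubleCoeff R P ((c : ℂ) ^ 2) := by
  induction P using OnePoint.rec with
  | infty =>
    set κ : ℂ := ((∫ x, h x ∂ν : ℝ) : ℂ) + 1 / 2 * ∑ j, ρ j with hκ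
    have hO := hR.isBigO H
    rw [← hκ] at hO
    have hlim : Tendsto (fun z => z ^ 2 * value R z) (cocompact ℂ) (𝓝 (κ ^ 2)) := by
      have h1 : (fun z : ℂ => z ^ 2 * (value R z - (κ / z) ^ 2)) =O[cocompact ℂ]
          fun z : ℂ => z ^ 2 * (z ^ 3)⁻¹ := (Asymptotics.isBigO_refl _ _).mul hO
      have hne : ∀ᶠ z : ℂ in cocompact ℂ, z ≠ 0 := by
        filter_upwards [(tendsto_norm_cocompact_atTop (E := ℂ)).eventually_gt_atTop 0] with z hz
        exact norm_pos_iff.1 hz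
      have h2 : Tendsto (fun z : ℂ => z ^ 2 * (z ^ 3)⁻¹) (cocompact ℂ) (𝓝 0) := by
        have h3 : Tendsto (fun z : ℂ => z⁻¹) (cocompact ℂ) (𝓝 0) := by
          rw [← Metric.cobounded_eq_cocompact]
          exact tendsto_inv₀_cobounded
        refine h3.congr' ?_
        filter_upwards [hne] with z hz
        field_simp
      have h4 := (h1.trans_tendsto h2).add_const (κ ^ 2)
      rw [zero_add] at h4
      refine h4.congr' ?_
      filter_upwards [hne] with z hz
      field_simp
      ring
    obtain ⟨R', ψ, b, hψ, hR'0, -, hord, -, -, hcoef⟩ := exists_coordinate hR0 OnePoint.infty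
    have hlim' := hcoef _ hlim
    obtain ⟨u, hu, hua, hval⟩ := exists_local_factor hR'0 b
    rw [← hord]
    have hu1 : Tendsto u (𝓝[≠] b) (𝓝 (u b)) :=
      hu.self_of_nhds.continuousAt.tendsto.mono_left nhdsWithin_le_nhds
    have hsub : Tendsto (fun z => z - b) (𝓝[≠] b) (𝓝[≠] 0) := by
      refine tendsto_nhdsWithin_iff.2 ⟨?_, ?_⟩
      · have : Tendsto (fun z => z - b) (𝓝 b) (𝓝 (b - b)) := by
          exact (continuous_id.sub continuous_const).tendsto b
        rw [sub_self] at this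
        exact this.mono_left nhdsWithin_le_nhds
      · filter_upwards [self_mem_nhdsWithin] with z hz using sub_ne_zero.2 hz
    have hval' : ∀ z, z ≠ b → (z - b) ^ 2 * value R' z = (z - b) ^ (order R' b + 2) * u z := by
      intro z hz
      have hz' : z - b ≠ 0 := sub_ne_zero.2 hz
      rw [hval z hz, zpow_add₀ hz', ← mul_assoc]
      norm_cast
      ring
    by_cases hge : -1 ≤ order R' b
    · exact Or.inl hge
    right
    -- The finite limit of `z² R` at infinity excludes orders below `-2`: otherwise the unit `u`
    -- would tend to `0`.
    have h5 : order R' b + 2 = 0 := by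
      by_contra hne
      have hneg : 0 < -(order R' b + 2) := by omega
      obtain ⟨n, hn⟩ : ∃ n : ℕ, (n : ℤ) = -(order R' b + 2) := ⟨_, Int.toNat_of_nonneg hneg.le⟩
      have hn0 : n ≠ 0 := by omega
      have h6 : Tendsto (fun z => (z - b) ^ n * ((z - b) ^ 2 * value R' z)) (𝓝[≠] b) (𝓝 (u b)) := by
        refine hu1.congr' ?_
        filter_upwards [self_mem_nhdsWithin] with z hz
        have hz' : z - b ≠ 0 := sub_ne_zero.2 hz
        rw [hval' z hz, ← mul_assoc, ← zpow_natCast, ← zpow_add₀ hz', hn]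
        simp
      have h7 : Tendsto (fun z => (z - b) ^ n) (𝓝[≠] b) (𝓝 0) := by
        have := (hsub.mono_right nhdsWithin_le_nhds).pow n
        rwa [zero_pow hn0] at this
      have h8 := tendsto_nhds_unique h6 (h7.mul hlim')
      rw [zero_mul] at h8
      exact hua h8
    have h6 : u b = κ ^ 2 := by
      refine tendsto_nhds_unique hu1 (hlim'.congr' ?_)
      filter_upwards [self_mem_nhdsWithin] with z hz
      rw [hval' z hz, h5, zpow_zero, one_mul]
    have hκ0 : κ ≠ 0 := by
      intro hc
      rw [hc] at h6
      exact hua (by rw [h6]; ring)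
    -- The measure and the charges are real, so the leading coefficient `κ²` is positive once it is
    -- nonzero.
    have hκr : κ = (κ.re : ℂ) := by
      refine Complex.ext (by simp) ?_
      have h7 : (1 / 2 * ∑ j, ρ j).im = 0 := by
        have h9 : (1 / 2 * ∑ j, ρ j) = ((1 / 2 : ℝ) : ℂ) * ∑ j, ρ j := by push_cast; ring
        rw [h9, Complex.im_ofReal_mul, Complex.im_sum, Finset.sum_eq_zero fun j _ => hρ j, mul_zero]
      rw [hκ, Complex.add_im, h7, Complex.ofReal_im, Complex.ofReal_im, add_zero]
    refine ⟨by omega, |κ.re|, abs_pos.2 ?_, ?_⟩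
    · intro hc
      rw [hc] at hκr
      exact hκ0 (by rw [hκr]; simp)
    · rw [← Complex.ofReal_pow, sq_abs, Complex.ofReal_pow, ← hκr]
      exact hlim
  | coe z =>
    change -1 ≤ order R z ∨ order R z = -2 ∧ _
    by_cases hneg : order R z < 0
    · obtain ⟨j, rfl⟩ := hR.poles z hneg
      by_cases hj : ρ j = 0
      · exact Or.inl (hR.order_ge j hj)
      · have hρr : ρ j = ((ρ j).re : ℂ) := Complex.ext (by simp) (by simp [hρ j])
        have hre : (ρ j).re ≠ 0 := fun hc => hj (by rw [hρr, hc]; simp)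
        refine Or.inr ⟨hR.order_eq j hj, |(ρ j).re| / 2, by positivity, ?_⟩
        have := hR.residue j hj
        have h1 : ((|(ρ j).re| / 2 : ℝ) : ℂ) ^ 2 = (ρ j / 2) ^ 2 := by
          rw [← Complex.ofReal_pow, div_pow, sq_abs, hρr]
          push_cast
          simp only [Complex.ofReal_re]
          ring
        rw [h1]
        exact this
    · left
      omega

end CriticalMeasure

namespace CriticalMeasure

variable {R : RatFunc ℂ} {e : OpenPartialHomeomorph (OnePoint ℂ) ℂ} {γ : ℝ → OnePoint ℂ}
  {D : Set ℝ} {p : ℕ} {a ρ : Fin (p + 1) → ℂ} {ν : Measure ℂ} {h : ℂ → ℝ}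

/-! ### The ends of maximal curves -/

theorem IsPreconnected.subset_of_disjoint_frontier {X : Type*} [TopologicalSpace X] {t s : Set X}
    (ht : IsPreconnected t) (hs : IsOpen s) (hts : (t ∩ s).Nonempty)
    (hf : ∀ x ∈ t, x ∉ frontier s) : t ⊆ s := by
  refine ht.subset_left_of_subset_union hs isClosed_closure.isOpen_compl
    (Set.disjoint_compl_right_iff_subset.2 subset_closure) (fun x hx => ?_) hts
  by_contra hc
  rw [Set.mem_union, Set.mem_compl_iff, not_or, not_not] at hc
  refine hf x hx ?_
  rw [hs.frontier_eq]
  exact ⟨hc.2, hc.1⟩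

/-- A curve with finitely many cluster points converges. -/
theorem exists_tendsto_of_mapClusterPt {X : Type*} [TopologicalSpace X] [CompactSpace X] [T2Space X]
    {F : Set X} (hF : F.Finite) {l : Filter ℝ} [l.NeBot] {γ : ℝ → X}
    (hl : ∀ s ∈ l, ∃ s' ∈ l, s' ⊆ s ∧ IsPreconnected s' ∧ ContinuousOn γ s')
    (hcl : ∀ Q, MapClusterPt Q l γ → Q ∈ F) : ∃ P ∈ F, Tendsto γ l (𝓝 P) := by
  obtain ⟨P, hP⟩ : ∃ P, MapClusterPt P l γ := exists_clusterPt_of_compactSpace _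
  refine ⟨P, hcl P hP, fun W hW => ?_⟩
  have hU : W ∩ (F \ {P})ᶜ ∈ 𝓝 P := inter_mem hW
    ((hF.subset Set.sdiff_subset).isClosed.isOpen_compl.mem_nhds fun hc => hc.2 rfl)
  obtain ⟨C, hC, hCc, hCs⟩ := exists_mem_nhds_isClosed_subset hU
  have hPC : P ∈ interior C := mem_interior_iff_mem_nhds.2 hC
  -- Frequent visits to the compact frontier would produce a cluster point there; the only cluster
  -- point in `C` is `P`, which is interior. A connected tail that visits the interior and avoids
  -- its frontier stays inside.
  have hfr : ∀ᶠ t in l, γ t ∉ frontier (interior C) := by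
    by_contra hc
    obtain ⟨Q, hQ, hQc⟩ := (isClosed_frontier.isCompact).exists_mapClusterPt_of_frequently
      (not_eventually.1 hc |>.mono fun t ht => not_not.1 ht)
    have hQC : Q ∈ C := (closure_minimal interior_subset hCc) (frontier_subset_closure hQ)
    have hQP : Q = P := by
      by_contra hne
      exact (hCs hQC).2 ⟨hcl Q hQc, hne⟩
    rw [hQP, isOpen_interior.frontier_eq] at hQ
    exact hQ.2 hPC
  obtain ⟨s', hs', hsub, hpre, hcont⟩ := hl _ hfr
  obtain ⟨t, htC, hts⟩ :=
    ((hP.frequently (isOpen_interior.mem_nhds hPC)).and_eventually hs').exists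
  have himg : γ '' s' ⊆ interior C := by
    refine IsPreconnected.subset_of_disjoint_frontier (hpre.image γ hcont) isOpen_interior
      ⟨γ t, ⟨t, hts, rfl⟩, htC⟩ ?_
    rintro _ ⟨v, hv, rfl⟩
    exact hsub hv
  exact mem_map.2 (mem_of_superset hs' fun v hv =>
    (hCs (interior_subset (himg ⟨v, hv, rfl⟩))).1)

theorem eventually_mem_nhdsLT_sSup (hDo : IsOpen D) (hDc : D.OrdConnected) (hne : D.Nonempty)
    (hb : BddAbove D) : sSup D ∉ D ∧ ∃ t₀ ∈ D, t₀ < sSup D ∧ Set.Ico t₀ (sSup D) ⊆ D := by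
  have h1 : ∀ t ∈ D, t < sSup D := by
    intro t ht
    obtain ⟨r, hr, hball⟩ := Metric.isOpen_iff.1 hDo t ht
    have : t + r / 2 ∈ D := hball (by
      rw [mem_ball_iff_norm, add_sub_cancel_left, Real.norm_of_nonneg (by positivity)]
      linarith)
    have := le_csSup hb this
    linarith
  obtain ⟨t₀, ht₀⟩ := hne
  refine ⟨fun hc => lt_irrefl _ (h1 _ hc), t₀, ht₀, h1 _ ht₀, fun t ht => ?_⟩
  obtain ⟨d, hd, htd⟩ := exists_lt_of_lt_csSup ⟨t₀, ht₀⟩ ht.2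
  exact hDc.out ht₀ hd ⟨ht.1, htd.le⟩

/-- A maximal curve does not accumulate at a regular point in finite time. -/
theorem IsMaxCurve.not_mapClusterPt_of_bddAbove (hM : IsMaxCurve R γ D) (hb : BddAbove D)
    (hR0 : R ≠ 0) {Q : OnePoint ℂ} (hQ : qdOrder R Q = 0) :
    ¬ MapClusterPt Q (𝓝[<] sSup D) γ := by
  intro hcl
  obtain ⟨hβ, t₀, ht₀, ht₀β, hsub⟩ :=
    eventually_mem_nhdsLT_sSup hM.isOpen hM.ordConnected hM.nonempty hb
  set β := sSup D
  obtain ⟨e, he, hQe⟩ := exists_isFlat hR0 hQ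
  obtain ⟨r, hr, hball⟩ := Metric.isOpen_iff.1 e.open_target _ (e.map_source hQe)
  have hU : e.source ∩ e ⁻¹' Metric.ball (e Q) (r / 2) ∈ 𝓝 Q :=
    inter_mem (e.open_source.mem_nhds hQe)
      ((e.continuousAt hQe).preimage_mem_nhds (Metric.ball_mem_nhds _ (by positivity)))
  have hev : ∀ᶠ t in 𝓝[<] β, t ∈ Set.Ioo (max t₀ (β - r / 2)) β :=
    Ioo_mem_nhdsLT (max_lt ht₀β (by linarith))
  obtain ⟨t, ⟨hts, htb⟩, ht⟩ := ((hcl.frequently hU).and_eventually hev).exists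
  have ht1 : t₀ < t := (le_max_left _ _).trans_lt ht.1
  have ht2 : β - r / 2 < t := (le_max_right _ _).trans_lt ht.1
  have htD : t ∈ D := hsub ⟨ht1.le, ht.2⟩
  -- The remaining time is less than `r / 2`, so the vertical segment up to time `β` stays in the
  -- ball. The curve would reach `β`, which is not in `D`.
  obtain ⟨ε, hε, hrel⟩ := (hM.vert t htD).chart' he hts
  have h1 := (hM.follow (τ := β - t) he htD hε hrel fun s hs => by
    rw [Set.uIcc_of_le (by linarith [ht.2])] at hs
    refine hball ?_
    have h2 : ‖((ε * s : ℝ) : ℂ) * Complex.I‖ ≤ r / 2 := by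
      rw [norm_mul, Complex.norm_I, mul_one, Complex.norm_real, Real.norm_eq_abs]
      rcases hε with rfl | rfl
      · rw [one_mul, abs_of_nonneg hs.1]
        linarith [hs.2]
      · rw [neg_one_mul, abs_neg, abs_of_nonneg hs.1]
        linarith [hs.2]
    have h3 : ‖e (γ t) - e Q‖ < r / 2 := mem_ball_iff_norm.1 htb
    rw [mem_ball_iff_norm]
    calc ‖e (γ t) + ((ε * s : ℝ) : ℂ) * Complex.I - e Q‖
        = ‖(e (γ t) - e Q) + ((ε * s : ℝ) : ℂ) * Complex.I‖ := by congr 1; ring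
      _ ≤ _ := norm_add_le _ _
      _ < r := by linarith).1
  rw [add_sub_cancel] at h1
  exact hβ h1

/-- At a regular point there is a chart whose horizontal axis meets the support and the point at
infinity at most at the origin. -/
theorem IsSquare.exists_box (hR : IsSquare a ρ ν h R) (H : IsPolar ν h) (hR0 : R ≠ 0)
    {Q : OnePoint ℂ} (hQ : qdOrder R Q = 0) : ∃ e b, IsFlat R e ∧ 0 < b ∧ Q ∈ e.source ∧ e Q = 0 ∧
      (∀ w : ℂ, |w.re| < b → |w.im| < b → w ∈ e.target) ∧
      ∀ x : ℝ, |x| < b → x ≠ 0 → e.symm x ∉ (fun z : ℂ => (z : OnePoint ℂ)) '' ν.support ∧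
        e.symm x ≠ OnePoint.infty := by
  obtain ⟨e₀, he₀, hQe₀⟩ := exists_isFlat hR0 hQ
  set e := shiftChart e₀ (-e₀ Q) with hedef
  have he : IsFlat R e := he₀.shiftChart _
  have hQe : Q ∈ e.source := by rwa [hedef, shiftChart_source]
  have he0 : e Q = 0 := by rw [hedef, shiftChart_apply, add_neg_cancel]
  have h0t : (0 : ℂ) ∈ e.target := he0 ▸ e.map_source hQe
  have hs0 : e.symm 0 = Q := by rw [← he0, e.left_inv hQe]
  obtain ⟨r, hr, hball⟩ := Metric.isOpen_iff.1 e.open_target _ h0t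
  have hofReal : Tendsto (fun x : ℝ => (x : ℂ)) (𝓝 0) (𝓝 0) := by
    have := Complex.continuous_ofReal.tendsto 0
    rwa [Complex.ofReal_zero] at this
  have hev : ∀ᶠ x : ℝ in 𝓝 0, x ≠ 0 →
      e.symm x ∉ (fun z : ℂ => (z : OnePoint ℂ)) '' ν.support ∧ e.symm x ≠ OnePoint.infty := by
    -- At `∞` the compact support is far away and injectivity of the chart isolates `∞`. Elsewhere
    -- the horizontal axis meets the support in finitely many points, and the box is shrunk to avoid
    -- those other than the origin.
    by_cases hQi : Q = OnePoint.infty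
    · have hcont := e.continuousAt_symm h0t
      have h1 : ∀ᶠ w in 𝓝 (0 : ℂ), e.symm w ∉ (fun z : ℂ => (z : OnePoint ℂ)) '' ν.support := by
        refine hcont.preimage_mem_nhds ((isClosed_coe_support H).isOpen_compl.mem_nhds ?_)
        rw [hs0, hQi]
        rintro ⟨z, -, hz⟩
        exact OnePoint.coe_ne_infty z hz
      filter_upwards [hofReal.eventually h1, hofReal.eventually (e.open_target.mem_nhds h0t)]
        with x hx hxt hx0
      refine ⟨hx, fun hc => hx0 ?_⟩
      rw [← hQi, ← hs0] at hc
      exact_mod_cast e.symm.injOn hxt h0t hc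
    · have hpt : (0 : ℂ) ∈ (planeChart e).target := mem_planeChart_target.2 ⟨h0t, by rwa [hs0]⟩
      obtain ⟨r', hr', hball'⟩ := Metric.isOpen_iff.1 (planeChart e).open_target _ hpt
      have hbox : Set.Ioo (-(r' / 2)) (r' / 2) ×ℂ Set.Ioo (-(r' / 2)) (r' / 2) ⊆
          (planeChart e).target := by
        intro w hw
        obtain ⟨h1, h2⟩ := Complex.mem_reProdIm.1 hw
        refine hball' (mem_ball_zero_iff.2 ((Complex.norm_le_abs_re_add_abs_im w).trans_lt ?_))
        linarith [abs_lt.2 h1, abs_lt.2 h2]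
      have hfin := hR.finite_support_horizontal H he.isNatural isOpen_Ioo (by positivity) hbox
      have h1 := (hfin.subset (Set.sdiff_subset (t := {0}))).isClosed.isOpen_compl.mem_nhds
        (x := (0 : ℝ)) fun hc => hc.2 rfl
      filter_upwards [h1, Ioo_mem_nhds (by linarith : -(r' / 2) < 0) (by linarith : 0 < r' / 2)]
        with x hx hxI hx0
      have hxt : (x : ℂ) ∈ (planeChart e).target := hbox (Complex.mem_reProdIm.2
        ⟨by simpa using hxI, by simpa using hr'⟩)
      refine ⟨fun hc => hx ⟨⟨hxI, ?_⟩, hx0⟩, (mem_planeChart_target.1 hxt).2⟩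
      rw [← planeChart_symm_apply hxt] at hc
      exact coe_mem_support_iff.1 hc
  obtain ⟨r', hr', hball'⟩ := Metric.mem_nhds_iff.1 hev
  refine ⟨e, min (r / 2) r', he, lt_min (by positivity) hr', hQe, he0, fun w h1 h2 => ?_,
    fun x hx hx0 => hball' ?_ hx0⟩
  · refine hball (mem_ball_zero_iff.2 ((Complex.norm_le_abs_re_add_abs_im w).trans_lt ?_))
    linarith [h1.trans_le (min_le_left _ _), h2.trans_le (min_le_left _ _)]
  · rw [mem_ball_zero_iff, Real.norm_eq_abs]
    exact hx.trans_le (min_le_right _ _)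

/-- The derivative of the potential along a straight line of a chart. -/
theorem IsSquare.hasDerivAt_potential (hR : IsSquare a ρ ν h R) (H : IsPolar ν h)
    (hρ : ∀ k, (ρ k).im = 0) (he : IsFlat R e) {c v : ℂ} {t : ℝ} {g : ℝ → OnePoint ℂ}
    (hg : ∀ᶠ s in 𝓝 t, g s ∈ e.source ∧ e (g s) = c + (s : ℂ) * v) (hgt : g t ≠ OnePoint.infty)
    (hgS : g t ∉ (fun z : ℂ => (z : OnePoint ℂ)) '' ν.support) : ∃ σ : ℂ, (σ = 1 ∨ σ = -1) ∧
      HasDerivAt (fun s => potential a ρ ν h (coordZ (g s))) (σ * v).re t := by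
  set z := coordZ (g t) with hz
  have hgz : (z : OnePoint ℂ) = g t := coe_coordZ hgt
  set f := planeChart e
  have hf : IsNatural R f := he.isNatural
  obtain ⟨ht1, ht2⟩ := hg.self_of_nhds
  have hzf : z ∈ f.source := mem_planeChart_source.2 (hgz ▸ ht1)
  have hfz : f z = c + (t : ℂ) * v := by rw [planeChart_apply, hgz, ht2]
  have hd0 := hf.deriv_ne_zero z hzf
  have hzS : z ∉ ν.support := fun hc => hgS ⟨z, hc, hgz⟩
  have hord := order_eq_zero_of_value_ne_zero (hf.value_ne_zero hzf)
  have hsq := hR.sq_eq_of_notMem H hord hzS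
  have h1 : HasDerivAt f.symm (deriv f z)⁻¹ (c + (t : ℂ) * v) := by
    have h2 := f.map_source hzf
    have h3 : HasDerivAt f (deriv f z) (f.symm (f z)) := by
      rw [f.left_inv hzf]
      exact hf.hasDerivAt z hzf
    rw [← hfz]
    exact f.hasDerivAt_symm h2 hd0 h3
  have h2 : HasDerivAt (fun s : ℝ => c + (s : ℂ) * v) (1 * v) t :=
    ((hasDerivAt_id t).ofReal_comp.mul_const v).const_add c
  have h3 : HasDerivAt (fun s : ℝ => f.symm (c + (s : ℂ) * v)) ((1 * v) • (deriv f z)⁻¹) t :=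
    h1.scomp t h2
  have h4 : (fun s => coordZ (g s)) =ᶠ[𝓝 t] fun s : ℝ => f.symm (c + (s : ℂ) * v) := by
    have h5 : ∀ᶠ s : ℝ in 𝓝 t, c + (s : ℂ) * v ∈ f.target :=
      h2.continuousAt.preimage_mem_nhds (f.open_target.mem_nhds (hfz ▸ f.map_source hzf))
    filter_upwards [hg, h5] with s hs hs'
    have h6 := planeChart_symm_apply hs'
    rw [← hs.2, e.left_inv hs.1] at h6
    rw [← h6, hs.2]
    rfl
  have h5 := h3.congr_of_eventuallyEq h4
  have h6 := (H.hasFDerivAt_potential (a := a) hρ (hR.ne_of_order hord) hzS).comp_hasDerivAt t h5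
  -- The differential `Re ((C + Φ') ·)` is composed with the inverse chart, of derivative `1 / f'`;
  -- the quotient `(C + Φ') / f'` squares to `R / R = 1`.
  refine ⟨critFun a ρ ν h z / deriv f z, ?_, h6.congr_deriv ?_⟩
  · refine sq_eq_one_iff.1 ?_
    rw [div_pow, hsq, hf.sq_deriv z hzf,
      div_self (hf.value_ne_zero hzf)]
  · rw [reMul_apply, smul_eq_mul, one_mul]
    congr 1
    ring

theorem injOn_of_hasDerivAt_ne_zero {f : ℝ → ℝ} {I : Set ℝ} (hI : I.OrdConnected)
    (hf : ∀ x ∈ I, ∃ d ≠ 0, HasDerivAt f d x) : Set.InjOn f I := by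
  have key : ∀ x ∈ I, ∀ y ∈ I, x < y → f x ≠ f y := by
    intro x hx y hy hxy heq
    have hsub := hI.out hx hy
    obtain ⟨c, hc, hc'⟩ := exists_deriv_eq_zero hxy (fun v hv => by
      obtain ⟨d, -, h⟩ := hf v (hsub hv)
      exact h.continuousAt.continuousWithinAt) heq
    obtain ⟨d, hd, h⟩ := hf c (hsub (Set.Ioo_subset_Icc_self hc))
    rw [h.deriv] at hc'
    exact hd hc'
  intro x hx y hy heq
  rcases lt_trichotomy x y with h1 | h1 | h1
  · exact absurd heq (key x hx y hy h1)
  · exact h1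
  · exact absurd heq.symm (key y hy x hx h1)

/-- An injective curve crosses the horizontal axis of a suitable chart finitely many times. -/
theorem IsSquare.finite_crossings (hR : IsSquare a ρ ν h R) (H : IsPolar ν h)
    (hρ : ∀ k, (ρ k).im = 0) (hM : IsMaxCurve R γ D) (hinj : Set.InjOn γ D) (hunb : ¬ BddAbove D)
    (he : IsFlat R e) {b : ℝ} (hbt : ∀ w : ℂ, |w.re| < b → |w.im| < b → w ∈ e.target)
    (hb : ∀ x : ℝ, |x| < b → x ≠ 0 → e.symm x ∉ (fun z : ℂ => (z : OnePoint ℂ)) '' ν.support ∧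
        e.symm x ≠ OnePoint.infty) :
    ∃ t₁, {x : ℝ | |x| < b ∧ ∃ t ∈ D, t₁ < t ∧ γ t = e.symm x}.Finite := by
  set S := (fun z : ℂ => (z : OnePoint ℂ)) '' ν.support with hS
  -- A curve that meets the support lies in it, and the support meets the axis only at the origin.
  by_cases hTS : ∃ t ∈ D, γ t ∈ S
  · obtain ⟨t, ht, htS⟩ := hTS
    have hsub := hM.isTrajectory.subset_of_saturated (hR.isSaturated_support H) ⟨t, ht, rfl⟩ htS
    refine ⟨0, (Set.finite_singleton (0 : ℝ)).subset ?_⟩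
    rintro x ⟨hx, s, hs, -, hsx⟩
    by_contra hx0
    exact (hb x hx hx0).1 (hsx ▸ hsub ⟨s, hs, rfl⟩)
  push Not at hTS
  -- An injective curve passes `∞` at most once; later times stay in the plane, where the potential
  -- is defined.
  obtain ⟨t₁, ht₁D, ht₁⟩ : ∃ t₁ ∈ D, ∀ t ∈ D, t₁ ≤ t → γ t ≠ OnePoint.infty := by
    by_cases hex : ∃ t ∈ D, γ t = OnePoint.infty
    · obtain ⟨t, ht, hti⟩ := hex
      obtain ⟨s, hs, hts⟩ := not_bddAbove_iff.1 hunb t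
      refine ⟨s, hs, fun v hv hsv hvi => ?_⟩
      have := hinj ht hv (hti.trans hvi.symm)
      linarith
    · push Not at hex
      obtain ⟨t, ht⟩ := hM.nonempty
      exact ⟨t, ht, fun v hv _ => hex v hv⟩
  have htail : ∀ t, t₁ ≤ t → t ∈ D := fun t ht => by
    obtain ⟨s, hs, hts⟩ := not_bddAbove_iff.1 hunb t
    exact hM.ordConnected.out ht₁D hs ⟨ht, hts.le⟩
  set U : ℝ → ℝ := fun t => potential a ρ ν h (coordZ (γ t)) with hU
  -- The velocity in the chart is `±i`, so the derivative of the potential is the real part of `±i`.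
  have hUd : ∀ t, t₁ ≤ t → HasDerivAt U 0 t := by
    intro t ht
    have htD := htail t ht
    obtain ⟨e', he', ε, c, hε, hrel⟩ := hM.vert t htD
    obtain ⟨σ, hσ, h1⟩ := hR.hasDerivAt_potential H hρ he' (c := c) (v := ε * Complex.I) (g := γ)
      (t := t) (by
        filter_upwards [hrel] with s hs
        refine ⟨hs.1, hs.2.trans ?_⟩
        push_cast
        ring) (ht₁ t htD ht) (hTS t htD)
    refine h1.congr_deriv ?_
    rcases hσ with rfl | rfl <;> simp
  have hUc : ∀ t, t₁ < t → U t = U (t₁ + 1) := fun t ht =>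
    isOpen_Ioi.is_const_of_deriv_eq_zero isPreconnected_Ioi
      (fun s hs => (hUd s (le_of_lt hs)).differentiableAt.differentiableWithinAt)
      (fun s hs => (hUd s (le_of_lt hs)).deriv) ht (by simp : t₁ + 1 ∈ Set.Ioi t₁)
  set g : ℝ → OnePoint ℂ := fun x => e.symm x with hg
  set W : ℝ → ℝ := fun x => potential a ρ ν h (coordZ (g x)) with hW
  have hbt' : ∀ x : ℝ, |x| < b → (x : ℂ) ∈ e.target := fun x hx =>
    hbt _ (by simpa using hx) (by simpa using (abs_nonneg x).trans_lt hx)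
  have hcross : ∀ x : ℝ, |x| < b → x ≠ 0 → (∃ t ∈ D, t₁ < t ∧ γ t = e.symm x) →
      g x ∉ S ∧ W x = U (t₁ + 1) := by
    rintro x hx hx0 ⟨t, ht, htt, htx⟩
    refine ⟨(hb x hx hx0).1, ?_⟩
    rw [← hUc t htt, hU, hW]
    simp only
    rw [htx]
  -- Along the axis the derivative is `±1`, so each half of the axis carries the constant value of
  -- the tail at most once.
  have hWd : ∀ x : ℝ, |x| < b → x ≠ 0 → ∃ d ≠ 0, HasDerivAt W d x := by
    intro x hx hx0
    obtain ⟨σ, hσ, h1⟩ := hR.hasDerivAt_potential H hρ he (c := 0) (v := 1) (g := g) (t := x) (by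
      have hev : ∀ᶠ s : ℝ in 𝓝 x, |s| < b := (continuous_abs.tendsto x).eventually_lt_const hx
      filter_upwards [hev] with s hs
      refine ⟨e.map_target (hbt' s hs), ?_⟩
      rw [hg]
      simp only
      rw [e.right_inv (hbt' s hs), zero_add, mul_one]) (hb x hx hx0).2 (hb x hx hx0).1
    refine ⟨_, ?_, h1⟩
    rcases hσ with rfl | rfl <;> simp
  have hpos : Set.InjOn W (Set.Ioo 0 b) := injOn_of_hasDerivAt_ne_zero Set.ordConnected_Ioo
    fun x hx => hWd x (abs_lt.2 ⟨by linarith [hx.1, hx.2], hx.2⟩) hx.1.ne'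
  have hneg : Set.InjOn W (Set.Ioo (-b) 0) := injOn_of_hasDerivAt_ne_zero Set.ordConnected_Ioo
    fun x hx => hWd x (abs_lt.2 ⟨hx.1, by linarith [hx.1, hx.2]⟩) hx.2.ne
  have hfin : ∀ I : Set ℝ, Set.InjOn W I → {x | x ∈ I ∧ W x = U (t₁ + 1)}.Finite := fun I hI =>
    Set.Subsingleton.finite fun x hx y hy => hI hx.1 hy.1 (hx.2.trans hy.2.symm)
  refine ⟨t₁, ((Set.finite_singleton (0 : ℝ)).union ((hfin _ hpos).union (hfin _ hneg))).subset ?_⟩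
  rintro x ⟨hx, hex⟩
  obtain ⟨hx1, hx2⟩ := abs_lt.1 hx
  rcases lt_trichotomy x 0 with h0 | h0 | h0
  · exact Or.inr (Or.inr ⟨⟨hx1, h0⟩, (hcross x hx h0.ne hex).2⟩)
  · exact Or.inl h0
  · exact Or.inr (Or.inl ⟨⟨h0, hx2⟩, (hcross x hx h0.ne' hex).2⟩)

/-- For real charges, an injective maximal curve does not accumulate at a regular point in infinite
time. -/
theorem IsSquare.not_mapClusterPt_atTop (hR : IsSquare a ρ ν h R) (H : IsPolar ν h) (hR0 : R ≠ 0)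
    (hρ : ∀ k, (ρ k).im = 0) (hM : IsMaxCurve R γ D) (hinj : Set.InjOn γ D) (hunb : ¬ BddAbove D)
    {Q : OnePoint ℂ} (hQ : qdOrder R Q = 0) : ¬ MapClusterPt Q atTop γ := by
  intro hcl
  obtain ⟨e, b, he, hb0, hQe, he0, hbt, hb⟩ := hR.exists_box H hR0 hQ
  obtain ⟨t₁, hfin⟩ := hR.finite_crossings H hρ hM hinj hunb he hbt hb
  obtain ⟨t₀, ht₀⟩ := hM.nonempty
  have htail : ∀ t, t₀ ≤ t → t ∈ D := fun t ht => by
    obtain ⟨s, hs, hts⟩ := not_bddAbove_iff.1 hunb t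
    exact hM.ordConnected.out ht₀ hs ⟨ht, hts.le⟩
  have hU : e.source ∩ e ⁻¹' (Set.Ioo (-b) b ×ℂ Set.Ioo (-b) b) ∈ 𝓝 Q := by
    refine inter_mem (e.open_source.mem_nhds hQe) ((e.continuousAt hQe).preimage_mem_nhds
      ((isOpen_Ioo.reProdIm isOpen_Ioo).mem_nhds ?_))
    rw [he0]
    exact Complex.mem_reProdIm.2 ⟨by simpa using hb0, by simpa using hb0⟩
  set A : Set ℝ := {t | t ∈ D ∧ t₁ < t ∧ ∃ x : ℝ, |x| < b ∧ γ t = e.symm x} with hA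
  -- Each late visit to the box can be followed vertically, within time less than `b`, to a crossing
  -- of the axis; visits occur at arbitrarily late times.
  have hAinf : A.Infinite := by
    refine Set.infinite_of_not_bddAbove (not_bddAbove_iff.2 fun N => ?_)
    obtain ⟨t, ⟨hts, htb⟩, ht⟩ := ((hcl.frequently hU).and_eventually
      (eventually_ge_atTop (max t₀ (max t₁ N + b)))).exists
    have htD := htail t ((le_max_left _ _).trans ht)
    have htN : max t₁ N + b ≤ t := (le_max_right _ _).trans ht
    obtain ⟨hre, him⟩ := Complex.mem_reProdIm.1 htb
    obtain ⟨ε, hε, hrel⟩ := (hM.vert t htD).chart' he hts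
    have hε2 : ε * ε = 1 := by rcases hε with rfl | rfl <;> norm_num
    set w := e (γ t) with hw
    have habs : |ε * w.im| < b := by
      rw [abs_mul]
      rcases hε with rfl | rfl <;> simpa using abs_lt.2 him
    obtain ⟨h1, h2⟩ := hM.follow (τ := -(ε * w.im)) he htD hε hrel fun s hs => by
      refine hbt _ ?_ ?_
      · simpa using abs_lt.2 hre
      · have h3 : (w + ((ε * s : ℝ) : ℂ) * Complex.I).im = w.im + ε * s := by simp
        rw [h3]
        have h4 := abs_lt.1 habs
        rcases hε with rfl | rfl <;> rcases Set.mem_uIcc.1 hs with hs | hs <;>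
          refine abs_lt.2 ⟨?_, ?_⟩ <;> linarith [him.1, him.2, hs.1, hs.2]
    have h3 : w + ((ε * -(ε * w.im) : ℝ) : ℂ) * Complex.I = (w.re : ℝ) := by
      have : ε * -(ε * w.im) = -w.im := by linear_combination (-w.im) * hε2
      rw [this]
      apply Complex.ext <;> simp
    rw [h3] at h2
    have h4 := abs_lt.1 habs
    have h5 : max t₁ N < t + -(ε * w.im) := by linarith
    exact ⟨t + -(ε * w.im), ⟨h1, (le_max_left _ _).trans_lt h5, w.re, abs_lt.2 hre, h2⟩,
      (le_max_right _ _).trans_lt h5⟩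
  have hex : ∀ t : ℝ, ∃ x : ℝ, t ∈ A → |x| < b ∧ γ t = e.symm x := fun t => by
    by_cases ht : t ∈ A
    · obtain ⟨-, -, x, hx⟩ := ht
      exact ⟨x, fun _ => hx⟩
    · exact ⟨0, fun hc => absurd hc ht⟩
  choose x hx using hex
  -- By injectivity of the curve, crossings at different times occur at different points of the
  -- axis, which are finite in number.
  refine Set.infinite_of_injOn_mapsTo (f := x) (fun s hs t ht hst => ?_) (fun t ht => ?_) hAinf hfin
  · refine hinj hs.1 ht.1 ?_
    rw [(hx s hs).2, (hx t ht).2, hst]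
  · exact ⟨(hx t ht).1, t, ht.1, ht.2.1, (hx t ht).2⟩

end CriticalMeasure

namespace CriticalMeasure

variable {R : RatFunc ℂ} {e : OpenPartialHomeomorph (OnePoint ℂ) ℂ} {γ : ℝ → OnePoint ℂ}
  {D : Set ℝ} {p : ℕ} {a ρ : Fin (p + 1) → ℂ} {ν : Measure ℂ} {h : ℂ → ℝ}

/-! ### Critical trajectories -/

theorem eq_of_locally_const {E : Type*} [NormedAddCommGroup E] [NormedSpace ℝ E] {f : ℝ → E}
    {J : Set ℝ} (hJ : IsOpen J) (hJc : J.OrdConnected)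
    (hf : ∀ t ∈ J, ∀ᶠ s in 𝓝 t, f s = f t) {x y : ℝ} (hx : x ∈ J) (hy : y ∈ J) : f x = f y := by
  have hd : ∀ t ∈ J, HasDerivAt f 0 t := fun t ht =>
    (hasDerivAt_const t (f t)).congr_of_eventuallyEq (hf t ht)
  exact hJ.is_const_of_deriv_eq_zero hJc.isPreconnected
    (fun t ht => (hd t ht).differentiableAt.differentiableWithinAt) (fun t ht => (hd t ht).deriv)
    hx hy

/-- A function which is locally the square of an affine function with slope `± i` is a quadratic
polynomial. -/
theorem exists_quadratic_of_locally {g : ℝ → ℂ} {J : Set ℝ} (hJ : IsOpen J) (hJc : J.OrdConnected)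
    (hg : ∀ t ∈ J, ∃ (ε : ℝ) (c : ℂ), (ε = 1 ∨ ε = -1) ∧
      ∀ᶠ s in 𝓝 t, g s = (c + (ε * s : ℝ) * Complex.I) ^ 2) :
    ∃ b c₀ : ℂ, ∀ s ∈ J, g s = -(s : ℂ) ^ 2 + b * s + c₀ := by
  rcases J.eq_empty_or_nonempty with rfl | ⟨t₀, ht₀⟩
  · exact ⟨0, 0, fun s hs => absurd hs (Set.notMem_empty s)⟩
  have hloc : ∀ t ∈ J, ∃ b c₀ : ℂ, ∀ᶠ s in 𝓝 t, g s = -(s : ℂ) ^ 2 + b * s + c₀ := by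
    intro t ht
    obtain ⟨ε, c, hε, h1⟩ := hg t ht
    refine ⟨2 * c * ε * Complex.I, c ^ 2, ?_⟩
    filter_upwards [h1] with s hs
    have h2 : ((ε : ℝ) : ℂ) ^ 2 = 1 := by rcases hε with rfl | rfl <;> simp
    rw [hs]
    push_cast
    linear_combination (s : ℂ) ^ 2 * ε ^ 2 * Complex.I_sq - (s : ℂ) ^ 2 * h2
  -- Since `(±i)² = -1`, adding `s²` leaves a locally affine function, whose slope is locally
  -- constant and hence constant.
  set F : ℝ → ℂ := fun s => g s + (s : ℂ) ^ 2 with hF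
  have hder : ∀ t ∈ J, ∃ b : ℂ, ∀ᶠ s in 𝓝 t, HasDerivAt F b s := by
    intro t ht
    obtain ⟨b, c₀, h1⟩ := hloc t ht
    refine ⟨b, ?_⟩
    filter_upwards [h1.eventually_nhds] with s hs
    have h2 : HasDerivAt (fun s : ℝ => b * (s : ℂ) + c₀) (b * 1) s :=
      ((hasDerivAt_id s).ofReal_comp.const_mul b).add_const c₀
    rw [mul_one] at h2
    refine h2.congr_of_eventuallyEq ?_
    filter_upwards [hs] with v hv
    rw [hF]
    simp only
    rw [hv]
    ring
  set b := deriv F t₀ with hb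
  have hderiv : ∀ t ∈ J, deriv F t = b := fun t ht =>
    eq_of_locally_const hJ hJc (fun v hv => by
      obtain ⟨b', hb'⟩ := hder v hv
      filter_upwards [hb'] with s hs
      rw [hs.deriv, hb'.self_of_nhds.deriv]) ht ht₀
  have hFd : ∀ t ∈ J, HasDerivAt (fun s : ℝ => F s - b * s) 0 t := by
    intro t ht
    obtain ⟨b', hb'⟩ := hder t ht
    have h1 : HasDerivAt F b t := by
      rw [← hderiv t ht]
      exact hb'.self_of_nhds.differentiableAt.hasDerivAt
    have h2 : HasDerivAt (fun s : ℝ => b * (s : ℂ)) (b * 1) t :=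
      (hasDerivAt_id t).ofReal_comp.const_mul b
    have h3 := h1.sub h2
    rw [mul_one, sub_self] at h3
    exact h3
  refine ⟨b, F t₀ - b * t₀, fun s hs => ?_⟩
  have h1 : F s - b * s = F t₀ - b * t₀ := hJ.is_const_of_deriv_eq_zero hJc.isPreconnected
    (fun t ht => (hFd t ht).differentiableAt.differentiableWithinAt) (fun t ht => (hFd t ht).deriv)
    hs ht₀
  rw [← h1, hF]
  ring

/-- Along a vertical curve near a finite critical point, the square of the natural parameter is a
quadratic polynomial. -/
theorem VertOn.exists_quadratic {J : Set ℝ} (hv : VertOn R γ J) (hJ : IsOpen J)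
    (hJc : J.OrdConnected) {V : Set (OnePoint ℂ)} {P : OnePoint ℂ} {G : OnePoint ℂ → ℂ}
    (hG : ∀ Q ∈ V, Q ≠ P → ∃ e, IsFlat R e ∧ Q ∈ e.source ∧ ∀ Q' ∈ e.source, e Q' ^ 2 = G Q')
    (hJV : ∀ t ∈ J, γ t ∈ V) (hJP : ∀ t ∈ J, γ t ≠ P) :
    (∀ t ∈ J, ∃ (ε : ℝ) (c : ℂ), (ε = 1 ∨ ε = -1) ∧
      ∀ᶠ s in 𝓝 t, G (γ s) = (c + (ε * s : ℝ) * Complex.I) ^ 2) ∧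
    ∃ b c₀ : ℂ, ∀ s ∈ J, G (γ s) = -(s : ℂ) ^ 2 + b * s + c₀ := by
  have h1 : ∀ t ∈ J, ∃ (ε : ℝ) (c : ℂ), (ε = 1 ∨ ε = -1) ∧
      ∀ᶠ s in 𝓝 t, G (γ s) = (c + (ε * s : ℝ) * Complex.I) ^ 2 := by
    intro t ht
    obtain ⟨e, he, hts, heG⟩ := hG _ (hJV t ht) (hJP t ht)
    obtain ⟨ε, c, hε, h1⟩ := (hv t ht).chart he hts
    refine ⟨ε, c, hε, ?_⟩
    filter_upwards [h1] with s hs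
    rw [← heG _ hs.1, hs.2]
  exact ⟨h1, exists_quadratic_of_locally hJ hJc h1⟩

/-- For real charges, the end of an injective maximal curve is reached in finite time, and it is a
finite critical point. -/
theorem IsSquare.exists_tendsto (hR : IsSquare a ρ ν h R) (H : IsPolar ν h) (hR0 : R ≠ 0)
    (hρ : ∀ k, (ρ k).im = 0) (hM : IsMaxCurve R γ D) (hinj : Set.InjOn γ D) :
    BddAbove D ∧ ∃ P ∈ finiteCriticalPoints R, Tendsto γ (𝓝[<] sSup D) (𝓝 P) := by
  have hcontD : ContinuousOn γ D := fun t ht => (hM.vert t ht).continuousAt.continuousWithinAt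
  -- Stated for a general filter, to serve both for an infinite end, which is then excluded, and for
  -- a finite one.
  have key : ∀ (l : Filter ℝ), l.NeBot →
      (∀ s ∈ l, ∃ s' ∈ l, s' ⊆ s ∧ s' ⊆ D ∧ IsOpen s' ∧ s'.OrdConnected) →
      (∀ Q, qdOrder R Q = 0 → ¬ MapClusterPt Q l γ) →
      ∃ P, P ∈ finiteCriticalPoints R ∧ Tendsto γ l (𝓝 P) ∧ ∃ J ∈ l, ∃ (G : ℝ → ℂ) (b c₀ : ℂ),
        Tendsto G l (𝓝 0) ∧ ∀ s ∈ J, G s = -(s : ℂ) ^ 2 + b * s + c₀ := by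
    intro l hl hbasis hcl
    obtain ⟨P, hP, hlim⟩ := exists_tendsto_of_mapClusterPt (singularPoints_finite hR0) (l := l)
      (γ := γ) (fun s hs => by
        obtain ⟨s', h1, h2, h3, -, h4⟩ := hbasis s hs
        exact ⟨s', h1, h2, h4.isPreconnected, hcontD.mono h3⟩)
      (fun Q hQ hc => hcl Q hc hQ)
    have hPD : ∀ t ∈ D, γ t ≠ P := fun t ht hc => hP (hc ▸ hM.notMem_singularPoints ht)
    obtain ⟨s₀, hs₀, -, hs₀D, -, -⟩ := hbasis Set.univ univ_mem
    have hlim' : Tendsto γ l (𝓝[≠] P) := tendsto_nhdsWithin_iff.2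
      ⟨hlim, mem_of_superset hs₀ fun t ht => hPD t (hs₀D ht)⟩
    rcases hR.singular_dichotomy H hR0 hρ P with hge | ⟨h2, c, hc, hcoef⟩
    · obtain ⟨V, hV, G, hG, hVG⟩ := exists_sqrt_form_sphere hR0 hge
      obtain ⟨J, hJl, hJV, hJD, hJo, hJc⟩ := hbasis _ (hlim.eventually hV)
      obtain ⟨-, b, c₀, h1⟩ := VertOn.exists_quadratic (fun t ht => hM.vert t (hJD ht)) hJo hJc hVG
        (fun t ht => hJV ht) (fun t ht => hPD t (hJD ht))
      exact ⟨P, ⟨hP, hge⟩, hlim, J, hJl, _, b, c₀, hG.comp hlim', h1⟩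
    -- Near a double pole `N = Re e` is constant along the curve, whereas it tends to `-∞` at the
    -- pole.
    · exfalso
      obtain ⟨V, hV, N, r, b, e, -, hN, he, heN, -, -, hcov⟩ := exists_double_form hc hR0 h2 hcoef
      obtain ⟨J, hJl, hJV, hJD, hJo, hJc⟩ := hbasis _ (hlim.eventually hV)
      have hconst : ∀ t ∈ J, ∀ᶠ s in 𝓝 t, N (γ s) = N (γ t) := by
        intro t ht
        obtain ⟨i, hi, -⟩ := hcov _ (hJV ht) (hPD t (hJD ht))
        obtain ⟨ε, hε, h3⟩ := (hM.vert t (hJD ht)).chart' (he i) hi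
        filter_upwards [h3] with s hs
        rw [← heN i _ hs.1, ← heN i _ hi, hs.2]
        simp
      obtain ⟨t, ht⟩ := nonempty_of_mem hJl
      have h4 := (hN.comp hlim').eventually_lt_atBot (N (γ t))
      obtain ⟨s, hs, hsJ⟩ := (h4.and hJl).exists
      exact absurd (eq_of_locally_const hJo hJc hconst hsJ ht) hs.ne
  have hbdd : BddAbove D := by
    by_contra hunb
    obtain ⟨t₀, ht₀⟩ := hM.nonempty
    have htail : ∀ t, t₀ ≤ t → t ∈ D := fun t ht => by
      obtain ⟨s, hs, hts⟩ := not_bddAbove_iff.1 hunb t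
      exact hM.ordConnected.out ht₀ hs ⟨ht, hts.le⟩
    obtain ⟨P, -, -, J, hJ, G, b, c₀, hG, hJG⟩ := key atTop inferInstance (fun s hs => by
        obtain ⟨N, hN⟩ := mem_atTop_sets.1 hs
        exact ⟨Set.Ioi (max N t₀), Ioi_mem_atTop _,
          fun t ht => hN t ((le_max_left _ _).trans (le_of_lt ht)),
          fun t ht => htail t ((le_max_right _ _).trans (le_of_lt ht)), isOpen_Ioi,
          Set.ordConnected_Ioi⟩)
      fun Q hQ => hR.not_mapClusterPt_atTop H hR0 hρ hM hinj hunb hQ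
    -- The second difference of `-s² + b s + c₀` is `-2`, incompatible with `G → 0`; so an infinite
    -- time is impossible.
    have h1 : Tendsto (fun s : ℝ => G (s + 2) - 2 * G (s + 1) + G s) atTop (𝓝 0) := by
      have h2 := hG.comp (tendsto_atTop_add_const_right atTop (2 : ℝ) tendsto_id)
      have h3 := hG.comp (tendsto_atTop_add_const_right atTop (1 : ℝ) tendsto_id)
      have h4 := (h2.sub (h3.const_mul 2)).add hG
      rw [mul_zero, sub_zero, add_zero] at h4
      exact h4
    have h2 : ∀ᶠ s in atTop, G (s + 2) - 2 * G (s + 1) + G s = -2 := by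
      obtain ⟨N, hN⟩ := mem_atTop_sets.1 hJ
      filter_upwards [eventually_ge_atTop N] with s hs
      rw [hJG _ (hN _ (by linarith)), hJG _ (hN _ (by linarith)), hJG _ (hN s hs)]
      push_cast
      ring
    have h3 := tendsto_nhds_unique (h1.congr' h2) tendsto_const_nhds
    norm_num at h3
  refine ⟨hbdd, ?_⟩
  obtain ⟨-, t₀, ht₀, ht₀β, hsub⟩ :=
    eventually_mem_nhdsLT_sSup hM.isOpen hM.ordConnected hM.nonempty hbdd
  obtain ⟨P, hP, hlim, -⟩ := key (𝓝[<] sSup D) inferInstance (fun s hs => by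
      obtain ⟨l, hl, hls⟩ := (mem_nhdsLT_iff_exists_Ioo_subset' ht₀β).1 hs
      refine ⟨Set.Ioo (max l t₀) (sSup D), Ioo_mem_nhdsLT (max_lt hl ht₀β), fun t ht => hls
        ⟨(le_max_left _ _).trans_lt ht.1, ht.2⟩, fun t ht => hsub
        ⟨((le_max_right _ _).trans_lt ht.1).le, ht.2⟩, isOpen_Ioo, Set.ordConnected_Ioo⟩)
    fun Q hQ => hM.not_mapClusterPt_of_bddAbove hbdd hR0 hQ
  exact ⟨P, hP, hlim⟩

/-- For real charges, an injective maximal curve joins two finite critical points. -/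
theorem IsSquare.exists_ends (hR : IsSquare a ρ ν h R) (H : IsPolar ν h) (hR0 : R ≠ 0)
    (hρ : ∀ k, (ρ k).im = 0) (hM : IsMaxCurve R γ D) (hinj : Set.InjOn γ D) :
    ∃ α β, α < β ∧ D = Set.Ioo α β ∧
      (∃ P ∈ finiteCriticalPoints R, Tendsto γ (𝓝[>] α) (𝓝 P)) ∧
      (∃ Q ∈ finiteCriticalPoints R, Tendsto γ (𝓝[<] β) (𝓝 Q)) := by
  obtain ⟨hba, hright⟩ := hR.exists_tendsto H hR0 hρ hM hinj
  -- The left end is the right end of the curve traversed backwards.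
  have hM' := hM.comp_affine (δ := -1) (Or.inr rfl) 0
  have hset : {s : ℝ | -1 * s + 0 ∈ D} = -D := by
    ext s
    simp
  have hfun : (fun s : ℝ => γ (-1 * s + 0)) = fun s => γ (-s) := by
    funext s
    congr 1
    ring
  rw [hset, hfun] at hM'
  obtain ⟨hba', P, hP, hleft⟩ := hR.exists_tendsto H hR0 hρ hM' fun s hs t ht hst =>
    neg_injective (hinj hs ht hst)
  have hbb : BddBelow D := bddAbove_neg.1 hba'
  obtain ⟨α, β, hαβ, rfl⟩ := eq_Ioo_of_isOpen hM.isOpen hM.ordConnected hM.nonempty hbb hba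
  refine ⟨α, β, hαβ, rfl, ⟨P, hP, ?_⟩, ?_⟩
  · rw [Real.sSup_neg, csInf_Ioo hαβ] at hleft
    have h1 := hleft.comp (tendsto_neg_nhdsGT (a := α))
    refine h1.congr fun s => ?_
    simp
  · rwa [csSup_Ioo hαβ] at hright

/-- For real charges, the quadratic differential is closed. -/
theorem IsSquare.isClosedDifferential (hR : IsSquare a ρ ν h R) (H : IsPolar ν h)
    (hρ : ∀ k, (ρ k).im = 0) : IsClosedDifferential R := by
  intro T hT
  obtain ⟨γ, D, hM, rfl⟩ := isTrajectory_iff.1 hT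
  by_cases hinj : Set.InjOn γ D
  · left
    have hR0 : R ≠ 0 := by
      obtain ⟨t, ht⟩ := hM.nonempty
      obtain ⟨e, he, ε, c, hε, h1⟩ := hM.vert t ht
      exact (he.qdOrder_eq_zero h1.self_of_nhds.1).1
    obtain ⟨α, β, hαβ, rfl, hl, hr⟩ := hR.exists_ends H hR0 hρ hM hinj
    exact ⟨hT, α, β, γ, hM.vert.isHorizontal hαβ (φ := fun s => s) (fun s hs => hs)
      (fun s _ => contDiffAt_id) (fun s _ => by simp), rfl, hl, hr⟩
  · exact Or.inr (hM.isClosedTrajectory hinj)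

end CriticalMeasure

namespace CriticalMeasure

variable {R : RatFunc ℂ} {p : ℕ} {a ρ : Fin (p + 1) → ℂ} {ν : Measure ℂ} {h : ℂ → ℝ}

/-! ### Finiteness of the set of trajectories in the support -/

/-- Different trajectories are disjoint, so at most one passes through each point. -/
theorem finite_trajectories_of_points {𝒯 : Set (Set (OnePoint ℂ))}
    (h𝒯 : ∀ T ∈ 𝒯, IsTrajectory R T) {F : Set (OnePoint ℂ)} (hF : F.Finite) :
    {T | T ∈ 𝒯 ∧ (T ∩ F).Nonempty}.Finite := by
  have h1 : {T | T ∈ 𝒯 ∧ (T ∩ F).Nonempty} ⊆ ⋃ P ∈ F, {T | T ∈ 𝒯 ∧ P ∈ T} := by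
    rintro T ⟨hT, P, hPT, hPF⟩
    exact Set.mem_biUnion hPF ⟨hT, hPT⟩
  refine (hF.biUnion fun P _ => Set.Subsingleton.finite ?_).subset h1
  intro T hT T' hT'
  exact (h𝒯 T hT.1).eq_of_mem (h𝒯 T' hT'.1) hT.2 hT'.2

/-- In a half-strip of a chart there are finitely many trajectories of the support. -/
theorem IsSquare.finite_in_strip (hR : IsSquare a ρ ν h R) (H : IsPolar ν h)
    {e : OpenPartialHomeomorph (OnePoint ℂ) ℂ} (he : IsFlat R e) {I : Set ℝ} (hI : IsOpen I) {b : ℝ}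
    (hb : 0 < b) (hbox : ∀ w : ℂ, w.re ∈ I → |w.im| < b → w ∈ e.target ∧ e.symm w ≠ OnePoint.infty) :
    {T | T ∈ supportTrajectories R ν ∧
      ∃ Q ∈ T, Q ∈ e.source ∧ (e Q).re ∈ I ∧ |(e Q).im| < b}.Finite := by
  have hbox' : I ×ℂ Set.Ioo (-b) b ⊆ (planeChart e).target := by
    intro w hw
    obtain ⟨h1, h2⟩ := Complex.mem_reProdIm.1 hw
    exact mem_planeChart_target.2 (hbox w h1 (abs_lt.2 h2))
  have hfin := hR.finite_support_horizontal H he.isNatural hI hb hbox'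
  refine (finite_trajectories_of_points (𝒯 := supportTrajectories R ν) (fun T hT => hT.1)
    (hfin.image fun x : ℝ => e.symm x)).subset ?_
  rintro T ⟨hT, Q, hQT, hQe, hre, him⟩
  -- A trajectory in the strip can be followed vertically to the horizontal axis, which the support
  -- meets in finitely many points.
  have hx : e.symm (e Q).re ∈ T := by
    obtain ⟨γ, D, hM, rfl⟩ := isTrajectory_iff.1 hT.1
    have h1 := hM.isSaturated e he (e Q) (-(e Q).im) (fun s hs => (hbox _ ?_ ?_).1)
      (by rwa [e.left_inv hQe])
    · have h2 : e Q + ((-(e Q).im : ℝ) : ℂ) * Complex.I = ((e Q).re : ℂ) := by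
        apply Complex.ext <;> simp
      rwa [h2] at h1
    · simpa using hre
    · have h3 := abs_lt.1 him
      have h4 : (e Q + ((s : ℝ) : ℂ) * Complex.I).im = (e Q).im + s := by simp
      rw [h4]
      rcases Set.mem_uIcc.1 hs with hs | hs <;> refine abs_lt.2 ⟨?_, ?_⟩ <;>
        linarith [hs.1, hs.2, h3.1, h3.2]
  refine ⟨hT, _, hx, (e Q).re, ⟨hre, ?_⟩, rfl⟩
  have hxt : ((e Q).re : ℂ) ∈ (planeChart e).target :=
    hbox' (Complex.mem_reProdIm.2 ⟨by simpa using hre, by simpa using hb⟩)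
  have h5 := hR.trajectory_subset_support H hT hx
  rw [← planeChart_symm_apply hxt] at h5
  exact coe_mem_support_iff.1 h5

/-- Finitely many trajectories of the support meet a small neighbourhood of a regular point. -/
theorem IsSquare.finite_near_regular (hR : IsSquare a ρ ν h R) (H : IsPolar ν h) (hR0 : R ≠ 0)
    {P : OnePoint ℂ} (hP : qdOrder R P = 0) (hPi : P ≠ OnePoint.infty) :
    ∃ V ∈ 𝓝 P, {T | T ∈ supportTrajectories R ν ∧ (T ∩ V).Nonempty}.Finite := by
  obtain ⟨e₀, he₀, hPe₀⟩ := exists_isFlat hR0 hP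
  set e := shiftChart e₀ (-e₀ P) with hedef
  have he : IsFlat R e := he₀.shiftChart _
  have hPe : P ∈ e.source := by rwa [hedef, shiftChart_source]
  have he0 : e P = 0 := by rw [hedef, shiftChart_apply, add_neg_cancel]
  have h0t : (0 : ℂ) ∈ (planeChart e).target := mem_planeChart_target.2
    ⟨he0 ▸ e.map_source hPe, by rwa [← he0, e.left_inv hPe]⟩
  obtain ⟨r, hr, hball⟩ := Metric.isOpen_iff.1 (planeChart e).open_target _ h0t
  have hfin := hR.finite_in_strip H he (isOpen_Ioo : IsOpen (Set.Ioo (-(r / 2)) (r / 2)))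
    (b := r / 2) (by positivity) fun w h1 h2 => mem_planeChart_target.1 (hball
      (mem_ball_zero_iff.2 ((Complex.norm_le_abs_re_add_abs_im w).trans_lt (by
        linarith [abs_lt.2 h1]))))
  refine ⟨e.source ∩ e ⁻¹' (Set.Ioo (-(r / 2)) (r / 2) ×ℂ Set.Ioo (-(r / 2)) (r / 2)),
    inter_mem (e.open_source.mem_nhds hPe) ((e.continuousAt hPe).preimage_mem_nhds
      ((isOpen_Ioo.reProdIm isOpen_Ioo).mem_nhds ?_)), hfin.subset ?_⟩
  · rw [he0]
    exact Complex.mem_reProdIm.2 ⟨by simpa using hr, by simpa using hr⟩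
  · rintro T ⟨hT, Q, hQT, hQe, hQb⟩
    obtain ⟨h1, h2⟩ := Complex.mem_reProdIm.1 hQb
    exact ⟨hT, Q, hQT, hQe, h1, abs_lt.2 h2⟩

/-- Compact induction: the property passes to subsets and finite unions. -/
theorem finite_of_locally_finite {X : Type*} [TopologicalSpace X] {K : Set X} (hK : IsCompact K)
    {𝒯 : Set (Set X)} (hloc : ∀ P ∈ K, ∃ V ∈ 𝓝 P, {T | T ∈ 𝒯 ∧ (T ∩ V).Nonempty}.Finite) :
    {T | T ∈ 𝒯 ∧ (T ∩ K).Nonempty}.Finite := by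
  refine hK.induction_on (p := fun s => {T | T ∈ 𝒯 ∧ (T ∩ s).Nonempty}.Finite) (by simp) ?_ ?_ ?_
  · intro s t hst ht
    exact ht.subset fun T hT => ⟨hT.1, hT.2.mono (Set.inter_subset_inter_right _ hst)⟩
  · intro s t hs ht
    refine (hs.union ht).subset ?_
    rintro T ⟨hT, P, hPT, hP | hP⟩
    · exact Or.inl ⟨hT, P, hPT, hP⟩
    · exact Or.inr ⟨hT, P, hPT, hP⟩
  · intro P hP
    obtain ⟨V, hV, hfin⟩ := hloc P hP
    exact ⟨V, mem_nhdsWithin_of_mem_nhds hV, hfin⟩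

/-- A trajectory does not stay in a small neighbourhood of a finite critical point. -/
theorem IsSquare.not_subset_near_critical (hR : IsSquare a ρ ν h R) (H : IsPolar ν h) (hR0 : R ≠ 0)
    (hρ : ∀ k, (ρ k).im = 0) {V : Set (OnePoint ℂ)} {P : OnePoint ℂ} (hP : qdOrder R P ≠ 0)
    {G : OnePoint ℂ → ℂ} (hG0 : Tendsto G (𝓝[≠] P) (𝓝 0))
    (hG : ∀ Q ∈ V, Q ≠ P → ∃ e, IsFlat R e ∧ Q ∈ e.source ∧ ∀ Q' ∈ e.source, e Q' ^ 2 = G Q')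
    (hV : ∀ Q ∈ closure V, qdOrder R Q ≠ 0 → Q = P) {T : Set (OnePoint ℂ)} (hT : IsTrajectory R T) :
    ¬ T ⊆ V := by
  intro hTV
  obtain ⟨γ, D, hM, rfl⟩ := isTrajectory_iff.1 hT
  have hDP : ∀ t ∈ D, γ t ≠ P := fun t ht hc => hP (hc ▸ hM.notMem_singularPoints ht)
  obtain ⟨hloc, b, c₀, hquad⟩ := VertOn.exists_quadratic hM.vert hM.isOpen hM.ordConnected hG
    (fun t ht => hTV ⟨t, ht, rfl⟩) hDP
  by_cases hinj : Set.InjOn γ D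
  · obtain ⟨α, β, hαβ, rfl, ⟨P₁, hP₁, hl⟩, P₂, hP₂, hr⟩ := hR.exists_ends H hR0 hρ hM hinj
    have hend : ∀ (l : Filter ℝ) [l.NeBot] (Q : OnePoint ℂ), (∀ᶠ t in l, t ∈ Set.Ioo α β) →
        qdOrder R Q ≠ 0 → Tendsto γ l (𝓝 Q) → Tendsto (fun t => G (γ t)) l (𝓝 0) := by
      intro l _ Q hev hQ hlim
      have hQP : Q = P := hV Q (mem_closure_of_tendsto hlim (by
        filter_upwards [hev] with t ht using hTV ⟨t, ht, rfl⟩)) hQ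
      subst hQP
      exact hG0.comp (tendsto_nhdsWithin_iff.2 ⟨hlim, by filter_upwards [hev] with t ht using hDP t ht⟩)
    have hα : -(α : ℂ) ^ 2 + b * α + c₀ = 0 := by
      have h1 := hend (𝓝[>] α) P₁ (Ioo_mem_nhdsGT hαβ) hP₁.1 hl
      have h2 : Tendsto (fun s : ℝ => -(s : ℂ) ^ 2 + b * s + c₀) (𝓝[>] α)
          (𝓝 (-(α : ℂ) ^ 2 + b * α + c₀)) :=
        ((by fun_prop : Continuous fun s : ℝ => -(s : ℂ) ^ 2 + b * s + c₀).tendsto α).mono_left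
          nhdsWithin_le_nhds
      refine tendsto_nhds_unique (h2.congr' ?_) h1
      filter_upwards [Ioo_mem_nhdsGT hαβ] with s hs using (hquad s hs).symm
    have hβ : -(β : ℂ) ^ 2 + b * β + c₀ = 0 := by
      have h1 := hend (𝓝[<] β) P₂ (Ioo_mem_nhdsLT hαβ) hP₂.1 hr
      have h2 : Tendsto (fun s : ℝ => -(s : ℂ) ^ 2 + b * s + c₀) (𝓝[<] β)
          (𝓝 (-(β : ℂ) ^ 2 + b * β + c₀)) :=
        ((by fun_prop : Continuous fun s : ℝ => -(s : ℂ) ^ 2 + b * s + c₀).tendsto β).mono_left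
          nhdsWithin_le_nhds
      refine tendsto_nhds_unique (h2.congr' ?_) h1
      filter_upwards [Ioo_mem_nhdsLT hαβ] with s hs using (hquad s hs).symm
    have hne : (β : ℂ) - α ≠ 0 := sub_ne_zero.2 (by exact_mod_cast hαβ.ne')
    have hb : b = α + β := by
      refine mul_left_cancel₀ hne ?_
      linear_combination hβ - hα
    have hc : c₀ = -(α * β) := by linear_combination hα - α * hb
    -- Both ends lie in the closure of `V` and are singular, so both are `P`, where `G` tends to
    -- `0`. The quadratic thus has roots `α` and `β` and is positive between them.
    have hval : ∀ s ∈ Set.Ioo α β, G (γ s) = (((s - α) * (β - s) : ℝ) : ℂ) := by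
      intro s hs
      rw [hquad s hs, hb, hc]
      push_cast
      ring
    obtain ⟨t, ht⟩ := hM.nonempty
    obtain ⟨ε, c, hε, hev⟩ := hloc t ht
    -- A square that is a positive real has a real root, so `c + i ε s` is real for all `s` near
    -- `t`; this is absurd for `ε = ±1`.
    have hre : ∀ᶠ s in 𝓝 t, c.re ≠ 0 ∧ c.im + ε * s = 0 := by
      filter_upwards [hev, Ioo_mem_nhds ht.1 ht.2] with s hs hsI
      rw [hval s hsI] at hs
      have h1 := congrArg Complex.re hs
      have h2 := congrArg Complex.im hs
      have hpos : 0 < (s - α) * (β - s) := mul_pos (by linarith [hsI.1]) (by linarith [hsI.2])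
      simp only [sq, Complex.ofReal_re, Complex.ofReal_im, Complex.mul_re, Complex.mul_im,
        Complex.add_re, Complex.add_im, Complex.I_re, Complex.I_im, mul_zero, mul_one,
        sub_zero, add_zero] at h1 h2
      have h3 : c.re ≠ 0 := by
        intro hc0
        rw [hc0] at h1
        nlinarith [mul_self_nonneg (c.im + ε * s)]
      refine ⟨h3, ?_⟩
      have h4 : c.re * (c.im + ε * s) = 0 := by linarith
      exact (mul_eq_zero.1 h4).resolve_left h3
    obtain ⟨r, hr0, hball⟩ := Metric.mem_nhds_iff.1 hre
    have h1 := (hball (Metric.mem_ball_self hr0)).2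
    have h2 := (hball (by
      rw [mem_ball_iff_norm, add_sub_cancel_left, Real.norm_of_nonneg (by positivity)]
      linarith : t + r / 2 ∈ Metric.ball t r)).2
    rcases hε with rfl | rfl <;> linarith
  -- A periodic curve would make a quadratic polynomial with leading coefficient `-1` periodic.
  · simp only [Set.InjOn, not_forall] at hinj
    obtain ⟨t₁, h₁, t₂, h₂, heq, hne⟩ := hinj
    obtain ⟨rfl, hper⟩ := hM.periodic h₁ h₂ hne heq
    set τ := t₁ - t₂ with hτ
    have hτ0 : (τ : ℂ) ≠ 0 := by exact_mod_cast sub_ne_zero.2 hne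
    have h3 : ∀ s, G (γ (s + τ)) = G (γ s) := fun s => by rw [hper]
    have h4 := h3 0
    have h5 := h3 τ
    rw [hquad _ (Set.mem_univ _), hquad _ (Set.mem_univ _)] at h4 h5
    push_cast at h4 h5
    have h6 : (τ : ℂ) * τ = 0 := by linear_combination (h4 - h5) / 2
    exact hτ0 (mul_self_eq_zero.1 h6)

/-- For real charges, finitely many trajectories of the support meet a small neighbourhood of a
point of the plane. -/
theorem IsSquare.locally_finite (hR : IsSquare a ρ ν h R) (H : IsPolar ν h) (hR0 : R ≠ 0)
    (hρ : ∀ k, (ρ k).im = 0) {P : OnePoint ℂ} (hPi : P ≠ OnePoint.infty) :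
    ∃ V ∈ 𝓝 P, {T | T ∈ supportTrajectories R ν ∧ (T ∩ V).Nonempty}.Finite := by
  by_cases hP : qdOrder R P = 0
  · exact hR.finite_near_regular H hR0 hP hPi
  rcases hR.singular_dichotomy H hR0 hρ P with hge | ⟨h2, c, hc, hcoef⟩
  · obtain ⟨V, hV, G, hG0, hG⟩ := exists_sqrt_form_sphere hR0 hge
    -- The neighbourhood avoids `∞` and all other singular points, so its frontier consists of
    -- regular points of the plane. No trajectory stays inside, so each one meeting it crosses this
    -- compact frontier.
    have hU : V ∩ ((insert OnePoint.infty (singularPoints R)) \ {P})ᶜ ∈ 𝓝 P := inter_mem hV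
      ((((singularPoints_finite hR0).insert _).subset
        Set.sdiff_subset).isClosed.isOpen_compl.mem_nhds fun hc => hc.2 rfl)
    obtain ⟨C, hC, hCc, hCs⟩ := exists_mem_nhds_isClosed_subset hU
    have hcl : closure (interior C) ⊆ C := closure_minimal interior_subset hCc
    have hPC : P ∈ interior C := mem_interior_iff_mem_nhds.2 hC
    refine ⟨interior C, isOpen_interior.mem_nhds hPC, ?_⟩
    have hfr : ∀ Q ∈ frontier (interior C), Q ≠ P ∧ Q ∈ C := by
      intro Q hQ
      refine ⟨?_, hcl (frontier_subset_closure hQ)⟩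
      rintro rfl
      rw [isOpen_interior.frontier_eq] at hQ
      exact hQ.2 hPC
    have hfin := finite_of_locally_finite (𝒯 := supportTrajectories R ν)
      (isClosed_frontier (s := interior C)).isCompact fun Q hQ => by
        obtain ⟨h1, h2⟩ := hfr Q hQ
        refine hR.finite_near_regular H hR0 ?_ ?_
        · by_contra hc
          exact (hCs h2).2 ⟨Or.inr hc, h1⟩
        · exact fun hc => (hCs h2).2 ⟨Or.inl hc, h1⟩
    refine hfin.subset ?_
    rintro T ⟨hT, hTC⟩
    refine ⟨hT, ?_⟩
    by_contra hne
    have hTsub : T ⊆ interior C := by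
      obtain ⟨γ, D, hM, rfl⟩ := isTrajectory_iff.1 hT.1
      refine IsPreconnected.subset_of_disjoint_frontier (hM.ordConnected.isPreconnected.image _
        fun t ht => (hM.vert t ht).continuousAt.continuousWithinAt) isOpen_interior hTC ?_
      exact fun x hx hxf => hne ⟨x, hx, hxf⟩
    refine hR.not_subset_near_critical H hR0 hρ hP hG0
      (fun Q hQ => hG Q (hCs (interior_subset hQ)).1) (fun Q hQ hQs => ?_) hT.1 hTsub
    by_contra hne'
    exact (hCs (hcl hQ)).2 ⟨Or.inr hQs, hne'⟩
  · obtain ⟨V, hV, N, r, b, e, hb, -, he, heN, hbox, hinf, hcov⟩ := exists_double_form hc hR0 h2 hcoef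
    refine ⟨V, hV, ?_⟩
    -- The half-strips are infinite, but the mass bound depends only on their height, so each
    -- contains finitely many lines of the support.
    have hfin : ∀ i, {T | T ∈ supportTrajectories R ν ∧
        ∃ Q ∈ T, Q ∈ (e i).source ∧ (e i Q).re ∈ Set.Iio r ∧ |(e i Q).im| < b}.Finite := fun i =>
      hR.finite_in_strip H (he i) isOpen_Iio hb fun w h3 h4 =>
        ⟨hbox i w h3 h4, fun hc' => hPi (hinf i (hc' ▸ (e i).map_target (hbox i w h3 h4)))⟩
    refine (Set.finite_iUnion hfin).subset ?_
    rintro T ⟨hT, Q, hQT, hQV⟩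
    obtain ⟨i, h3, h4, h5⟩ := hcov Q hQV fun hc' => hP (hc' ▸ hT.1.qdOrder_eq_zero hQT)
    exact Set.mem_iUnion.2 ⟨i, hT, Q, hQT, h3, by rw [heN i Q h3]; exact h4, h5⟩

/-- For real charges, the support consists of finitely many trajectories. -/
theorem IsSquare.finite_supportTrajectories (hR : IsSquare a ρ ν h R) (H : IsPolar ν h)
    (hρ : ∀ k, (ρ k).im = 0) : (supportTrajectories R ν).Finite := by
  by_cases hR0 : R = 0
  · subst hR0
    refine Set.finite_empty.subset ?_
    rintro T ⟨-, z, hz, -⟩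
    rw [hR.support_eq_empty H] at hz
    exact hz
  refine (finite_of_locally_finite (H.compact.image OnePoint.continuous_coe)
    (𝒯 := supportTrajectories R ν) fun P hP => hR.locally_finite H hR0 hρ ?_).subset ?_
  · rintro rfl
    obtain ⟨z, -, hz⟩ := hP
    exact OnePoint.coe_ne_infty z hz
  · rintro T hT
    obtain ⟨-, z, hz, hzT⟩ := id hT
    exact ⟨hT, z, hzT, z, hz, rfl⟩

end CriticalMeasure

/-! ### The theorem -/

theorem mainTheorem1 (p : ℕ) (a ρ : Fin (p + 1) → ℂ) (ha : Function.Injective a)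
    (μ : SignedMeasure ℂ) (hμ : CriticalMeasure.IsCritical a ρ μ) :
    ∃ R : RatFunc ℂ,
      (∀ z, CriticalMeasure.order R z < 0 → z ∈ Set.range a) ∧
      ((fun z : ℂ => CriticalMeasure.value R z -
          ((((μ Set.univ : ℝ) : ℂ) + 1 / 2 * ∑ j, ρ j) / z) ^ 2)
        =O[cocompact ℂ] fun z : ℂ => (z ^ 3)⁻¹) ∧
      (∃ 𝒯 : Set (Set (OnePoint ℂ)),
        (∀ T ∈ 𝒯, CriticalMeasure.IsTrajectory R T) ∧
        ⋃₀ 𝒯 = CriticalMeasure.supportOnSphere μ \ CriticalMeasure.singularPoints R ∧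
        closure (⋃₀ 𝒯) = CriticalMeasure.supportOnSphere μ ∧
        ((∀ j, (ρ j).im = 0) → 𝒯.Finite)) ∧
      ((∀ j, (ρ j).im = 0) → CriticalMeasure.IsClosedDifferential R) ∧
      (∀ j, (ρ j = 0 → -1 ≤ CriticalMeasure.order R (a j)) ∧
        (ρ j ≠ 0 → CriticalMeasure.order R (a j) = -2)) := by
  obtain ⟨h, hm, h1, huniv, hint⟩ := CriticalMeasure.exists_density μ
  have H : CriticalMeasure.IsPolar μ.variation h :=
    ⟨CriticalMeasure.isFiniteMeasure_variation μ, hμ.isCompact_support,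
      hμ.finite_energy.singleton_eq_zero, hm, h1⟩
  obtain ⟨R, hR⟩ := (hμ.isStationary hm h1 hint).exists_isSquare H ha
  refine ⟨R, hR.poles, ?_, ⟨CriticalMeasure.supportTrajectories R μ.variation, fun T hT => hT.1,
    hR.sUnion_supportTrajectories H, hR.closure_sUnion_supportTrajectories H,
    hR.finite_supportTrajectories H⟩, hR.isClosedDifferential H,
    fun j => ⟨hR.order_ge j, hR.order_eq j⟩⟩
  rw [huniv]
  exact hR.isBigO H
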